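/- **Setting.** Let $M$ be a smooth (Hausdorff, $\sigma$-compact) oriented $3$-manifold with (possibly empty) boundary inclusion $\iota:\partial M\hookrightarrow M$. Let $\partial M$ carry the induced orientation (outward vector first), a Lorentzian metric $g$ of signature $(-,+)$ with volume form $\mathrm{vol}$, and a time-orientation, given by a smooth vector field $t$ with $g(t,t)<0$. Let $\ast\alpha=\mathrm{vol}(\alpha^\sharp,\,\cdot\,)$ be the Hodge operator on $1$-forms on $\partial M$. Fix a sign $\varepsilon=\pm$. *Fields and observables.* Let $\mathfrak F^n(M)$ be the space of smooth $n$-forms $\alpha$ on $M$ subject to $\iota^\ast\alpha=0$ if $n=0$, to $\ast\,\iota^\ast\alpha=\varepsilon\,\iota^\ast\alpha$ if $n=1$, and to no condition if $n\ge 2$. For $U\subseteq M$ open let $\mathfrak F^n_{c}(U)$ be the space of those $\alpha \in\mathfrak F^n(M)$ with compact support contained in $U$. The complex of linear observables is $V(U)=\bigoplus_n\mathfrak F^n_{c}(U)$ with differential the exterior derivative, an $n$-form having degree $|\varphi|=n-2$. *Flow.* Let $\Theta:\mathbb R\times\partial M\to\partial M$ be a smooth $\mathbb R$-action whose generating vector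 field $\nu$ satisfies $g(\nu,\nu)=0$, $g(t,\nu)<0$ and $\varepsilon\,\mathrm{vol}(t,\nu)>0$ everywhere (an $\varepsilon$-chiral flow). Let $\widehat\Theta:\mathbb R\times M\to M$ be a smooth $\mathbb R$-action that is proper, i.e. $(s,p)\mapsto(p,\widehat\Theta(s,p))$ is a proper map, and that extends $\Theta$: $\widehat\Theta(s,\iota p)=\iota\,\Theta(s,p)$. Set $G\psi = G^\uparrow\psi-G^\downarrow\psi$ with $G^\uparrow\psi=-\int_{\mathbb R^{\le 0}}\widehat\Theta^\ast\psi$ and $G^\downarrow\psi=\int_{\mathbb R^{\ge 0}}\widehat\Theta^\ast\psi$ (fiber integration along the projection $\mathbb R\times M\to M$, with the fiber direction contracted into the first slot), and $$\tau(\varphi\otimes\psi)=(-1)^{|\varphi|+1}\int_M\varphi\wedge G\psi .$$ *Regions.* For $S\subseteq M$ put $J^{\uparrow}(S)=\{\widehat\Theta(s,p): p\in S,\ s\ge 0\}$ and $J^{\downarrow}(S)=\{\widehat\Theta(s,p): p\in S,\ s\le 0\}$. Let $\widehat\Theta\text{-}\mathbf{Open}(M)$ be the category of nonempty open $U\subseteq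 M$ with $J^\uparrow(U)\cap J^\downarrow(U)\subseteq U$ ($\widehat\Theta$-convex), with inclusions as morphisms. Call $U_1,U_2$ $\widehat\Theta$-disjoint if $(J^\uparrow(U_1)\cup J^\downarrow(U_1))\cap U_2=\emptyset$. Call an inclusion $U\subseteq U'$ $\widehat\Theta$-Cauchy if $U$ and $U'$ have the same image in the orbit space $M/\widehat\Theta$. *Quantization.* For a complex $V$ of real vector spaces with a pairing $\tau$ let $\mathrm{CCR}(V,\tau)$ be the differential graded $\ast$-algebra over $\mathbb C$ which is the quotient of the complexified tensor algebra of $V$ (with $v^\ast=v$ for $v\in V$, $(ab)^\ast=(-1)^{|a||b|}b^\ast a^\ast$ and $\ast$ antilinear) by the two-sided differential graded $\ast$-ideal generated by $$\varphi\otimes\psi-(-1)^{|\varphi||\psi|}\psi\otimes\varphi-\mathrm i\,\tau(\varphi\otimes\psi)\,1,\qquad \varphi,\psi\in V\text{ homogeneous}.$$ **Theorem.** 1. $G$ maps $\mathfrak F^{n+1}_{c}(M)$ into $\mathfrak F^{n}(M)$ for every $n$, and for every region $U$ the pairing $\tau$ is an unshifted linear Poisson structure on $V(U)$: it is bilinear,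 $\tau(\varphi\otimes\psi)=0$ unless $|\varphi|+|\psi|=0$, $\tau(\varphi\otimes\psi)=-(-1)^{|\varphi||\psi|}\tau(\psi\otimes\varphi)$, and $\tau(d\varphi\otimes\psi)+(-1)^{|\varphi|}\tau(\varphi\otimes d\psi)=0$. 2. Consequently $U\mapsto\mathfrak A(U):=\mathrm{CCR}(V(U),\tau)$, with the morphisms induced by extension by zero, is a functor from $\widehat\Theta\text{-}\mathbf{Open}(M)$ to differential graded $\ast$-algebras over $\mathbb C$. It satisfies - *Einstein causality*: for $U_1,U_2\subseteq U$ with $U_1,U_2$ $\widehat\Theta$-disjoint, the images in $\mathfrak A(U)$ of homogeneous $a\in\mathfrak A(U_1)$ and $b\in\mathfrak A(U_2)$ satisfy $ab=(-1)^{|a||b|}ba$; - *the homotopy time-slice axiom*: for every $\widehat\Theta$-Cauchy inclusion $U\subseteq U'$ the cochain map underlying $\mathfrak A(U)\to\mathfrak A(U')$ is a quasi-isomorphism. -/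

import Mathlib

open Set Filter Topology MeasureTheory CategoryTheory
open scoped Manifold ContDiff TensorProduct DirectSum

namespace CSWZW
noncomputable section

section Forms

variable {E : Type*} [NormedAddCommGroup E] [NormedSpace ℝ E]
  {H : Type*} [TopologicalSpace H] (I : ModelWithCorners ℝ E H)
  {M : Type*} [TopologicalSpace M] [ChartedSpace H M]

/-- The derivative at `y` of the inverse chart `(extChartAt I x₀).symm`, as a map from `E` to the
tangent space at the image point (which is `E`, by the definition of `TangentSpace`). -/
def coordDeriv (x₀ : M) (y : E) : E →L[ℝ] E :=
  mfderivWithin 𝓘(ℝ, E) I (extChartAt I x₀).symm (range I) y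

/-- The expression of a differential form in the chart at `x₀`, i.e. its pullback along the inverse
chart. A (not necessarily smooth) `n`-form is a family of alternating maps on the tangent spaces
`TangentSpace I x = E`. -/
def localRep {n : ℕ} (α : M → E [⋀^Fin n]→L[ℝ] ℝ) (x₀ : M) (y : E) : E [⋀^Fin n]→L[ℝ] ℝ :=
  (α ((extChartAt I x₀).symm y)).compContinuousLinearMap (coordDeriv I x₀ y)

/-- A differential form is smooth if all its chart expressions are. -/
def IsSmoothForm {n : ℕ} (α : M → E [⋀^Fin n]→L[ℝ] ℝ) : Prop :=
  ∀ x₀ : M, ContDiffOn ℝ ∞ (localRep I α x₀) (extChartAt I x₀).target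

/-- The exterior derivative of a differential form. At `x` it is computed in the chart at `x`, whose
derivative at `x` is the identity of `TangentSpace I x = E`. -/
def extD {n : ℕ} (α : M → E [⋀^Fin n]→L[ℝ] ℝ) (x : M) : E [⋀^Fin (n + 1)]→L[ℝ] ℝ :=
  extDerivWithin (localRep I α x) (range I) (extChartAt I x x)

variable {I}

theorem minSmoothness_two_le_infty : minSmoothness ℝ 2 ≤ (∞ : WithTop ℕ∞) := by
  rw [minSmoothness_of_isRCLikeNormedField]
  exact WithTop.coe_le_coe.mpr le_top

theorem coordDeriv_eq [IsManifold I ∞ M] {x₀ : M} {y : E} (hy : y ∈ (extChartAt I x₀).target) :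
    coordDeriv I x₀ y = fderivWithin ℝ
      (extChartAt I ((extChartAt I x₀).symm y) ∘ (extChartAt I x₀).symm) (range I) y := by
  have : IsManifold I 1 M := .of_le (n := ∞) (by simp)
  have h := mdifferentiableWithinAt_extChartAt_symm (I := I) hy
  unfold coordDeriv mfderivWithin
  refine (if_pos h).trans ?_
  simp only [writtenInExtChartAt, extChartAt_model_space_eq_id, PartialEquiv.refl_coe,
    PartialEquiv.refl_symm, preimage_id, modelWithCornersSelf_coe, range_id, inter_univ, id_eq]
  rfl

theorem coordDeriv_self [IsManifold I ∞ M] (x : M) :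
    coordDeriv I x (extChartAt I x x) = ContinuousLinearMap.id ℝ E := by
  rw [coordDeriv_eq (mem_extChartAt_target x), extChartAt_to_inv]
  exact fderivWithin_extChartAt_comp_extChartAt_symm_range

/-- Chain rule for a change of charts. -/
theorem coordDeriv_change [IsManifold I ∞ M] {x₀ x₁ : M} {y : E}
    (hy : y ∈ (extChartAt I x₀).target) (hy' : (extChartAt I x₀).symm y ∈ (extChartAt I x₁).source) :
    coordDeriv I x₀ y = (coordDeriv I x₁ (extChartAt I x₁ ((extChartAt I x₀).symm y))).comp
      (fderivWithin ℝ (extChartAt I x₁ ∘ (extChartAt I x₀).symm) (range I) y) := by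
  set z := (extChartAt I x₀).symm y with hz
  set y₁ := extChartAt I x₁ z with hy₁
  have hy₁t : y₁ ∈ (extChartAt I x₁).target := (extChartAt I x₁).map_source hy'
  have hz₁ : (extChartAt I x₁).symm y₁ = z := (extChartAt I x₁).left_inv hy'
  have hyr : y ∈ range I := extChartAt_target_subset_range x₀ hy
  rw [coordDeriv_eq hy, coordDeriv_eq hy₁t, hz₁, ← hz]
  have hs0 : y ∈ ((extChartAt I x₀).symm ≫ extChartAt I x₁).source := ⟨hy, hy'⟩
  have d1 : DifferentiableWithinAt ℝ (extChartAt I x₁ ∘ (extChartAt I x₀).symm) (range I) y :=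
    (contDiffWithinAt_ext_coord_change (n := ∞) x₁ x₀ hs0).differentiableWithinAt (by simp)
  have hs1 : y₁ ∈ ((extChartAt I x₁).symm ≫ extChartAt I z).source :=
    ⟨hy₁t, by
      change (extChartAt I x₁).symm y₁ ∈ (extChartAt I z).source
      rw [hz₁]; exact mem_extChartAt_source z⟩
  have d2 : DifferentiableWithinAt ℝ (extChartAt I z ∘ (extChartAt I x₁).symm) (range I) y₁ :=
    (contDiffWithinAt_ext_coord_change (n := ∞) z x₁ hs1).differentiableWithinAt (by simp)
  have hmaps : MapsTo (extChartAt I x₁ ∘ (extChartAt I x₀).symm) (range I) (range I) := by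
    intro w _
    exact ⟨_, rfl⟩
  have hu := I.uniqueDiffOn y hyr
  have key := fderivWithin_comp y (g := extChartAt I z ∘ (extChartAt I x₁).symm)
    (f := extChartAt I x₁ ∘ (extChartAt I x₀).symm) (t := range I) d2 d1 hmaps hu
  have hev : (extChartAt I z ∘ (extChartAt I x₁).symm) ∘
      (extChartAt I x₁ ∘ (extChartAt I x₀).symm) =ᶠ[𝓝[range I] y]
      (extChartAt I z ∘ (extChartAt I x₀).symm) := by
    have hc : ContinuousAt (extChartAt I x₀).symm y := continuousAt_extChartAt_symm'' hy
    have hnb : (extChartAt I x₁).source ∈ 𝓝 ((extChartAt I x₀).symm y) :=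
      (isOpen_extChartAt_source x₁).mem_nhds hy'
    filter_upwards [nhdsWithin_le_nhds (hc hnb)] with w hw
    simp only [Function.comp_apply]
    rw [(extChartAt I x₁).left_inv hw]
  rw [← hev.fderivWithin_eq_of_mem hyr, key]
  rfl

theorem localRep_change [IsManifold I ∞ M] {n : ℕ} (α : M → E [⋀^Fin n]→L[ℝ] ℝ) {x₀ x₁ : M} {y : E}
    (hy : y ∈ (extChartAt I x₀).target) (hy' : (extChartAt I x₀).symm y ∈ (extChartAt I x₁).source) :
    localRep I α x₀ y =
      (localRep I α x₁ ((extChartAt I x₁ ∘ (extChartAt I x₀).symm) y)).compContinuousLinearMap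
        (fderivWithin ℝ (extChartAt I x₁ ∘ (extChartAt I x₀).symm) (range I) y) := by
  rw [localRep, localRep, coordDeriv_change hy hy', Function.comp_apply,
    (extChartAt I x₁).left_inv hy']
  rfl

theorem localRep_self [IsManifold I ∞ M] {n : ℕ} (α : M → E [⋀^Fin n]→L[ℝ] ℝ) (x : M) :
    localRep I α x (extChartAt I x x) = α x := by
  rw [localRep, coordDeriv_self, extChartAt_to_inv]
  ext v
  rfl

theorem IsSmoothForm.contDiffWithinAt {n : ℕ} {α : M → E [⋀^Fin n]→L[ℝ] ℝ}
    (hα : IsSmoothForm I α) {x₀ : M} {y : E} (hy : y ∈ (extChartAt I x₀).target) :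
    ContDiffWithinAt ℝ ∞ (localRep I α x₀) (range I) y :=
  (hα x₀ y hy).mono_of_mem_nhdsWithin (extChartAt_target_mem_nhdsWithin_of_mem hy)

/-- The exterior derivative is computed by the same formula in all charts. -/
theorem localRep_extD [IsManifold I ∞ M] {n : ℕ} {α : M → E [⋀^Fin n]→L[ℝ] ℝ}
    (hα : IsSmoothForm I α) {x₀ : M} {y : E} (hy : y ∈ (extChartAt I x₀).target) :
    localRep I (extD I α) x₀ y = extDerivWithin (localRep I α x₀) (range I) y := by
  set z := (extChartAt I x₀).symm y with hz
  set f := extChartAt I z ∘ (extChartAt I x₀).symm with hf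
  have hyr : y ∈ range I := extChartAt_target_subset_range x₀ hy
  have hfy : f y = extChartAt I z z := rfl
  have hs0 : y ∈ ((extChartAt I x₀).symm ≫ extChartAt I z).source :=
    ⟨hy, mem_extChartAt_source z⟩
  have hev : localRep I α x₀ =ᶠ[𝓝[range I] y] fun w =>
      (localRep I α z (f w)).compContinuousLinearMap (fderivWithin ℝ f (range I) w) := by
    have hc : ContinuousAt (extChartAt I x₀).symm y := continuousAt_extChartAt_symm'' hy
    have hnb : (extChartAt I z).source ∈ 𝓝 ((extChartAt I x₀).symm y) :=
      (isOpen_extChartAt_source z).mem_nhds (mem_extChartAt_source z)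
    filter_upwards [nhdsWithin_le_nhds (hc hnb), extChartAt_target_mem_nhdsWithin_of_mem hy]
      with w hw hw'
    exact localRep_change α hw' hw
  rw [hev.extDerivWithin_eq_of_mem hyr, localRep, ← hz, coordDeriv_eq hy, ← hz, ← hf]
  have hsm : ContDiffWithinAt ℝ ∞ f (range I) y := contDiffWithinAt_ext_coord_change z x₀ hs0
  have hd : DifferentiableWithinAt ℝ (localRep I α z) (range I) (f y) :=
    (hα.contDiffWithinAt (mem_extChartAt_target z)).differentiableWithinAt (by simp)
  rw [extDerivWithin_pullback (r := ∞) (t := range I) hd hsm minSmoothness_two_le_infty I.uniqueDiffOn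
    (I.range_subset_closure_interior hyr) hyr (fun w _ => ⟨_, rfl⟩)]
  rfl

theorem IsSmoothForm.extD [IsManifold I ∞ M] {n : ℕ} {α : M → E [⋀^Fin n]→L[ℝ] ℝ}
    (hα : IsSmoothForm I α) : IsSmoothForm I (extD I α) := by
  intro x₀ y hy
  have h1 : ContDiffWithinAt ℝ ∞ (fderivWithin ℝ (localRep I α x₀) (range I)) (range I) y :=
    (hα.contDiffWithinAt hy).fderivWithin_right I.uniqueDiffOn (by simp)
      (extChartAt_target_subset_range x₀ hy)
  have hc : ContDiff ℝ ∞ (fun L : E →L[ℝ] E [⋀^Fin n]→L[ℝ] ℝ =>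
      ContinuousAlternatingMap.alternatizeUncurryFinCLM ℝ E ℝ L) := ContinuousLinearMap.contDiff _
  have h2 : ContDiffWithinAt ℝ ∞ (extDerivWithin (localRep I α x₀) (range I)) (range I) y :=
    hc.comp_contDiffWithinAt h1
  exact (h2.mono (extChartAt_target_subset_range x₀)).congr (fun w hw => localRep_extD hα hw)
    (localRep_extD hα hy)

theorem extD_extD [IsManifold I ∞ M] {n : ℕ} {α : M → E [⋀^Fin n]→L[ℝ] ℝ}
    (hα : IsSmoothForm I α) : extD I (extD I α) = 0 := by
  funext x
  have hxr : extChartAt I x x ∈ range I := ⟨_, rfl⟩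
  have hev : localRep I (extD I α) x =ᶠ[𝓝[range I] (extChartAt I x x)]
      extDerivWithin (localRep I α x) (range I) := by
    filter_upwards [extChartAt_target_mem_nhdsWithin x] with w hw
    exact localRep_extD hα hw
  rw [CSWZW.extD, hev.extDerivWithin_eq_of_mem hxr]
  exact extDerivWithin_extDerivWithin_apply
    (hα.contDiffWithinAt (mem_extChartAt_target x)) minSmoothness_two_le_infty I.uniqueDiffOn
    (I.range_subset_closure_interior hxr) hxr

theorem localRep_add {n : ℕ} (α η : M → E [⋀^Fin n]→L[ℝ] ℝ) (x₀ : M) :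
    localRep I (α + η) x₀ = localRep I α x₀ + localRep I η x₀ := rfl

theorem localRep_smul {n : ℕ} (c : ℝ) (α : M → E [⋀^Fin n]→L[ℝ] ℝ) (x₀ : M) :
    localRep I (c • α) x₀ = c • localRep I α x₀ := rfl

theorem extD_add {n : ℕ} {α η : M → E [⋀^Fin n]→L[ℝ] ℝ}
    (hα : IsSmoothForm I α) (hη : IsSmoothForm I η) : extD I (α + η) = extD I α + extD I η := by
  funext x
  exact extDerivWithin_add (I.uniqueDiffOn _ ⟨_, rfl⟩)
    ((hα.contDiffWithinAt (mem_extChartAt_target x)).differentiableWithinAt (by simp))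
    ((hη.contDiffWithinAt (mem_extChartAt_target x)).differentiableWithinAt (by simp))

theorem extD_smul {n : ℕ} (c : ℝ) (α : M → E [⋀^Fin n]→L[ℝ] ℝ) :
    extD I (c • α) = c • extD I α := by
  funext x
  exact extDerivWithin_smul c (localRep I α x) (I.uniqueDiffOn _ ⟨_, rfl⟩)

theorem tsupport_extD {n : ℕ} (α : M → E [⋀^Fin n]→L[ℝ] ℝ) :
    tsupport (extD I α) ⊆ tsupport α := by
  refine closure_minimal ?_ (isClosed_tsupport α)
  intro x hx
  by_contra hn
  apply hx
  have h0 : α =ᶠ[𝓝 x] 0 := notMem_tsupport_iff_eventuallyEq.mp hn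
  have hc : ContinuousAt (extChartAt I x).symm (extChartAt I x x) := continuousAt_extChartAt_symm x
  rw [ContinuousAt, extChartAt_to_inv] at hc
  have hev : localRep I α x =ᶠ[𝓝[range I] (extChartAt I x x)] 0 := by
    filter_upwards [nhdsWithin_le_nhds (hc.eventually h0)] with w hw
    ext v
    change α ((extChartAt I x).symm w) _ = 0
    rw [hw]
    rfl
  rw [CSWZW.extD, hev.extDerivWithin_eq_of_mem ⟨_, rfl⟩]
  rw [extDerivWithin, show (0 : E → E [⋀^Fin n]→L[ℝ] ℝ) = fun _ => 0 from rfl,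
    fderivWithin_const_apply]
  exact map_zero (ContinuousAlternatingMap.alternatizeUncurryFinCLM ℝ E ℝ)

theorem isSmoothForm_zero {n : ℕ} : IsSmoothForm I (0 : M → E [⋀^Fin n]→L[ℝ] ℝ) :=
  fun _ => contDiffOn_const (c := (0 : E [⋀^Fin n]→L[ℝ] ℝ))

theorem IsSmoothForm.add {n : ℕ} {α η : M → E [⋀^Fin n]→L[ℝ] ℝ}
    (hα : IsSmoothForm I α) (hη : IsSmoothForm I η) : IsSmoothForm I (α + η) :=
  fun x₀ => (hα x₀).add (hη x₀)

theorem IsSmoothForm.smul {n : ℕ} (c : ℝ) {α : M → E [⋀^Fin n]→L[ℝ] ℝ}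
    (hα : IsSmoothForm I α) : IsSmoothForm I (c • α) :=
  fun x₀ => (contDiffOn_const (c := c)).smul (hα x₀)

end Forms

section Algebra

/-- The sign `(-1)^i`, as an integer. -/
def sgn (i : ℤ) : ℤ := (i.negOnePow : ℤ)

theorem sgn_add (i j : ℤ) : sgn (i + j) = sgn i * sgn j := by
  simp [sgn, Int.negOnePow_add]

theorem sgn_mul_self (i : ℤ) : sgn i * sgn i = 1 := by
  rw [sgn, ← Units.val_mul, Int.units_mul_self, Units.val_one]

theorem sgn_zero : sgn 0 = 1 := rfl

theorem sgn_one : sgn 1 = -1 := rfl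

universe u

/-- A cochain complex of real vector spaces (with underlying vector space `V`, the direct sum of
the homogeneous parts `gr i`) together with a real-valued pairing `τ`. It is a Poisson cochain
complex if it satisfies `PairedComplex.IsPoisson` below. -/
structure PairedComplex : Type (u + 1) where
  V : Type u
  [addCommGroup : AddCommGroup V]
  [module : Module ℝ V]
  gr : ℤ → Submodule ℝ V
  [decomposition : DirectSum.Decomposition gr]
  d : V →ₗ[ℝ] V
  d_mem : ∀ i, ∀ v ∈ gr i, d v ∈ gr (i + 1)
  d_d : ∀ v, d (d v) = 0
  τ : V → V → ℝ

attribute [instance] PairedComplex.addCommGroup PairedComplex.module PairedComplex.decomposition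

namespace PairedComplex

/-- `τ` is an unshifted linear Poisson structure: a graded antisymmetric cochain map
`V ⊗ V ⟶ ℝ`, where `ℝ` sits in degree zero. -/
structure IsPoisson (P : PairedComplex.{u}) : Prop where
  add_left : ∀ v v' w, P.τ (v + v') w = P.τ v w + P.τ v' w
  smul_left : ∀ (c : ℝ) (v w), P.τ (c • v) w = c * P.τ v w
  add_right : ∀ v w w', P.τ v (w + w') = P.τ v w + P.τ v w'
  smul_right : ∀ (c : ℝ) (v w), P.τ v (c • w) = c * P.τ v w
  degree_zero : ∀ i j, ∀ v ∈ P.gr i, ∀ w ∈ P.gr j, i + j ≠ 0 → P.τ v w = 0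
  antisymm : ∀ i j, ∀ v ∈ P.gr i, ∀ w ∈ P.gr j, P.τ v w = -(sgn (i * j) * P.τ w v)
  cocycle : ∀ i, ∀ v ∈ P.gr i, ∀ w, P.τ (P.d v) w + sgn i * P.τ v (P.d w) = 0

/-- Morphisms: cochain maps preserving the pairings. -/
@[ext]
structure Hom (P Q : PairedComplex.{u}) where
  map : P.V →ₗ[ℝ] Q.V
  map_mem : ∀ i, ∀ v ∈ P.gr i, map v ∈ Q.gr i
  map_d : ∀ v, map (P.d v) = Q.d (map v)
  map_τ : ∀ v w, Q.τ (map v) (map w) = P.τ v w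

instance : Category PairedComplex.{u} where
  Hom := Hom
  id P := ⟨LinearMap.id, fun _ _ h => h, fun _ => rfl, fun _ _ => rfl⟩
  comp f g := ⟨g.map ∘ₗ f.map, fun i v h => g.map_mem i _ (f.map_mem i v h),
    fun v => by simp [f.map_d, g.map_d], fun v w => by simp [f.map_τ, g.map_τ]⟩

variable (P : PairedComplex.{u})

/-- The linear map out of `V` which is given by `f i` on the part of degree `i`. -/
def byDegree {W : Type*} [AddCommGroup W] [Module ℝ W] (f : ℤ → P.V →ₗ[ℝ] W) : P.V →ₗ[ℝ] W :=
  DirectSum.toModule ℝ ℤ W (fun i => f i ∘ₗ (P.gr i).subtype) ∘ₗ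
    (DirectSum.decomposeLinearEquiv P.gr).toLinearMap

variable {P} in
theorem byDegree_of_mem {W : Type*} [AddCommGroup W] [Module ℝ W] (f : ℤ → P.V →ₗ[ℝ] W) {i : ℤ}
    {v : P.V} (hv : v ∈ P.gr i) : P.byDegree f v = f i v := by
  change DirectSum.toModule ℝ ℤ W (fun i => f i ∘ₗ (P.gr i).subtype) (DirectSum.decompose P.gr v) = _
  rw [DirectSum.decompose_of_mem P.gr hv, ← DirectSum.lof_eq_of ℝ, DirectSum.toModule_lof]
  rfl

variable {P} in
theorem gr_induction {p : P.V → Prop} (h0 : ∀ i, ∀ v ∈ P.gr i, p v)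
    (hadd : ∀ v w, p v → p w → p (v + w)) (v : P.V) : p v :=
  DirectSum.Decomposition.inductionOn P.gr (h0 0 0 (zero_mem _)) (fun {i} v => h0 i v v.2)
    (fun v w hv hw => hadd v w hv hw) v

variable {P} in
theorem linearMap_ext_gr {W : Type*} [AddCommGroup W] [Module ℝ W] {f g : P.V →ₗ[ℝ] W}
    (h : ∀ i, ∀ v ∈ P.gr i, f v = g v) : f = g := by
  ext v
  refine gr_induction (p := fun v => f v = g v) h (fun v w hv hw => ?_) v
  rw [map_add, map_add, hv, hw]

/-- The real tensor algebra of `V`. -/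
abbrev T : Type u := TensorAlgebra ℝ P.V

/-- The inclusion of generators. -/
def gen : P.V →ₗ[ℝ] P.T := TensorAlgebra.ι ℝ

theorem lift_gen {B : Type*} [Semiring B] [Algebra ℝ B] (f : P.V →ₗ[ℝ] B) (v : P.V) :
    TensorAlgebra.lift ℝ f (P.gen v) = f v := TensorAlgebra.lift_ι_apply f v

/-- `IsWord i x` says that `x` is a product `v₁ ⊗ ⋯ ⊗ vₙ` of homogeneous generators of total
degree `i`. -/
inductive IsWord : ℤ → P.T → Prop
  | one : IsWord 0 1
  | cons {i j : ℤ} {v : P.V} {x : P.T} (hv : v ∈ P.gr i) (hx : IsWord j x) :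
      IsWord (i + j) (P.gen v * x)

/-- The elements of degree `i` in the tensor algebra. -/
def grT (i : ℤ) : Submodule ℝ P.T := Submodule.span ℝ {x | P.IsWord i x}

variable {P}

theorem IsWord.mem {i : ℤ} {x : P.T} (h : P.IsWord i x) : x ∈ P.grT i := Submodule.subset_span h

theorem gen_mem {i : ℤ} {v : P.V} (hv : v ∈ P.gr i) : P.gen v ∈ P.grT i := by
  have h := (IsWord.cons hv IsWord.one).mem
  rwa [add_zero, mul_one] at h

theorem IsWord.mul {i j : ℤ} {x y : P.T} (hx : P.IsWord i x) (hy : P.IsWord j y) :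
    P.IsWord (i + j) (x * y) := by
  induction hx with
  | one => rwa [zero_add, one_mul]
  | cons hv _ ih =>
    rw [mul_assoc, add_assoc]
    exact IsWord.cons hv ih

theorem mem_span_words (x : P.T) : x ∈ Submodule.span ℝ {z | ∃ i, P.IsWord i z} := by
  suffices key : ∀ z ∈ Submodule.span ℝ {z | ∃ i, P.IsWord i z},
      x * z ∈ Submodule.span ℝ {z | ∃ i, P.IsWord i z} by
    simpa using key 1 (Submodule.subset_span ⟨0, IsWord.one⟩)
  induction x using TensorAlgebra.induction with
  | algebraMap r =>
    intro z hz
    rw [← Algebra.smul_def]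
    exact Submodule.smul_mem _ _ hz
  | ι v =>
    intro z hz
    induction hz using Submodule.span_induction with
    | mem z hz =>
      obtain ⟨j, hj⟩ := hz
      refine gr_induction (p := fun v => TensorAlgebra.ι ℝ v * z ∈
        Submodule.span ℝ {z | ∃ i, P.IsWord i z})
        (fun i v hv => Submodule.subset_span ⟨_, IsWord.cons hv hj⟩) (fun v w h1 h2 => ?_) v
      rw [map_add, add_mul]
      exact add_mem h1 h2
    | zero => simp
    | add z w _ _ h1 h2 => rw [mul_add]; exact add_mem h1 h2
    | smul c z _ h => rw [mul_smul_comm]; exact Submodule.smul_mem _ _ h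
  | mul a b ha hb =>
    intro z hz
    rw [mul_assoc]
    exact ha _ (hb z hz)
  | add a b ha hb =>
    intro z hz
    rw [add_mul]
    exact add_mem (ha z hz) (hb z hz)

/-- Additive statements about the tensor algebra may be checked on words. -/
theorem word_induction {p : P.T → Prop} (hw : ∀ i x, P.IsWord i x → p x)
    (hsmul : ∀ (c : ℝ) x, p x → p (c • x)) (hadd : ∀ x y, p x → p y → p (x + y)) (x : P.T) :
    p x :=
  Submodule.span_induction (p := fun z _ => p z) (fun z hz => hz.elim fun i hi => hw i z hi)
    (by simpa using hsmul 0 _ (hw 0 1 IsWord.one)) (fun z w _ _ h1 h2 => hadd z w h1 h2)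
    (fun c z _ h => hsmul c z h) (mem_span_words x)

theorem grT_induction {i : ℤ} {p : P.T → Prop} (hw : ∀ x, P.IsWord i x → p x) (h0 : p 0)
    (hsmul : ∀ (c : ℝ) x, p x → p (c • x)) (hadd : ∀ x y, p x → p y → p (x + y)) {x : P.T}
    (hx : x ∈ P.grT i) : p x :=
  Submodule.span_induction (p := fun x _ => p x) hw h0 (fun x y _ _ => hadd x y)
    (fun c x _ => hsmul c x) hx

instance : SetLike.GradedMonoid P.grT where
  one_mem := IsWord.one.mem
  mul_mem i j x y hx hy := by
    refine grT_induction (p := fun x => x * y ∈ P.grT (i + j)) (fun x hx => ?_) (by simp)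
      (fun c x h => by rw [smul_mul_assoc]; exact Submodule.smul_mem _ _ h)
      (fun x x' h h' => by rw [add_mul]; exact add_mem h h') hx
    exact grT_induction (p := fun y => x * y ∈ P.grT (i + j)) (fun y hy => (hx.mul hy).mem)
      (by simp) (fun c y h => by rw [mul_smul_comm]; exact Submodule.smul_mem _ _ h)
      (fun y y' h h' => by rw [mul_add]; exact add_mem h h') hy

variable (P)

/-- The inclusion of generators into the direct sum of the homogeneous parts. -/
def genDecompose : P.V →ₗ[ℝ] ⨁ i, P.grT i :=
  DirectSum.toModule ℝ ℤ _ (fun i => DirectSum.lof ℝ ℤ (fun i => P.grT i) i ∘ₗ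
    (P.gen ∘ₗ (P.gr i).subtype).codRestrict (P.grT i) (fun v => gen_mem v.2)) ∘ₗ
    (DirectSum.decomposeLinearEquiv P.gr).toLinearMap

variable {P}

theorem genDecompose_of_mem {i : ℤ} {v : P.V} (hv : v ∈ P.gr i) :
    P.genDecompose v = DirectSum.of (fun i => P.grT i) i ⟨P.gen v, gen_mem hv⟩ := by
  change DirectSum.toModule ℝ ℤ _ _ (DirectSum.decompose P.gr v) = _
  rw [DirectSum.decompose_of_mem P.gr hv, ← DirectSum.lof_eq_of ℝ, DirectSum.toModule_lof]
  rfl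

/-- The tensor algebra is graded by the total degree. -/
instance : GradedAlgebra P.grT :=
  GradedAlgebra.ofAlgHom _ (TensorAlgebra.lift ℝ P.genDecompose)
    (by
      refine TensorAlgebra.hom_ext (linearMap_ext_gr fun i v hv => ?_)
      simp only [LinearMap.comp_apply, AlgHom.toLinearMap_apply, AlgHom.comp_apply,
        TensorAlgebra.lift_ι_apply, genDecompose_of_mem hv, AlgHom.id_apply]
      exact DirectSum.coeAlgHom_of _ _ _)
    (by
      rintro i ⟨x, hx⟩
      have hmain : ∀ {i : ℤ} {x : P.T} (h : P.IsWord i x),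
          TensorAlgebra.lift ℝ P.genDecompose x =
            DirectSum.of (fun i => P.grT i) i ⟨x, h.mem⟩ := by
        intro i x h
        induction h with
        | one => rw [map_one]; rfl
        | cons hv hx ih =>
          rw [map_mul, ih, lift_gen, genDecompose_of_mem hv, DirectSum.of_mul_of]
          rfl
      change TensorAlgebra.lift ℝ P.genDecompose x = _
      have : ∀ y (hy : y ∈ P.grT i), TensorAlgebra.lift ℝ P.genDecompose y =
          DirectSum.lof ℝ ℤ (fun i => P.grT i) i ⟨y, hy⟩ := by
        intro y hy
        refine Submodule.span_induction (p := fun y hy => TensorAlgebra.lift ℝ P.genDecompose y =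
          DirectSum.lof ℝ ℤ (fun i => P.grT i) i ⟨y, hy⟩) (fun y hy => hmain hy) ?_
          (fun y z hy hz h1 h2 => ?_) (fun c y hy h => ?_) hy
        · rw [map_zero]; exact (map_zero _).symm
        · rw [map_add, h1, h2, ← map_add]; rfl
        · rw [map_smul, h, ← map_smul]; rfl
      exact this x hx)

/-! The parity automorphism, the differential and the involution of the tensor algebra. -/

variable (P)

/-- The involution `v ↦ (-1)^|v| v`. -/
def signV : P.V →ₗ[ℝ] P.V := P.byDegree fun i => sgn i • LinearMap.id

/-- The algebra automorphism `x ↦ (-1)^|x| x`. -/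
def signT : P.T →ₐ[ℝ] P.T := TensorAlgebra.lift ℝ (P.gen ∘ₗ P.signV)

/-- The algebra homomorphism sending `x` to the operator `(a, b) ↦ (x a, (d x) a + (-1)^|x| x b)`,
which is determined by its values on generators. -/
def dOp : P.T →ₐ[ℝ] Module.End ℝ (P.T × P.T) :=
  TensorAlgebra.lift ℝ (LinearMap.mk₂ ℝ
    (fun v (ab : P.T × P.T) =>
      (P.gen v * ab.1, P.gen (P.d v) * ab.1 + P.gen (P.signV v) * ab.2))
    (fun v w ab => by ext <;> simp [add_mul]; abel)
    (fun c v ab => by ext <;> simp)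
    (fun v ab ab' => by ext <;> simp [mul_add]; abel)
    (fun c v ab => by ext <;> simp))

/-- The differential of the tensor algebra: the derivation (in the graded sense) which extends the
differential of `V`, see `dT_gen` and `dT_mul`. -/
def dT : P.T →ₗ[ℝ] P.T where
  toFun x := (P.dOp x (1, 0)).2
  map_add' x y := by simp
  map_smul' c x := by simp

/-- The algebra homomorphism to the opposite of the algebra of operators which sends a generator `v`
to the operator `a ↦ (-1)^(|v||a|) v a`. -/
def starOp : P.T →ₐ[ℝ] (Module.End ℝ P.T)ᵐᵒᵖ :=
  TensorAlgebra.lift ℝ ((MulOpposite.opLinearEquiv ℝ).toLinearMap ∘ₗ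
    P.byDegree fun i => (LinearMap.mulRight ℝ (P.signT ^ i.natAbs).toLinearMap) ∘ₗ
      (LinearMap.mul ℝ P.T) ∘ₗ P.gen)

/-- The real-linear involution of the tensor algebra:
`(v₁ ⊗ ⋯ ⊗ vₙ)^* = (-1)^(∑_{i<j} |vᵢ||vⱼ|) vₙ ⊗ ⋯ ⊗ v₁`, see `starT_gen` and `starT_mul`. -/
def starT : P.T →ₗ[ℝ] P.T where
  toFun x := (P.starOp x).unop 1
  map_add' x y := by simp
  map_smul' c x := by simp

variable {P}

theorem signV_of_mem {i : ℤ} {v : P.V} (hv : v ∈ P.gr i) : P.signV v = sgn i • v := by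
  rw [signV, byDegree_of_mem _ hv]
  rfl

theorem signT_gen (v : P.V) : P.signT (P.gen v) = P.gen (P.signV v) := by
  rw [signT, lift_gen]
  rfl

theorem signT_word {i : ℤ} {x : P.T} (h : P.IsWord i x) : P.signT x = sgn i • x := by
  induction h with
  | one => simp [sgn_zero]
  | cons hv hx ih =>
    rw [map_mul, ih, signT_gen, signV_of_mem hv, map_zsmul, sgn_add, smul_mul_smul_comm]

theorem signT_of_mem {i : ℤ} {x : P.T} (h : x ∈ P.grT i) : P.signT x = sgn i • x := by
  refine grT_induction (p := fun x => P.signT x = sgn i • x) (fun x hx => signT_word hx) (by simp)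
    (fun c x h => ?_) (fun x y h1 h2 => ?_) h
  · rw [map_smul, h, smul_comm]
  · rw [map_add, h1, h2, smul_add]

theorem dOp_gen (v : P.V) (a b : P.T) : P.dOp (P.gen v) (a, b) =
    (P.gen v * a, P.gen (P.d v) * a + P.gen (P.signV v) * b) := by
  rw [dOp, lift_gen]
  rfl

theorem dOp_apply (x a b : P.T) : P.dOp x (a, b) = (x * a, P.dT x * a + P.signT x * b) := by
  induction x using TensorAlgebra.induction generalizing a b with
  | algebraMap r => simp [dT, AlgHom.commutes, Module.algebraMap_end_apply, Algebra.smul_def]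
  | ι v =>
    change P.dOp (P.gen v) (a, b) = (P.gen v * a, (P.dOp (P.gen v) (1, 0)).2 * a +
      P.signT (P.gen v) * b)
    rw [dOp_gen, dOp_gen, signT_gen]
    simp
  | mul x y hx hy =>
    have h : P.dT (x * y) = P.dT x * y + P.signT x * P.dT y := by
      change (P.dOp (x * y) (1, 0)).2 = _
      rw [map_mul, Module.End.mul_apply, hy, hx]
      simp
    rw [map_mul, Module.End.mul_apply, hy, hx, h, map_mul]
    simp only [mul_add, add_mul, mul_assoc, add_assoc]
  | add x y hx hy =>
    rw [map_add, LinearMap.add_apply, hx, hy, map_add, map_add]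
    ext <;> simp [add_mul]; abel

theorem dT_mul' (x y : P.T) : P.dT (x * y) = P.dT x * y + P.signT x * P.dT y := by
  change (P.dOp (x * y) (1, 0)).2 = _
  rw [map_mul, Module.End.mul_apply, dOp_apply, dOp_apply]
  simp

theorem dT_gen (v : P.V) : P.dT (P.gen v) = P.gen (P.d v) := by
  change (P.dOp (P.gen v) (1, 0)).2 = _
  rw [dOp_gen]
  simp

theorem dT_one : P.dT 1 = 0 := by
  change (P.dOp 1 (1, 0)).2 = _
  simp

theorem dT_mul {i : ℤ} {x : P.T} (hx : x ∈ P.grT i) (y : P.T) :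
    P.dT (x * y) = P.dT x * y + sgn i • (x * P.dT y) := by
  rw [dT_mul', signT_of_mem hx, smul_mul_assoc]

theorem dT_word {i : ℤ} {x : P.T} (h : P.IsWord i x) : P.dT x ∈ P.grT (i + 1) := by
  induction h with
  | one => rw [dT_one]; exact zero_mem _
  | @cons i j v x hv hx ih =>
    rw [dT_mul (gen_mem hv), dT_gen]
    refine add_mem ?_ (zsmul_mem ?_ _)
    · have := SetLike.mul_mem_graded (gen_mem (P.d_mem i v hv)) hx.mem
      rwa [add_right_comm] at this
    · have := SetLike.mul_mem_graded (gen_mem hv) ih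
      rwa [← add_assoc] at this

theorem dT_mem {i : ℤ} {x : P.T} (h : x ∈ P.grT i) : P.dT x ∈ P.grT (i + 1) :=
  grT_induction (p := fun x => P.dT x ∈ P.grT (i + 1)) (fun x hx => dT_word hx) (by simp)
    (fun c x h => by rw [map_smul]; exact Submodule.smul_mem _ _ h)
    (fun x y h1 h2 => by rw [map_add]; exact add_mem h1 h2) h

theorem dT_dT (x : P.T) : P.dT (P.dT x) = 0 := by
  refine word_induction (p := fun x => P.dT (P.dT x) = 0) (fun i x h => ?_)
    (fun c x h => by rw [map_smul, map_smul, h, smul_zero])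
    (fun x y h1 h2 => by rw [map_add, map_add, h1, h2, add_zero]) x
  induction h with
  | one => rw [dT_one, map_zero]
  | @cons i j v x hv hx ih =>
    rw [dT_mul (gen_mem hv), map_add, map_zsmul, dT_gen, dT_mul (gen_mem (P.d_mem i v hv)),
      dT_mul (gen_mem hv), dT_gen, dT_gen, P.d_d, ih, sgn_add, sgn_one]
    simp

theorem starOp_gen {i : ℤ} {v : P.V} (hv : v ∈ P.gr i) (a : P.T) :
    (P.starOp (P.gen v)).unop a = P.gen v * (P.signT ^ i.natAbs) a := by
  rw [starOp, lift_gen, LinearMap.comp_apply, byDegree_of_mem _ hv]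
  rfl

theorem signT_pow_of_mem {j : ℤ} (n : ℕ) {x : P.T} (h : x ∈ P.grT j) :
    (P.signT ^ n) x = sgn (n * j) • x := by
  induction n with
  | zero => simp [sgn_zero]
  | succ n ih =>
    rw [pow_succ', AlgHom.mul_apply, ih, map_zsmul, signT_of_mem h, smul_smul, ← sgn_add]
    congr 2
    push_cast
    ring

theorem sgn_natAbs_mul (i j : ℤ) : sgn (i.natAbs * j) = sgn (i * j) := by
  rcases Int.natAbs_eq i with h | h
  · conv_rhs => rw [h]
  · conv_rhs => rw [h]
    rw [neg_mul, sgn, sgn, Int.negOnePow_neg]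

theorem starT_mul_gen_aux {i j : ℤ} {v : P.V} (hv : v ∈ P.gr i) {a : P.T} (ha : a ∈ P.grT j) :
    (P.starOp (P.gen v)).unop a = sgn (i * j) • (P.gen v * a) := by
  rw [starOp_gen hv, signT_pow_of_mem _ ha, sgn_natAbs_mul, mul_smul_comm]

end PairedComplex
namespace PairedComplex

variable {P : PairedComplex.{u}}

theorem starT_one : P.starT 1 = 1 := by
  change (P.starOp 1).unop 1 = 1
  simp

theorem starT_gen (v : P.V) : P.starT (P.gen v) = P.gen v := by
  refine gr_induction (p := fun v => P.starT (P.gen v) = P.gen v) (fun i v hv => ?_)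
    (fun v w h1 h2 => by rw [map_add, map_add, h1, h2]) v
  change (P.starOp (P.gen v)).unop 1 = P.gen v
  rw [starT_mul_gen_aux hv IsWord.one.mem]
  simp [sgn_zero]

theorem starOp_word {i : ℤ} {x : P.T} (h : P.IsWord i x) : P.starT x ∈ P.grT i ∧
    ∀ j, ∀ a ∈ P.grT j, (P.starOp x).unop a = sgn (i * j) • (P.starT x * a) := by
  induction h with
  | one =>
    refine ⟨?_, fun j a _ => ?_⟩
    · rw [starT_one]; exact IsWord.one.mem
    · rw [starT_one]; simp [sgn_zero]
  | @cons i k v x hv hx ih =>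
    have e (j : ℤ) (a : P.T) (ha : a ∈ P.grT j) : (P.starOp (P.gen v * x)).unop a =
        (sgn (i * j) * sgn (k * (i + j))) • (P.starT x * (P.gen v * a)) := by
      rw [map_mul, MulOpposite.unop_mul, Module.End.mul_apply, starT_mul_gen_aux hv ha, map_zsmul,
        ih.2 _ _ (SetLike.mul_mem_graded (gen_mem hv) ha), smul_smul]
    have e1 : P.starT (P.gen v * x) = sgn (k * i) • (P.starT x * P.gen v) := by
      have := e 0 1 IsWord.one.mem
      rw [mul_one] at this
      change (P.starOp (P.gen v * x)).unop 1 = _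
      rw [this]
      simp [sgn_zero]
    refine ⟨?_, fun j a ha => ?_⟩
    · rw [e1, add_comm i k]
      exact zsmul_mem (SetLike.mul_mem_graded ih.1 (gen_mem hv)) _
    · rw [e j a ha, e1, smul_mul_assoc, smul_smul, mul_assoc]
      congr 1
      rw [← sgn_add, ← sgn_add]
      congr 1
      ring

theorem starT_mem {i : ℤ} {x : P.T} (h : x ∈ P.grT i) : P.starT x ∈ P.grT i :=
  grT_induction (p := fun x => P.starT x ∈ P.grT i) (fun x hx => (starOp_word hx).1) (by simp)
    (fun c x h => by rw [map_smul]; exact Submodule.smul_mem _ _ h)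
    (fun x y h1 h2 => by rw [map_add]; exact add_mem h1 h2) h

theorem starT_mul {i j : ℤ} {x y : P.T} (hx : x ∈ P.grT i) (hy : y ∈ P.grT j) :
    P.starT (x * y) = sgn (i * j) • (P.starT y * P.starT x) := by
  refine grT_induction (p := fun y => P.starT (x * y) = sgn (i * j) • (P.starT y * P.starT x))
    (fun y hy => ?_) (by simp) (fun c y h => ?_) (fun y z h1 h2 => ?_) hy
  · change (P.starOp (x * y)).unop 1 = _
    rw [map_mul, MulOpposite.unop_mul, Module.End.mul_apply]
    rw [mul_comm]
    exact (starOp_word hy).2 i (P.starT x) (starT_mem hx)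
  · rw [mul_smul_comm, map_smul, h, map_smul, smul_mul_assoc, smul_comm]
  · rw [mul_add, map_add, h1, h2, map_add, add_mul, smul_add]

theorem starT_starT (x : P.T) : P.starT (P.starT x) = x := by
  refine word_induction (p := fun x => P.starT (P.starT x) = x) (fun i x h => ?_)
    (fun c x h => by rw [map_smul, map_smul, h])
    (fun x y h1 h2 => by rw [map_add, map_add, h1, h2]) x
  induction h with
  | one => rw [starT_one, starT_one]
  | @cons i j v x hv hx ih =>
    rw [starT_mul (gen_mem hv) hx.mem, map_zsmul,
      starT_mul (starT_mem hx.mem) (starT_mem (gen_mem hv)), starT_gen, starT_gen, ih, smul_smul,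
      mul_comm j i, sgn_mul_self, one_smul]

theorem starT_dT (x : P.T) : P.starT (P.dT x) = P.dT (P.starT x) := by
  refine word_induction (p := fun x => P.starT (P.dT x) = P.dT (P.starT x)) (fun i x h => ?_)
    (fun c x h => by simp only [map_smul, h])
    (fun x y h1 h2 => by simp only [map_add, h1, h2]) x
  induction h with
  | one => simp [starT_one, dT_one]
  | @cons i j v x hv hx ih =>
    rw [dT_mul (gen_mem hv), map_add, map_zsmul, dT_gen,
      starT_mul (gen_mem (P.d_mem i v hv)) hx.mem, starT_mul (gen_mem hv) (dT_word hx),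
      starT_mul (gen_mem hv) hx.mem, starT_gen, starT_gen, ih, map_zsmul,
      dT_mul (starT_mem hx.mem), dT_gen, smul_add, smul_smul, smul_smul, add_comm, ← sgn_add,
      ← sgn_add]
    congr 2
    · rw [sgn, sgn, show i + i * (j + 1) = i * j + (i + i) by ring, Int.negOnePow_add (i * j),
        Int.negOnePow_even _ ⟨i, rfl⟩, mul_one]
    · rw [show (i + 1) * j = i * j + j by ring]

end PairedComplex

/-- A differential graded *-algebra over `ℂ`, whose underlying algebra `A` is the direct sum of its
homogeneous parts `gr i`. -/
structure DGStarAlg : Type (u + 1) where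
  A : Type u
  [ring : Ring A]
  [algebra : Algebra ℂ A]
  gr : ℤ → Submodule ℂ A
  [graded : GradedAlgebra gr]
  d : A →ₗ[ℂ] A
  d_mem : ∀ i, ∀ a ∈ gr i, d a ∈ gr (i + 1)
  d_d : ∀ a, d (d a) = 0
  d_mul : ∀ i, ∀ a ∈ gr i, ∀ b, d (a * b) = d a * b + sgn i • (a * d b)
  conj : A →ₗ⋆[ℂ] A
  conj_mem : ∀ i, ∀ a ∈ gr i, conj a ∈ gr i
  conj_conj : ∀ a, conj (conj a) = a
  conj_one : conj 1 = 1
  conj_mul : ∀ i j, ∀ a ∈ gr i, ∀ b ∈ gr j, conj (a * b) = sgn (i * j) • (conj b * conj a)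
  conj_d : ∀ a, conj (d a) = d (conj a)

attribute [instance] DGStarAlg.ring DGStarAlg.algebra DGStarAlg.graded

namespace DGStarAlg

/-- Morphisms of differential graded *-algebras. -/
@[ext]
structure Hom (B C : DGStarAlg.{u}) where
  map : B.A →ₐ[ℂ] C.A
  map_mem : ∀ i, ∀ a ∈ B.gr i, map a ∈ C.gr i
  map_d : ∀ a, map (B.d a) = C.d (map a)
  map_conj : ∀ a, map (B.conj a) = C.conj (map a)

instance : Category DGStarAlg.{u} where
  Hom := Hom
  id B := ⟨AlgHom.id ℂ B.A, fun _ _ h => h, fun _ => rfl, fun _ => rfl⟩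
  comp f g := ⟨g.map.comp f.map, fun i a h => g.map_mem i _ (f.map_mem i a h),
    fun a => by simp [f.map_d, g.map_d], fun a => by simp [f.map_conj, g.map_conj]⟩

/-- The underlying cochain complex of a differential graded *-algebra. -/
def toComplex (B : DGStarAlg.{u}) : CochainComplex (ModuleCat.{u} ℂ) ℤ :=
  CochainComplex.of (fun i => ModuleCat.of ℂ (B.gr i))
    (fun i => ModuleCat.ofHom (B.d.restrict (B.d_mem i)))
    (fun i => by
      refine ModuleCat.hom_ext (LinearMap.ext fun a => ?_)
      exact Subtype.ext (B.d_d a))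

theorem toComplex_d (B : DGStarAlg.{u}) (i : ℤ) :
    B.toComplex.d i (i + 1) = ModuleCat.ofHom (B.d.restrict (B.d_mem i)) :=
  CochainComplex.of_d _ (fun i => ModuleCat.ofHom (B.d.restrict (B.d_mem i))) i

/-- The cochain map underlying a morphism of differential graded *-algebras. -/
def Hom.toComplex {B C : DGStarAlg.{u}} (f : Hom B C) : B.toComplex ⟶ C.toComplex :=
  CochainComplex.ofHom
    (fun i => ModuleCat.ofHom (f.map.toLinearMap.restrict fun a ha => f.map_mem i a ha))
    (fun i => by
      rw [toComplex_d, toComplex_d]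
      refine ModuleCat.hom_ext (LinearMap.ext fun a => ?_)
      exact Subtype.ext (f.map_d _).symm)

/-- A two-sided differential graded *-ideal. -/
structure IsDGIdeal (B : DGStarAlg.{u}) (J : Ideal B.A) : Prop where
  mul_mem_right : ∀ a ∈ J, ∀ b, a * b ∈ J
  decompose_mem : ∀ a ∈ J, ∀ i, (DirectSum.decompose B.gr a i : B.A) ∈ J
  d_mem : ∀ a ∈ J, B.d a ∈ J
  conj_mem : ∀ a ∈ J, B.conj a ∈ J

end DGStarAlg

/-! Quotients by differential graded *-ideals. -/

namespace DGStarAlg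

variable {B : DGStarAlg.{u}} {J : Ideal B.A}

theorem IsDGIdeal.isTwoSided (hJ : B.IsDGIdeal J) : J.IsTwoSided :=
  ⟨fun b ha => hJ.mul_mem_right _ ha b⟩

/-- The intersection of all differential graded *-ideals containing `S`. -/
def dgSpan (B : DGStarAlg.{u}) (S : Set B.A) : Ideal B.A :=
  sInf {J | B.IsDGIdeal J ∧ S ⊆ J}

theorem isDGIdeal_dgSpan (B : DGStarAlg.{u}) (S : Set B.A) : B.IsDGIdeal (B.dgSpan S) where
  mul_mem_right a ha b := by
    rw [dgSpan, Submodule.mem_sInf] at ha ⊢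
    exact fun J hJ => hJ.1.mul_mem_right a (ha J hJ) b
  decompose_mem a ha i := by
    rw [dgSpan, Submodule.mem_sInf] at ha ⊢
    exact fun J hJ => hJ.1.decompose_mem a (ha J hJ) i
  d_mem a ha := by
    rw [dgSpan, Submodule.mem_sInf] at ha ⊢
    exact fun J hJ => hJ.1.d_mem a (ha J hJ)
  conj_mem a ha := by
    rw [dgSpan, Submodule.mem_sInf] at ha ⊢
    exact fun J hJ => hJ.1.conj_mem a (ha J hJ)

theorem subset_dgSpan (B : DGStarAlg.{u}) (S : Set B.A) {a : B.A} (ha : a ∈ S) :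
    a ∈ B.dgSpan S := by
  rw [dgSpan, Submodule.mem_sInf]
  exact fun J hJ => hJ.2 ha

theorem dgSpan_le {S : Set B.A} (hJ : B.IsDGIdeal J) (h : S ⊆ J) : B.dgSpan S ≤ J :=
  sInf_le ⟨hJ, h⟩

/-- The preimage of a differential graded *-ideal under a morphism. -/
theorem IsDGIdeal.comap {C : DGStarAlg.{u}} (f : Hom B C) {K : Ideal C.A} (hK : C.IsDGIdeal K) :
    B.IsDGIdeal (K.comap f.map) where
  mul_mem_right a ha b := by
    rw [Ideal.mem_comap] at ha ⊢
    rw [map_mul]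
    exact hK.mul_mem_right _ ha _
  decompose_mem a ha i := by
    rw [Ideal.mem_comap] at ha ⊢
    have key : ∀ a, f.map (DirectSum.decompose B.gr a i) = DirectSum.decompose C.gr (f.map a) i := by
      intro a
      refine DirectSum.Decomposition.inductionOn B.gr
        (motive := fun a => f.map (DirectSum.decompose B.gr a i) =
          DirectSum.decompose C.gr (f.map a) i) (by simp) (fun {j} a => ?_)
        (fun a b h1 h2 => by simp [h1, h2]) a
      by_cases hij : j = i
      · subst hij
        rw [DirectSum.decompose_of_mem_same _ a.2,
          DirectSum.decompose_of_mem_same _ (f.map_mem _ _ a.2)]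
      · rw [DirectSum.decompose_of_mem_ne _ a.2 hij,
          DirectSum.decompose_of_mem_ne _ (f.map_mem _ _ a.2) hij, map_zero]
    rw [key]
    exact hK.decompose_mem _ ha i
  d_mem a ha := by
    rw [Ideal.mem_comap] at ha ⊢
    rw [f.map_d]
    exact hK.d_mem _ ha
  conj_mem a ha := by
    rw [Ideal.mem_comap] at ha ⊢
    rw [f.map_conj]
    exact hK.conj_mem _ ha

section Quot

variable (B J) [J.IsTwoSided]

/-- The homogeneous parts of the quotient. -/
def grQuot (i : ℤ) : Submodule ℂ (B.A ⧸ J) :=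
  (B.gr i).map (Ideal.Quotient.mkₐ ℂ J).toLinearMap

variable {B J}

theorem mk_mem_grQuot {i : ℤ} {a : B.A} (ha : a ∈ B.gr i) :
    Ideal.Quotient.mk J a ∈ grQuot B J i := ⟨a, ha, rfl⟩

instance : SetLike.GradedMonoid (grQuot B J) where
  one_mem := ⟨1, SetLike.one_mem_graded B.gr, rfl⟩
  mul_mem := by
    rintro i j _ _ ⟨a, ha, rfl⟩ ⟨b, hb, rfl⟩
    exact ⟨a * b, SetLike.mul_mem_graded ha hb, rfl⟩

variable (B J)

/-- The decomposition of the class of an element into homogeneous components. -/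
def decomposeQuot : B.A →ₐ[ℂ] ⨁ i, grQuot B J i :=
  (DirectSum.toAlgebra ℂ (fun i => B.gr i)
    (fun i => DirectSum.lof ℂ ℤ (fun i => grQuot B J i) i ∘ₗ
      ((Ideal.Quotient.mkₐ ℂ J).toLinearMap.restrict fun a ha => mk_mem_grQuot ha))
    rfl (fun {i j} a b => by
      simp only [LinearMap.comp_apply, DirectSum.lof_eq_of, DirectSum.of_mul_of]
      congr 1)).comp
    (DirectSum.decomposeAlgEquiv B.gr).toAlgHom

variable {B J}

theorem decomposeQuot_of_mem {i : ℤ} {a : B.A} (ha : a ∈ B.gr i) :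
    decomposeQuot B J a = DirectSum.of (fun i => grQuot B J i) i
      ⟨Ideal.Quotient.mk J a, mk_mem_grQuot ha⟩ := by
  have h : DirectSum.decomposeAlgEquiv B.gr a =
      DirectSum.lof ℂ ℤ (fun i => B.gr i) i ⟨a, ha⟩ := DirectSum.decompose_of_mem _ ha
  rw [decomposeQuot, AlgHom.comp_apply]
  refine (congrArg _ h).trans ?_
  exact DirectSum.toModule_lof ..

theorem decomposeQuot_apply (a : B.A) (i : ℤ) : (decomposeQuot B J a i : B.A ⧸ J) =
    Ideal.Quotient.mk J (DirectSum.decompose B.gr a i) := by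
  refine DirectSum.Decomposition.inductionOn B.gr
    (motive := fun a => (decomposeQuot B J a i : B.A ⧸ J) =
      Ideal.Quotient.mk J (DirectSum.decompose B.gr a i)) (by simp) (fun {j} a => ?_)
    (fun a b h1 h2 => by simp [h1, h2]) a
  rw [decomposeQuot_of_mem a.2]
  by_cases hij : j = i
  · subst hij
    rw [DirectSum.of_eq_same, DirectSum.decompose_of_mem_same _ a.2]
  · rw [DirectSum.of_eq_of_ne _ _ _ (Ne.symm hij), DirectSum.decompose_of_mem_ne _ a.2 hij, map_zero]
    rfl

/-- The quotient by a differential graded ideal is graded. -/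
@[reducible]
def gradedQuot (hJ : B.IsDGIdeal J) : GradedAlgebra (grQuot B J) :=
  GradedAlgebra.ofAlgHom _ (Ideal.Quotient.liftₐ J (decomposeQuot B J) fun a ha => by
      refine DFinsupp.ext fun i => Subtype.ext ?_
      rw [decomposeQuot_apply]
      exact Ideal.Quotient.eq_zero_iff_mem.mpr (hJ.decompose_mem a ha i))
    (by
      refine Ideal.Quotient.algHom_ext _ (AlgHom.ext fun a => ?_)
      change DirectSum.coeAlgHom (grQuot B J) (decomposeQuot B J a) = Ideal.Quotient.mk J a
      refine DirectSum.Decomposition.inductionOn B.gr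
        (motive := fun a => DirectSum.coeAlgHom (grQuot B J) (decomposeQuot B J a) =
          Ideal.Quotient.mk J a) (by simp) (fun {j} a => ?_)
        (fun a b h1 h2 => by simp [h1, h2]) a
      rw [decomposeQuot_of_mem a.2, DirectSum.coeAlgHom_of])
    (by
      rintro i ⟨_, a, ha, rfl⟩
      exact decomposeQuot_of_mem ha)

/-- The differential of the quotient. -/
def dQuot (hJ : B.IsDGIdeal J) : (B.A ⧸ J) →ₗ[ℂ] (B.A ⧸ J) where
  toFun := Quotient.lift (fun a => Ideal.Quotient.mk J (B.d a)) (fun a b hab => by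
    have h : a - b ∈ J := (Submodule.quotientRel_def J).mp hab
    refine Ideal.Quotient.eq.mpr ?_
    rw [← map_sub]
    exact hJ.d_mem _ h)
  map_add' := by
    rintro ⟨a⟩ ⟨b⟩
    change Ideal.Quotient.mk J (B.d (a + b)) = _
    rw [map_add]
    rfl
  map_smul' := by
    rintro c ⟨a⟩
    change Ideal.Quotient.mk J (B.d (c • a)) = _
    rw [map_smul]
    exact map_smul (Ideal.Quotient.mkₐ ℂ J) c (B.d a)

theorem dQuot_mk (hJ : B.IsDGIdeal J) (a : B.A) :
    dQuot hJ (Ideal.Quotient.mk J a) = Ideal.Quotient.mk J (B.d a) := rfl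

/-- The involution of the quotient. -/
def conjQuot (hJ : B.IsDGIdeal J) : (B.A ⧸ J) →ₗ⋆[ℂ] (B.A ⧸ J) where
  toFun := Quotient.lift (fun a => Ideal.Quotient.mk J (B.conj a)) (fun a b hab => by
    have h : a - b ∈ J := (Submodule.quotientRel_def J).mp hab
    refine Ideal.Quotient.eq.mpr ?_
    rw [← map_sub]
    exact hJ.conj_mem _ h)
  map_add' := by
    rintro ⟨a⟩ ⟨b⟩
    change Ideal.Quotient.mk J (B.conj (a + b)) = _
    rw [map_add]
    rfl
  map_smul' := by
    rintro c ⟨a⟩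
    change Ideal.Quotient.mk J (B.conj (c • a)) = _
    rw [LinearMap.map_smulₛₗ]
    exact map_smul (Ideal.Quotient.mkₐ ℂ J) _ (B.conj a)

theorem conjQuot_mk (hJ : B.IsDGIdeal J) (a : B.A) :
    conjQuot hJ (Ideal.Quotient.mk J a) = Ideal.Quotient.mk J (B.conj a) := rfl

end Quot

/-- The quotient of a differential graded *-algebra by a differential graded *-ideal. -/
def quot (B : DGStarAlg.{u}) (J : Ideal B.A) (hJ : B.IsDGIdeal J) : DGStarAlg.{u} :=
  haveI := hJ.isTwoSided
  { A := B.A ⧸ J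
    gr := grQuot B J
    graded := gradedQuot hJ
    d := dQuot hJ
    d_mem := by
      rintro i _ ⟨a, ha, rfl⟩
      exact mk_mem_grQuot (B.d_mem i a ha)
    d_d := by
      rintro ⟨a⟩
      change Ideal.Quotient.mk J (B.d (B.d a)) = 0
      rw [B.d_d, map_zero]
    d_mul := by
      rintro i _ ⟨a, ha, rfl⟩ ⟨b⟩
      change Ideal.Quotient.mk J (B.d (a * b)) = _
      rw [B.d_mul i a ha b, map_add, map_zsmul, map_mul, map_mul]
      rfl
    conj := conjQuot hJ
    conj_mem := by
      rintro i _ ⟨a, ha, rfl⟩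
      exact mk_mem_grQuot (B.conj_mem i a ha)
    conj_conj := by
      rintro ⟨a⟩
      change Ideal.Quotient.mk J (B.conj (B.conj a)) = Ideal.Quotient.mk J a
      rw [B.conj_conj]
    conj_one := by
      change Ideal.Quotient.mk J (B.conj 1) = Ideal.Quotient.mk J 1
      rw [B.conj_one]
    conj_mul := by
      rintro i j _ ⟨a, ha, rfl⟩ _ ⟨b, hb, rfl⟩
      change Ideal.Quotient.mk J (B.conj (a * b)) = _
      rw [B.conj_mul i j a ha b hb, map_zsmul, map_mul]
      rfl
    conj_d := by
      rintro ⟨a⟩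
      change Ideal.Quotient.mk J (B.conj (B.d a)) = Ideal.Quotient.mk J (B.d (B.conj a))
      rw [B.conj_d] }

/-- A morphism which maps the ideal `J` into the ideal `K` descends to the quotients. -/
def quotMap {B C : DGStarAlg.{u}} (f : Hom B C) {J : Ideal B.A} (hJ : B.IsDGIdeal J)
    {K : Ideal C.A} (hK : C.IsDGIdeal K) (h : ∀ a ∈ J, f.map a ∈ K) :
    Hom (B.quot J hJ) (C.quot K hK) :=
  haveI := hJ.isTwoSided
  haveI := hK.isTwoSided
  { map := Ideal.Quotient.liftₐ J ((Ideal.Quotient.mkₐ ℂ K).comp f.map) fun a ha =>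
      Ideal.Quotient.eq_zero_iff_mem.mpr (h a ha)
    map_mem := by
      rintro i _ ⟨a, ha, rfl⟩
      exact mk_mem_grQuot (f.map_mem i a ha)
    map_d := by
      rintro ⟨a⟩
      exact congrArg (Ideal.Quotient.mk K) (f.map_d a)
    map_conj := by
      rintro ⟨a⟩
      exact congrArg (Ideal.Quotient.mk K) (f.map_conj a) }

end DGStarAlg

/-! The canonical commutation relations. -/

namespace PairedComplex

variable (P : PairedComplex.{u})

/-- The complexified tensor algebra. -/
abbrev TC : Type u := ℂ ⊗[ℝ] P.T

/-- Complex conjugation as a real-linear map. -/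
def conjR : ℂ →ₗ[ℝ] ℂ := Complex.conjAe.toLinearMap

variable {P} in
theorem tc_ext {W : Type*} [AddCommMonoid W] {f g : P.TC →+ W}
    (h : ∀ z x, f (z ⊗ₜ x) = g (z ⊗ₜ x)) : f = g := by
  ext a
  induction a using TensorProduct.induction_on with
  | zero => simp
  | tmul z x => exact h z x
  | add a b h1 h2 => rw [map_add, map_add, h1, h2]

variable {P} in
theorem tc_gr_induction {i : ℤ} {p : P.TC → Prop} (h0 : p 0)
    (ht : ∀ (z : ℂ) (x : P.T), x ∈ P.grT i → p (z ⊗ₜ x)) (hadd : ∀ a b, p a → p b → p (a + b))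
    {a : P.TC} (ha : a ∈ (P.grT i).baseChange ℂ) : p a := by
  rw [Submodule.baseChange_eq_span] at ha
  have key : ∀ z : ℂ, p (z • a) := by
    refine Submodule.span_induction (p := fun a _ => ∀ z : ℂ, p (z • a)) ?_ ?_ ?_ ?_ ha
    · rintro _ ⟨x, hx, rfl⟩ z
      have := ht z x hx
      simpa [TensorProduct.smul_tmul'] using this
    · intro z
      rwa [smul_zero]
    · intro a b _ _ h1 h2 z
      rw [smul_add]
      exact hadd _ _ (h1 z) (h2 z)
    · intro c a _ h z
      rw [smul_smul]
      exact h _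
  simpa using key 1

/-- The antilinear involution of the complexified tensor algebra. -/
def conjTC : P.TC →ₗ⋆[ℂ] P.TC where
  toFun := TensorProduct.map conjR P.starT
  map_add' := map_add _
  map_smul' c a := by
    induction a using TensorProduct.induction_on with
    | zero => simp
    | tmul z x => simp [TensorProduct.smul_tmul', conjR]
    | add a b h1 h2 => rw [smul_add, map_add, h1, h2, map_add, smul_add]

variable {P} in
theorem conjTC_tmul (z : ℂ) (x : P.T) :
    P.conjTC (z ⊗ₜ x) = (starRingEnd ℂ z) ⊗ₜ P.starT x := rfl

/-- The free differential graded *-algebra on a cochain complex. -/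
def tensorDG : DGStarAlg.{u} where
  A := P.TC
  gr i := (P.grT i).baseChange ℂ
  d := P.dT.baseChange ℂ
  d_mem i a ha := by
    refine tc_gr_induction (p := fun a => P.dT.baseChange ℂ a ∈ (P.grT (i + 1)).baseChange ℂ)
      ?_ (fun z x hx => ?_) (fun a b h1 h2 => ?_) ha
    · rw [map_zero]; exact zero_mem _
    · exact Submodule.tmul_mem_baseChange_of_mem z (dT_mem hx)
    · rw [map_add]; exact add_mem h1 h2
  d_d a := by
    induction a using TensorProduct.induction_on with
    | zero => simp
    | tmul z x => simp [dT_dT]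
    | add a b h1 h2 => rw [map_add, map_add, h1, h2, add_zero]
  d_mul i a ha b := by
    refine tc_gr_induction (p := fun a => P.dT.baseChange ℂ (a * b) =
      P.dT.baseChange ℂ a * b + sgn i • (a * P.dT.baseChange ℂ b)) (by simp) (fun z x hx => ?_)
      (fun a b h1 h2 => ?_) ha
    · induction b using TensorProduct.induction_on with
      | zero => simp
      | tmul w y =>
        simp only [Algebra.TensorProduct.tmul_mul_tmul, LinearMap.baseChange_tmul, dT_mul hx,
          TensorProduct.tmul_add]
        congr 1
        exact (map_zsmul (TensorProduct.mk ℝ ℂ P.T (z * w)) _ _)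
      | add b b' h1 h2 =>
        rw [mul_add, map_add, h1, h2, map_add, mul_add, mul_add, smul_add]
        abel
    · rw [add_mul, map_add, h1, h2, map_add, add_mul, add_mul, smul_add]
      abel
  conj := P.conjTC
  conj_mem i a ha := by
    refine tc_gr_induction (p := fun a => P.conjTC a ∈ (P.grT i).baseChange ℂ)
      ?_ (fun z x hx => ?_) (fun a b h1 h2 => ?_) ha
    · rw [map_zero]; exact zero_mem _
    · exact Submodule.tmul_mem_baseChange_of_mem _ (starT_mem hx)
    · rw [map_add]; exact add_mem h1 h2
  conj_conj a := by
    induction a using TensorProduct.induction_on with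
    | zero => simp
    | tmul z x => rw [conjTC_tmul, conjTC_tmul, starT_starT, Complex.conj_conj]
    | add a b h1 h2 => rw [map_add, map_add, h1, h2]
  conj_one := by
    rw [Algebra.TensorProduct.one_def, conjTC_tmul, starT_one, map_one]
  conj_mul i j a ha b hb := by
    refine tc_gr_induction (p := fun a => P.conjTC (a * b) =
      sgn (i * j) • (P.conjTC b * P.conjTC a)) (by simp) (fun z x hx => ?_)
      (fun a b h1 h2 => ?_) ha
    · refine tc_gr_induction (p := fun b => P.conjTC (z ⊗ₜ x * b) =
        sgn (i * j) • (P.conjTC b * P.conjTC (z ⊗ₜ x))) (by simp) (fun w y hy => ?_)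
        (fun a b h1 h2 => ?_) hb
      · simp only [Algebra.TensorProduct.tmul_mul_tmul, conjTC_tmul, starT_mul hx hy, map_mul]
        rw [mul_comm (starRingEnd ℂ z)]
        exact (map_zsmul (TensorProduct.mk ℝ ℂ P.T _) _ _)
      · rw [mul_add, map_add, h1, h2, map_add, add_mul, smul_add]
    · rw [add_mul, map_add, h1, h2, map_add, mul_add, smul_add]
  conj_d a := by
    induction a using TensorProduct.induction_on with
    | zero => simp
    | tmul z x => rw [LinearMap.baseChange_tmul, conjTC_tmul, conjTC_tmul,
        LinearMap.baseChange_tmul, starT_dT]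
    | add a b h1 h2 => simp only [map_add, h1, h2]

/-- The generator of the complexified tensor algebra given by an element of `V`. -/
def genC (v : P.V) : P.tensorDG.A := (1 : ℂ) ⊗ₜ[ℝ] P.gen v

/-- The differences of the two sides of the canonical commutation relations
`v ⊗ w - (-1)^(|v||w|) w ⊗ v = i τ(v, w) 1`. -/
def ccrRel : Set P.tensorDG.A :=
  {a | ∃ i j, ∃ v ∈ P.gr i, ∃ w ∈ P.gr j,
    a = P.genC v * P.genC w - sgn (i * j) • (P.genC w * P.genC v) -
      algebraMap ℂ P.tensorDG.A (Complex.I * (P.τ v w : ℂ))}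

/-- The algebra of canonical commutation relations: the quotient of the complexified tensor algebra
by the differential graded *-ideal generated by the canonical commutation relations. -/
def ccrAlg : DGStarAlg.{u} :=
  P.tensorDG.quot (P.tensorDG.dgSpan P.ccrRel) (P.tensorDG.isDGIdeal_dgSpan _)

variable {P} {Q : PairedComplex.{u}} (f : Hom P Q)

/-- The algebra homomorphism between tensor algebras induced by a morphism. -/
def Hom.mapT : P.T →ₐ[ℝ] Q.T := TensorAlgebra.lift ℝ (Q.gen ∘ₗ f.map)

theorem Hom.mapT_gen (v : P.V) : f.mapT (P.gen v) = Q.gen (f.map v) := by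
  rw [Hom.mapT, lift_gen]
  rfl

theorem Hom.mapT_word {i : ℤ} {x : P.T} (h : P.IsWord i x) : Q.IsWord i (f.mapT x) := by
  induction h with
  | one => rw [map_one]; exact IsWord.one
  | cons hv _ ih => rw [map_mul, Hom.mapT_gen]; exact IsWord.cons (f.map_mem _ _ hv) ih

theorem Hom.mapT_mem {i : ℤ} {x : P.T} (h : x ∈ P.grT i) : f.mapT x ∈ Q.grT i :=
  grT_induction (p := fun x => f.mapT x ∈ Q.grT i) (fun x hx => (f.mapT_word hx).mem) (by simp)
    (fun c x h => by rw [map_smul]; exact Submodule.smul_mem _ _ h)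
    (fun x y h1 h2 => by rw [map_add]; exact add_mem h1 h2) h

theorem Hom.mapT_dT (x : P.T) : f.mapT (P.dT x) = Q.dT (f.mapT x) := by
  refine word_induction (p := fun x => f.mapT (P.dT x) = Q.dT (f.mapT x)) (fun i x h => ?_)
    (fun c x h => by simp only [map_smul, h])
    (fun x y h1 h2 => by simp only [map_add, h1, h2]) x
  induction h with
  | one => simp [dT_one]
  | cons hv hx ih =>
    rw [dT_mul (gen_mem hv), map_mul, f.mapT_gen, dT_mul (gen_mem (f.map_mem _ _ hv)), dT_gen,
      dT_gen, map_add, map_zsmul, map_mul, map_mul, f.mapT_gen, f.mapT_gen, ih, f.map_d]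

theorem Hom.mapT_starT (x : P.T) : f.mapT (P.starT x) = Q.starT (f.mapT x) := by
  refine word_induction (p := fun x => f.mapT (P.starT x) = Q.starT (f.mapT x)) (fun i x h => ?_)
    (fun c x h => by simp only [map_smul, h])
    (fun x y h1 h2 => by simp only [map_add, h1, h2]) x
  induction h with
  | one => simp [starT_one]
  | cons hv hx ih =>
    rw [starT_mul (gen_mem hv) hx.mem, map_zsmul, map_mul, map_mul, f.mapT_gen,
      starT_mul (gen_mem (f.map_mem _ _ hv)) (f.mapT_word hx).mem, starT_gen, starT_gen,
      f.mapT_gen, ih]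

/-- The morphism between complexified tensor algebras induced by a morphism. -/
def Hom.mapTC : DGStarAlg.Hom P.tensorDG Q.tensorDG where
  map := Algebra.TensorProduct.map (AlgHom.id ℂ ℂ) f.mapT
  map_mem i a ha := by
    refine tc_gr_induction (p := fun a => Algebra.TensorProduct.map (AlgHom.id ℂ ℂ) f.mapT a ∈
      (Q.grT i).baseChange ℂ) ?_ (fun z x hx => ?_) (fun a b h1 h2 => ?_) ha
    · rw [map_zero]; exact zero_mem _
    · exact Submodule.tmul_mem_baseChange_of_mem _ (f.mapT_mem hx)
    · rw [map_add]; exact add_mem h1 h2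
  map_d a := by
    change Algebra.TensorProduct.map (AlgHom.id ℂ ℂ) f.mapT (P.dT.baseChange ℂ a) =
      Q.dT.baseChange ℂ (Algebra.TensorProduct.map (AlgHom.id ℂ ℂ) f.mapT a)
    induction a using TensorProduct.induction_on with
    | zero => simp
    | tmul z x => simp [f.mapT_dT]
    | add a b h1 h2 => simp only [map_add, h1, h2]
  map_conj a := by
    change Algebra.TensorProduct.map (AlgHom.id ℂ ℂ) f.mapT (P.conjTC a) =
      Q.conjTC (Algebra.TensorProduct.map (AlgHom.id ℂ ℂ) f.mapT a)
    induction a using TensorProduct.induction_on with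
    | zero => simp
    | tmul z x => simp [conjTC_tmul, f.mapT_starT]
    | add a b h1 h2 => simp only [map_add, h1, h2]

theorem Hom.mapTC_genC (v : P.V) : f.mapTC.map (P.genC v) = Q.genC (f.map v) := by
  change (AlgHom.id ℂ ℂ 1) ⊗ₜ[ℝ] f.mapT (P.gen v) = _
  rw [f.mapT_gen]
  rfl

theorem Hom.mapTC_mem {a : P.tensorDG.A} (ha : a ∈ P.tensorDG.dgSpan P.ccrRel) :
    f.mapTC.map a ∈ Q.tensorDG.dgSpan Q.ccrRel := by
  have hle : P.tensorDG.dgSpan P.ccrRel ≤ (Q.tensorDG.dgSpan Q.ccrRel).comap f.mapTC.map := by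
    refine DGStarAlg.dgSpan_le ((Q.tensorDG.isDGIdeal_dgSpan _).comap f.mapTC) ?_
    rintro _ ⟨i, j, v, hv, w, hw, rfl⟩
    refine DGStarAlg.subset_dgSpan _ _
      ⟨i, j, f.map v, f.map_mem _ _ hv, f.map w, f.map_mem _ _ hw, ?_⟩
    rw [map_sub, map_sub, map_zsmul, map_mul, map_mul, f.mapTC_genC, f.mapTC_genC, AlgHom.commutes,
      f.map_τ]
  exact hle ha

/-- The morphism between algebras of canonical commutation relations induced by a morphism. -/
def Hom.mapCCR : DGStarAlg.Hom P.ccrAlg Q.ccrAlg :=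
  DGStarAlg.quotMap f.mapTC _ _ fun _ ha => f.mapTC_mem ha

theorem mapTC_id (a : P.TC) : (Hom.mapTC (𝟙 P : Hom P P)).map a = a := by
  have h : Hom.mapT (𝟙 P : Hom P P) = AlgHom.id ℝ P.T := by
    refine TensorAlgebra.hom_ext (LinearMap.ext fun v => ?_)
    exact Hom.mapT_gen _ v
  change Algebra.TensorProduct.map (AlgHom.id ℂ ℂ) (Hom.mapT (𝟙 P : Hom P P)) a = a
  rw [h]
  simp

theorem mapTC_comp {R : PairedComplex.{u}} (f : P ⟶ Q) (g : Q ⟶ R) (a : P.TC) :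
    (Hom.mapTC (f ≫ g : Hom P R)).map a =
      (Hom.mapTC (g : Hom Q R)).map ((Hom.mapTC (f : Hom P Q)).map a) := by
  have h : Hom.mapT (f ≫ g : Hom P R) = (Hom.mapT (g : Hom Q R)).comp (Hom.mapT (f : Hom P Q)) := by
    refine TensorAlgebra.hom_ext (LinearMap.ext fun v => ?_)
    change Hom.mapT (f ≫ g : Hom P R) (P.gen v) =
      Hom.mapT (g : Hom Q R) (Hom.mapT (f : Hom P Q) (P.gen v))
    rw [Hom.mapT_gen, Hom.mapT_gen, Hom.mapT_gen]
    rfl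
  change Algebra.TensorProduct.map (AlgHom.id ℂ ℂ) (Hom.mapT (f ≫ g : Hom P R)) a =
    Algebra.TensorProduct.map (AlgHom.id ℂ ℂ) (Hom.mapT (g : Hom Q R))
      (Algebra.TensorProduct.map (AlgHom.id ℂ ℂ) (Hom.mapT (f : Hom P Q)) a)
  rw [h]
  induction a using TensorProduct.induction_on with
  | zero => simp
  | tmul z x => simp
  | add a b h1 h2 => simp only [map_add, h1, h2]

/-- The functor of canonical commutation relations, from Poisson cochain complexes to differential
graded *-algebras. -/
def CCR : PairedComplex.{u} ⥤ DGStarAlg.{u} where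
  obj P := P.ccrAlg
  map f := Hom.mapCCR f
  map_id P := by
    refine DGStarAlg.Hom.ext (AlgHom.ext ?_)
    rintro ⟨a⟩
    exact congrArg (Submodule.Quotient.mk (p := P.tensorDG.dgSpan P.ccrRel)) (mapTC_id a)
  map_comp {P Q R} f g := by
    refine DGStarAlg.Hom.ext (AlgHom.ext ?_)
    rintro ⟨a⟩
    exact congrArg (Submodule.Quotient.mk (p := R.tensorDG.dgSpan R.ccrRel)) (mapTC_comp f g a)

end PairedComplex
end Algebra

section Geometry

universe u v

/-- The model space of the boundary. -/
abbrev E2 : Type := EuclideanSpace ℝ (Fin 2)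

/-- The model vector space of the bulk. -/
abbrev E3 : Type := EuclideanSpace ℝ (Fin 3)

/-- The standard basis. -/
abbrev stdVec {n : ℕ} (i : Fin n) : EuclideanSpace ℝ (Fin n) := EuclideanSpace.single i 1

/-- An oriented `3`-manifold `M` with boundary, with boundary inclusion `ι : N → M`, whose boundary
is endowed with a time-oriented Lorentzian metric of signature `(-,+)`. The orientation of `M` is
represented by a nowhere vanishing `3`-form, the time-orientation of `N = ∂M` by a timelike
vector field. -/
structure BulkBoundary (M : Type u) [TopologicalSpace M] [ChartedSpace (EuclideanHalfSpace 3) M]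
    (N : Type v) [TopologicalSpace N] [ChartedSpace E2 N] [IsManifold (𝓡 2) ∞ N] where
  orient : M → E3 [⋀^Fin 3]→L[ℝ] ℝ
  orient_smooth : IsSmoothForm (𝓡∂ 3) orient
  orient_ne_zero : ∀ x, orient x ≠ 0
  ι : N → M
  ι_smooth : ContMDiff (𝓡 2) (𝓡∂ 3) ∞ ι
  ι_embedding : IsEmbedding ι
  ι_immersion : ∀ p, Function.Injective (mfderiv (𝓡 2) (𝓡∂ 3) ι p)
  range_ι : range ι = (𝓡∂ 3).boundary M
  g : N → E2 →L[ℝ] E2 →L[ℝ] ℝ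
  g_symm : ∀ p u w, g p u w = g p w u
  g_smooth : ∀ (p₀ : N) (u w : E2), ContDiffOn ℝ ∞ (fun y => g ((extChartAt (𝓡 2) p₀).symm y)
    (coordDeriv (𝓡 2) p₀ y u) (coordDeriv (𝓡 2) p₀ y w)) (extChartAt (𝓡 2) p₀).target
  g_pos : ∀ p, ∃ w, 0 < g p w w
  t : (p : N) → TangentSpace (𝓡 2) p
  t_smooth : ContMDiff (𝓡 2) (𝓡 2).tangent ∞ fun p => (⟨p, t p⟩ : TangentBundle (𝓡 2) N)
  t_timelike : ∀ p, g p (t p) (t p) < 0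

variable {M : Type u} [TopologicalSpace M] [ChartedSpace (EuclideanHalfSpace 3) M]
  {N : Type v} [TopologicalSpace N] [ChartedSpace E2 N] [IsManifold (𝓡 2) ∞ N]

namespace BulkBoundary

variable (X : BulkBoundary M N)

/-- The derivative of the boundary inclusion. -/
def dι (p : N) : E2 →L[ℝ] E3 := mfderiv (𝓡 2) (𝓡∂ 3) X.ι p

/-- The induced orientation of the boundary, represented by the contraction of the orientation of
the bulk with an outward pointing vector (in the first slot). In the preferred chart at a boundary
point, `M` is the half space `0 ≤ x₀`, so that `-e₀` is outward pointing. -/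
def bdryOrient (p : N) : E2 [⋀^Fin 2]→L[ℝ] ℝ :=
  ((X.orient (X.ι p)).curryLeft (-stdVec 0)).compContinuousLinearMap (X.dι p)

/-- The volume form of the boundary metric: the positive multiple of `bdryOrient` with
`|vol(e₀, e₁)| = √|det g|`. -/
def vol (p : N) : E2 [⋀^Fin 2]→L[ℝ] ℝ :=
  (√|X.g p (stdVec 0) (stdVec 0) * X.g p (stdVec 1) (stdVec 1) - X.g p (stdVec 0) (stdVec 1) ^ 2| /
    |X.bdryOrient p ![stdVec 0, stdVec 1]|) • X.bdryOrient p

/-- The pullback of a form to the boundary. -/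
def pull {n : ℕ} (α : M → E3 [⋀^Fin n]→L[ℝ] ℝ) (p : N) : E2 [⋀^Fin n]→L[ℝ] ℝ :=
  (α (X.ι p)).compContinuousLinearMap (X.dι p)

/-- Self-duality (`ε = 1`) or anti-self-duality (`ε = -1`) of a covector at a boundary point,
`∗α = ε α`, where `∗α = vol(u, -)` for the vector `u` with `g(u, -) = α`. -/
def IsSelfDual (ε : ℤˣ) (p : N) (α : E2 [⋀^Fin 1]→L[ℝ] ℝ) : Prop :=
  ∃ u, (∀ w, X.g p u w = α ![w]) ∧ (X.vol p).curryLeft u = (ε : ℤ) • α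

/-- The (anti-)self-dual boundary condition on differential forms of degree `n`. -/
def BoundaryCond (ε : ℤˣ) : {n : ℕ} → (M → E3 [⋀^Fin n]→L[ℝ] ℝ) → Prop
  | 0, α => ∀ p, X.pull α p = 0
  | 1, α => ∀ p, X.IsSelfDual ε p (X.pull α p)
  | _ + 2, _ => True

variable {X} {ε : ℤˣ}

theorem pull_zero {n : ℕ} (p : N) : X.pull (0 : M → E3 [⋀^Fin n]→L[ℝ] ℝ) p = 0 := rfl

theorem pull_add {n : ℕ} (α β : M → E3 [⋀^Fin n]→L[ℝ] ℝ) (p : N) :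
    X.pull (α + β) p = X.pull α p + X.pull β p := rfl

theorem pull_smul {n : ℕ} (c : ℝ) (α : M → E3 [⋀^Fin n]→L[ℝ] ℝ) (p : N) :
    X.pull (c • α) p = c • X.pull α p := rfl

theorem isSelfDual_zero (p : N) : X.IsSelfDual ε p 0 :=
  ⟨0, fun w => by simp, by simp⟩

theorem IsSelfDual.add {p : N} {α β : E2 [⋀^Fin 1]→L[ℝ] ℝ} :
    X.IsSelfDual ε p α → X.IsSelfDual ε p β → X.IsSelfDual ε p (α + β) := by
  rintro ⟨u, h1, h2⟩ ⟨u', h1', h2'⟩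
  exact ⟨u + u', fun w => by simp [h1, h1'], by rw [map_add, h2, h2', smul_add]⟩

theorem IsSelfDual.smul (c : ℝ) {p : N} {α : E2 [⋀^Fin 1]→L[ℝ] ℝ} :
    X.IsSelfDual ε p α → X.IsSelfDual ε p (c • α) := by
  rintro ⟨u, h1, h2⟩
  exact ⟨c • u, fun w => by simp [h1], by rw [map_smul, h2, smul_comm]⟩

theorem boundaryCond_zero : ∀ {n : ℕ}, X.BoundaryCond ε (0 : M → E3 [⋀^Fin n]→L[ℝ] ℝ)
  | 0 => fun _ => rfl
  | 1 => fun p => isSelfDual_zero p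
  | _ + 2 => trivial

theorem BoundaryCond.add : ∀ {n : ℕ} {α β : M → E3 [⋀^Fin n]→L[ℝ] ℝ}, X.BoundaryCond ε α →
    X.BoundaryCond ε β → X.BoundaryCond ε (α + β)
  | 0, _, _ => fun h1 h2 p => by rw [pull_add, h1 p, h2 p, add_zero]
  | 1, _, _ => fun h1 h2 p => (h1 p).add (h2 p)
  | _ + 2, _, _ => fun _ _ => trivial

theorem BoundaryCond.smul (c : ℝ) : ∀ {n : ℕ} {α : M → E3 [⋀^Fin n]→L[ℝ] ℝ}, X.BoundaryCond ε α →
    X.BoundaryCond ε (c • α)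
  | 0, _ => fun h p => by rw [pull_smul, h p, smul_zero]
  | 1, _ => fun h p => (h p).smul c
  | _ + 2, _ => fun _ => trivial

/-- The pullback to the boundary of the differential of a function which vanishes on the boundary
is zero. -/
theorem pull_extD [IsManifold (𝓡∂ 3) ∞ M]
    {α : M → E3 [⋀^Fin 0]→L[ℝ] ℝ} (hα : IsSmoothForm (𝓡∂ 3) α) (h0 : ∀ p, X.pull α p = 0) (p : N) :
    X.pull (extD (𝓡∂ 3) α) p = 0 := by
  set x := X.ι p with hx
  set f : M → ℝ := fun z => α z ![] with hf
  set y := extChartAt (𝓡∂ 3) x x with hy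
  have hd : DifferentiableWithinAt ℝ (localRep (𝓡∂ 3) α x) (range (𝓡∂ 3)) y :=
    (hα.contDiffWithinAt (mem_extChartAt_target x)).differentiableWithinAt (by simp)
  have hloc : (f ∘ (extChartAt (𝓡∂ 3) x).symm) = fun y => localRep (𝓡∂ 3) α x y ![] := by
    funext z
    simp only [Function.comp_apply, hf, localRep,
      ContinuousAlternatingMap.compContinuousLinearMap_apply]
    congr 1
    exact Subsingleton.elim _ _
  have hdf : DifferentiableWithinAt ℝ (f ∘ (extChartAt (𝓡∂ 3) x).symm) (range (𝓡∂ 3)) y := by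
    rw [hloc]
    exact (ContinuousAlternatingMap.apply ℝ E3 ℝ (![] : Fin 0 → E3)).differentiableAt
      |>.comp_differentiableWithinAt y hd
  have hcont : ContinuousAt f x := by
    have h1 : ContinuousWithinAt ((f ∘ (extChartAt (𝓡∂ 3) x).symm) ∘ extChartAt (𝓡∂ 3) x) univ x :=
      hdf.continuousWithinAt.comp (continuousAt_extChartAt x).continuousWithinAt
        (fun z _ => mem_range_self (f := 𝓡∂ 3) _)
    refine (continuousWithinAt_univ _ _ |>.mp h1).congr ?_
    filter_upwards [extChartAt_source_mem_nhds (I := 𝓡∂ 3) x] with z hz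
    simp only [Function.comp_apply]
    rw [(extChartAt (𝓡∂ 3) x).left_inv hz]
  have hmd : MDifferentiableAt (𝓡∂ 3) 𝓘(ℝ, ℝ) f x := (mdifferentiableAt_iff f x).mpr ⟨hcont, hdf⟩
  have hmf : mfderiv (𝓡∂ 3) 𝓘(ℝ, ℝ) f x =
      fderivWithin ℝ (f ∘ (extChartAt (𝓡∂ 3) x).symm) (range (𝓡∂ 3)) y := by
    unfold mfderiv
    exact if_pos hmd
  have hι : MDifferentiableAt (𝓡 2) (𝓡∂ 3) X.ι p := X.ι_smooth.mdifferentiableAt (by simp)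
  have hcomp : f ∘ X.ι = fun _ => 0 := by
    funext q
    have h1 : α (X.ι q) (X.dι q ∘ ![]) = 0 := congrArg (fun η => η ![]) (h0 q)
    rwa [Subsingleton.elim (X.dι q ∘ ![]) ![]] at h1
  have hchain : (mfderiv (𝓡∂ 3) 𝓘(ℝ, ℝ) f x).comp (mfderiv (𝓡 2) (𝓡∂ 3) X.ι p) = 0 := by
    rw [← mfderiv_comp p hmd hι, hcomp]
    exact mfderiv_const
  ext v
  rw [pull, ContinuousAlternatingMap.compContinuousLinearMap_apply, extD,
    extDerivWithin_apply hd ((𝓡∂ 3).uniqueDiffOn _ ⟨_, rfl⟩), Fin.sum_univ_one]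
  have h2 : (fun z => localRep (𝓡∂ 3) α x z ((0 : Fin 1).removeNth (X.dι p ∘ v))) =
      f ∘ (extChartAt (𝓡∂ 3) x).symm := by
    rw [hloc]
    funext z
    congr 1
    exact Subsingleton.elim _ _
  rw [h2]
  have h3 := congrArg (fun L : E2 →L[ℝ] ℝ => L (v 0)) hchain
  rw [hmf] at h3
  rw [Fin.val_zero, pow_zero, one_smul]
  exact h3


section Spaces

variable (X ε)

/-- The smooth `n`-forms which satisfy the boundary condition. -/
def fields (n : ℕ) : Submodule ℝ (M → E3 [⋀^Fin n]→L[ℝ] ℝ) where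
  carrier := {α | IsSmoothForm (𝓡∂ 3) α ∧ X.BoundaryCond ε α}
  zero_mem' := ⟨isSmoothForm_zero, boundaryCond_zero⟩
  add_mem' h1 h2 := ⟨h1.1.add h2.1, h1.2.add h2.2⟩
  smul_mem' c _ h := ⟨h.1.smul c, h.2.smul c⟩

/-- The smooth `n`-forms which satisfy the boundary condition and have compact support contained
in `U`. (Extension by zero identifies these with forms on the open subset `U`.) -/
def fieldsC (U : Set M) (n : ℕ) : Submodule ℝ (M → E3 [⋀^Fin n]→L[ℝ] ℝ) where
  carrier := {α | α ∈ X.fields ε n ∧ HasCompactSupport α ∧ tsupport α ⊆ U}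
  zero_mem' := ⟨zero_mem _, HasCompactSupport.zero, by simp⟩
  add_mem' h1 h2 := ⟨add_mem h1.1 h2.1, h1.2.1.add h2.2.1,
    (tsupport_add _ _).trans (union_subset h1.2.2 h2.2.2)⟩
  smul_mem' c α h := ⟨Submodule.smul_mem _ c h.1, h.2.1.smul_left (f := fun _ => c),
    (tsupport_smul_subset_right (fun _ => c) α).trans h.2.2⟩

variable {X ε}

theorem fieldsC_mono {U U' : Set M} (h : U ⊆ U') (n : ℕ) :
    X.fieldsC ε U n ≤ X.fieldsC ε U' n := fun _ hα => ⟨hα.1, hα.2.1, hα.2.2.trans h⟩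

variable [IsManifold (𝓡∂ 3) ∞ M]

theorem extD_mem_fields : ∀ {n : ℕ} {α : M → E3 [⋀^Fin n]→L[ℝ] ℝ}, α ∈ X.fields ε n →
    extD (𝓡∂ 3) α ∈ X.fields ε (n + 1)
  | 0, _, h => ⟨h.1.extD, fun p => by
      rw [pull_extD h.1 h.2]
      exact isSelfDual_zero p⟩
  | _ + 1, _, h => ⟨h.1.extD, trivial⟩

theorem extD_mem_fieldsC {U : Set M} {n : ℕ} {α : M → E3 [⋀^Fin n]→L[ℝ] ℝ}
    (h : α ∈ X.fieldsC ε U n) : extD (𝓡∂ 3) α ∈ X.fieldsC ε U (n + 1) :=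
  ⟨extD_mem_fields h.1, h.2.1.of_isClosed_subset (isClosed_tsupport _) (tsupport_extD α),
    (tsupport_extD α).trans h.2.2⟩

end Spaces

/-! Wedge product and integration. -/

/-- The wedge product of alternating forms. -/
def wedge {p q : ℕ} (α : E3 [⋀^Fin p]→L[ℝ] ℝ) (β : E3 [⋀^Fin q]→L[ℝ] ℝ) :
    E3 [⋀^Fin (p + q)]→ₗ[ℝ] ℝ :=
  (((LinearMap.mul' ℝ ℝ).compAlternatingMap
    (α.toAlternatingMap.domCoprod β.toAlternatingMap))).domDomCongr finSumFinEquiv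

section Integral

variable [IsManifold (𝓡∂ 3) ∞ M] [T2Space M] [SigmaCompactSpace M] (X)

variable (M) in
/-- A smooth partition of unity subordinate to the covering by chart domains. -/
def chartPartition : SmoothPartitionOfUnity M (𝓡∂ 3) M univ :=
  (SmoothPartitionOfUnity.exists_isSubordinate_chartAt_source (𝓡∂ 3) M).choose

/-- The integral of a (smooth, compactly supported) `3`-form over the oriented manifold `M`. -/
def integral (χ : M → E3 [⋀^Fin 3]→ₗ[ℝ] ℝ) : ℝ :=
  ∑ᶠ i : M, ∫ y in (extChartAt (𝓡∂ 3) i).target,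
    (SignType.sign (localRep (𝓡∂ 3) X.orient i y stdVec) : ℝ) *
      (chartPartition M i ((extChartAt (𝓡∂ 3) i).symm y) *
        χ ((extChartAt (𝓡∂ 3) i).symm y) fun j => coordDeriv (𝓡∂ 3) i y (stdVec j))

/-- The evaluation `(-1)^(|φ| + 1) ∫_M φ ∧ α` of a linear observable, given by a `p`-form `φ` (of
degree `|φ| = p - 2`), on a field, given by a `q`-form `α`. It is zero unless `p + q = 3`. -/
def ev {p q : ℕ} (φ : M → E3 [⋀^Fin p]→L[ℝ] ℝ) (α : M → E3 [⋀^Fin q]→L[ℝ] ℝ) : ℝ :=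
  if h : p + q = 3 then
    sgn ((p : ℤ) - 2 + 1) * X.integral fun x => (wedge (φ x) (α x)).domDomCongr (finCongr h)
  else 0

end Integral

end BulkBoundary

/-- The velocity of a curve in a manifold. -/
def velocity {E : Type*} [NormedAddCommGroup E] [NormedSpace ℝ E] {H : Type*} [TopologicalSpace H]
    (I : ModelWithCorners ℝ E H) {Q : Type*} [TopologicalSpace Q] [ChartedSpace H Q]
    (γ : ℝ → Q) (s : ℝ) : E :=
  mfderiv 𝓘(ℝ, ℝ) I γ s (1 : ℝ)

/-- A chiral flow `Θ` on the boundary (`+`-chiral if `ε = 1`, `-`-chiral if `ε = -1`), i.e. the flow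
of a vector field consisting of null vectors `v` with `g(t, v) < 0` and `ε vol(t, v) > 0`, and an
extension `Θ̂` of it to a proper `ℝ`-action on the bulk. -/
structure BulkFlow (X : BulkBoundary M N) (ε : ℤˣ) where
  flow : ℝ → N → N
  flow_smooth : ContMDiff (𝓘(ℝ, ℝ).prod (𝓡 2)) (𝓡 2) ∞ fun q : ℝ × N => flow q.1 q.2
  flow_zero : ∀ p, flow 0 p = p
  flow_add : ∀ s s' p, flow (s + s') p = flow s (flow s' p)
  flow_null : ∀ p, X.g p (velocity (𝓡 2) (fun s => flow s p) 0)
    (velocity (𝓡 2) (fun s => flow s p) 0) = 0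
  flow_future : ∀ p, X.g p (X.t p) (velocity (𝓡 2) (fun s => flow s p) 0) < 0
  flow_chiral : ∀ p, 0 < ((ε : ℤ) : ℝ) *
    X.vol p ![X.t p, velocity (𝓡 2) (fun s => flow s p) 0]
  act : ℝ → M → M
  act_smooth : ContMDiff (𝓘(ℝ, ℝ).prod (𝓡∂ 3)) (𝓡∂ 3) ∞ fun q : ℝ × M => act q.1 q.2
  act_zero : ∀ x, act 0 x = x
  act_add : ∀ s s' x, act (s + s') x = act s (act s' x)
  act_proper : IsProperMap fun q : ℝ × M => (q.2, act q.1 q.2)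
  act_ι : ∀ s p, act s (X.ι p) = X.ι (flow s p)

namespace BulkFlow

variable {X : BulkBoundary M N} {ε : ℤˣ} (F : BulkFlow X ε)

/-- The fiber integral `∫_S Θ̂^* ψ` of the pullback of a form along `Θ̂ : ℝ × M → M` over `S ⊆ ℝ`, in
the convention where the fiber direction is contracted into the first slot. -/
def fiberInt (S : Set ℝ) {n : ℕ} (ψ : M → E3 [⋀^Fin (n + 1)]→L[ℝ] ℝ) (x : M) :
    E3 [⋀^Fin n]→L[ℝ] ℝ :=
  ∫ s in S, ((ψ (F.act s x)).curryLeft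
    (velocity (𝓡∂ 3) (fun s => F.act s x) s)).compContinuousLinearMap
      (mfderiv (𝓡∂ 3) (𝓡∂ 3) (F.act s) x : E3 →L[ℝ] E3)

/-- The forward Green's homotopy for the `1`-shifted de Rham complex. -/
def greenUp {n : ℕ} (ψ : M → E3 [⋀^Fin (n + 1)]→L[ℝ] ℝ) : M → E3 [⋀^Fin n]→L[ℝ] ℝ :=
  -F.fiberInt (Iic 0) ψ

/-- The backward Green's homotopy for the `1`-shifted de Rham complex. -/
def greenDown {n : ℕ} (ψ : M → E3 [⋀^Fin (n + 1)]→L[ℝ] ℝ) : M → E3 [⋀^Fin n]→L[ℝ] ℝ :=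
  F.fiberInt (Ici 0) ψ

/-- The difference of the forward and backward Green's homotopies. -/
def green {n : ℕ} (ψ : M → E3 [⋀^Fin (n + 1)]→L[ℝ] ℝ) : M → E3 [⋀^Fin n]→L[ℝ] ℝ :=
  F.greenUp ψ - F.greenDown ψ

/-- The `Θ̂`-future of a subset. -/
def JUp (S : Set M) : Set M := {y | ∃ x ∈ S, ∃ s : ℝ, 0 ≤ s ∧ y = F.act s x}

/-- The `Θ̂`-past of a subset. -/
def JDown (S : Set M) : Set M := {y | ∃ x ∈ S, ∃ s : ℝ, s ≤ 0 ∧ y = F.act s x}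

/-- The category of nonempty `Θ̂`-convex open subsets of `M`, with inclusions as morphisms. -/
def Region : Type u :=
  {U : TopologicalSpace.Opens M // (U : Set M).Nonempty ∧
    F.JUp (U : Set M) ∩ F.JDown (U : Set M) ⊆ U}

instance : PartialOrder F.Region := inferInstanceAs (PartialOrder (Subtype _))

/-- The underlying subset of a region. -/
def Region.carrier {F : BulkFlow X ε} (U : F.Region) : Set M := U.1

theorem Region.le_iff {F : BulkFlow X ε} {U U' : F.Region} : U ≤ U' ↔ U.carrier ⊆ U'.carrier :=
  Iff.rfl

/-- `Θ̂`-disjointness. -/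
def Disjoint (U₁ U₂ : F.Region) : Prop :=
  (F.JUp U₁.carrier ∪ F.JDown U₁.carrier) ∩ U₂.carrier = ∅

/-- The orbit relation of `Θ̂`. -/
def orbitRel : Setoid M where
  r x y := ∃ s, y = F.act s x
  iseqv :=
    { refl := fun x => ⟨0, (F.act_zero x).symm⟩
      symm := by
        rintro x _ ⟨s, rfl⟩
        exact ⟨-s, by rw [← F.act_add, neg_add_cancel, F.act_zero]⟩
      trans := by
        rintro x _ _ ⟨s, rfl⟩ ⟨s', rfl⟩
        exact ⟨s' + s, by rw [F.act_add]⟩ }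

/-- An inclusion `U ⊆ U'` is `Θ̂`-Cauchy if `U` and `U'` have the same image in the orbit space. -/
def IsCauchy {U U' : F.Region} (_ : U ⟶ U') : Prop :=
  (Quotient.mk F.orbitRel) '' U.carrier = (Quotient.mk F.orbitRel) '' U'.carrier

/-! The Poisson cochain complexes of linear observables and their quantization. -/

section Observables

/-- The vector space of compactly supported `n`-forms in `U` satisfying the boundary condition. -/
def FieldC (X : BulkBoundary M N) (ε : ℤˣ) (U : Set M) (n : ℕ) : Type u := X.fieldsC ε U n

instance (U : Set M) (n : ℕ) : AddCommGroup (FieldC X ε U n) :=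
  inferInstanceAs (AddCommGroup (X.fieldsC ε U n))

instance (U : Set M) (n : ℕ) : Module ℝ (FieldC X ε U n) :=
  inferInstanceAs (Module ℝ (X.fieldsC ε U n))

/-- The underlying form. -/
def FieldC.form {U : Set M} {n : ℕ} (α : FieldC X ε U n) : M → E3 [⋀^Fin n]→L[ℝ] ℝ := α.1

theorem FieldC.form_mem {U : Set M} {n : ℕ} (α : FieldC X ε U n) : α.form ∈ X.fieldsC ε U n := α.2

theorem FieldC.form_ext {U : Set M} {n : ℕ} {α β : FieldC X ε U n} (h : α.form = β.form) : α = β :=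
  Subtype.ext h

/-- Extension by zero in a fixed form degree. -/
def extForm {U U' : Set M} (h : U ⊆ U') (n : ℕ) : FieldC X ε U n →ₗ[ℝ] FieldC X ε U' n where
  toFun α := ⟨α.form, BulkBoundary.fieldsC_mono h n α.form_mem⟩
  map_add' _ _ := rfl
  map_smul' _ _ := rfl

/-- The exterior derivative of compactly supported forms. -/
def dForm [IsManifold (𝓡∂ 3) ∞ M] (X : BulkBoundary M N) (ε : ℤˣ) (U : Set M) (n : ℕ) :
    FieldC X ε U n →ₗ[ℝ] FieldC X ε U (n + 1) where
  toFun α := ⟨extD (𝓡∂ 3) α.form, BulkBoundary.extD_mem_fieldsC α.form_mem⟩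
  map_add' α β := Subtype.ext (extD_add α.form_mem.1.1 β.form_mem.1.1)
  map_smul' c α := Subtype.ext (extD_smul c α.form)

/-- The vector space of linear observables in `U`: the direct sum of the spaces of compactly
supported forms of all form degrees. -/
abbrev ObsSpace (X : BulkBoundary M N) (ε : ℤˣ) (U : Set M) : Type u :=
  ⨁ n : ℕ, FieldC X ε U n

/-- A form of degree `n` has degree `n - 2` as a linear observable. -/
def obsGr (X : BulkBoundary M N) (ε : ℤˣ) (U : Set M) (i : ℤ) :
    Submodule ℝ (ObsSpace X ε U) where
  carrier := {φ | ∀ n : ℕ, (n : ℤ) - 2 ≠ i → φ n = 0}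
  zero_mem' n _ := rfl
  add_mem' h1 h2 n hn := by rw [DirectSum.add_apply, h1 n hn, h2 n hn, add_zero]
  smul_mem' c φ h n hn := by rw [DirectSum.smul_apply, h n hn, smul_zero]

theorem lof_mem_obsGr {U : Set M} {n : ℕ} (α : FieldC X ε U n) :
    DirectSum.lof ℝ ℕ (FieldC X ε U) n α ∈ obsGr X ε U ((n : ℤ) - 2) := by
  intro m hm
  refine DirectSum.of_eq_of_ne _ _ _ ?_
  rintro rfl
  exact hm rfl

theorem eq_lof_of_mem_obsGr {U : Set M} {n : ℕ} {φ : ObsSpace X ε U}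
    (h : φ ∈ obsGr X ε U ((n : ℤ) - 2)) :
    φ = DirectSum.lof ℝ ℕ (FieldC X ε U) n (φ n) := by
  refine DFinsupp.ext fun m => ?_
  by_cases hm : m = n
  · subst hm
    exact (DirectSum.of_eq_same (β := FieldC X ε U) m (φ m)).symm
  · rw [h m (by omega)]
    exact (DirectSum.of_eq_of_ne (β := FieldC X ε U) _ _ _ hm).symm

instance (U : Set M) : DirectSum.Decomposition (obsGr X ε U) :=
  .ofLinearMap _ (DirectSum.toModule ℝ ℕ _ fun n =>
      DirectSum.lof ℝ ℤ (fun i => obsGr X ε U i) ((n : ℤ) - 2) ∘ₗ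
        (DirectSum.lof ℝ ℕ (FieldC X ε U) n).codRestrict _ lof_mem_obsGr)
    (by
      refine DirectSum.linearMap_ext _ fun n => LinearMap.ext fun α => ?_
      simp only [LinearMap.comp_apply, DirectSum.toModule_lof, DirectSum.coeLinearMap_lof]
      rfl)
    (by
      refine DirectSum.linearMap_ext _ fun i => LinearMap.ext fun φ => ?_
      simp only [LinearMap.comp_apply, DirectSum.coeLinearMap_lof, LinearMap.id_apply]
      by_cases hi : ∃ n : ℕ, (n : ℤ) - 2 = i
      · obtain ⟨n, rfl⟩ := hi
        conv_lhs => rw [eq_lof_of_mem_obsGr φ.2]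
        rw [DirectSum.toModule_lof]
        refine congrArg (DirectSum.lof ℝ ℤ (fun i => obsGr X ε U i) ((n : ℤ) - 2)) (Subtype.ext ?_)
        exact (eq_lof_of_mem_obsGr φ.2).symm
      · have h0 : φ = 0 := Subtype.ext (DFinsupp.ext fun n => φ.2 n fun h => hi ⟨n, h⟩)
        rw [h0]
        simp)

/-- Extension by zero. -/
def ext {U U' : Set M} (h : U ⊆ U') : ObsSpace X ε U →ₗ[ℝ] ObsSpace X ε U' :=
  DirectSum.lmap fun n => extForm h n

theorem ext_apply {U U' : Set M} (h : U ⊆ U') (φ : ObsSpace X ε U) (n : ℕ) :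
    ext h φ n = extForm h n (φ n) := by
  rw [ext, DirectSum.lmap_apply]

theorem ext_lof {U U' : Set M} (h : U ⊆ U') {n : ℕ} (α : FieldC X ε U n) :
    ext h (DirectSum.lof ℝ ℕ (FieldC X ε U) n α) =
      DirectSum.lof ℝ ℕ (FieldC X ε U') n (extForm h n α) := by
  rw [ext, DirectSum.lmap_lof]

theorem ext_mem {U U' : Set M} (h : U ⊆ U') {i : ℤ} {φ : ObsSpace X ε U} (hφ : φ ∈ obsGr X ε U i) :
    ext h φ ∈ obsGr X ε U' i := fun n hn => by
  rw [ext_apply, hφ n hn, map_zero]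

theorem ext_ext {U U' U'' : Set M} (h : U ⊆ U') (h' : U' ⊆ U'') (φ : ObsSpace X ε U) :
    ext h' (ext h φ) = ext (h.trans h') φ :=
  DFinsupp.ext fun n => by
    rw [ext_apply, ext_apply, ext_apply]
    rfl

theorem ext_self {U : Set M} (h : U ⊆ U) (φ : ObsSpace X ε U) : ext h φ = φ :=
  DFinsupp.ext fun n => ext_apply h φ n

variable [IsManifold (𝓡∂ 3) ∞ M]

/-- The differential of the complex of linear observables. -/
def obsD (X : BulkBoundary M N) (ε : ℤˣ) (U : Set M) : ObsSpace X ε U →ₗ[ℝ] ObsSpace X ε U :=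
  DirectSum.toModule ℝ ℕ _ fun n =>
    DirectSum.lof ℝ ℕ (FieldC X ε U) (n + 1) ∘ₗ dForm X ε U n

theorem obsD_lof {U : Set M} {n : ℕ} (α : FieldC X ε U n) :
    obsD X ε U (DirectSum.lof ℝ ℕ (FieldC X ε U) n α) =
      DirectSum.lof ℝ ℕ (FieldC X ε U) (n + 1) (dForm X ε U n α) := by
  rw [obsD, DirectSum.toModule_lof]
  rfl

variable [T2Space M] [SigmaCompactSpace M]

/-- The unshifted Poisson structure `τ(φ, ψ) = ev(φ, G ψ)` on linear observables. -/
def obsτ {U : Set M} (φ ψ : ObsSpace X ε U) : ℝ :=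
  ∑ p ∈ Finset.range 4, ∑ q ∈ Finset.range 4,
    X.ev (φ p).form (F.green (ψ (q + 1)).form)

theorem obsτ_ext {U U' : Set M} (h : U ⊆ U') (φ ψ : ObsSpace X ε U) :
    F.obsτ (ext h φ) (ext h ψ) = F.obsτ φ ψ := by
  simp only [obsτ, ext_apply]
  rfl

/-- The complex of linear observables in `U`, with its unshifted linear Poisson structure. -/
def obs (U : Set M) : PairedComplex.{u} where
  V := ObsSpace X ε U
  gr := obsGr X ε U
  d := obsD X ε U
  d_mem i φ h := by
    by_cases hi : ∃ n : ℕ, (n : ℤ) - 2 = i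
    · obtain ⟨n, rfl⟩ := hi
      rw [eq_lof_of_mem_obsGr h, obsD_lof]
      have := lof_mem_obsGr (dForm X ε U n (φ n))
      rwa [show ((n + 1 : ℕ) : ℤ) - 2 = (n : ℤ) - 2 + 1 by push_cast; ring] at this
    · have h0 : φ = 0 := DFinsupp.ext fun n => h n fun h => hi ⟨n, h⟩
      rw [h0, map_zero]
      exact zero_mem _
  d_d φ := by
    suffices h : obsD X ε U ∘ₗ obsD X ε U = 0 from congrArg (fun L => L φ) h
    refine DirectSum.linearMap_ext _ fun n => LinearMap.ext fun α => ?_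
    simp only [LinearMap.comp_apply, obsD_lof, LinearMap.zero_apply]
    rw [show dForm X ε U (n + 1) (dForm X ε U n α) = 0 from
      FieldC.form_ext (extD_extD α.form_mem.1.1), map_zero]
  τ := F.obsτ

/-- Extension by zero as a morphism of complexes with pairing. -/
def extHom {U U' : Set M} (h : U ⊆ U') : PairedComplex.Hom (F.obs U) (F.obs U') where
  map := ext h
  map_mem i φ hφ := ext_mem h hφ
  map_d φ := by
    suffices H : ext h ∘ₗ obsD X ε U = obsD X ε U' ∘ₗ ext h from congrArg (fun L => L φ) H
    refine DirectSum.linearMap_ext _ fun n => LinearMap.ext fun α => ?_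
    simp only [LinearMap.comp_apply, obsD_lof, ext_lof]
    rfl
  map_τ := F.obsτ_ext h

/-- The functor of linear observables. -/
def obsFunctor : F.Region ⥤ PairedComplex.{u} where
  obj U := F.obs U.carrier
  map f := F.extHom (leOfHom f)
  map_id _ := PairedComplex.Hom.ext (LinearMap.ext fun φ => ext_self _ φ)
  map_comp f g := PairedComplex.Hom.ext (LinearMap.ext fun φ =>
    (ext_ext (leOfHom f) (leOfHom g) φ).symm)

/-- The functor `𝔄 = CCR(obs)`. -/
def aqft : F.Region ⥤ DGStarAlg.{u} := F.obsFunctor ⋙ PairedComplex.CCR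

end Observables

/-- Einstein causality of a functor on regions: observables in disjoint regions commute in the
graded sense. -/
def EinsteinCausality (𝔄 : F.Region ⥤ DGStarAlg.{u}) : Prop :=
  ∀ (U₁ U₂ U : F.Region) (f₁ : U₁ ⟶ U) (f₂ : U₂ ⟶ U), F.Disjoint U₁ U₂ →
    ∀ (i j : ℤ), ∀ a ∈ (𝔄.obj U₁).gr i, ∀ b ∈ (𝔄.obj U₂).gr j,
      (𝔄.map f₁).map a * (𝔄.map f₂).map b =
        sgn (i * j) • ((𝔄.map f₂).map b * (𝔄.map f₁).map a)

/-- The homotopy time-slice axiom: Cauchy morphisms are sent to quasi-isomorphisms. -/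
def TimeSlice (𝔄 : F.Region ⥤ DGStarAlg.{u}) : Prop :=
  ∀ (U U' : F.Region) (f : U ⟶ U'), F.IsCauchy f → QuasiIso (𝔄.map f).toComplex

end BulkFlow

end Geometry

end

end CSWZW

/-!
# Chiral Chern–Simons theory on a manifold with boundary as an algebraic quantum field theory

**Green's homotopies.** Let `ν` be the generator of the flow on the bulk. Integrating the Cartan formula
for `ν` over the orbits shows that `d G + G d = -1` for the fiber integrals `G↑` and `G↓` of compactly
supported forms (`extD_cyl_add`, `extD_greenUp`, `extD_greenDown`): properness of the flow makes these
integrals locally integrals over bounded intervals, one end of which lies outside of the support.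
Hence `G = G↑ - G↓` anticommutes with `d`. On the boundary `ν` is null and chiral, and in dimension two
this means that the `1`-forms with `∗α = ε α` are exactly those which annihilate `ν`
(`isSelfDual_iff`, `boundaryCond_one_iff`). Since the integrand of `G` contains a contraction with `ν`,
this description makes it evident that `G` preserves the boundary conditions (`boundaryCond_cyl`).

**The Poisson structure.** By the same description, if `φ` and `η` are fields of degrees adding up to
two, the boundary term `φ ∧ η` of Stokes' theorem vanishes: a `0`-form vanishes at the boundary, and two
`1`-forms which annihilate the nonzero tangent vector `ν` of a surface are proportional. Stokes' theorem
without boundary terms (`integral_leibniz`) is obtained from a partition of unity and the divergence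
theorem on a half space (`integral_halfSpace_divergence`), and gives the compatibility of `τ` with the
differential. Graded antisymmetry is the invariance of the integral under the flow (`integral_actPull3`)
combined with Fubini's theorem and the fact that forms of degree four vanish, so that
`ι_ν (φ ∧ ψ) = 0` for forms of complementary degrees in `τ` (`integral_wedgeForm_green_comm`).

**Einstein causality.** If no orbit through `U₁` meets `U₂`, then `Gψ` vanishes on the support of `φ`,
hence `τ (φ ⊗ ψ) = 0`, and generators commute in the graded sense (`obsτ_ext_of_disjoint`,
`mapCCR_commute`).

**The time-slice axiom for linear observables.** Let every orbit through `U'` meet `U`. For `ψ` with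
compact support in `U'`, choose a nonnegative function `w` with compact support in `U` which is not
identically zero on any orbit through the support of `ψ` (`exists_weight`). Let `f` and `g = 1 - f` be
the fractions of the total weight of an orbit which lie in the past and in the future of a point, and
put `η = -(f G↓ψ + g G↑ψ)`. The cutoffs make the support of `η` compact and, by convexity, contained in
`U'`. Away from `U` the functions `f` and `g` are locally constant, so that `ψ - dη` vanishes there if
`dψ` is supported in `U` (`exists_sub_extD_mem`). It follows that extension by zero is an injective
quasi-isomorphism of complexes of vector spaces, and linear algebra provides a cochain retraction
`r` and a homotopy `k` (`exists_splitting`, `exists_retraction`).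

**The time-slice axiom for the quantization.** The commutation relations are first removed: contractions
with `(i/2) τ` define a linear automorphism `changeTau` of the tensor algebra which is a cochain map and
maps the ideal of commutation relations to the ideal of graded commutators (`changeTau_dC`,
`changeTau_mem_ccrIdeal`), as in the comparison of a Clifford algebra with an exterior algebra. It is
natural in `(V, τ)`, so that it suffices to treat graded-symmetric algebras. There the homotopy `k`
extends to an odd derivation `D`, and `E = d D + D d` is a derivation which counts the factors from the
complement of the image of the smaller complex. On each vector the products `(1 - E) (1 - E / 2) ⋯ (1 - E / N)`
become the projection onto the kernel of `E`, and each factor changes cocycles by coboundaries only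
(`Retraction.eventually_proj_eq`, `Retraction.exists_homologous`); this replaces a contraction of the
symmetric powers and needs no bookkeeping of tensor degrees.
-/

namespace CSWZW
noncomputable section

universe u v

/-! ### The complexified tensor algebra -/

section

theorem DGStarAlg.hom_induction {B : DGStarAlg.{u}} {p : B.A → Prop}
    (hom : ∀ i, ∀ x ∈ B.gr i, p x) (add : ∀ x y, p x → p y → p (x + y)) (x : B.A) : p x :=
  DirectSum.Decomposition.inductionOn B.gr (motive := p) (hom 0 0 (zero_mem _))
    (fun {i} x => hom i x x.2) (fun x y => add x y) x

namespace PairedComplex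

variable (P : PairedComplex.{u})

variable {P} in
theorem one_tmul_smul (c : ℝ) (x : P.T) :
    ((1 : ℂ) ⊗ₜ[ℝ] (c • x) : P.TC) = (c : ℂ) • ((1 : ℂ) ⊗ₜ[ℝ] x) := by
  rw [TensorProduct.tmul_smul, TensorProduct.smul_tmul', TensorProduct.smul_tmul']
  simp

/-- The inclusion of generators into the complexified tensor algebra, as a linear map. -/
def ιC : P.V →ₛₗ[Complex.ofRealHom] P.TC where
  toFun := P.genC
  map_add' v w := by
    change (1 : ℂ) ⊗ₜ[ℝ] P.gen (v + w) = (1 : ℂ) ⊗ₜ[ℝ] P.gen v + (1 : ℂ) ⊗ₜ[ℝ] P.gen w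
    rw [map_add, TensorProduct.tmul_add]
  map_smul' c v := by
    change (1 : ℂ) ⊗ₜ[ℝ] P.gen (c • v) = (c : ℂ) • ((1 : ℂ) ⊗ₜ[ℝ] P.gen v)
    rw [map_smul, one_tmul_smul]

/-- The homogeneous parts of the complexified tensor algebra. -/
abbrev grC (i : ℤ) : Submodule ℂ P.TC := (P.grT i).baseChange ℂ

/-- The differential of the complexified tensor algebra. -/
abbrev dC : P.TC →ₗ[ℂ] P.TC := P.dT.baseChange ℂ

variable {P}

instance : SetLike.GradedMonoid P.grC :=
  inferInstanceAs (SetLike.GradedMonoid P.tensorDG.gr)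

theorem ιC_mem {i : ℤ} {v : P.V} (hv : v ∈ P.gr i) : P.ιC v ∈ P.grC i :=
  Submodule.tmul_mem_baseChange_of_mem 1 (gen_mem hv)

theorem one_mem_grC : (1 : P.TC) ∈ P.grC 0 := SetLike.GradedOne.one_mem

theorem mul_mem_grC {i j : ℤ} {x y : P.TC} (hx : x ∈ P.grC i) (hy : y ∈ P.grC j) :
    x * y ∈ P.grC (i + j) := SetLike.GradedMul.mul_mem hx hy

theorem smul_one_tmul (z : ℂ) (x : P.T) : (z ⊗ₜ[ℝ] x : P.TC) = z • ((1 : ℂ) ⊗ₜ[ℝ] x) := by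
  simp [TensorProduct.smul_tmul']

theorem one_tmul_gen_mul (v : P.V) (x : P.T) :
    ((1 : ℂ) ⊗ₜ[ℝ] (P.gen v * x) : P.TC) = P.ιC v * (1 : ℂ) ⊗ₜ[ℝ] x := by
  change _ = (1 : ℂ) ⊗ₜ[ℝ] P.gen v * (1 : ℂ) ⊗ₜ[ℝ] x
  rw [Algebra.TensorProduct.tmul_mul_tmul, mul_one]

/-- Homogeneous elements are combinations of words: an induction principle which keeps track of the
degree. -/
theorem grC_induction {p : (i : ℤ) → (x : P.TC) → x ∈ P.grC i → Prop}
    (one : p 0 1 one_mem_grC)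
    (cons : ∀ i j v (hv : v ∈ P.gr i) x (hx : x ∈ P.grC j), p j x hx →
      p (i + j) (P.ιC v * x) (mul_mem_grC (ιC_mem hv) hx))
    (zero : ∀ i, p i 0 (zero_mem _))
    (add : ∀ i x y hx hy, p i x hx → p i y hy → p i (x + y) (add_mem hx hy))
    (smul : ∀ i (c : ℂ) x hx, p i x hx → p i (c • x) (Submodule.smul_mem _ c hx))
    {i : ℤ} {x : P.TC} (hx : x ∈ P.grC i) : p i x hx := by
  have hw : ∀ i (x : P.T), P.IsWord i x → ∃ h : (1 : ℂ) ⊗ₜ[ℝ] x ∈ P.grC i, p i _ h := by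
    intro i x h
    induction h with
    | one => exact ⟨one_mem_grC, one⟩
    | @cons i j v x hv hx ih =>
      obtain ⟨h, hp⟩ := ih
      have := cons i j v hv _ h hp
      refine ⟨by rw [one_tmul_gen_mul]; exact mul_mem_grC (ιC_mem hv) h, ?_⟩
      convert this using 1
      exact one_tmul_gen_mul v x
  have key : ∃ h : x ∈ P.grC i, p i x h := by
    refine tc_gr_induction (p := fun x => ∃ h : x ∈ P.grC i, p i x h) ⟨_, zero i⟩ ?_ ?_ hx
    · intro z x hx
      have : ∃ h : (1 : ℂ) ⊗ₜ[ℝ] x ∈ P.grC i, p i _ h := by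
        refine grT_induction (p := fun x => ∃ h : (1 : ℂ) ⊗ₜ[ℝ] x ∈ P.grC i, p i _ h)
          (fun x hx => hw i x hx) ?_ ?_ ?_ hx
        · simp only [TensorProduct.tmul_zero]
          exact ⟨zero_mem _, zero i⟩
        · rintro c x ⟨h, hp⟩
          simp only [one_tmul_smul]
          exact ⟨Submodule.smul_mem _ _ h, smul i _ _ h hp⟩
        · rintro x y ⟨h1, hp1⟩ ⟨h2, hp2⟩
          simp only [TensorProduct.tmul_add]
          exact ⟨add_mem h1 h2, add i _ _ h1 h2 hp1 hp2⟩
      obtain ⟨h, hp⟩ := this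
      simp only [smul_one_tmul z x]
      exact ⟨Submodule.smul_mem _ _ h, smul i z _ h hp⟩
    · rintro a b ⟨h1, hp1⟩ ⟨h2, hp2⟩
      exact ⟨add_mem h1 h2, add i _ _ h1 h2 hp1 hp2⟩
  exact key.2

/-- Every element of the complexified tensor algebra is a combination of words. -/
theorem tc_word_induction {p : P.TC → Prop} (one : p 1)
    (cons : ∀ v x, p x → p (P.ιC v * x))
    (add : ∀ x y, p x → p y → p (x + y)) (smul : ∀ (c : ℂ) x, p x → p (c • x)) (x : P.TC) : p x := by
  induction x using TensorProduct.induction_on with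
  | zero => simpa using smul 0 1 one
  | tmul z x =>
    rw [smul_one_tmul]
    refine smul z _ ?_
    refine word_induction (p := fun x => p ((1 : ℂ) ⊗ₜ[ℝ] x)) ?_ ?_ ?_ x
    · intro i x h
      induction h with
      | one => exact one
      | cons hv hx ih => rw [one_tmul_gen_mul]; exact cons _ _ ih
    · intro c x h
      rw [one_tmul_smul]
      exact smul _ _ h
    · intro x y h1 h2
      rw [TensorProduct.tmul_add]
      exact add _ _ h1 h2
  | add a b h1 h2 => exact add _ _ h1 h2

/-- Additive properties of the complexified tensor algebra may be checked on homogeneous elements. -/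
theorem tc_hom_induction {p : P.TC → Prop} (hom : ∀ i, ∀ x ∈ P.grC i, p x)
    (add : ∀ x y, p x → p y → p (x + y)) (x : P.TC) : p x :=
  DGStarAlg.hom_induction (B := P.tensorDG) hom add x

/-- Linear maps from the complexified tensor algebra are determined by a recursion over words. -/
theorem tc_linearMap_ext {W : Type*} [AddCommGroup W] [Module ℂ W] {f g : P.TC →ₗ[ℂ] W}
    (one : f 1 = g 1)
    (cons : ∀ i, ∀ v ∈ P.gr i, ∀ x, f x = g x → f (P.ιC v * x) = g (P.ιC v * x)) : f = g := by
  refine LinearMap.ext fun x => ?_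
  refine tc_word_induction (p := fun x => f x = g x) one ?_ ?_ ?_ x
  · intro v x h
    refine gr_induction (p := fun v => f (P.ιC v * x) = g (P.ιC v * x))
      (fun i v hv => cons i v hv x h) (fun v w h1 h2 => ?_) v
    rw [map_add, add_mul, map_add, map_add, h1, h2]
  · intro x y h1 h2
    rw [map_add, map_add, h1, h2]
  · intro c x h
    rw [map_smul, map_smul, h]

section Lift

variable {B : Type*} [Ring B] [Algebra ℂ B]

/-- A real-linear map into a complex algebra, as a linear map for the restricted scalars. -/
def restrictLin (f : P.V →ₛₗ[Complex.ofRealHom] B) : P.V →ₗ[ℝ] B where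
  toFun := f
  map_add' := map_add f
  map_smul' c v := by
    rw [map_smulₛₗ]
    exact (algebraMap_smul ℂ c (f v))

/-- The universal property of the complexified tensor algebra. -/
def liftC (f : P.V →ₛₗ[Complex.ofRealHom] B) : P.TC →ₐ[ℂ] B :=
  Algebra.TensorProduct.lift (Algebra.ofId ℂ B) (TensorAlgebra.lift ℝ (restrictLin f))
    (fun z _ => show Commute _ _ from Algebra.commutes z _)

theorem liftC_ιC (f : P.V →ₛₗ[Complex.ofRealHom] B) (v : P.V) : liftC f (P.ιC v) = f v := by
  change Algebra.TensorProduct.lift (Algebra.ofId ℂ B) (TensorAlgebra.lift ℝ (restrictLin f)) _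
    ((1 : ℂ) ⊗ₜ[ℝ] P.gen v) = f v
  rw [Algebra.TensorProduct.lift_tmul, map_one, one_mul, lift_gen]
  rfl

theorem tc_algHom_ext {f g : P.TC →ₐ[ℂ] B} (h : ∀ i, ∀ v ∈ P.gr i, f (P.ιC v) = g (P.ιC v)) :
    f = g := by
  refine AlgHom.toLinearMap_injective (tc_linearMap_ext (by simp) fun i v hv x hx => ?_)
  simp only [AlgHom.toLinearMap_apply] at hx ⊢
  rw [map_mul, map_mul, h i v hv, hx]

end Lift

/-! ### Derivations of the complexified tensor algebra -/

section Derivation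

/-- The upper triangular matrices which encode a derivation twisted by `s` on generators. -/
def twDerMat (s : P.TC →ₐ[ℂ] P.TC) (δ : P.V →ₛₗ[Complex.ofRealHom] P.TC) :
    P.V →ₛₗ[Complex.ofRealHom] Matrix (Fin 2) (Fin 2) P.TC where
  toFun v := !![s (P.ιC v), δ v; 0, P.ιC v]
  map_add' v w := by ext i j; fin_cases i <;> fin_cases j <;> simp
  map_smul' c v := by
    have h1 : P.ιC (c • v) = (c : ℂ) • P.ιC v := map_smulₛₗ _ c v
    have h2 : δ (c • v) = (c : ℂ) • δ v := map_smulₛₗ _ c v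
    rw [h1, h2, map_smul]
    ext i j; fin_cases i <;> fin_cases j <;> rfl

/-- The extension of a linear map `V → T(V)` to a derivation `Δ` twisted by an algebra endomorphism
`s`, i.e. `Δ (x * y) = Δ x * y + s x * Δ y`. It is read off from the algebra homomorphism to upper
triangular matrices with `s x` and `x` on the diagonal. -/
def twDer (s : P.TC →ₐ[ℂ] P.TC) (δ : P.V →ₛₗ[Complex.ofRealHom] P.TC) : P.TC →ₗ[ℂ] P.TC where
  toFun x := liftC (twDerMat s δ) x 0 1
  map_add' x y := by rw [map_add]; rfl
  map_smul' c x := by rw [map_smul]; rfl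

variable (s : P.TC →ₐ[ℂ] P.TC) (δ : P.V →ₛₗ[Complex.ofRealHom] P.TC)

theorem twDer_ιC (v : P.V) : twDer s δ (P.ιC v) = δ v := by
  change liftC (twDerMat s δ) (P.ιC v) 0 1 = δ v
  rw [liftC_ιC]
  rfl

theorem twDer_mul (x y : P.TC) : twDer s δ (x * y) = twDer s δ x * y + s x * twDer s δ y := by
  set Φ := liftC (twDerMat s δ) with hΦ
  have h : ∀ x, Φ x 0 0 = s x ∧ Φ x 1 0 = 0 ∧ Φ x 1 1 = x := by
    refine tc_word_induction ?_ ?_ ?_ ?_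
    · simp
    · rintro v x ⟨h1, h2, h3⟩
      have e : Φ (P.ιC v) = !![s (P.ιC v), δ v; 0, P.ιC v] := liftC_ιC _ v
      simp [map_mul, e, Matrix.mul_apply, Fin.sum_univ_two, h1, h2, h3]
    · rintro x y ⟨h1, h2, h3⟩ ⟨h1', h2', h3'⟩
      simp [h1, h2, h3, h1', h2', h3']
    · rintro c x ⟨h1, h2, h3⟩
      simp [h1, h2, h3]
  change Φ (x * y) 0 1 = Φ x 0 1 * y + s x * Φ y 0 1
  rw [map_mul, Matrix.mul_apply, Fin.sum_univ_two, (h x).1, (h y).2.2, add_comm]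

theorem twDer_one : twDer s δ 1 = 0 := by
  have h := twDer_mul s δ 1 1
  rw [mul_one, map_one s, one_mul, mul_one, left_eq_add] at h
  exact h

/-- The parity automorphism of the complexified tensor algebra. -/
def signC : P.TC →ₐ[ℂ] P.TC := Algebra.TensorProduct.map (AlgHom.id ℂ ℂ) P.signT

theorem signC_ιC {i : ℤ} {v : P.V} (hv : v ∈ P.gr i) : signC (P.ιC v) = sgn i • P.ιC v := by
  change (1 : ℂ) ⊗ₜ[ℝ] P.signT (P.gen v) = sgn i • ((1 : ℂ) ⊗ₜ[ℝ] P.gen v)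
  rw [signT_of_mem (gen_mem hv)]
  exact map_zsmul (TensorProduct.mk ℝ ℂ P.T 1) _ _

theorem signC_pow_ιC {i : ℤ} {v : P.V} (hv : v ∈ P.gr i) (n : ℕ) :
    (signC ^ n) (P.ιC v) = sgn (n * i) • P.ιC v := by
  induction n with
  | zero => simp [sgn_zero]
  | succ n ih =>
    rw [pow_succ, AlgHom.mul_apply, signC_ιC hv, map_zsmul, ih, smul_smul, ← sgn_add]
    congr 2
    push_cast
    ring

theorem signC_pow_of_mem {i : ℤ} {x : P.TC} (hx : x ∈ P.grC i) (n : ℕ) :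
    (signC ^ n) x = sgn (n * i) • x := by
  refine grC_induction (p := fun i x _ => (signC ^ n) x = sgn (n * i) • x) ?_ ?_ ?_ ?_ ?_ hx
  · simp [sgn_zero]
  · intro i j v hv x hx ih
    rw [map_mul, signC_pow_ιC hv, ih, smul_mul_smul_comm, ← sgn_add, mul_add]
  · intro i; simp
  · intro i x y _ _ h1 h2
    rw [map_add, h1, h2, smul_add]
  · intro i c x _ h
    rw [map_smul, h, smul_comm]

theorem dC_ιC (v : P.V) : P.dC (P.ιC v) = P.ιC (P.d v) := by
  change P.dT.baseChange ℂ ((1 : ℂ) ⊗ₜ[ℝ] P.gen v) = (1 : ℂ) ⊗ₜ[ℝ] P.gen (P.d v)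
  rw [LinearMap.baseChange_tmul, dT_gen]

theorem dC_one : P.dC 1 = 0 := by
  change P.dT.baseChange ℂ ((1 : ℂ) ⊗ₜ[ℝ] 1) = 0
  rw [LinearMap.baseChange_tmul, dT_one, TensorProduct.tmul_zero]

theorem dC_dC (x : P.TC) : P.dC (P.dC x) = 0 := P.tensorDG.d_d x

theorem dC_mem {i : ℤ} {x : P.TC} (hx : x ∈ P.grC i) : P.dC x ∈ P.grC (i + 1) :=
  P.tensorDG.d_mem i x hx

theorem dC_mul {i : ℤ} {x : P.TC} (hx : x ∈ P.grC i) (y : P.TC) :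
    P.dC (x * y) = P.dC x * y + sgn i • (x * P.dC y) := P.tensorDG.d_mul i x hx y

end Derivation

end PairedComplex

end

/-! ### The ideal of canonical commutation relations -/

section

theorem DGStarAlg.decompose_mem_of_mem {B : DGStarAlg.{u}} {J : Ideal B.A} {k : ℤ} {a : B.A}
    (ha : a ∈ B.gr k) (haJ : a ∈ J) (i : ℤ) : (DirectSum.decompose B.gr a i : B.A) ∈ J := by
  by_cases h : k = i
  · subst h
    rwa [DirectSum.decompose_of_mem_same B.gr ha]
  · rw [DirectSum.decompose_of_mem_ne B.gr ha h]
    exact J.zero_mem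

theorem DGStarAlg.decompose_add_mem {B : DGStarAlg.{u}} {J : Ideal B.A} {i : ℤ} {a b : B.A}
    (ha : (DirectSum.decompose B.gr a i : B.A) ∈ J)
    (hb : (DirectSum.decompose B.gr b i : B.A) ∈ J) :
    (DirectSum.decompose B.gr (a + b) i : B.A) ∈ J := by
  rw [DirectSum.decompose_add]
  exact J.add_mem ha hb

namespace PairedComplex

variable {P : PairedComplex.{u}}

/-- The difference of the two sides of a commutation relation, for an arbitrary pairing `τ`. -/
def rel (τ : P.V → P.V → ℝ) (i j : ℤ) (v w : P.V) : P.TC :=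
  P.ιC v * P.ιC w - sgn (i * j) • (P.ιC w * P.ιC v) - algebraMap ℂ P.TC (Complex.I * (τ v w : ℂ))

/-- The two-sided ideal generated by the commutation relations of a pairing `τ`, as a subspace. -/
def ccrIdeal (τ : P.V → P.V → ℝ) : Submodule ℂ P.TC :=
  Submodule.span ℂ {a | ∃ i j, ∃ v ∈ P.gr i, ∃ w ∈ P.gr j, ∃ x y, a = x * rel τ i j v w * y}

variable {τ : P.V → P.V → ℝ}

theorem mul_rel_mul_mem {i j : ℤ} {v w : P.V} (hv : v ∈ P.gr i) (hw : w ∈ P.gr j) (x y : P.TC) :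
    x * rel τ i j v w * y ∈ ccrIdeal τ :=
  Submodule.subset_span ⟨i, j, v, hv, w, hw, x, y, rfl⟩

theorem rel_mem {i j : ℤ} {v w : P.V} (hv : v ∈ P.gr i) (hw : w ∈ P.gr j) :
    rel τ i j v w ∈ ccrIdeal τ := by
  simpa using mul_rel_mul_mem (τ := τ) hv hw 1 1

/-- Additive properties of the ideal may be checked on products of homogeneous elements. -/
theorem ccrIdeal_induction {p : P.TC → Prop} (h0 : p 0)
    (hrel : ∀ i j, ∀ v ∈ P.gr i, ∀ w ∈ P.gr j, ∀ k, ∀ x ∈ P.grC k, ∀ l, ∀ y ∈ P.grC l,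
      p (x * rel τ i j v w * y))
    (hadd : ∀ x y, p x → p y → p (x + y)) {a : P.TC} (ha : a ∈ ccrIdeal τ) : p a := by
  have key : ∀ c : ℂ, p (c • a) := by
    refine Submodule.span_induction (p := fun a _ => ∀ c : ℂ, p (c • a)) ?_ ?_ ?_ ?_ ha
    · rintro _ ⟨i, j, v, hv, w, hw, x, y, rfl⟩ c
      rw [← smul_mul_assoc, ← smul_mul_assoc]
      refine tc_hom_induction (p := fun x => p (x * rel τ i j v w * y)) (fun k x hx => ?_) ?_ (c • x)
      · refine tc_hom_induction (p := fun y => p (x * rel τ i j v w * y))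
          (fun l y hy => hrel i j v hv w hw k x hx l y hy) ?_ y
        intro y y' h1 h2
        rw [mul_add]
        exact hadd _ _ h1 h2
      · intro x x' h1 h2
        rw [add_mul, add_mul]
        exact hadd _ _ h1 h2
    · intro c
      rwa [smul_zero]
    · intro a b _ _ h1 h2 c
      rw [smul_add]
      exact hadd _ _ (h1 c) (h2 c)
    · intro c' a _ h c
      rw [smul_smul]
      exact h _
  simpa using key 1

theorem mul_mem_ccrIdeal_left (z : P.TC) {a : P.TC} (ha : a ∈ ccrIdeal τ) : z * a ∈ ccrIdeal τ := by
  refine ccrIdeal_induction (p := fun a => z * a ∈ ccrIdeal τ) (by simp) ?_ ?_ ha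
  · intro i j v hv w hw k x _ l y _
    rw [← mul_assoc, ← mul_assoc]
    exact mul_rel_mul_mem hv hw _ _
  · intro x y h1 h2
    rw [mul_add]
    exact add_mem h1 h2

theorem mul_mem_ccrIdeal_right {a : P.TC} (ha : a ∈ ccrIdeal τ) (z : P.TC) : a * z ∈ ccrIdeal τ := by
  refine ccrIdeal_induction (p := fun a => a * z ∈ ccrIdeal τ) (by simp) ?_ ?_ ha
  · intro i j v hv w hw k x _ l y _
    rw [mul_assoc _ y]
    exact mul_rel_mul_mem hv hw _ _
  · intro x y h1 h2
    rw [add_mul]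
    exact add_mem h1 h2

theorem algebraMap_mem_grC (z : ℂ) : algebraMap ℂ P.TC z ∈ P.grC 0 := by
  rw [Algebra.algebraMap_eq_smul_one]
  exact Submodule.smul_mem _ _ one_mem_grC

/-- The relations are homogeneous if the pairing has degree zero. -/
theorem rel_mem_grC (hτ : ∀ i j, ∀ v ∈ P.gr i, ∀ w ∈ P.gr j, i + j ≠ 0 → τ v w = 0) {i j : ℤ}
    {v w : P.V} (hv : v ∈ P.gr i) (hw : w ∈ P.gr j) : rel τ i j v w ∈ P.grC (i + j) := by
  refine sub_mem (sub_mem (mul_mem_grC (ιC_mem hv) (ιC_mem hw)) (zsmul_mem ?_ _)) ?_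
  · rw [add_comm]
    exact mul_mem_grC (ιC_mem hw) (ιC_mem hv)
  · by_cases h : i + j = 0
    · rw [h]
      exact algebraMap_mem_grC _
    · rw [hτ i j v hv w hw h]
      simp

theorem dC_algebraMap (z : ℂ) : P.dC (algebraMap ℂ P.TC z) = 0 := by
  rw [Algebra.algebraMap_eq_smul_one, map_smul, dC_one, smul_zero]

theorem sgn_mul_eq {a b c : ℤ} (h : sgn (a + b + c) = 1) : sgn a * sgn b = sgn c := by
  have h1 := congrArg (· * sgn c) h
  simp only [sgn_add, one_mul, mul_assoc, sgn_mul_self, mul_one] at h1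
  exact h1

theorem sgn_two_mul (a : ℤ) : sgn (2 * a) = 1 := by
  rw [two_mul, sgn_add, sgn_mul_self]

/-- The cocycle condition for the pairing says that the relations are stable under the
differential. -/
theorem dC_rel {i j : ℤ} {v w : P.V} (hv : v ∈ P.gr i) (hw : w ∈ P.gr j)
    (hτ : τ (P.d v) w + sgn i * τ v (P.d w) = 0) :
    P.dC (rel τ i j v w) =
      rel τ (i + 1) j (P.d v) w + sgn i • rel τ i (j + 1) v (P.d w) := by
  have h3 : algebraMap ℂ P.TC (Complex.I * (τ (P.d v) w : ℂ)) +
      sgn i • algebraMap ℂ P.TC (Complex.I * (τ v (P.d w) : ℂ)) = 0 := by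
    rw [← map_zsmul, ← map_add]
    have : Complex.I * (τ (P.d v) w : ℂ) + sgn i • (Complex.I * (τ v (P.d w) : ℂ)) =
        Complex.I * ((τ (P.d v) w + sgn i * τ v (P.d w) : ℝ) : ℂ) := by
      push_cast
      rw [zsmul_eq_mul]
      ring
    rw [this, hτ]
    simp
  rw [rel, map_sub, map_sub, map_zsmul, dC_algebraMap, dC_mul (ιC_mem hv), dC_mul (ιC_mem hw),
    dC_ιC, dC_ιC, sub_zero, rel, rel, smul_sub, smul_sub, smul_add, smul_smul, smul_smul,
    sgn_mul_eq (a := i * j) (b := j) (c := (i + 1) * j)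
      (by rw [show i * j + j + (i + 1) * j = 2 * (i * j + j) by ring, sgn_two_mul]),
    sgn_mul_eq (a := i) (b := i * (j + 1)) (c := i * j)
      (by rw [show i + i * (j + 1) + i * j = 2 * (i + i * j) by ring, sgn_two_mul])]
  rw [eq_neg_of_add_eq_zero_left h3]
  abel

theorem conjTC_mul {i j : ℤ} {x y : P.TC} (hx : x ∈ P.grC i) (hy : y ∈ P.grC j) :
    P.conjTC (x * y) = sgn (i * j) • (P.conjTC y * P.conjTC x) :=
  P.tensorDG.conj_mul i j x hx y hy

/-- Antisymmetry of the pairing says that the relations are anti-hermitian. -/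
theorem conjTC_rel {i j : ℤ} {v w : P.V} (hv : v ∈ P.gr i) (hw : w ∈ P.gr j) :
    P.conjTC (rel τ i j v w) = (-1 : ℤ) • rel τ i j v w := by
  have hconj : ∀ v, P.conjTC (P.ιC v) = P.ιC v := fun v => by
    change P.conjTC ((1 : ℂ) ⊗ₜ[ℝ] P.gen v) = _
    rw [conjTC_tmul, starT_gen, map_one]
    rfl
  have h1 : P.conjTC 1 = 1 := P.tensorDG.conj_one
  rw [rel, map_sub, map_sub, map_zsmul, conjTC_mul (ιC_mem hv) (ιC_mem hw),
    conjTC_mul (ιC_mem hw) (ιC_mem hv), hconj, hconj, smul_smul, mul_comm j i, sgn_mul_self,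
    one_smul, Algebra.algebraMap_eq_smul_one, LinearMap.map_smulₛₗ, h1]
  simp only [map_mul, Complex.conj_I, Complex.conj_ofReal, neg_mul, neg_smul]
  abel

/-- The ideal of the quantization of a Poisson complex is the ordinary two-sided ideal generated by
the commutation relations. -/
theorem mem_dgSpan_iff (hP : P.IsPoisson) (a : P.TC) :
    a ∈ P.tensorDG.dgSpan P.ccrRel ↔ a ∈ ccrIdeal P.τ := by
  constructor
  · intro ha
    let J : Ideal P.tensorDG.A :=
      { carrier := ((ccrIdeal P.τ : Submodule ℂ P.TC) : Set P.TC)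
        add_mem' := fun h1 h2 => add_mem (S := Submodule ℂ P.TC) h1 h2
        zero_mem' := zero_mem (ccrIdeal P.τ)
        smul_mem' := fun c x hx => mul_mem_ccrIdeal_left c hx }
    have hJ : P.tensorDG.IsDGIdeal J :=
      { mul_mem_right := fun a ha b => mul_mem_ccrIdeal_right ha b
        decompose_mem := fun a ha i => by
          refine ccrIdeal_induction (τ := P.τ) (p := fun a : P.TC =>
            (DirectSum.decompose P.tensorDG.gr (a : P.tensorDG.A) i : P.tensorDG.A) ∈ J) ?_ ?_ ?_ ha
          · exact DGStarAlg.decompose_mem_of_mem (P.tensorDG.gr 0).zero_mem J.zero_mem i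
          · intro i' j v hv w hw k x hx l y hy
            exact DGStarAlg.decompose_mem_of_mem (B := P.tensorDG)
              (mul_mem_grC (mul_mem_grC hx (rel_mem_grC hP.degree_zero hv hw)) hy)
              (mul_rel_mul_mem (τ := P.τ) hv hw x y) i
          · intro x y h1 h2
            exact DGStarAlg.decompose_add_mem h1 h2
        d_mem := fun a ha => by
          refine ccrIdeal_induction (τ := P.τ) (p := fun a : P.TC => P.dC a ∈ ccrIdeal P.τ)
            (by simp) ?_ ?_ ha
          · intro i j v hv w hw k x hx l y hy
            rw [dC_mul (mul_mem_grC hx (rel_mem_grC hP.degree_zero hv hw)), dC_mul hx, add_mul,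
              dC_rel hv hw (hP.cocycle i v hv w)]
            refine add_mem (add_mem (mul_rel_mul_mem hv hw _ _) ?_)
              (zsmul_mem (mul_rel_mul_mem hv hw _ _) _)
            rw [smul_mul_assoc, mul_add, add_mul, mul_smul_comm, smul_mul_assoc]
            exact zsmul_mem (add_mem (mul_rel_mul_mem (P.d_mem _ _ hv) hw _ _)
              (zsmul_mem (mul_rel_mul_mem hv (P.d_mem _ _ hw) _ _) _)) _
          · intro x y h1 h2
            rw [map_add]
            exact add_mem h1 h2
        conj_mem := fun a ha => by
          refine ccrIdeal_induction (τ := P.τ) (p := fun a : P.TC => P.conjTC a ∈ ccrIdeal P.τ)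
            (by simp) ?_ ?_ ha
          · intro i j v hv w hw k x hx l y hy
            rw [conjTC_mul (mul_mem_grC hx (rel_mem_grC hP.degree_zero hv hw)) hy,
              conjTC_mul hx (rel_mem_grC hP.degree_zero hv hw), conjTC_rel hv hw, mul_smul_comm,
              smul_mul_assoc, mul_smul_comm, ← mul_assoc]
            exact zsmul_mem (zsmul_mem (zsmul_mem (mul_rel_mul_mem hv hw _ _) _) _) _
          · intro x y h1 h2
            rw [map_add]
            exact add_mem h1 h2 }
    refine DGStarAlg.dgSpan_le hJ ?_ ha
    rintro _ ⟨i, j, v, hv, w, hw, rfl⟩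
    exact rel_mem (τ := P.τ) hv hw
  · intro ha
    refine ccrIdeal_induction (τ := P.τ)
      (p := fun a : P.TC => (a : P.tensorDG.A) ∈ P.tensorDG.dgSpan P.ccrRel)
      (Ideal.zero_mem _) ?_ (fun x y h1 h2 => Ideal.add_mem _ h1 h2) ha
    intro i j v hv w hw k x _ l y _
    refine (P.tensorDG.isDGIdeal_dgSpan _).mul_mem_right _ (Ideal.mul_mem_left _ _ ?_) _
    exact DGStarAlg.subset_dgSpan _ _ ⟨i, j, v, hv, w, hw, rfl⟩

end PairedComplex

end

/-! ### Contractions and the comparison with the graded-symmetric algebra -/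

section

namespace PairedComplex

variable {P : PairedComplex.{u}}

/-- The sign `(-1)^i`, as a complex number. -/
def csgn (i : ℤ) : ℂ := (sgn i : ℂ)

theorem csgn_add (i j : ℤ) : csgn (i + j) = csgn i * csgn j := by
  rw [csgn, sgn_add, Int.cast_mul]
  rfl

theorem csgn_mul_self (i : ℤ) : csgn i * csgn i = 1 := by
  rw [csgn, ← Int.cast_mul, sgn_mul_self, Int.cast_one]

theorem sgn_smul (i : ℤ) (x : P.TC) : sgn i • x = csgn i • x :=
  (Int.cast_smul_eq_zsmul ℂ (sgn i) x).symm

theorem csgn_eq_one_of_even {i : ℤ} (h : Even i) : csgn i = 1 := by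
  obtain ⟨k, rfl⟩ := h
  rw [csgn_add, csgn_mul_self]

theorem csgn_eq_of_even {i j : ℤ} (h : Even (i + j)) : csgn i = csgn j := by
  have h1 := csgn_eq_one_of_even h
  rw [csgn_add] at h1
  linear_combination csgn j * h1 - csgn i * csgn_mul_self j

/-- The semilinear map which is given by `f i` on the part of degree `i`. -/
def byDegreeC {W : Type*} [AddCommGroup W] [Module ℂ W] (f : ℤ → P.V →ₛₗ[Complex.ofRealHom] W) :
    P.V →ₛₗ[Complex.ofRealHom] W where
  toFun v := DirectSum.toAddMonoid (fun i => (f i).toAddMonoidHom.comp (P.gr i).subtype.toAddMonoidHom)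
    (DirectSum.decompose P.gr v)
  map_add' v w := by rw [DirectSum.decompose_add, map_add]
  map_smul' c v := by
    refine gr_induction (p := fun v => DirectSum.toAddMonoid
      (fun i => (f i).toAddMonoidHom.comp (P.gr i).subtype.toAddMonoidHom)
      (DirectSum.decompose P.gr (c • v)) = Complex.ofRealHom c • DirectSum.toAddMonoid
      (fun i => (f i).toAddMonoidHom.comp (P.gr i).subtype.toAddMonoidHom)
      (DirectSum.decompose P.gr v)) ?_ ?_ v
    · intro i v hv
      rw [DirectSum.decompose_of_mem P.gr hv,
        DirectSum.decompose_of_mem P.gr (Submodule.smul_mem _ c hv), DirectSum.toAddMonoid_of,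
        DirectSum.toAddMonoid_of]
      exact map_smulₛₗ (f i) c v
    · intro v w h1 h2
      rw [smul_add, DirectSum.decompose_add, map_add, h1, h2, DirectSum.decompose_add, map_add,
        smul_add]

theorem byDegreeC_of_mem {W : Type*} [AddCommGroup W] [Module ℂ W]
    (f : ℤ → P.V →ₛₗ[Complex.ofRealHom] W) {i : ℤ} {v : P.V} (hv : v ∈ P.gr i) :
    byDegreeC f v = f i v := by
  change DirectSum.toAddMonoid _ (DirectSum.decompose P.gr v) = _
  rw [DirectSum.decompose_of_mem P.gr hv, DirectSum.toAddMonoid_of]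
  rfl

/-- The scalar multiple `z τ(v, -)` of the pairing with a fixed vector. -/
def pairC (hP : P.IsPoisson) (z : ℂ) (v : P.V) : P.V →ₛₗ[Complex.ofRealHom] P.TC where
  toFun w := (z * P.τ v w) • (1 : P.TC)
  map_add' w w' := by rw [hP.add_right]; push_cast; rw [mul_add, add_smul]
  map_smul' c w := by
    rw [hP.smul_right, smul_smul]
    push_cast
    congr 1
    simp only [Complex.ofRealHom_eq_coe]
    ring

/-- The contraction with `z τ(v, -)`, a graded derivation of the degree `i` of `v`. -/
def ctr (hP : P.IsPoisson) (z : ℂ) (i : ℤ) (v : P.V) : P.TC →ₗ[ℂ] P.TC :=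
  twDer (signC ^ i.natAbs) (pairC hP z v)

variable (hP : P.IsPoisson) (z : ℂ)

theorem ctr_one (i : ℤ) (v : P.V) : ctr hP z i v 1 = 0 := twDer_one _ _

theorem ctr_mul (i : ℤ) (v : P.V) {j : ℤ} {x : P.TC} (hx : x ∈ P.grC j) (y : P.TC) :
    ctr hP z i v (x * y) = ctr hP z i v x * y + csgn (i * j) • (x * ctr hP z i v y) := by
  rw [ctr, twDer_mul, signC_pow_of_mem hx, sgn_natAbs_mul, smul_mul_assoc, sgn_smul]

theorem ctr_ιC (i : ℤ) (v w : P.V) : ctr hP z i v (P.ιC w) = (z * P.τ v w) • (1 : P.TC) :=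
  twDer_ιC _ _ w

theorem ctr_ιC_mul (i : ℤ) (v : P.V) {j : ℤ} {w : P.V} (hw : w ∈ P.gr j) (x : P.TC) :
    ctr hP z i v (P.ιC w * x) =
      (z * P.τ v w) • x + csgn (i * j) • (P.ιC w * ctr hP z i v x) := by
  rw [ctr_mul _ _ _ _ (ιC_mem hw), ctr_ιC, smul_mul_assoc, one_mul]

theorem ctr_add (i : ℤ) (v w : P.V) :
    ctr hP z i (v + w) = ctr hP z i v + ctr hP z i w := by
  refine tc_linearMap_ext (by simp [ctr_one]) fun j u hu x hx => ?_
  rw [LinearMap.add_apply] at hx ⊢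
  rw [ctr_ιC_mul _ _ _ _ hu, ctr_ιC_mul _ _ _ _ hu, ctr_ιC_mul _ _ _ _ hu, hx, hP.add_left]
  push_cast
  rw [mul_add, add_smul, mul_add, smul_add]
  abel

theorem ctr_smul (i : ℤ) (c : ℝ) (v : P.V) : ctr hP z i (c • v) = (c : ℂ) • ctr hP z i v := by
  refine tc_linearMap_ext (by simp [ctr_one]) fun j u hu x hx => ?_
  rw [LinearMap.smul_apply] at hx ⊢
  rw [ctr_ιC_mul _ _ _ _ hu, ctr_ιC_mul _ _ _ _ hu, hx, hP.smul_left, mul_smul_comm]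
  push_cast
  module

theorem ctr_neg (i : ℤ) (v : P.V) : ctr hP (-z) i v = (-1 : ℂ) • ctr hP z i v := by
  refine tc_linearMap_ext (by simp [ctr_one]) fun j u hu x hx => ?_
  rw [LinearMap.smul_apply] at hx ⊢
  rw [ctr_ιC_mul _ _ _ _ hu, ctr_ιC_mul _ _ _ _ hu, hx, mul_smul_comm]
  module

variable {hP z}

/-- A pairing of degree zero only sees the signs of elements of opposite degrees. -/
theorem pair_eq (hP : P.IsPoisson) {i j : ℤ} {v w : P.V} (hv : v ∈ P.gr i) (hw : w ∈ P.gr j) {a b : ℂ}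
    (hab : i = -j → a = b) : a * (P.τ v w : ℂ) = b * (P.τ v w : ℂ) := by
  by_cases h : i + j = 0
  · rw [hab (by omega)]
  · rw [hP.degree_zero i j v hv w hw h]
    simp

/-- Contractions anticommute in the graded sense. Words are compared recursively; the signs agree
because `τ` pairs only elements of opposite degrees. -/
theorem ctr_ctr {z' : ℂ} {i j : ℤ} {v w : P.V} (hv : v ∈ P.gr i) (hw : w ∈ P.gr j) (x : P.TC) :
    ctr hP z i v (ctr hP z' j w x) = csgn (i * j) • ctr hP z' j w (ctr hP z i v x) := by
  suffices h : ctr hP z i v ∘ₗ ctr hP z' j w = csgn (i * j) • ctr hP z' j w ∘ₗ ctr hP z i v from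
    congrArg (fun L => L x) h
  refine tc_linearMap_ext (by simp [ctr_one]) fun k u hu x hx => ?_
  simp only [LinearMap.comp_apply, LinearMap.smul_apply] at hx ⊢
  have h1 : csgn (j * k) * (P.τ v u : ℂ) = csgn (i * j) * (P.τ v u : ℂ) :=
    pair_eq hP hv hu fun h => csgn_eq_of_even ⟨0, by rw [h]; ring⟩
  have h2 : 1 * (P.τ w u : ℂ) = (csgn (i * j) * csgn (i * k)) * (P.τ w u : ℂ) :=
    pair_eq hP hw hu fun h => by
      rw [← csgn_add, csgn_eq_one_of_even ⟨0, by rw [h]; ring⟩]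
  simp only [ctr_ιC_mul hP _ _ _ hu, map_add, map_smul, hx, mul_smul_comm]
  linear_combination (norm := module) (z * h1) • ctr hP z' j w x + (z' * h2) • ctr hP z i v x

/-- The graded commutator of the differential with the contraction by `v` is the contraction by
`d v`; this is the compatibility of the pairing with the differential. -/
theorem dC_ctr {i : ℤ} {v : P.V} (hv : v ∈ P.gr i) (x : P.TC) :
    P.dC (ctr hP z i v x) = ctr hP z (i + 1) (P.d v) x + csgn i • ctr hP z i v (P.dC x) := by
  suffices h : P.dC ∘ₗ ctr hP z i v = ctr hP z (i + 1) (P.d v) + csgn i • ctr hP z i v ∘ₗ P.dC from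
    congrArg (fun L => L x) h
  refine tc_linearMap_ext (by simp [ctr_one, dC_one]) fun k u hu x hx => ?_
  simp only [LinearMap.comp_apply, LinearMap.smul_apply, LinearMap.add_apply] at hx ⊢
  have h1 : (P.τ (P.d v) u : ℂ) + csgn i * (P.τ v (P.d u) : ℂ) = 0 := by
    have := hP.cocycle i v hv u
    rw [csgn]
    exact_mod_cast this
  have h2 : 1 * (P.τ v u : ℂ) = (csgn i * csgn k) * (P.τ v u : ℂ) :=
    pair_eq hP hv hu fun h => by
      rw [← csgn_add, csgn_eq_one_of_even ⟨0, by rw [h]; ring⟩]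
  have h3 : csgn (i * k + i * 1) = csgn (i * k) * csgn i := by
    rw [csgn_add, mul_one]
  have h4 : csgn ((i + 1) * k) = csgn (i * k) * csgn k := by
    rw [← csgn_add, add_mul, one_mul]
  simp only [ctr_ιC_mul hP _ _ _ hu, ctr_ιC_mul hP _ _ _ (P.d_mem _ _ hu), map_add, map_smul, hx,
    mul_smul_comm, dC_mul (ιC_mem hu), dC_ιC, sgn_smul, mul_add]
  rw [h4, h3]
  linear_combination (norm := module) (z * h2) • P.dC x - (z * h1) • x -
    (csgn (i * k) * csgn_mul_self i) • (P.ιC (P.d u) * ctr hP z i v x)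

theorem ctr_mem {i : ℤ} {v : P.V} (hv : v ∈ P.gr i) {n : ℤ} {x : P.TC} (hx : x ∈ P.grC n) :
    ctr hP z i v x ∈ P.grC (i + n) := by
  refine grC_induction (p := fun n x _ => ctr hP z i v x ∈ P.grC (i + n)) ?_ ?_ ?_ ?_ ?_ hx
  · rw [ctr_one]
    exact zero_mem _
  · intro j n u hu x hx h
    rw [ctr_ιC_mul hP _ _ _ hu]
    refine add_mem ?_ (Submodule.smul_mem _ _ ?_)
    · by_cases hij : i + j = 0
      · rw [← add_assoc, hij, zero_add]
        exact Submodule.smul_mem _ _ hx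
      · rw [hP.degree_zero i j v hv u hu hij]
        simp
    · rw [show i + (j + n) = j + (i + n) by ring]
      exact mul_mem_grC (ιC_mem hu) h
  · intro i; rw [map_zero]; exact zero_mem _
  · intro i x y _ _ h1 h2
    rw [map_add]
    exact add_mem h1 h2
  · intro i c x _ h
    rw [map_smul]
    exact Submodule.smul_mem _ c h

/-- The contractions annihilate the relations and hence preserve the ideal generated by them. -/
theorem ctr_mem_ccrIdeal {a : ℝ} {i : ℤ} {v : P.V} (hv : v ∈ P.gr i) {x : P.TC}
    (hx : x ∈ ccrIdeal (fun v w => a * P.τ v w)) :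
    ctr hP z i v x ∈ ccrIdeal (fun v w => a * P.τ v w) := by
  set τ' : P.V → P.V → ℝ := fun v w => a * P.τ v w with hτ'
  refine ccrIdeal_induction (τ := τ') (p := fun x => ctr hP z i v x ∈ ccrIdeal τ') ?_ ?_ ?_ hx
  · rw [map_zero]; exact zero_mem _
  · intro j k w hw u hu l x hx n y _
    have hr : rel τ' j k w u ∈ P.grC (j + k) := rel_mem_grC (fun i j v hv w hw h => by
      rw [hτ']
      simp only
      rw [hP.degree_zero i j v hv w hw h, mul_zero]) hw hu
    -- the contraction of a graded commutator of generators vanishes, and so does that of a scalar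
    have h0 : ctr hP z i v (rel τ' j k w u) = 0 := by
      have h1 : 1 * (P.τ v w : ℂ) = (csgn (j * k) * csgn (i * k)) * (P.τ v w : ℂ) :=
        pair_eq hP hv hw fun h => by
          rw [← csgn_add, csgn_eq_one_of_even ⟨0, by rw [h]; ring⟩]
      have h2 : csgn (i * j) * (P.τ v u : ℂ) = csgn (j * k) * (P.τ v u : ℂ) :=
        pair_eq hP hv hu fun h => csgn_eq_of_even ⟨0, by rw [h]; ring⟩
      rw [rel, map_sub, map_sub, sgn_smul, map_smul, ctr_ιC_mul hP _ _ _ hw,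
        ctr_ιC_mul hP _ _ _ hu, ctr_ιC, ctr_ιC, Algebra.algebraMap_eq_smul_one, map_smul, ctr_one,
        mul_smul_comm, mul_one, mul_smul_comm, mul_one]
      linear_combination (norm := module) (z * h1) • P.ιC u + (z * h2) • P.ιC w
    rw [ctr_mul hP _ _ _ (mul_mem_grC hx hr), ctr_mul hP _ _ _ hx, h0, mul_zero, smul_zero, add_zero]
    exact add_mem (mul_rel_mul_mem hw hu _ _) (Submodule.smul_mem _ _ (mul_rel_mul_mem hw hu _ _))
  · intro x y h1 h2
    rw [map_add]
    exact add_mem h1 h2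

variable (hP z)

/-- The operator `x ↦ v * x + ∂_v x`, where `∂_v` is the contraction with `z τ(v, -)`. -/
def shiftOp : P.V →ₛₗ[Complex.ofRealHom] Module.End ℂ P.TC := byDegreeC fun i =>
  { toFun v := LinearMap.mulLeft ℂ (P.ιC v) + ctr hP z i v
    map_add' v w := by
      refine LinearMap.ext fun x => ?_
      simp only [map_add, LinearMap.add_apply, LinearMap.mulLeft_apply, ctr_add, add_mul]
      abel
    map_smul' c v := by
      refine LinearMap.ext fun x => ?_
      have h : P.ιC (c • v) = (c : ℂ) • P.ιC v := map_smulₛₗ _ c v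
      simp only [h, LinearMap.add_apply, LinearMap.mulLeft_apply, ctr_smul, LinearMap.smul_apply,
        smul_mul_assoc, Complex.ofRealHom_eq_coe, smul_add] }

/-- The linear automorphism of the tensor algebra determined by `1 ↦ 1` and
`v * x ↦ v * α x + ∂_v (α x)`, where `∂_v` is the contraction with `z τ(v, -)`. This is the analogue
of `CliffordAlgebra.changeForm` for graded tensor algebras. -/
def changeTau : P.TC →ₗ[ℂ] P.TC := LinearMap.applyₗ (1 : P.TC) ∘ₗ (liftC (shiftOp hP z)).toLinearMap

theorem changeTau_one : changeTau hP z 1 = 1 := by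
  change liftC (shiftOp hP z) 1 1 = 1
  rw [map_one (liftC (shiftOp hP z))]
  rfl

theorem changeTau_ιC_mul {i : ℤ} {v : P.V} (hv : v ∈ P.gr i) (x : P.TC) :
    changeTau hP z (P.ιC v * x) = P.ιC v * changeTau hP z x + ctr hP z i v (changeTau hP z x) := by
  change liftC (shiftOp hP z) (P.ιC v * x) 1 = _
  rw [map_mul, liftC_ιC, shiftOp, byDegreeC_of_mem _ hv]
  rfl

theorem changeTau_mem {n : ℤ} {x : P.TC} (hx : x ∈ P.grC n) : changeTau hP z x ∈ P.grC n := by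
  refine grC_induction (p := fun n x _ => changeTau hP z x ∈ P.grC n) ?_ ?_ ?_ ?_ ?_ hx
  · rw [changeTau_one]
    exact one_mem_grC
  · intro j n u hu x hx h
    rw [changeTau_ιC_mul _ _ hu]
    exact add_mem (mul_mem_grC (ιC_mem hu) h) (ctr_mem hu h)
  · intro i; rw [map_zero]; exact zero_mem _
  · intro i x y _ _ h1 h2
    rw [map_add]
    exact add_mem h1 h2
  · intro i c x _ h
    rw [map_smul]
    exact Submodule.smul_mem _ c h

/-- The comparison map is a cochain map, although it is not multiplicative. -/
theorem changeTau_dC (x : P.TC) : changeTau hP z (P.dC x) = P.dC (changeTau hP z x) := by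
  suffices h : changeTau hP z ∘ₗ P.dC = P.dC ∘ₗ changeTau hP z from congrArg (fun L => L x) h
  refine tc_linearMap_ext (by simp [changeTau_one, dC_one]) fun k u hu x hx => ?_
  simp only [LinearMap.comp_apply] at hx ⊢
  rw [dC_mul (ιC_mem hu), sgn_smul, map_add, map_smul, dC_ιC, changeTau_ιC_mul hP z (P.d_mem _ _ hu),
    changeTau_ιC_mul hP z hu, changeTau_ιC_mul hP z hu, map_add, hx, dC_mul (ιC_mem hu), dC_ctr hu,
    dC_ιC, sgn_smul]
  module

theorem ctr_changeTau {z' : ℂ} {i : ℤ} {v : P.V} (hv : v ∈ P.gr i) (x : P.TC) :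
    ctr hP z' i v (changeTau hP z x) = changeTau hP z (ctr hP z' i v x) := by
  suffices h : ctr hP z' i v ∘ₗ changeTau hP z = changeTau hP z ∘ₗ ctr hP z' i v from
    congrArg (fun L => L x) h
  refine tc_linearMap_ext (by simp [changeTau_one, ctr_one]) fun k u hu x hx => ?_
  simp only [LinearMap.comp_apply] at hx ⊢
  rw [changeTau_ιC_mul hP z hu, map_add, ctr_ιC_mul hP _ _ _ hu, ctr_ιC_mul hP _ _ _ hu, map_add,
    map_smul, map_smul, changeTau_ιC_mul hP z hu, ctr_ctr hv hu, hx]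
  module

theorem changeTau_neg_changeTau (x : P.TC) : changeTau hP (-z) (changeTau hP z x) = x := by
  suffices h : changeTau hP (-z) ∘ₗ changeTau hP z = LinearMap.id from congrArg (fun L => L x) h
  refine tc_linearMap_ext (by simp [changeTau_one]) fun k u hu x hx => ?_
  simp only [LinearMap.comp_apply, LinearMap.id_apply] at hx ⊢
  rw [changeTau_ιC_mul hP z hu, map_add, changeTau_ιC_mul hP _ hu, hx, ctr_neg, LinearMap.smul_apply,
    ← ctr_changeTau hP (-z) hu, hx]
  module

/-- The comparison map `changeTau` intertwines the commutation relations of different multiples of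
the pairing. -/
theorem changeTau_mem_ccrIdeal {a b : ℝ} (hab : 2 * z = Complex.I * (a - b)) {x : P.TC}
    (hx : x ∈ ccrIdeal (fun v w => a * P.τ v w)) :
    changeTau hP z x ∈ ccrIdeal (fun v w => b * P.τ v w) := by
  refine ccrIdeal_induction (τ := fun v w => a * P.τ v w)
    (p := fun x => changeTau hP z x ∈ ccrIdeal (fun v w => b * P.τ v w)) ?_ ?_ ?_ hx
  · rw [map_zero]; exact zero_mem _
  · intro i j v hv w hw k x _ l y _
    -- Recursion over the left factor `x`. For `x = 1` the two contractions of `v * w - ± w * v` add up to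
    -- `2 z τ(v, w)`, which accounts for the difference of the two commutation relations.
    refine tc_word_induction (p := fun x => changeTau hP z (x * rel _ i j v w * y) ∈ ccrIdeal _)
      ?_ ?_ ?_ ?_ x
    · have h1 : (P.τ v w : ℂ) = -(csgn (i * j) * P.τ w v) := by
        have := hP.antisymm i j v hv w hw
        rw [csgn]
        exact_mod_cast this
      have e : changeTau hP z (1 * rel (fun v w => a * P.τ v w) i j v w * y) =
          1 * rel (fun v w => b * P.τ v w) i j v w * changeTau hP z y := by
        rw [one_mul, one_mul, rel, rel, sub_mul, sub_mul, sub_mul, sub_mul, map_sub, map_sub, sgn_smul,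
          smul_mul_assoc, smul_mul_assoc, map_smul, mul_assoc, mul_assoc, mul_assoc,
          mul_assoc, changeTau_ιC_mul hP z hv, changeTau_ιC_mul hP z hw, changeTau_ιC_mul hP z hw,
          changeTau_ιC_mul hP z hv, mul_add, mul_add, map_add, map_add, ctr_ctr hv hw,
          ctr_ιC_mul hP _ _ _ hw, ctr_ιC_mul hP _ _ _ hv, Algebra.algebraMap_eq_smul_one,
          Algebra.algebraMap_eq_smul_one, smul_mul_assoc, smul_mul_assoc, one_mul, one_mul,
          map_smul, mul_comm j i]
        have h2 := csgn_mul_self (i * j)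
        push_cast
        linear_combination (norm := module) (hab * (P.τ v w : ℂ) - z * h1) • changeTau hP z y -
          h2 • (P.ιC v * ctr hP z j w (changeTau hP z y))
      rw [e]
      exact mul_rel_mul_mem hv hw _ _
    · intro u x h
      refine gr_induction (p := fun u => changeTau hP z (P.ιC u * x * rel _ i j v w * y) ∈ ccrIdeal _)
        ?_ ?_ u
      · intro n u hu
        rw [mul_assoc, mul_assoc, changeTau_ιC_mul hP z hu, ← mul_assoc x]
        exact add_mem (mul_mem_ccrIdeal_left _ h) (ctr_mem_ccrIdeal hu h)
      · intro u u' h1 h2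
        rw [map_add, add_mul, add_mul, add_mul, map_add]
        exact add_mem h1 h2
    · intro x y h1 h2
      rw [add_mul, add_mul, map_add]
      exact add_mem h1 h2
    · intro c x h
      rw [smul_mul_assoc, smul_mul_assoc, map_smul]
      exact Submodule.smul_mem _ c h
  · intro x y h1 h2
    rw [map_add]
    exact add_mem h1 h2

variable {Q : PairedComplex.{u}} (hQ : Q.IsPoisson) (f : Hom P Q)

theorem Hom.mapTC_ιC (v : P.V) : f.mapTC.map (P.ιC v) = Q.ιC (f.map v) := f.mapTC_genC v

theorem mapTC_changeTau (x : P.TC) :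
    f.mapTC.map (changeTau hP z x) = changeTau hQ z (f.mapTC.map x) := by
  let F : P.TC →ₐ[ℂ] Q.TC := f.mapTC.map
  have hF : ∀ v, F (P.ιC v) = Q.ιC (f.map v) := f.mapTC_ιC
  have hc : ∀ i, ∀ v ∈ P.gr i, F.toLinearMap ∘ₗ ctr hP z i v =
      ctr hQ z i (f.map v) ∘ₗ F.toLinearMap := by
    intro i v hv
    refine tc_linearMap_ext (by simp [ctr_one]) fun k u hu x hx => ?_
    simp only [LinearMap.comp_apply, AlgHom.toLinearMap_apply] at hx ⊢
    rw [ctr_ιC_mul hP _ _ _ hu, map_mul, hF, ctr_ιC_mul hQ _ _ _ (f.map_mem _ _ hu), ← hx, f.map_τ,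
      map_add, map_smul, map_smul, map_mul, hF]
  suffices h : F.toLinearMap ∘ₗ changeTau hP z = changeTau hQ z ∘ₗ F.toLinearMap from
    congrArg (fun L => L x) h
  refine tc_linearMap_ext (by simp [changeTau_one]) fun k u hu x hx => ?_
  have hcu := fun y => congrArg (fun L => L y) (hc k u hu)
  simp only [LinearMap.comp_apply, AlgHom.toLinearMap_apply] at hx hcu ⊢
  rw [changeTau_ιC_mul hP _ hu, map_mul, hF, changeTau_ιC_mul hQ _ (f.map_mem _ _ hu), map_add,
    map_mul, hF, hcu, hx]

end PairedComplex

end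

/-! ### Splitting of injective quasi-isomorphisms of complexes of vector spaces -/

section

/-- An injective quasi-isomorphism of complexes of vector spaces has a cochain retraction, and the
complement is contractible. If `B` is a complement of the vectors whose differential lies in the
image of `f`, then the target is the direct sum of the image of `f`, of `d B`, and of `B`. -/
theorem exists_splitting {A Q : Type*} [AddCommGroup A] [Module ℝ A] [AddCommGroup Q] [Module ℝ Q]
    {dA : A →ₗ[ℝ] A} {dQ : Q →ₗ[ℝ] Q} (hQ : ∀ q, dQ (dQ q) = 0)
    (f : A →ₗ[ℝ] Q) (hf : Function.Injective f) (hd : ∀ a, f (dA a) = dQ (f a))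
    (h1 : ∀ q, dQ q = 0 → ∃ a q', q = f a + dQ q') (h2 : ∀ a q, f a = dQ q → ∃ a', a = dA a') :
    ∃ (r : Q →ₗ[ℝ] A) (k : Q →ₗ[ℝ] Q), (∀ a, r (f a) = a) ∧ (∀ q, r (dQ q) = dA (r q)) ∧
      ∀ q, dQ (k q) + k (dQ q) = q - f (r q) := by
  obtain ⟨B, hB⟩ := Submodule.exists_isCompl ((LinearMap.range f).comap dQ)
  -- the decomposition of the target into `f A`, `d B` and `B`
  let Ψ : (A × B × B) →ₗ[ℝ] Q :=
    f.coprod ((dQ ∘ₗ B.subtype).coprod B.subtype)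
  have hΨ : ∀ a b b', Ψ (a, b, b') = f a + (dQ b + b') := fun _ _ _ => rfl
  have hzero : ∀ b : B, dQ b ∈ LinearMap.range f → b = 0 := fun b hb => by
    have := (Submodule.disjoint_def.mp hB.disjoint) (b : Q) hb b.2
    exact Subtype.ext this
  have hinj : Function.Injective Ψ := by
    rw [← LinearMap.ker_eq_bot, LinearMap.ker_eq_bot']
    rintro ⟨a, b, b'⟩ h
    rw [hΨ] at h
    have e1 : dQ b' = f (-dA a) := by
      have := congrArg dQ h
      rw [map_add, map_add, hQ, zero_add, map_zero, ← hd] at this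
      rw [map_neg]
      exact eq_neg_of_add_eq_zero_right this
    have hb' : b' = 0 := hzero b' ⟨_, e1.symm⟩
    subst hb'
    rw [Submodule.coe_zero, add_zero] at h
    have hb : b = 0 := hzero b ⟨-a, by rw [map_neg]; exact (eq_neg_of_add_eq_zero_right h).symm⟩
    subst hb
    rw [Submodule.coe_zero, map_zero, add_zero] at h
    rw [(map_eq_zero_iff f hf).mp h]
    rfl
  have hsurj : Function.Surjective Ψ := by
    intro q
    have hdec : ∀ q : Q, ∃ x, dQ x ∈ LinearMap.range f ∧ ∃ b : B, q = x + b := fun q => by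
      have : q ∈ (LinearMap.range f).comap dQ ⊔ B := by rw [hB.sup_eq_top]; trivial
      obtain ⟨x, hx, b, hb, rfl⟩ := Submodule.mem_sup.mp this
      exact ⟨x, hx, ⟨b, hb⟩, rfl⟩
    obtain ⟨x, ⟨a, ha⟩, b', rfl⟩ := hdec q
    obtain ⟨a', rfl⟩ := h2 a x ha
    obtain ⟨a'', q', h⟩ := h1 (x - f a') (by rw [map_sub, ← hd, ha, sub_self])
    obtain ⟨x', hx', b, rfl⟩ := hdec q'
    obtain ⟨c, hc⟩ := hx'
    refine ⟨(a' + a'' + c, b, b'), ?_⟩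
    rw [hΨ, map_add, map_add, hc, sub_eq_iff_eq_add.mp h, map_add]
    abel
  let e := LinearEquiv.ofBijective Ψ ⟨hinj, hsurj⟩
  have he : ∀ a (b b' : B), e.symm (f a + (dQ b + b')) = (a, b, b') := fun a b b' => by
    rw [LinearEquiv.symm_apply_eq]
    rfl
  have hrep : ∀ q, ∃ a, ∃ b b' : B, q = f a + (dQ b + b') := fun q => by
    obtain ⟨⟨a, b, b'⟩, h⟩ := hsurj q
    exact ⟨a, b, b', h.symm⟩
  have hdrep : ∀ a (b b' : B), dQ (f a + (dQ b + b')) = f (dA a) + (dQ b' + (0 : B)) := fun a b b' => by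
    rw [map_add, map_add, hQ, hd, zero_add, Submodule.coe_zero, add_zero]
  refine ⟨LinearMap.fst ℝ _ _ ∘ₗ e.symm.toLinearMap,
    B.subtype ∘ₗ LinearMap.fst ℝ _ _ ∘ₗ LinearMap.snd ℝ _ _ ∘ₗ e.symm.toLinearMap, ?_, ?_, ?_⟩
  · intro a
    have := he a 0 0
    rw [Submodule.coe_zero, map_zero, add_zero, add_zero] at this
    change (e.symm (f a)).1 = a
    rw [this]
  · intro q
    obtain ⟨a, b, b', rfl⟩ := hrep q
    change (e.symm _).1 = dA (e.symm _).1
    rw [hdrep, he, he]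
  · intro q
    obtain ⟨a, b, b', rfl⟩ := hrep q
    change dQ ((e.symm _).2.1 : Q) + ((e.symm _).2.1 : Q) = _ - f (e.symm _).1
    rw [hdrep, he, he]
    abel

namespace PairedComplex

variable {P Q : PairedComplex.{u}}

variable (P) in
/-- The projection to the part of degree `i`. -/
def projV (i : ℤ) : P.V →ₗ[ℝ] P.V :=
  P.byDegree fun j => if j = i then LinearMap.id else 0

theorem projV_same {i : ℤ} {v : P.V} (hv : v ∈ P.gr i) : P.projV i v = v := by
  rw [projV, byDegree_of_mem _ hv, if_pos rfl]
  rfl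

theorem projV_ne {i j : ℤ} {v : P.V} (hv : v ∈ P.gr j) (h : j ≠ i) : P.projV i v = 0 := by
  rw [projV, byDegree_of_mem _ hv, if_neg h]
  rfl

theorem projV_mem (i : ℤ) (v : P.V) : P.projV i v ∈ P.gr i := by
  refine gr_induction (p := fun v => P.projV i v ∈ P.gr i) (fun j v hv => ?_)
    (fun v w h1 h2 => by rw [map_add]; exact add_mem h1 h2) v
  by_cases h : j = i
  · subst h
    rwa [projV_same hv]
  · rw [projV_ne hv h]
    exact zero_mem _

theorem d_projV (i : ℤ) (v : P.V) : P.d (P.projV i v) = P.projV (i + 1) (P.d v) := by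
  refine gr_induction (p := fun v => P.d (P.projV i v) = P.projV (i + 1) (P.d v)) (fun j v hv => ?_)
    (fun v w h1 h2 => by simp only [map_add, h1, h2]) v
  by_cases h : j = i
  · subst h
    rw [projV_same hv, projV_same (P.d_mem _ _ hv)]
  · rw [projV_ne hv h, projV_ne (P.d_mem _ _ hv) (by omega), map_zero]

theorem Hom.map_projV (f : Hom P Q) (i : ℤ) (v : P.V) :
    f.map (P.projV i v) = Q.projV i (f.map v) := by
  refine gr_induction (p := fun v => f.map (P.projV i v) = Q.projV i (f.map v)) (fun j v hv => ?_)
    (fun v w h1 h2 => by simp only [map_add, h1, h2]) v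
  by_cases h : j = i
  · subst h
    rw [projV_same hv, projV_same (f.map_mem _ _ hv)]
  · rw [projV_ne hv h, projV_ne (f.map_mem _ _ hv) h, map_zero]

/-- The data of a cochain retraction `r` of a morphism `f`, together with a homotopy `k` of degree `-1`
from the identity to `f ∘ r`. -/
structure Retraction (f : Hom P Q) where
  r : Q.V →ₗ[ℝ] P.V
  k : Q.V →ₗ[ℝ] Q.V
  r_mem : ∀ i, ∀ v ∈ Q.gr i, r v ∈ P.gr i
  k_mem : ∀ i, ∀ v ∈ Q.gr i, k v ∈ Q.gr (i - 1)
  r_map : ∀ v, r (f.map v) = v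
  r_d : ∀ v, r (Q.d v) = P.d (r v)
  d_k : ∀ v, Q.d (k v) + k (Q.d v) = v - f.map (r v)

/-- An injective quasi-isomorphism admits a retraction of degree zero with a homotopy of
degree `-1`. -/
theorem exists_retraction (f : Hom P Q) (hf : Function.Injective f.map)
    (h1 : ∀ i, ∀ q ∈ Q.gr i, Q.d q = 0 → ∃ a q', q = f.map a + Q.d q')
    (h2 : ∀ i, ∀ a ∈ P.gr i, ∀ q, f.map a = Q.d q → ∃ a', a = P.d a') : Nonempty (Retraction f) := by
  have hsum : ∀ (R : PairedComplex.{u}) (v : R.V), ∃ s : Finset ℤ, v = ∑ i ∈ s, R.projV i v := by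
    intro R v
    classical
    refine ⟨(DirectSum.decompose R.gr v).support, ?_⟩
    conv_lhs => rw [← DirectSum.sum_support_decompose R.gr v]
    refine Finset.sum_congr rfl fun i _ => ?_
    refine gr_induction (p := fun v => (DirectSum.decompose R.gr v i : R.V) = R.projV i v)
      (fun j v hv => ?_) (fun v w h1 h2 => by rw [DirectSum.decompose_add, map_add, ← h1, ← h2]; rfl) v
    by_cases h : j = i
    · subst h
      rw [projV_same hv, DirectSum.decompose_of_mem_same _ hv]
    · rw [projV_ne hv h, DirectSum.decompose_of_mem_ne _ hv h]
  -- The splitting of the ungraded complexes need not respect degrees; its homogeneous components of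
  -- degree `0` and `-1` do.
  obtain ⟨r, k, hr, hrd, hk⟩ := exists_splitting (dA := P.d) (dQ := Q.d) Q.d_d f.map hf f.map_d
    (fun q hq => by
      obtain ⟨s, hs⟩ := hsum Q q
      choose a q' h using fun i => h1 i (Q.projV i q) (projV_mem i q) (by
        rw [d_projV, hq, map_zero])
      refine ⟨∑ i ∈ s, a i, ∑ i ∈ s, q' i, ?_⟩
      rw [map_sum, map_sum, ← Finset.sum_add_distrib]
      exact hs.trans (Finset.sum_congr rfl fun i _ => h i))
    (fun a q haq => by
      obtain ⟨s, hs⟩ := hsum P a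
      choose a' h using fun i => h2 i (P.projV i a) (projV_mem i a) (Q.projV (i - 1) q) (by
        rw [d_projV, sub_add_cancel, f.map_projV, haq])
      exact ⟨∑ i ∈ s, a' i, by
        rw [map_sum]
        exact hs.trans (Finset.sum_congr rfl fun i _ => h i)⟩)
  have hext : ∀ {p : Q.V → Prop}, (∀ i, ∀ v ∈ Q.gr i, p v) → (∀ v w, p v → p w → p (v + w)) →
    ∀ v, p v := fun h0 hadd v => gr_induction h0 hadd v
  refine ⟨⟨Q.byDegree fun i => P.projV i ∘ₗ r, Q.byDegree fun i => Q.projV (i - 1) ∘ₗ k,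
    fun i v hv => ?_, fun i v hv => ?_, fun v => ?_, fun v => ?_, fun v => ?_⟩⟩
  · rw [byDegree_of_mem _ hv]
    exact projV_mem _ _
  · rw [byDegree_of_mem _ hv]
    exact projV_mem _ _
  · refine gr_induction (p := fun v => Q.byDegree (fun i => P.projV i ∘ₗ r) (f.map v) = v) ?_
      (fun v w h1 h2 => by simp only [map_add, h1, h2]) v
    intro i v hv
    rw [byDegree_of_mem _ (f.map_mem _ _ hv), LinearMap.comp_apply, hr, projV_same hv]
  · refine gr_induction (p := fun v => Q.byDegree (fun i => P.projV i ∘ₗ r) (Q.d v) =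
      P.d (Q.byDegree (fun i => P.projV i ∘ₗ r) v)) ?_ (fun v w h1 h2 => by simp only [map_add, h1, h2]) v
    intro i v hv
    rw [byDegree_of_mem _ hv, byDegree_of_mem _ (Q.d_mem _ _ hv), LinearMap.comp_apply,
      LinearMap.comp_apply, d_projV, hrd]
  · refine gr_induction (p := fun v => Q.d (Q.byDegree (fun i => Q.projV (i - 1) ∘ₗ k) v) +
      Q.byDegree (fun i => Q.projV (i - 1) ∘ₗ k) (Q.d v) =
      v - f.map (Q.byDegree (fun i => P.projV i ∘ₗ r) v)) ?_ (fun v w h1 h2 => ?_) v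
    · intro i v hv
      rw [byDegree_of_mem _ hv, byDegree_of_mem _ hv, byDegree_of_mem _ (Q.d_mem _ _ hv),
        LinearMap.comp_apply, LinearMap.comp_apply, LinearMap.comp_apply, d_projV, f.map_projV,
        add_sub_cancel_right, sub_add_cancel, ← map_add, hk, map_sub, projV_same hv]
    · simp only [map_add]
      rw [add_add_add_comm, h1, h2]
      abel

end PairedComplex

end

/-! ### Quasi-isomorphisms of differential graded algebras -/

section

/-- A linear map into the range of `Φ` factors through `Φ`, since complex vector spaces are
projective. -/
theorem exists_linear_lift {A M N : Type*} [AddCommGroup A] [Module ℂ A] [AddCommGroup M] [Module ℂ M]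
    [AddCommGroup N] [Module ℂ N] (Φ : M →ₗ[ℂ] N) (y : A →ₗ[ℂ] N) (h : ∀ a, ∃ m, Φ m = y a) :
    ∃ l : A →ₗ[ℂ] M, ∀ a, Φ (l a) = y a := by
  obtain ⟨s, hs⟩ := Φ.rangeRestrict.exists_rightInverse_of_surjective Φ.range_rangeRestrict
  refine ⟨s ∘ₗ y.codRestrict (LinearMap.range Φ) h, fun a => ?_⟩
  exact congrArg Subtype.val (LinearMap.congr_fun hs ⟨y a, h a⟩)

namespace DGStarAlg

theorem toComplex_f {B C : DGStarAlg.{u}} (f : Hom B C) (i : ℤ) : f.toComplex.f i =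
    ModuleCat.ofHom (f.map.toLinearMap.restrict fun a ha => f.map_mem i a ha) := rfl

/-- An elementwise criterion for quasi-isomorphisms. -/
theorem quasiIso_toComplex {B C : DGStarAlg.{u}} (f : Hom B C)
    (hS : ∀ i, ∀ b ∈ C.gr (i + 1), C.d b = 0 →
      ∃ a ∈ B.gr (i + 1), B.d a = 0 ∧ ∃ c ∈ C.gr i, b = f.map a + C.d c)
    (hI : ∀ i, ∀ a ∈ B.gr (i + 1), B.d a = 0 → ∀ c ∈ C.gr i, f.map a = C.d c →
      ∃ a' ∈ B.gr i, a = B.d a') : QuasiIso f.toComplex := by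
  rw [quasiIso_iff]
  intro j
  obtain ⟨i, rfl⟩ : ∃ i, j = i + 1 := ⟨j - 1, by ring⟩
  rw [quasiIsoAt_iff_isIso_homologyMap]
  have hp : (ComplexShape.up ℤ).prev (i + 1) = i := by simp
  have hn : (ComplexShape.up ℤ).next (i + 1) = i + 1 + 1 := by simp
  have hmono : Mono (HomologicalComplex.homologyMap f.toComplex (i + 1)) := by
    rw [HomologicalComplex.mono_homologyMap_iff_up_to_refinements _ i (i + 1) (i + 1 + 1) hp hn]
    intro A x₂ hx₂ y₁ hy
    rw [toComplex_d] at hx₂ hy ⊢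
    rw [toComplex_f] at hy
    let x : A →ₗ[ℂ] B.gr (i + 1) := x₂.hom
    let y : A →ₗ[ℂ] C.gr i := y₁.hom
    obtain ⟨l, hl⟩ := exists_linear_lift (B.d.restrict (B.d_mem i)) x fun a => by
      have e1 : B.d (x a) = 0 :=
        congrArg Subtype.val (LinearMap.congr_fun (congrArg ModuleCat.Hom.hom hx₂) a)
      have e2 : f.map (x a) = C.d (y a) :=
        congrArg Subtype.val (LinearMap.congr_fun (congrArg ModuleCat.Hom.hom hy) a)
      obtain ⟨a', ha', h⟩ := hI i _ (x a).2 e1 _ (y a).2 e2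
      exact ⟨⟨a', ha'⟩, Subtype.ext h.symm⟩
    refine ⟨A, 𝟙 A, inferInstance, ModuleCat.ofHom l, ?_⟩
    refine ModuleCat.hom_ext (LinearMap.ext fun a => ?_)
    exact (hl a).symm
  have hepi : Epi (HomologicalComplex.homologyMap f.toComplex (i + 1)) := by
    rw [HomologicalComplex.epi_homologyMap_iff_up_to_refinements _ i (i + 1) (i + 1 + 1) hp hn]
    intro A y₂ hy₂
    rw [toComplex_d] at hy₂
    simp only [toComplex_d, toComplex_f]
    let Z : Submodule ℂ (B.gr (i + 1)) := LinearMap.ker (B.d.restrict (B.d_mem (i + 1)))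
    let Φ : (Z × C.gr i) →ₗ[ℂ] C.gr (i + 1) :=
      ((f.map.toLinearMap.restrict fun a ha => f.map_mem (i + 1) a ha) ∘ₗ Z.subtype).coprod
        (C.d.restrict (C.d_mem i))
    let y : A →ₗ[ℂ] C.gr (i + 1) := y₂.hom
    have hΦ : ∀ a, ∃ m, Φ m = y a := fun a => by
      have e1 : C.d (y a) = 0 :=
        congrArg Subtype.val (LinearMap.congr_fun (congrArg ModuleCat.Hom.hom hy₂) a)
      obtain ⟨b, hb, hdb, c, hc, h⟩ := hS i _ (y a).2 e1
      exact ⟨(⟨⟨b, hb⟩, Subtype.ext hdb⟩, ⟨c, hc⟩), Subtype.ext h.symm⟩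
    obtain ⟨l, hl⟩ := exists_linear_lift (M := Z × C.gr i) Φ y hΦ
    refine ⟨A, 𝟙 A, inferInstance, ModuleCat.ofHom (Z.subtype ∘ₗ LinearMap.fst ℂ _ _ ∘ₗ l), ?_,
      ModuleCat.ofHom (LinearMap.snd ℂ _ _ ∘ₗ l), ?_⟩
    · refine ModuleCat.hom_ext (LinearMap.ext fun a => ?_)
      exact (l a).1.2
    · refine ModuleCat.hom_ext (LinearMap.ext fun a => ?_)
      exact (hl a).symm
  exact isIso_of_mono_of_epi _

end DGStarAlg

/-! ### Quasi-isomorphisms of algebras of canonical commutation relations -/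

namespace PairedComplex

variable {P Q : PairedComplex.{u}}

/-- The Leibniz rule for the differential, with the sign expressed by the parity automorphism. -/
theorem dC_mul' (x y : P.TC) : P.dC (x * y) = P.dC x * y + signC x * P.dC y := by
  refine tc_hom_induction (p := fun x => P.dC (x * y) = P.dC x * y + signC x * P.dC y) ?_ ?_ x
  · intro i x hx
    have := signC_pow_of_mem hx 1
    rw [pow_one, Nat.cast_one, one_mul] at this
    rw [dC_mul hx, this, smul_mul_assoc]
  · intro x x' h1 h2
    rw [add_mul, map_add, h1, h2, map_add, map_add, add_mul, add_mul]
    abel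

theorem dC_mem_ccrIdeal {τ : P.V → P.V → ℝ}
    (hdeg : ∀ i j, ∀ v ∈ P.gr i, ∀ w ∈ P.gr j, i + j ≠ 0 → τ v w = 0)
    (hcoc : ∀ i, ∀ v ∈ P.gr i, ∀ w, τ (P.d v) w + sgn i * τ v (P.d w) = 0) {a : P.TC}
    (ha : a ∈ ccrIdeal τ) : P.dC a ∈ ccrIdeal τ := by
  refine ccrIdeal_induction (τ := τ) (p := fun a : P.TC => P.dC a ∈ ccrIdeal τ) (by simp) ?_ ?_ ha
  · intro i j v hv w hw k x hx l y hy
    rw [dC_mul (mul_mem_grC hx (rel_mem_grC hdeg hv hw)), dC_mul hx, add_mul,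
      dC_rel hv hw (hcoc i v hv w)]
    refine add_mem (add_mem (mul_rel_mul_mem hv hw _ _) ?_)
      (zsmul_mem (mul_rel_mul_mem hv hw _ _) _)
    rw [smul_mul_assoc, mul_add, add_mul, mul_smul_comm, smul_mul_assoc]
    exact zsmul_mem (add_mem (mul_rel_mul_mem (P.d_mem _ _ hv) hw _ _)
      (zsmul_mem (mul_rel_mul_mem hv (P.d_mem _ _ hw) _ _) _)) _
  · intro x y h1 h2
    rw [map_add]
    exact add_mem h1 h2

/-- The ideal of the graded-symmetric algebra. -/
abbrev symIdeal (P : PairedComplex.{u}) : Submodule ℂ P.TC := ccrIdeal fun _ _ => 0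

theorem dC_mem_symIdeal {a : P.TC} (ha : a ∈ P.symIdeal) : P.dC a ∈ P.symIdeal :=
  dC_mem_ccrIdeal (fun _ _ _ _ _ _ _ => rfl) (fun _ _ _ _ => by simp) ha

theorem symRel_eq (i j : ℤ) (v w : P.V) : rel (fun _ _ => 0) i j v w =
    P.ιC v * P.ιC w - csgn (i * j) • (P.ιC w * P.ιC v) := by
  rw [rel, sgn_smul]
  simp

/-- The algebra homomorphism induced by a linear map of degree zero preserves the ideal of the
graded-symmetric algebra. -/
theorem liftC_mem_symIdeal {r : Q.V →ₗ[ℝ] P.V} (hr : ∀ i, ∀ v ∈ Q.gr i, r v ∈ P.gr i) {a : Q.TC}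
    (ha : a ∈ Q.symIdeal) : liftC (P.ιC.comp r) a ∈ P.symIdeal := by
  refine ccrIdeal_induction (p := fun a => liftC (P.ιC.comp r) a ∈ P.symIdeal)
    (by rw [map_zero]; exact zero_mem _) ?_ ?_ ha
  · intro i j v hv w hw k x _ l y _
    rw [map_mul, map_mul, symRel_eq, map_sub, map_smul, map_mul, map_mul, liftC_ιC, liftC_ιC]
    change _ * (P.ιC (r v) * P.ιC (r w) - csgn (i * j) • (P.ιC (r w) * P.ιC (r v))) * _ ∈ _
    rw [← symRel_eq]
    exact mul_rel_mul_mem (hr _ _ hv) (hr _ _ hw) _ _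
  · intro x y h1 h2
    rw [map_add]
    exact add_mem h1 h2

theorem liftC_mem {r : Q.V →ₗ[ℝ] P.V} (hr : ∀ i, ∀ v ∈ Q.gr i, r v ∈ P.gr i) {i : ℤ} {a : Q.TC}
    (ha : a ∈ Q.grC i) : liftC (P.ιC.comp r) a ∈ P.grC i := by
  refine grC_induction (p := fun i a _ => liftC (P.ιC.comp r) a ∈ P.grC i) ?_ ?_ ?_ ?_ ?_ ha
  · rw [map_one]; exact one_mem_grC
  · intro i j v hv x _ h
    rw [map_mul, liftC_ιC]
    exact mul_mem_grC (ιC_mem (hr _ _ hv)) h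
  · intro i; rw [map_zero]; exact zero_mem _
  · intro i x y _ _ h1 h2
    rw [map_add]; exact add_mem h1 h2
  · intro i c x _ h
    rw [map_smul]; exact Submodule.smul_mem _ c h

theorem liftC_dC {r : Q.V →ₗ[ℝ] P.V} (hr : ∀ i, ∀ v ∈ Q.gr i, r v ∈ P.gr i)
    (hd : ∀ v, r (Q.d v) = P.d (r v)) (a : Q.TC) :
    liftC (P.ιC.comp r) (Q.dC a) = P.dC (liftC (P.ιC.comp r) a) := by
  set R := liftC (P.ιC.comp r) with hR
  have hι : ∀ v, R (Q.ιC v) = P.ιC (r v) := fun v => liftC_ιC _ v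
  suffices h : R.toLinearMap ∘ₗ Q.dC = P.dC ∘ₗ R.toLinearMap from congrArg (fun L => L a) h
  refine tc_linearMap_ext (by simp [dC_one]) fun i v hv x hx => ?_
  simp only [LinearMap.comp_apply, AlgHom.toLinearMap_apply] at hx ⊢
  rw [dC_mul (ιC_mem hv), sgn_smul, map_add, map_smul, map_mul, map_mul, map_mul, dC_ιC, hι, hι, hx,
    dC_mul (ιC_mem (hr _ _ hv)), dC_ιC, hd, sgn_smul]

variable {f : Hom P Q} (ρ : Retraction f)

namespace Retraction

/-- The odd derivation which extends the homotopy of a retraction. -/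
def D : Q.TC →ₗ[ℂ] Q.TC := twDer signC (Q.ιC.comp ρ.k)

theorem D_one : ρ.D 1 = 0 := twDer_one _ _

theorem D_mul (x y : Q.TC) : ρ.D (x * y) = ρ.D x * y + signC x * ρ.D y := twDer_mul _ _ x y

theorem D_ιC (v : Q.V) : ρ.D (Q.ιC v) = Q.ιC (ρ.k v) := twDer_ιC _ _ v

theorem signC_ιC' {i : ℤ} {v : Q.V} (hv : v ∈ Q.gr i) : signC (Q.ιC v) = csgn i • Q.ιC v := by
  rw [signC_ιC hv, sgn_smul]

theorem signC_of_mem {i : ℤ} {x : Q.TC} (hx : x ∈ Q.grC i) : signC x = csgn i • x := by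
  have := signC_pow_of_mem hx 1
  rw [pow_one, Nat.cast_one, one_mul, sgn_smul] at this
  exact this

theorem csgn_one : csgn 1 = -1 := by
  rw [csgn, sgn_one]
  norm_num

theorem csgn_sub_one (i : ℤ) : csgn (i - 1) = -csgn i := by
  have := csgn_add (i - 1) 1
  rw [sub_add_cancel, csgn_one] at this
  rw [this]
  ring

theorem csgn_add_one (i : ℤ) : csgn (i + 1) = -csgn i := by
  rw [csgn_add, csgn_one]
  ring

theorem D_mem {i : ℤ} {x : Q.TC} (hx : x ∈ Q.grC i) : ρ.D x ∈ Q.grC (i - 1) := by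
  refine grC_induction (p := fun i x _ => ρ.D x ∈ Q.grC (i - 1)) ?_ ?_ ?_ ?_ ?_ hx
  · rw [D_one]; exact zero_mem _
  · intro i j v hv x hx h
    rw [D_mul, D_ιC, signC_ιC' hv]
    refine add_mem ?_ ?_
    · rw [show i + j - 1 = i - 1 + j by ring]
      exact mul_mem_grC (ιC_mem (ρ.k_mem _ _ hv)) hx
    · rw [smul_mul_assoc, show i + j - 1 = i + (j - 1) by ring]
      exact Submodule.smul_mem _ _ (mul_mem_grC (ιC_mem hv) h)
  · intro i; rw [map_zero]; exact zero_mem _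
  · intro i x y _ _ h1 h2
    rw [map_add]; exact add_mem h1 h2
  · intro i c x _ h
    rw [map_smul]; exact Submodule.smul_mem _ c h

/-- The derivation maps a graded commutator of generators to a sum of two graded commutators. -/
theorem D_mem_symIdeal {a : Q.TC} (ha : a ∈ Q.symIdeal) : ρ.D a ∈ Q.symIdeal := by
  refine ccrIdeal_induction (p := fun a => ρ.D a ∈ Q.symIdeal) (by rw [map_zero]; exact zero_mem _)
    ?_ ?_ ha
  · intro i j v hv w hw k x hx l y _
    have hr : rel (fun _ _ => 0) i j v w ∈ Q.grC (i + j) :=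
      rel_mem_grC (fun _ _ _ _ _ _ _ => rfl) hv hw
    have e : ρ.D (rel (fun _ _ => 0) i j v w) = rel (fun _ _ => 0) (i - 1) j (ρ.k v) w +
        csgn i • rel (fun _ _ => 0) i (j - 1) v (ρ.k w) := by
      have h1 := csgn_mul_self i
      have h2 : csgn ((i - 1) * j) = csgn (i * j) * csgn j := by
        rw [← csgn_add]
        exact csgn_eq_of_even ⟨i * j, by ring⟩
      have h3 : csgn (i * (j - 1)) = csgn (i * j) * csgn i := by
        rw [← csgn_add]
        exact csgn_eq_of_even ⟨i * j, by ring⟩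
      rw [symRel_eq, symRel_eq, symRel_eq, map_sub, map_smul, D_mul, D_mul, D_ιC, D_ιC, signC_ιC' hv,
        signC_ιC' hw, h2, h3, smul_mul_assoc, smul_mul_assoc]
      linear_combination (norm := module) (csgn (i * j) * h1) • (Q.ιC (ρ.k w) * Q.ιC v)
    rw [D_mul, D_mul, e, signC_of_mem (mul_mem_grC hx hr), signC_of_mem hx, add_mul, smul_mul_assoc,
      smul_mul_assoc, mul_add, add_mul, smul_mul_assoc, mul_smul_comm, smul_mul_assoc]
    exact add_mem (add_mem (mul_rel_mul_mem hv hw _ _) (Submodule.smul_mem _ _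
      (add_mem (mul_rel_mul_mem (ρ.k_mem _ _ hv) hw _ _) (Submodule.smul_mem _ _
        (mul_rel_mul_mem hv (ρ.k_mem _ _ hw) _ _)))))
      (Submodule.smul_mem _ _ (mul_rel_mul_mem hv hw _ _))
  · intro x y h1 h2
    rw [map_add]
    exact add_mem h1 h2

/-- The even derivation which extends the projection onto the contractible complement. On a product
of elements of the image of `f` and of elements of the complement, it multiplies by the number of
factors in the complement. -/
def E : Q.TC →ₗ[ℂ] Q.TC := Q.dC ∘ₗ ρ.D + ρ.D ∘ₗ Q.dC

theorem E_apply (x : Q.TC) : ρ.E x = Q.dC (ρ.D x) + ρ.D (Q.dC x) := rfl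

theorem dC_E (x : Q.TC) : Q.dC (ρ.E x) = ρ.E (Q.dC x) := by
  rw [E_apply, E_apply, map_add, dC_dC, dC_dC, map_zero, zero_add, add_zero]

theorem E_mem {i : ℤ} {x : Q.TC} (hx : x ∈ Q.grC i) : ρ.E x ∈ Q.grC i := by
  refine add_mem ?_ ?_
  · have := dC_mem (ρ.D_mem hx)
    rwa [sub_add_cancel] at this
  · have := ρ.D_mem (dC_mem hx)
    rwa [add_sub_cancel_right] at this

theorem E_one : ρ.E 1 = 0 := by
  rw [E_apply, D_one, dC_one, map_zero, map_zero, add_zero]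

/-- On a generator, `E` is `v ↦ d (k v) + k (d v) = v - f (r v)`. -/
theorem E_ιC_mul (v : Q.V) (x : Q.TC) :
    ρ.E (Q.ιC v * x) = Q.ιC (v - f.map (ρ.r v)) * x + Q.ιC v * ρ.E x := by
  refine gr_induction (p := fun v => ρ.E (Q.ιC v * x) =
    Q.ιC (v - f.map (ρ.r v)) * x + Q.ιC v * ρ.E x) ?_ ?_ v
  · intro i v hv
    have h1 := csgn_mul_self i
    rw [← ρ.d_k v, E_apply, E_apply, D_mul, D_ιC, signC_ιC' hv, smul_mul_assoc, map_add, map_smul,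
      dC_mul', dC_mul', dC_mul', dC_ιC, dC_ιC, signC_ιC' (ρ.k_mem _ _ hv), signC_ιC' hv,
      smul_mul_assoc, smul_mul_assoc, smul_mul_assoc, map_add, map_smul, D_mul, D_mul, D_ιC, D_ιC,
      signC_ιC' (Q.d_mem _ _ hv), signC_ιC' hv, csgn_sub_one, csgn_add_one, map_add, add_mul, mul_add]
    simp only [smul_mul_assoc]
    linear_combination (norm := module) h1 • (Q.ιC v * Q.dC (ρ.D x)) + h1 • (Q.ιC v * ρ.D (Q.dC x))
  · intro v w h1 h2
    rw [map_add, add_mul, map_add, h1, h2, add_mul, map_add, map_add, add_sub_add_comm, map_add,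
      add_mul]
    abel

/-- The algebra endomorphism induced by the projection onto the image of `f`. -/
def e : Q.TC →ₐ[ℂ] Q.TC := liftC (Q.ιC.comp (f.map ∘ₗ ρ.r))

theorem e_ιC_mul (v : Q.V) (x : Q.TC) : ρ.e (Q.ιC v * x) = Q.ιC (f.map (ρ.r v)) * ρ.e x := by
  rw [map_mul]
  exact congrArg (· * _) (liftC_ιC _ v)

/-- The products `(1 - E) (1 - E / 2) ⋯ (1 - E / N)`, which stabilize on each vector to the
projection `e` onto the kernel of `E`. -/
def proj : ℕ → Q.TC →ₗ[ℂ] Q.TC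
  | 0 => LinearMap.id
  | N + 1 => proj N - ((N : ℂ) + 1)⁻¹ • ρ.E ∘ₗ proj N

theorem proj_succ (N : ℕ) (x : Q.TC) :
    ρ.proj (N + 1) x = ρ.proj N x - ((N : ℂ) + 1)⁻¹ • ρ.E (ρ.proj N x) := rfl

/-- On an eigenvector of `E` for the eigenvalue `m`, the factor with index `m` vanishes. -/
theorem proj_eq_prod {m : ℕ} {x : Q.TC} (hx : ρ.E x = (m : ℂ) • x) (N : ℕ) :
    ρ.proj N x = (∏ j ∈ Finset.range N, (1 - (m : ℂ) / (j + 1))) • x := by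
  induction N with
  | zero => simp [proj]
  | succ N ih =>
    rw [proj_succ, ih, map_smul, hx, Finset.prod_range_succ]
    module

/-- The tensor algebra is spanned by eigenvectors of `E` for natural numbers: words in elements of the
image of `f` and of the complement. Those for the eigenvalue `0` are fixed by `e`, the others are
annihilated by it. -/
theorem eventually_proj_eq (x : Q.TC) : ∃ n, ∀ N, n ≤ N → ρ.proj N x = ρ.e x := by
  -- eigenvectors of `E` on which `e` acts as the projection onto the kernel of `E`
  let S : Set Q.TC := {x | ∃ m : ℕ, ρ.E x = (m : ℂ) • x ∧ (m = 0 → ρ.e x = x) ∧ (m ≠ 0 → ρ.e x = 0)}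
  have hS : ∀ x, x ∈ Submodule.span ℂ S := by
    refine tc_word_induction ?_ ?_ (fun x y => add_mem) (fun c x => Submodule.smul_mem _ c)
    · exact Submodule.subset_span ⟨0, by simp [E_one], fun _ => map_one _, fun h => (h rfl).elim⟩
    · intro v x hx
      refine Submodule.span_induction (p := fun x _ => Q.ιC v * x ∈ Submodule.span ℂ S)
        ?_ (by simp) (fun x y _ _ h1 h2 => by rw [mul_add]; exact add_mem h1 h2)
        (fun c x _ h => by rw [mul_smul_comm]; exact Submodule.smul_mem _ c h) hx
      rintro x ⟨m, h1, h2, h3⟩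
      have hr0 : ρ.r (v - f.map (ρ.r v)) = 0 := by rw [map_sub, ρ.r_map, sub_self]
      rw [← add_sub_cancel (f.map (ρ.r v)) v, map_add, add_mul]
      refine add_mem (Submodule.subset_span ⟨m, ?_, ?_, ?_⟩) (Submodule.subset_span ⟨m + 1, ?_, ?_, ?_⟩)
      · rw [E_ιC_mul, ρ.r_map, sub_self, map_zero, zero_mul, zero_add, h1, mul_smul_comm]
      · intro hm
        rw [e_ιC_mul, ρ.r_map, h2 hm]
      · intro hm
        rw [e_ιC_mul, h3 hm, mul_zero]
      · rw [E_ιC_mul, hr0, map_zero, sub_zero, h1, mul_smul_comm]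
        push_cast
        module
      · intro h
        omega
      · intro _
        rw [e_ιC_mul, hr0, map_zero, map_zero, zero_mul]
  refine Submodule.span_induction (p := fun x _ => ∃ n, ∀ N, n ≤ N → ρ.proj N x = ρ.e x)
    ?_ ⟨0, by simp⟩ ?_ ?_ (hS x)
  · rintro x ⟨m, h1, h2, h3⟩
    refine ⟨m, fun N hN => ?_⟩
    rw [ρ.proj_eq_prod h1]
    by_cases hm : m = 0
    · rw [h2 hm, hm]
      simp
    · rw [h3 hm, Finset.prod_eq_zero (Finset.mem_range.mpr (show m - 1 < N by omega)), zero_smul]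
      obtain ⟨k, rfl⟩ := Nat.exists_eq_succ_of_ne_zero hm
      have : (k : ℂ) + 1 ≠ 0 := by exact_mod_cast Nat.succ_ne_zero k
      simp [div_self this]
  · rintro x y _ _ ⟨n, hn⟩ ⟨n', hn'⟩
    refine ⟨max n n', fun N hN => ?_⟩
    rw [map_add, map_add, hn N (le_of_max_le_left hN), hn' N (le_of_max_le_right hN)]
  · rintro c x _ ⟨n, hn⟩
    exact ⟨n, fun N hN => by rw [map_smul, map_smul, hn N hN]⟩

/-- Modulo the ideal, a cocycle is cohomologous to its image under the projection `e`. -/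
theorem exists_homologous {i : ℤ} {b : Q.TC} (hb : b ∈ Q.grC (i + 1)) (hdb : Q.dC b ∈ Q.symIdeal) :
    ∃ c ∈ Q.grC i, b - ρ.e b - Q.dC c ∈ Q.symIdeal := by
  have key : ∀ N, ρ.proj N b ∈ Q.grC (i + 1) ∧ Q.dC (ρ.proj N b) ∈ Q.symIdeal ∧
      ∃ c ∈ Q.grC i, b - ρ.proj N b - Q.dC c ∈ Q.symIdeal := by
    intro N
    induction N with
    | zero => exact ⟨hb, hdb, 0, zero_mem _, by simp [proj]⟩
    | succ N ih =>
      obtain ⟨h1, h2, c, hc, h3⟩ := ih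
      -- One more factor `1 - E / (N + 1)` changes a cocycle modulo the ideal by a coboundary, because
      -- `E = d D + D d`.
      have hE : ∀ y ∈ Q.symIdeal, ρ.E y ∈ Q.symIdeal := fun y hy =>
        add_mem (dC_mem_symIdeal (ρ.D_mem_symIdeal hy)) (ρ.D_mem_symIdeal (dC_mem_symIdeal hy))
      refine ⟨?_, ?_, c + ((N : ℂ) + 1)⁻¹ • ρ.D (ρ.proj N b), ?_, ?_⟩
      · rw [proj_succ]
        exact sub_mem h1 (Submodule.smul_mem _ _ (ρ.E_mem h1))
      · rw [proj_succ, map_sub, map_smul, dC_E]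
        exact sub_mem h2 (Submodule.smul_mem _ _ (hE _ h2))
      · refine add_mem hc (Submodule.smul_mem _ _ ?_)
        have := ρ.D_mem h1
        rwa [add_sub_cancel_right] at this
      · have h4 := Submodule.smul_mem _ ((N : ℂ) + 1)⁻¹ (ρ.D_mem_symIdeal h2)
        convert add_mem h3 h4 using 1
        rw [proj_succ, E_apply, map_add, map_smul]
        module
  obtain ⟨n, hn⟩ := ρ.eventually_proj_eq b
  rw [← hn n le_rfl]
  exact (key n).2.2

/-- The endomorphism `e` factors through the source of `f`. -/
theorem e_eq (b : Q.TC) : ρ.e b = f.mapTC.map (liftC (P.ιC.comp ρ.r) b) := by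
  let F : P.TC →ₐ[ℂ] Q.TC := f.mapTC.map
  have h : ρ.e = F.comp (liftC (P.ιC.comp ρ.r)) := by
    refine tc_algHom_ext fun i v _ => ?_
    rw [AlgHom.comp_apply, liftC_ιC]
    exact (liftC_ιC _ v).trans (f.mapTC_ιC _).symm
  exact congrArg (fun g => g b) h

theorem liftC_r_mapTC (a : P.TC) : liftC (P.ιC.comp ρ.r) (f.mapTC.map a) = a := by
  let F : P.TC →ₐ[ℂ] Q.TC := f.mapTC.map
  have h : (liftC (P.ιC.comp ρ.r)).comp F = AlgHom.id ℂ P.TC := by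
    refine tc_algHom_ext fun i v _ => ?_
    have e1 : F (P.ιC v) = Q.ιC (f.map v) := f.mapTC_ιC v
    rw [AlgHom.comp_apply, e1, liftC_ιC]
    exact congrArg P.ιC (ρ.r_map v)
  exact congrArg (fun g => g a) h

end Retraction

end PairedComplex

end

section

/-- An elementwise criterion for quasi-isomorphisms between quotients. -/
theorem DGStarAlg.quasiIso_quotMap {B C : DGStarAlg.{u}} (f : Hom B C) {J : Ideal B.A}
    (hJ : B.IsDGIdeal J) {K : Ideal C.A} (hK : C.IsDGIdeal K) (h : ∀ a ∈ J, f.map a ∈ K)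
    (hS : ∀ i, ∀ b ∈ C.gr (i + 1), C.d b ∈ K →
      ∃ a ∈ B.gr (i + 1), B.d a ∈ J ∧ ∃ c ∈ C.gr i, b - f.map a - C.d c ∈ K)
    (hI : ∀ i, ∀ a ∈ B.gr (i + 1), ∀ c ∈ C.gr i, f.map a - C.d c ∈ K →
      ∃ a' ∈ B.gr i, a - B.d a' ∈ J) : QuasiIso (quotMap f hJ hK h).toComplex := by
  have := hJ.isTwoSided
  have := hK.isTwoSided
  refine quasiIso_toComplex _ ?_ ?_
  · rintro i _ ⟨b, hb, rfl⟩ hdb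
    obtain ⟨a, ha, hda, c, hc, e⟩ := hS i b hb (Ideal.Quotient.eq_zero_iff_mem.mp hdb)
    refine ⟨Ideal.Quotient.mk J a, mk_mem_grQuot ha, Ideal.Quotient.eq_zero_iff_mem.mpr hda,
      Ideal.Quotient.mk K c, mk_mem_grQuot hc, ?_⟩
    change Ideal.Quotient.mk K b = Ideal.Quotient.mk K (f.map a) + Ideal.Quotient.mk K (C.d c)
    rw [← map_add, Ideal.Quotient.eq, ← sub_sub]
    exact e
  · rintro i _ ⟨a, ha, rfl⟩ _ _ ⟨c, hc, rfl⟩ e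
    obtain ⟨a', ha', e'⟩ := hI i a ha c hc (Ideal.Quotient.eq.mp e)
    exact ⟨Ideal.Quotient.mk J a', mk_mem_grQuot ha', Ideal.Quotient.eq.mpr e'⟩

theorem DGStarAlg.quot_commute {B : DGStarAlg.{u}} {J : Ideal B.A} (hJ : B.IsDGIdeal J) {n : ℤ}
    {x y : B.A} (h : x * y - n • (y * x) ∈ J) :
    have := hJ.isTwoSided
    let π : B.A → (B.quot J hJ).A := Ideal.Quotient.mk J
    π x * π y = n • (π y * π x) := by
  have := hJ.isTwoSided
  have h1 := Ideal.Quotient.eq.mpr h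
  rw [map_zsmul, map_mul, map_mul] at h1
  exact h1

namespace PairedComplex

variable {P Q : PairedComplex.{u}}

theorem changeTau_mem_symIdeal (hP : P.IsPoisson) {x : P.TC} (hx : x ∈ ccrIdeal P.τ) :
    changeTau hP (Complex.I / 2) x ∈ P.symIdeal := by
  have := changeTau_mem_ccrIdeal hP (Complex.I / 2) (a := 1) (b := 0) (by push_cast; ring) (x := x)
    (by simpa using hx)
  simpa using this

theorem changeTau_mem_ccrIdeal_τ (hP : P.IsPoisson) {x : P.TC} (hx : x ∈ P.symIdeal) :
    changeTau hP (-(Complex.I / 2)) x ∈ ccrIdeal P.τ := by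
  have := changeTau_mem_ccrIdeal hP (-(Complex.I / 2)) (a := 0) (b := 1) (by push_cast; ring) (x := x)
    (by simpa using hx)
  simpa using this

/-- The homomorphism of tensor algebras which underlies `Hom.mapTC`. -/
def Hom.mapAlg (f : Hom P Q) : P.TC →ₐ[ℂ] Q.TC := f.mapTC.map

theorem Hom.mapAlg_ιC (f : Hom P Q) (v : P.V) : f.mapAlg (P.ιC v) = Q.ιC (f.map v) := f.mapTC_ιC v

section Transfer

variable (hP : P.IsPoisson) (hQ : Q.IsPoisson) {f : Hom P Q} (ρ : Retraction f)

theorem changeTau_inv (x : P.TC) :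
    changeTau hP (-(Complex.I / 2)) (changeTau hP (Complex.I / 2) x) = x :=
  changeTau_neg_changeTau hP _ x

theorem mapAlg_changeTau (z : ℂ) (x : P.TC) :
    f.mapAlg (changeTau hP z x) = changeTau hQ z (f.mapAlg x) := mapTC_changeTau hP z hQ f x

include hP hQ ρ in
/-- Surjectivity in cohomology: the statement is transported by the comparison map to the
graded-symmetric algebra, where it is `Retraction.exists_homologous`. -/
theorem exists_homologous_ccr {i : ℤ} {b : Q.TC} (hb : b ∈ Q.grC (i + 1))
    (hdb : Q.dC b ∈ ccrIdeal Q.τ) :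
    ∃ a ∈ P.grC (i + 1), P.dC a ∈ ccrIdeal P.τ ∧
      ∃ c ∈ Q.grC i, b - f.mapAlg a - Q.dC c ∈ ccrIdeal Q.τ := by
  set b' := changeTau hQ (Complex.I / 2) b with hb'
  have h1 : Q.dC b' ∈ Q.symIdeal := by
    rw [hb', ← changeTau_dC]
    exact changeTau_mem_symIdeal hQ hdb
  obtain ⟨c, hc, h2⟩ := ρ.exists_homologous (changeTau_mem hQ _ hb) h1
  refine ⟨changeTau hP (-(Complex.I / 2)) (liftC (P.ιC.comp ρ.r) b'),
    changeTau_mem hP _ (liftC_mem ρ.r_mem (changeTau_mem hQ _ hb)), ?_,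
    changeTau hQ (-(Complex.I / 2)) c, changeTau_mem hQ _ hc, ?_⟩
  · rw [← changeTau_dC, ← liftC_dC ρ.r_mem ρ.r_d]
    exact changeTau_mem_ccrIdeal_τ hP (liftC_mem_symIdeal ρ.r_mem h1)
  · have h3 := changeTau_mem_ccrIdeal_τ hQ h2
    have h4 : ρ.e b' = f.mapAlg (liftC (P.ιC.comp ρ.r) b') := ρ.e_eq b'
    rw [h4, map_sub, map_sub, changeTau_inv, changeTau_dC, ← mapAlg_changeTau hP] at h3
    exact h3

include hP hQ ρ in
/-- Injectivity in cohomology: in the graded-symmetric algebra, a primitive is obtained by applying the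
retraction. -/
theorem exists_primitive_ccr {i : ℤ} {a : P.TC} {c : Q.TC} (hc : c ∈ Q.grC i)
    (hac : f.mapAlg a - Q.dC c ∈ ccrIdeal Q.τ) :
    ∃ a' ∈ P.grC i, a - P.dC a' ∈ ccrIdeal P.τ := by
  refine ⟨changeTau hP (-(Complex.I / 2)) (liftC (P.ιC.comp ρ.r) (changeTau hQ (Complex.I / 2) c)),
    changeTau_mem hP _ (liftC_mem ρ.r_mem (changeTau_mem hQ _ hc)), ?_⟩
  have h2 := changeTau_mem_symIdeal hQ hac
  rw [map_sub, ← mapAlg_changeTau hP, changeTau_dC] at h2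
  have h3 := liftC_mem_symIdeal ρ.r_mem h2
  have h5 : ∀ a, liftC (P.ιC.comp ρ.r) (f.mapAlg a) = a := ρ.liftC_r_mapTC
  rw [map_sub (liftC (P.ιC.comp ρ.r)), h5, liftC_dC ρ.r_mem ρ.r_d] at h3
  have h4 := changeTau_mem_ccrIdeal_τ hP h3
  rw [map_sub, changeTau_inv, changeTau_dC] at h4
  exact h4

/-- The algebra of canonical commutation relations sends morphisms of Poisson complexes which admit
a retraction up to homotopy to quasi-isomorphisms. -/
theorem quasiIso_mapCCR (hP : P.IsPoisson) (hQ : Q.IsPoisson) {f : Hom P Q} (ρ : Retraction f) :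
    QuasiIso f.mapCCR.toComplex := by
  refine DGStarAlg.quasiIso_quotMap _ _ _ _ ?_ ?_
  · intro i b hb hdb
    obtain ⟨a, ha, h1, c, hc, h2⟩ :=
      exists_homologous_ccr hP hQ ρ hb ((mem_dgSpan_iff hQ _).mp hdb)
    exact ⟨a, ha, (mem_dgSpan_iff hP _).mpr h1, c, hc, (mem_dgSpan_iff hQ _).mpr h2⟩
  · intro i a _ c hc hac
    obtain ⟨a', ha', h⟩ := exists_primitive_ccr hP hQ ρ hc ((mem_dgSpan_iff hQ _).mp hac)
    exact ⟨a', ha', (mem_dgSpan_iff hP _).mpr h⟩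

end Transfer

/-! ### Graded commutativity of observables with vanishing pairing -/

theorem commutator_mul_mem {τ : P.V → P.V → ℝ} {i j k : ℤ} {x y z : P.TC}
    (h1 : x * y - csgn (i * j) • (y * x) ∈ ccrIdeal τ)
    (h2 : x * z - csgn (i * k) • (z * x) ∈ ccrIdeal τ) :
    x * (y * z) - csgn (i * (j + k)) • (y * z * x) ∈ ccrIdeal τ := by
  have e : x * (y * z) - csgn (i * (j + k)) • (y * z * x) =
      (x * y - csgn (i * j) • (y * x)) * z +
        csgn (i * j) • (y * (x * z - csgn (i * k) • (z * x))) := by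
    rw [mul_add, csgn_add, sub_mul, mul_sub, smul_mul_assoc, mul_smul_comm, mul_assoc, mul_assoc,
      mul_assoc]
    module
  rw [e]
  exact add_mem (mul_mem_ccrIdeal_right h1 _) (Submodule.smul_mem _ _ (mul_mem_ccrIdeal_left _ h2))

theorem commutator_symm {τ : P.V → P.V → ℝ} {i j : ℤ} {x y : P.TC}
    (h : x * y - csgn (i * j) • (y * x) ∈ ccrIdeal τ) :
    y * x - csgn (j * i) • (x * y) ∈ ccrIdeal τ := by
  have h1 := csgn_mul_self (i * j)
  have e : y * x - csgn (j * i) • (x * y) =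
      (-csgn (i * j)) • (x * y - csgn (i * j) • (y * x)) := by
    rw [mul_comm j i]
    linear_combination (norm := module) -h1 • (y * x)
  rw [e]
  exact Submodule.smul_mem _ _ h

/-- A generator commutes with the image of an algebra with which its pairing vanishes. -/
theorem ιC_commutator_mem {f : Hom Q P} {i : ℤ} {v : P.V} (hv : v ∈ P.gr i)
    (h : ∀ w, P.τ v (f.map w) = 0) {j : ℤ} {y : Q.TC} (hy : y ∈ Q.grC j) :
    P.ιC v * f.mapAlg y - csgn (i * j) • (f.mapAlg y * P.ιC v) ∈ ccrIdeal P.τ := by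
  set F := f.mapAlg with hF
  refine grC_induction (p := fun j y _ => P.ιC v * F y - csgn (i * j) • (F y * P.ιC v) ∈
    ccrIdeal P.τ) ?_ ?_ ?_ ?_ ?_ hy
  · rw [map_one F, mul_zero, csgn_eq_one_of_even ⟨0, by ring⟩, one_smul, mul_one, one_mul, sub_self]
    exact zero_mem _
  · intro j k w hw x _ hx
    rw [map_mul F]
    refine commutator_mul_mem ?_ hx
    have := rel_mem (τ := P.τ) hv (f.map_mem _ _ hw)
    rw [rel, h w, sgn_smul] at this
    rw [hF, f.mapAlg_ιC]
    simpa using this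
  · intro j
    rw [map_zero F, mul_zero, zero_mul, smul_zero, sub_self]
    exact zero_mem _
  · intro j x y _ _ h1 h2
    rw [map_add F, mul_add, add_mul, smul_add, add_sub_add_comm]
    exact add_mem h1 h2
  · intro j c x _ h
    rw [map_smul F, mul_smul_comm, smul_mul_assoc, smul_comm, ← smul_sub]
    exact Submodule.smul_mem _ _ h

/-- Graded commutators of elements generated by observables with vanishing pairing lie in the ideal of
commutation relations. -/
theorem mapAlg_commutator_mem {P₁ P₂ : PairedComplex.{u}} {f₁ : Hom P₁ P} {f₂ : Hom P₂ P}
    (h : ∀ v w, P.τ (f₁.map v) (f₂.map w) = 0) {i j : ℤ} {x : P₁.TC} (hx : x ∈ P₁.grC i)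
    {y : P₂.TC} (hy : y ∈ P₂.grC j) :
    f₂.mapAlg y * f₁.mapAlg x - csgn (j * i) • (f₁.mapAlg x * f₂.mapAlg y) ∈
      ccrIdeal P.τ := by
  set F := f₁.mapAlg with hF
  set G := f₂.mapAlg with hG
  refine grC_induction (p := fun i x _ => G y * F x - csgn (j * i) • (F x * G y) ∈
    ccrIdeal P.τ) ?_ ?_ ?_ ?_ ?_ hx
  · rw [map_one F, mul_zero, csgn_eq_one_of_even ⟨0, by ring⟩, one_smul, mul_one, one_mul, sub_self]
    exact zero_mem _
  · intro i k v hv x _ hx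
    rw [map_mul F]
    refine commutator_mul_mem ?_ hx
    rw [hF, f₁.mapAlg_ιC]
    exact commutator_symm (ιC_commutator_mem (f₁.map_mem _ _ hv) (h v) hy)
  · intro j
    rw [map_zero F, mul_zero, zero_mul, smul_zero, sub_self]
    exact zero_mem _
  · intro j x y _ _ h1 h2
    rw [map_add F, mul_add, add_mul, smul_add, add_sub_add_comm]
    exact add_mem h1 h2
  · intro j c x _ h
    rw [map_smul F, mul_smul_comm, smul_mul_assoc, smul_comm, ← smul_sub]
    exact Submodule.smul_mem _ _ h

/-- Algebras generated by observables with vanishing pairing commute in the graded sense. -/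
theorem mapCCR_commute (hP : P.IsPoisson) {P₁ P₂ : PairedComplex.{u}} (f₁ : Hom P₁ P)
    (f₂ : Hom P₂ P) (h : ∀ v w, P.τ (f₁.map v) (f₂.map w) = 0) (i j : ℤ) :
    ∀ a ∈ P₁.ccrAlg.gr i, ∀ b ∈ P₂.ccrAlg.gr j,
      f₁.mapCCR.map a * f₂.mapCCR.map b = sgn (i * j) • (f₂.mapCCR.map b * f₁.mapCCR.map a) := by
  rintro _ ⟨a, ha, rfl⟩ _ ⟨b, hb, rfl⟩
  refine DGStarAlg.quot_commute (P.tensorDG.isDGIdeal_dgSpan P.ccrRel) ((mem_dgSpan_iff hP _).mpr ?_)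
  have := commutator_symm (mapAlg_commutator_mem h ha hb)
  rw [← sgn_smul] at this
  exact this

end PairedComplex

end

/-! ### Integrals depending on a parameter -/

section

section ParametricIntegral

/-- Differentiation under the integral sign, for a parameter in a convex set. -/
theorem hasFDerivWithinAt_intervalIntegral {E : Type*} [NormedAddCommGroup E] [NormedSpace ℝ E]
    {G : Type*} [NormedAddCommGroup G] [NormedSpace ℝ G] [CompleteSpace G]
    {S : Set E} (hS : Convex ℝ S) {y : E} (hy : y ∈ S)
    {f : ℝ → E → G} {f' : ℝ → E → E →L[ℝ] G} {a b : ℝ}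
    (hf : ∀ z ∈ S, ContinuousOn (fun s => f s z) (uIcc a b))
    (hf' : ContinuousOn (fun q : E × ℝ => f' q.2 q.1) (S ×ˢ uIcc a b))
    (hd : ∀ s ∈ uIcc a b, ∀ z ∈ S, HasFDerivWithinAt (f s) (f' s z) S z) :
    HasFDerivWithinAt (fun z => ∫ s in a..b, f s z) (∫ s in a..b, f' s y) S y := by
  refine HasFDerivWithinAt.of_isLittleO (Asymptotics.isLittleO_iff.mpr fun c hc => ?_)
  set δ := c / (|b - a| + 1) with hδ
  have hδ0 : 0 < δ := by positivity
  obtain ⟨v, hv, hv'⟩ := IsCompact.mem_uniformity_of_prod (f := fun z s => f' s z) isCompact_uIcc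
    hf' hy (Metric.dist_mem_uniformity hδ0)
  obtain ⟨r, hr, hrv⟩ := Metric.mem_nhdsWithin_iff.mp hv
  have hf'y : ContinuousOn (fun s => f' s y) (uIcc a b) :=
    hf'.comp (by fun_prop) fun s hs => (⟨hy, hs⟩ : (y, s) ∈ S ×ˢ uIcc a b)
  filter_upwards [inter_mem_nhdsWithin S (Metric.ball_mem_nhds y hr)] with z hz
  have hmv : ∀ s ∈ uIcc a b, ‖f s z - f s y - f' s y (z - y)‖ ≤ δ * ‖z - y‖ := by
    intro s hs
    refine (hS.inter (convex_ball y r)).norm_image_sub_le_of_norm_hasFDerivWithin_le'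
      (f' := f' s) (fun x hx => (hd s hs x hx.1).mono inter_subset_left) (fun x hx => ?_)
      ⟨hy, Metric.mem_ball_self hr⟩ hz
    rw [← dist_eq_norm]
    exact (hv' x (hrv ⟨hx.2, hx.1⟩) s hs).le
  have e : (∫ s in a..b, f s z) - (∫ s in a..b, f s y) - (∫ s in a..b, f' s y) (z - y) =
      ∫ s in a..b, (f s z - f s y - f' s y (z - y)) := by
    have i1 : IntervalIntegrable (fun s => f s z) volume a b := (hf z hz.1).intervalIntegrable
    have i2 : IntervalIntegrable (fun s => f s y) volume a b := (hf y hy).intervalIntegrable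
    have i3 : IntervalIntegrable (fun s => f' s y (z - y)) volume a b :=
      (hf'y.clm_apply continuousOn_const).intervalIntegrable
    rw [intervalIntegral.integral_sub (i1.sub i2) i3, intervalIntegral.integral_sub i1 i2]
    congr 1
    exact (ContinuousLinearMap.intervalIntegral_apply hf'y.intervalIntegrable _)
  rw [e]
  refine (intervalIntegral.norm_integral_le_of_norm_le_const fun s hs =>
    hmv s (uIoc_subset_uIcc hs)).trans ?_
  have h1 : δ * |b - a| ≤ c := by
    rw [hδ, div_mul_eq_mul_div, div_le_iff₀ (by positivity)]
    nlinarith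
  calc δ * ‖z - y‖ * |b - a| = δ * |b - a| * ‖z - y‖ := by ring
    _ ≤ c * ‖z - y‖ := by gcongr

/-- Differentiation under the integral sign for parameters in a relatively open subset `T` of a convex
set `R`. -/
theorem hasFDerivWithinAt_intervalIntegral_of_contDiffOn {E : Type*} [NormedAddCommGroup E]
    [NormedSpace ℝ E] {R T : Set E} (hR : Convex ℝ R) (hTR : T ⊆ R) (hTn : ∀ y ∈ T, T ∈ 𝓝[R] y)
    (hT : UniqueDiffOn ℝ T) (a b : ℝ) {G : Type*} [NormedAddCommGroup G] [NormedSpace ℝ G]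
    [CompleteSpace G] {f : ℝ × E → G} (hf : ContDiffOn ℝ 1 f (univ ×ˢ T)) {y : E} (hy : y ∈ T) :
    HasFDerivWithinAt (fun y => ∫ s in a..b, f (s, y))
      (∫ s in a..b, (fderivWithin ℝ f (univ ×ˢ T) (s, y)).comp (.inr ℝ ℝ E)) T y := by
  have hU : UniqueDiffOn ℝ ((univ : Set ℝ) ×ˢ T) := uniqueDiffOn_univ.prod hT
  obtain ⟨r, hr, hrT⟩ := Metric.mem_nhdsWithin_iff.mp (hTn y hy)
  have hST : R ∩ Metric.ball y r ⊆ T := fun z hz => hrT ⟨hz.2, hz.1⟩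
  have hyS : y ∈ R ∩ Metric.ball y r := ⟨hTR hy, Metric.mem_ball_self hr⟩
  have hcd := hf.continuousOn_fderivWithin hU le_rfl
  have := hasFDerivWithinAt_intervalIntegral (f := fun s y => f (s, y))
    (f' := fun s y => (fderivWithin ℝ f (univ ×ˢ T) (s, y)).comp (.inr ℝ ℝ E)) (a := a) (b := b)
    (hR.inter (convex_ball y r)) hyS ?_ ?_ ?_
  · exact this.mono_of_mem_nhdsWithin
      (nhdsWithin_mono y hTR (inter_mem_nhdsWithin R (Metric.ball_mem_nhds y hr)))
  · exact fun z hz => hf.continuousOn.comp (by fun_prop) fun s _ => ⟨mem_univ _, hST hz⟩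
  · exact (hcd.comp (by fun_prop : Continuous fun q : E × ℝ => (q.2, q.1)).continuousOn
      fun q hq => ⟨mem_univ _, hST hq.1⟩).clm_comp continuousOn_const
  · intro s _ z hz
    have h1 : HasFDerivWithinAt (fun w : E => (s, w)) (.inr ℝ ℝ E) (R ∩ Metric.ball y r) z :=
      (hasFDerivAt_prodMk_right s z).hasFDerivWithinAt
    exact ((hf.differentiableOn one_ne_zero (s, z) ⟨mem_univ _, hST hz⟩).hasFDerivWithinAt).comp z
      h1 fun w hw => ⟨mem_univ _, hST hw⟩

/-- Integrals of smooth functions over a bounded interval depend smoothly on parameters in a relatively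
open subset `T` of a convex set `R`, such as a half space. -/
theorem contDiffOn_intervalIntegral {E : Type v} [NormedAddCommGroup E] [NormedSpace ℝ E]
    {R T : Set E} (hR : Convex ℝ R) (hTR : T ⊆ R) (hTn : ∀ y ∈ T, T ∈ 𝓝[R] y)
    (hT : UniqueDiffOn ℝ T) (a b : ℝ) {G : Type v} [NormedAddCommGroup G] [NormedSpace ℝ G]
    [CompleteSpace G] {f : ℝ × E → G} (hf : ContDiffOn ℝ ∞ f (univ ×ˢ T)) :
    ContDiffOn ℝ ∞ (fun y => ∫ s in a..b, f (s, y)) T := by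
  have hU : UniqueDiffOn ℝ ((univ : Set ℝ) ×ˢ T) := uniqueDiffOn_univ.prod hT
  have main : ∀ n : ℕ, ∀ {G : Type v} [NormedAddCommGroup G] [NormedSpace ℝ G] [CompleteSpace G]
      {f : ℝ × E → G}, ContDiffOn ℝ ∞ f (univ ×ˢ T) →
      ContDiffOn ℝ n (fun y => ∫ s in a..b, f (s, y)) T := by
    intro n
    induction n with
    | zero =>
      intro G _ _ _ f hf
      refine contDiffOn_zero.mpr fun y hy => ?_
      exact (hasFDerivWithinAt_intervalIntegral_of_contDiffOn hR hTR hTn hT a b (hf.of_le (by simp))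
        hy).continuousWithinAt
    | succ n ih =>
      intro G _ _ _ f hf
      -- the derivative in the parameter is again an integral of the same kind
      have hk := fun y hy => hasFDerivWithinAt_intervalIntegral_of_contDiffOn hR hTR hTn hT a b
        (hf.of_le (by simp)) (y := y) hy
      rw [show ((n + 1 : ℕ) : WithTop ℕ∞) = n + 1 by simp, contDiffOn_succ_iff_fderivWithin hT]
      refine ⟨fun y hy => (hk y hy).differentiableWithinAt, fun h => by simp at h, ?_⟩
      refine (ih (f := fun q => (fderivWithin ℝ f (univ ×ˢ T) q).comp (.inr ℝ ℝ E)) ?_).congr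
        fun y hy => (hk y hy).fderivWithin (hT y hy)
      exact (hf.fderivWithin hU (by simp)).clm_comp contDiffOn_const
  exact contDiffOn_infty.mpr fun n => main n hf

end ParametricIntegral

/-! ### Smoothness of pullbacks of alternating maps -/

section Pullback

variable {F E : Type*} [NormedAddCommGroup F] [NormedSpace ℝ F] [NormedAddCommGroup E]
  [NormedSpace ℝ E]

/-- The pullback of an alternating map along a linear map depends smoothly on both. -/
theorem contDiff_compContinuousLinearMap (n : ℕ) : ContDiff ℝ ∞
    fun q : (E [⋀^Fin n]→L[ℝ] ℝ) × (F →L[ℝ] E) => q.1.compContinuousLinearMap q.2 := by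
  -- alternatization is a left inverse (up to `n!`) of the inclusion into multilinear maps
  let A : ContinuousMultilinearMap ℝ (fun _ : Fin n => F) ℝ →L[ℝ] F [⋀^Fin n]→L[ℝ] ℝ :=
    LinearMap.mkContinuous
      { toFun f := ContinuousMultilinearMap.alternatization f
        map_add' f g := map_add _ f g
        map_smul' c f := by
          ext v
          simp [ContinuousMultilinearMap.alternatization_apply_apply, Finset.mul_sum,
            mul_smul_comm] } (n.factorial : ℝ) (fun f => by
      refine ContinuousAlternatingMap.opNorm_le_bound _ (by positivity) fun v => ?_
      change ‖ContinuousMultilinearMap.alternatization f v‖ ≤ _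
      rw [ContinuousMultilinearMap.alternatization_apply_apply]
      refine (norm_sum_le _ _).trans ?_
      have h : ∀ σ ∈ (Finset.univ : Finset (Equiv.Perm (Fin n))),
          ‖Equiv.Perm.sign σ • f (v ∘ σ)‖ ≤ ‖f‖ * ∏ i, ‖v i‖ := fun σ _ => by
        have h1 : ‖Equiv.Perm.sign σ • f (v ∘ σ)‖ = ‖f (v ∘ σ)‖ := by
          rcases Int.units_eq_one_or (Equiv.Perm.sign σ) with h | h <;> simp [h]
        rw [h1, ← Equiv.prod_comp σ fun i => ‖v i‖]
        exact f.le_opNorm _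
      refine (Finset.sum_le_card_nsmul _ _ _ h).trans_eq ?_
      rw [Finset.card_univ, Fintype.card_perm, Fintype.card_fin, nsmul_eq_mul, mul_assoc])
  have hA : ∀ g : F [⋀^Fin n]→L[ℝ] ℝ, A g.toContinuousMultilinearMap = (n.factorial : ℝ) • g := by
    intro g
    have h1 := AlternatingMap.coe_alternatization g.toAlternatingMap
    ext v
    have h2 := congrArg (fun f => f v) h1
    simp only [Fintype.card_fin, AlternatingMap.smul_apply, nsmul_eq_mul] at h2
    rw [ContinuousAlternatingMap.smul_apply, smul_eq_mul]
    refine Eq.trans ?_ h2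
    change ContinuousMultilinearMap.alternatization _ v = _
    rw [ContinuousMultilinearMap.alternatization_apply_apply, MultilinearMap.alternatization_apply]
    rfl
  have h1 : ContDiff ℝ ∞ fun q : (E [⋀^Fin n]→L[ℝ] ℝ) × (F →L[ℝ] E) =>
      ContinuousMultilinearMap.compContinuousLinearMapContinuousMultilinear ℝ (fun _ : Fin n => F)
        (fun _ => E) ℝ (fun _ => q.2) q.1.toContinuousMultilinearMap := by
    refine ContDiff.clm_apply ?_ ?_
    · exact (ContinuousMultilinearMap.contDiff _).comp (contDiff_pi.mpr fun _ => contDiff_snd)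
    · exact (ContinuousAlternatingMap.toContinuousMultilinearMapLI (𝕜 := ℝ) (ι := Fin n)
        (E := E) (F := ℝ)).toContinuousLinearMap.contDiff.comp contDiff_fst
  have h2 := (contDiff_const (c := ((n.factorial : ℝ))⁻¹)).smul (A.contDiff.comp h1)
  convert h2 using 2 with q
  have h3 : A (q.1.compContinuousLinearMap q.2).toContinuousMultilinearMap = _ := hA _
  have h4 : (n.factorial : ℝ) ≠ 0 := by exact_mod_cast n.factorial_ne_zero
  change _ = ((n.factorial : ℝ))⁻¹ • A (q.1.compContinuousLinearMap q.2).toContinuousMultilinearMap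
  rw [h3, inv_smul_smul₀ h4]

end Pullback

end

/-! ### Pullback of differential forms along maps from a vector space -/

section

section FormPull

variable {E : Type*} [NormedAddCommGroup E] [NormedSpace ℝ E]
  {H : Type*} [TopologicalSpace H] (I : ModelWithCorners ℝ E H)
  {M : Type*} [TopologicalSpace M] [ChartedSpace H M]
  {F : Type*} [NormedAddCommGroup F] [NormedSpace ℝ F]

/-- The derivative within `S` of a map from a vector space to a manifold. -/
def derivOn (f : F → M) (S : Set F) (z : F) : F →L[ℝ] E := mfderivWithin 𝓘(ℝ, F) I f S z

/-- The pullback of a differential form along a map from a vector space to a manifold; the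
derivative of the map is taken within `S`. -/
def formPull {n : ℕ} (α : M → E [⋀^Fin n]→L[ℝ] ℝ) (f : F → M) (S : Set F) (z : F) :
    F [⋀^Fin n]→L[ℝ] ℝ :=
  (α (f z)).compContinuousLinearMap (derivOn I f S z)

variable {I} {f : F → M} {S T : Set F}

theorem _root_.ContMDiffOn.contDiffWithinAt_extChartAt_comp [IsManifold I ∞ M]
    (hf : ContMDiffOn 𝓘(ℝ, F) I ∞ f T) {z : F} (hTn : T ∈ 𝓝[S] z) (hz : z ∈ T) {x₁ : M}
    (hx₁ : f z ∈ (extChartAt I x₁).source) :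
    ContDiffWithinAt ℝ ∞ (extChartAt I x₁ ∘ f) S z := by
  rw [← contMDiffWithinAt_iff_contDiffWithinAt]
  rw [extChartAt_source] at hx₁
  exact (contMDiffAt_extChartAt' hx₁).comp_contMDiffWithinAt z
    ((hf z hz).mono_of_mem_nhdsWithin hTn)

theorem derivOn_eq [IsManifold I ∞ M] {z : F} (hS : UniqueDiffWithinAt ℝ S z) (hzS : z ∈ S)
    (hf : MDifferentiableWithinAt 𝓘(ℝ, F) I f S z) {x₁ : M}
    (hx₁ : f z ∈ (extChartAt I x₁).source) :
    derivOn I f S z = (coordDeriv I x₁ (extChartAt I x₁ (f z))).comp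
      (fderivWithin ℝ (extChartAt I x₁ ∘ f) S z) := by
  have : IsManifold I 1 M := .of_le (n := ∞) (by simp)
  have h1 : MDifferentiableWithinAt 𝓘(ℝ, F) 𝓘(ℝ, E) (extChartAt I x₁ ∘ f) S z := by
    rw [extChartAt_source] at hx₁
    exact (mdifferentiableAt_extChartAt hx₁).comp_mdifferentiableWithinAt z hf
  have h2 : MDifferentiableWithinAt 𝓘(ℝ, E) I (extChartAt I x₁).symm (range I)
      (extChartAt I x₁ (f z)) :=
    mdifferentiableWithinAt_extChartAt_symm ((extChartAt I x₁).map_source hx₁)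
  have hev : (extChartAt I x₁).symm ∘ (extChartAt I x₁ ∘ f) =ᶠ[𝓝[S] z] f := by
    filter_upwards [hf.continuousWithinAt ((isOpen_extChartAt_source x₁).mem_nhds hx₁)] with w hw
    exact (extChartAt I x₁).left_inv hw
  have h3 := mfderivWithin_comp z (g := (extChartAt I x₁).symm) (f := extChartAt I x₁ ∘ f) h2 h1
    (fun w _ => ⟨_, rfl⟩) hS.uniqueMDiffWithinAt
  rw [derivOn, ← hev.mfderivWithin_eq (hev.self_of_nhdsWithin hzS)]
  refine h3.trans ?_
  rw [mfderivWithin_eq_fderivWithin]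
  rfl

theorem formPull_eq [IsManifold I ∞ M] {n : ℕ} (α : M → E [⋀^Fin n]→L[ℝ] ℝ) {z : F}
    (hS : UniqueDiffWithinAt ℝ S z) (hzS : z ∈ S)
    (hf : MDifferentiableWithinAt 𝓘(ℝ, F) I f S z) {x₁ : M}
    (hx₁ : f z ∈ (extChartAt I x₁).source) :
    formPull I α f S z = (localRep I α x₁ ((extChartAt I x₁ ∘ f) z)).compContinuousLinearMap
      (fderivWithin ℝ (extChartAt I x₁ ∘ f) S z) := by
  rw [formPull, derivOn_eq hS hzS hf hx₁, localRep, Function.comp_apply,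
    (extChartAt I x₁).left_inv hx₁]
  rfl

theorem formPull_eventuallyEq [IsManifold I ∞ M] {n : ℕ} (α : M → E [⋀^Fin n]→L[ℝ] ℝ) {z : F}
    (hS : UniqueDiffOn ℝ S) (hTS : T ⊆ S) (hTn : ∀ w ∈ T, T ∈ 𝓝[S] w)
    (hf : ContMDiffOn 𝓘(ℝ, F) I ∞ f T) (hz : z ∈ T) {x₁ : M}
    (hx₁ : f z ∈ (extChartAt I x₁).source) :
    formPull I α f S =ᶠ[𝓝[S] z] fun w =>
      (localRep I α x₁ ((extChartAt I x₁ ∘ f) w)).compContinuousLinearMap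
        (fderivWithin ℝ (extChartAt I x₁ ∘ f) S w) := by
  have hc : ContinuousWithinAt f S z := ((hf z hz).continuousWithinAt).mono_of_mem_nhdsWithin (hTn z hz)
  filter_upwards [hTn z hz, hc ((isOpen_extChartAt_source x₁).mem_nhds hx₁)] with w hw hw'
  exact formPull_eq α (hS w (hTS hw)) (hTS hw)
    (((hf w hw).mdifferentiableWithinAt (by simp)).mono_of_mem_nhdsWithin (hTn w hw)) hw'

theorem IsSmoothForm.formPull_contDiffWithinAt [IsManifold I ∞ M] {n : ℕ}
    {α : M → E [⋀^Fin n]→L[ℝ] ℝ} (hα : IsSmoothForm I α) {z : F}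
    (hS : UniqueDiffOn ℝ S) (hTS : T ⊆ S) (hTn : ∀ w ∈ T, T ∈ 𝓝[S] w)
    (hf : ContMDiffOn 𝓘(ℝ, F) I ∞ f T) (hz : z ∈ T) :
    ContDiffWithinAt ℝ ∞ (formPull I α f S) S z := by
  have hx₁ := mem_extChartAt_source (I := I) (f z)
  refine ContDiffWithinAt.congr_of_eventuallyEq_of_mem ?_
    (formPull_eventuallyEq α hS hTS hTn hf hz hx₁) (hTS hz)
  have h1 := hf.contDiffWithinAt_extChartAt_comp (hTn z hz) hz hx₁
  have h2 : ContDiffWithinAt ℝ ∞ (fun w => localRep I α (f z) ((extChartAt I (f z) ∘ f) w)) S z :=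
    ContDiffWithinAt.comp (g := localRep I α (f z)) (t := range I) z
      (hα.contDiffWithinAt (mem_extChartAt_target (f z))) h1 fun w _ => ⟨_, rfl⟩
  exact (contDiff_compContinuousLinearMap n).comp_contDiffWithinAt
    (h2.prodMk (h1.fderivWithin_right hS (by simp) (hTS hz)))

theorem IsSmoothForm.formPull_contDiffOn [IsManifold I ∞ M] {n : ℕ}
    {α : M → E [⋀^Fin n]→L[ℝ] ℝ} (hα : IsSmoothForm I α)
    (hS : UniqueDiffOn ℝ S) (hTS : T ⊆ S) (hTn : ∀ w ∈ T, T ∈ 𝓝[S] w)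
    (hf : ContMDiffOn 𝓘(ℝ, F) I ∞ f T) : ContDiffOn ℝ ∞ (formPull I α f S) T :=
  fun _ hz => (hα.formPull_contDiffWithinAt hS hTS hTn hf hz).mono hTS

/-- The exterior derivative commutes with pullbacks. -/
theorem extDerivWithin_formPull [IsManifold I ∞ M] {n : ℕ}
    {α : M → E [⋀^Fin n]→L[ℝ] ℝ} (hα : IsSmoothForm I α) {z : F}
    (hS : UniqueDiffOn ℝ S) (hTS : T ⊆ S) (hTn : ∀ w ∈ T, T ∈ 𝓝[S] w)
    (hf : ContMDiffOn 𝓘(ℝ, F) I ∞ f T) (hz : z ∈ T) (hzc : z ∈ closure (interior S)) :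
    extDerivWithin (formPull I α f S) S z = formPull I (extD I α) f S z := by
  have hx₁ := mem_extChartAt_source (I := I) (f z)
  have h1 := hf.contDiffWithinAt_extChartAt_comp (hTn z hz) hz hx₁
  have hd : DifferentiableWithinAt ℝ (localRep I α (f z)) (range I) ((extChartAt I (f z) ∘ f) z) :=
    (hα.contDiffWithinAt (mem_extChartAt_target (f z))).differentiableWithinAt (by simp)
  rw [(formPull_eventuallyEq α hS hTS hTn hf hz hx₁).extDerivWithin_eq_of_mem (hTS hz),
    extDerivWithin_pullback (r := ∞) (t := range I) hd h1 minSmoothness_two_le_infty hS hzc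
      (hTS hz) (fun w _ => ⟨_, rfl⟩),
    formPull_eq (extD I α) (hS z (hTS hz)) (hTS hz)
      (((hf z hz).mdifferentiableWithinAt (by simp)).mono_of_mem_nhdsWithin (hTn z hz)) hx₁,
    Function.comp_apply, localRep_extD hα (mem_extChartAt_target (f z))]

/-! ### Local properties of differential forms -/

theorem localRep_congr {n : ℕ} {α β : M → E [⋀^Fin n]→L[ℝ] ℝ} {x x₀ : M} (h : α =ᶠ[𝓝 x] β)
    (hx : x ∈ (extChartAt I x₀).source) :
    localRep I α x₀ =ᶠ[𝓝[range I] (extChartAt I x₀ x)] localRep I β x₀ := by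
  have hc : ContinuousAt (extChartAt I x₀).symm (extChartAt I x₀ x) :=
    continuousAt_extChartAt_symm' hx
  rw [ContinuousAt, (extChartAt I x₀).left_inv hx] at hc
  filter_upwards [nhdsWithin_le_nhds (hc.eventually h)] with w hw
  rw [localRep, localRep, hw]

theorem extD_congr {n : ℕ} {α β : M → E [⋀^Fin n]→L[ℝ] ℝ} {x : M} (h : α =ᶠ[𝓝 x] β) :
    extD I α x = extD I β x :=
  (localRep_congr h (mem_extChartAt_source x)).extDerivWithin_eq_of_mem ⟨_, rfl⟩

theorem _root_.Filter.EventuallyEq.extD {n : ℕ} {α β : M → E [⋀^Fin n]→L[ℝ] ℝ} {x : M}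
    (h : α =ᶠ[𝓝 x] β) : CSWZW.extD I α =ᶠ[𝓝 x] CSWZW.extD I β :=
  (eventually_eventually_nhds.mpr h).mono fun _ hx => extD_congr hx

/-- A differential form is smooth if it agrees near each point with a smooth form. -/
theorem isSmoothForm_of_eventuallyEq {n : ℕ} {α : M → E [⋀^Fin n]→L[ℝ] ℝ}
    (h : ∀ x, ∃ β, IsSmoothForm I β ∧ α =ᶠ[𝓝 x] β) : IsSmoothForm I α := by
  intro x₀ y hy
  obtain ⟨β, hβ, he⟩ := h ((extChartAt I x₀).symm y)
  have h1 := localRep_congr he ((extChartAt I x₀).map_target hy)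
  rw [(extChartAt I x₀).right_inv hy] at h1
  exact ((hβ x₀ y hy).congr_of_eventuallyEq_of_mem
    (h1.filter_mono (nhdsWithin_mono y (extChartAt_target_subset_range x₀))) hy)

omit [TopologicalSpace M] in
theorem neg_eq_smul_form {n : ℕ} (α : M → E [⋀^Fin n]→L[ℝ] ℝ) : -α = (-1 : ℝ) • α :=
  funext fun x => (neg_one_smul ℝ (α x)).symm

theorem IsSmoothForm.neg {n : ℕ} {α : M → E [⋀^Fin n]→L[ℝ] ℝ} (hα : IsSmoothForm I α) :
    IsSmoothForm I (-α) := by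
  rw [neg_eq_smul_form]
  exact hα.smul _

theorem extD_neg {n : ℕ} (α : M → E [⋀^Fin n]→L[ℝ] ℝ) : extD I (-α) = -extD I α := by
  rw [neg_eq_smul_form, extD_smul, ← neg_eq_smul_form]

theorem extD_sub {n : ℕ} {α η : M → E [⋀^Fin n]→L[ℝ] ℝ}
    (hα : IsSmoothForm I α) (hη : IsSmoothForm I η) : extD I (α - η) = extD I α - extD I η := by
  rw [sub_eq_add_neg, extD_add hα hη.neg, extD_neg, ← sub_eq_add_neg]

end FormPull

end

section

/-! ### Velocities of curves -/

section FormPull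

variable {E : Type*} [NormedAddCommGroup E] [NormedSpace ℝ E]
  {H : Type*} [TopologicalSpace H] {I : ModelWithCorners ℝ E H}
  {M : Type*} [TopologicalSpace M] [ChartedSpace H M]
  {F F' : Type*} [NormedAddCommGroup F] [NormedSpace ℝ F] [NormedAddCommGroup F'] [NormedSpace ℝ F']

theorem derivOn_comp {f : F → M} {S : Set F} {g : F' → F} {S' : Set F'} {z : F'}
    (hf : MDifferentiableWithinAt 𝓘(ℝ, F) I f S (g z)) (hg : DifferentiableWithinAt ℝ g S' z)
    (hS' : UniqueDiffWithinAt ℝ S' z) (hm : MapsTo g S' S) :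
    derivOn I (f ∘ g) S' z = (derivOn I f S (g z)).comp (fderivWithin ℝ g S' z) := by
  have h := mfderivWithin_comp z hf hg.mdifferentiableWithinAt hm hS'.uniqueMDiffWithinAt
  rw [mfderivWithin_eq_fderivWithin] at h
  exact h

theorem velocity_eq_derivOn (γ : ℝ → M) (s : ℝ) : velocity I γ s = derivOn I γ univ s 1 := by
  rw [derivOn, mfderivWithin_univ]
  rfl

theorem velocity_comp_add {γ : ℝ → M} {s : ℝ} (hγ : MDifferentiableAt 𝓘(ℝ, ℝ) I γ s) :
    velocity I (fun t => γ (t + s)) 0 = velocity I γ s := by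
  have h1 : DifferentiableWithinAt ℝ (fun t : ℝ => t + s) univ 0 := by fun_prop
  have h2 : MDifferentiableWithinAt 𝓘(ℝ, ℝ) I γ univ (0 + s) := by
    rw [zero_add]
    exact hγ.mdifferentiableWithinAt
  have h := derivOn_comp (g := fun t : ℝ => t + s) h2 h1 uniqueDiffWithinAt_univ (mapsTo_univ _ _)
  rw [velocity_eq_derivOn, velocity_eq_derivOn]
  refine (congrArg (fun L : ℝ →L[ℝ] E => L 1) h).trans ?_
  rw [ContinuousLinearMap.comp_apply, fderivWithin_univ, fderiv_add_const, zero_add]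
  simp

/-- The derivative of a map between manifolds, as a map between the model spaces. -/
def mderiv {E' : Type*} [NormedAddCommGroup E'] [NormedSpace ℝ E']
    {H' : Type*} [TopologicalSpace H'] (I : ModelWithCorners ℝ E H) (I' : ModelWithCorners ℝ E' H')
    {M' : Type*} [TopologicalSpace M'] [ChartedSpace H' M'] (f : M → M') (x : M) : E →L[ℝ] E' :=
  mfderiv I I' f x

theorem velocity_comp {E' : Type*} [NormedAddCommGroup E'] [NormedSpace ℝ E']
    {H' : Type*} [TopologicalSpace H'] {I' : ModelWithCorners ℝ E' H'}
    {M' : Type*} [TopologicalSpace M'] [ChartedSpace H' M'] {f : M → M'} {γ : ℝ → M} {s : ℝ}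
    (hf : MDifferentiableAt I I' f (γ s)) (hγ : MDifferentiableAt 𝓘(ℝ, ℝ) I γ s) :
    velocity I' (fun t => f (γ t)) s = mderiv I I' f (γ s) (velocity I γ s) :=
  congrArg (fun L : ℝ →L[ℝ] E' => L 1) (mfderiv_comp s hf hγ)

end FormPull

/-! ### The flow in charts -/

variable {M : Type u} [TopologicalSpace M] [ChartedSpace (EuclideanHalfSpace 3) M]
  {N : Type v} [TopologicalSpace N] [ChartedSpace E2 N] [IsManifold (𝓡 2) ∞ N]
  {X : BulkBoundary M N} {ε : ℤˣ} (F : BulkFlow X ε)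

namespace BulkFlow

/-- The vector field which generates the flow on the bulk. -/
def nu (x : M) : E3 := velocity (𝓡∂ 3) (fun s => F.act s x) 0

/-- The derivative of the flow on the bulk at a fixed time. -/
def dact (s : ℝ) (x : M) : E3 →L[ℝ] E3 := mfderiv (𝓡∂ 3) (𝓡∂ 3) (F.act s) x

theorem act_contMDiff (s : ℝ) : ContMDiff (𝓡∂ 3) (𝓡∂ 3) ∞ (F.act s) :=
  F.act_smooth.comp (contMDiff_const.prodMk contMDiff_id)

theorem act_mdifferentiableAt (s : ℝ) (x : M) :
    MDifferentiableAt (𝓡∂ 3) (𝓡∂ 3) (F.act s) x := (F.act_contMDiff s).mdifferentiableAt (by simp)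

theorem continuous_act : Continuous fun q : ℝ × M => F.act q.1 q.2 := F.act_smooth.continuous

theorem orbit_contMDiff (x : M) : ContMDiff 𝓘(ℝ, ℝ) (𝓡∂ 3) ∞ fun s => F.act s x :=
  F.act_smooth.comp (contMDiff_id.prodMk contMDiff_const)

theorem orbit_mdifferentiableAt (x : M) (s : ℝ) :
    MDifferentiableAt 𝓘(ℝ, ℝ) (𝓡∂ 3) (fun s => F.act s x) s :=
  (F.orbit_contMDiff x).mdifferentiableAt (by simp)

theorem act_neg_act (s : ℝ) (x : M) : F.act (-s) (F.act s x) = x := by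
  rw [← F.act_add, neg_add_cancel, F.act_zero]

theorem act_act_neg (s : ℝ) (x : M) : F.act s (F.act (-s) x) = x := by
  rw [← F.act_add, add_neg_cancel, F.act_zero]

theorem velocity_act (x : M) (s : ℝ) :
    velocity (𝓡∂ 3) (fun s => F.act s x) s = F.nu (F.act s x) := by
  rw [nu, ← velocity_comp_add (F.orbit_mdifferentiableAt x s)]
  simp only [F.act_add]

/-- The flow preserves its generator. -/
theorem dact_nu (s : ℝ) (x : M) : F.dact s x (F.nu x) = F.nu (F.act s x) := by
  have h := velocity_comp (f := F.act s) (γ := fun t => F.act t x) (s := 0)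
    (F.act_mdifferentiableAt s _) (F.orbit_mdifferentiableAt x 0)
  simp only [F.act_zero] at h
  refine Eq.trans (b := velocity (𝓡∂ 3) (fun t => F.act s (F.act t x)) 0) h.symm ?_
  rw [← F.velocity_act, ← velocity_comp_add (F.orbit_mdifferentiableAt x s)]
  congr 1
  funext t
  rw [add_comm, F.act_add]

theorem dact_add (s t : ℝ) (x : M) :
    F.dact (s + t) x = (F.dact s (F.act t x)).comp (F.dact t x) := by
  have h := mfderiv_comp x (F.act_mdifferentiableAt s (F.act t x)) (F.act_mdifferentiableAt t x)
  have e : F.act s ∘ F.act t = F.act (s + t) := funext fun x => (F.act_add s t x).symm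
  rw [e] at h
  exact h

theorem dact_zero (x : M) : F.dact 0 x = ContinuousLinearMap.id ℝ E3 := by
  have e : F.act 0 = id := funext F.act_zero
  rw [dact, e]
  exact mfderiv_id

/-- The pullback of a form along the flow. -/
def actPull (s : ℝ) {n : ℕ} (ψ : M → E3 [⋀^Fin n]→L[ℝ] ℝ) (x : M) : E3 [⋀^Fin n]→L[ℝ] ℝ :=
  (ψ (F.act s x)).compContinuousLinearMap (F.dact s x)

/-- The contraction of a form with the generating vector field. -/
def ctrNu {n : ℕ} (ψ : M → E3 [⋀^Fin (n + 1)]→L[ℝ] ℝ) (x : M) : E3 [⋀^Fin n]→L[ℝ] ℝ :=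
  (ψ x).curryLeft (F.nu x)

theorem actPull_zero {n : ℕ} (ψ : M → E3 [⋀^Fin n]→L[ℝ] ℝ) : F.actPull 0 ψ = ψ := by
  funext x
  rw [actPull, dact_zero, F.act_zero]
  rfl

theorem actPull_actPull (s t : ℝ) {n : ℕ} (ψ : M → E3 [⋀^Fin n]→L[ℝ] ℝ) :
    F.actPull s (F.actPull t ψ) = F.actPull (t + s) ψ := by
  funext x
  rw [actPull, actPull, actPull, dact_add, F.act_add]
  rfl

theorem ctrNu_actPull (s : ℝ) {n : ℕ} (ψ : M → E3 [⋀^Fin (n + 1)]→L[ℝ] ℝ) :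
    F.ctrNu (F.actPull s ψ) = F.actPull s (F.ctrNu ψ) := by
  funext x
  rw [ctrNu, actPull, actPull, ctrNu, ContinuousAlternatingMap.curryLeft_compContinuousLinearMap,
    dact_nu]

theorem fiberInt_eq (S : Set ℝ) {n : ℕ} (ψ : M → E3 [⋀^Fin (n + 1)]→L[ℝ] ℝ) (x : M) :
    F.fiberInt S ψ x = ∫ s in S, F.actPull s (F.ctrNu ψ) x := by
  simp only [fiberInt, velocity_act]
  rfl

/-- The flow, with the chart at `x₀` on its source. -/
def chartMap (x₀ : M) (q : ℝ × E3) : M := F.act q.1 ((extChartAt (𝓡∂ 3) x₀).symm q.2)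

/-- The set on which the expressions of the flow in charts are differentiated. -/
abbrev slab : Set (ℝ × E3) := univ ×ˢ range (𝓡∂ 3)

theorem uniqueDiffOn_slab : UniqueDiffOn ℝ slab := uniqueDiffOn_univ.prod (𝓡∂ 3).uniqueDiffOn

theorem mem_closure_interior_slab {q : ℝ × E3} (h : q ∈ slab) : q ∈ closure (interior slab) := by
  rw [interior_prod_eq, closure_prod_eq, interior_univ, closure_univ]
  exact ⟨mem_univ _, (𝓡∂ 3).range_subset_closure_interior h.2⟩

theorem cyl_target_mem_nhdsWithin (x₀ : M) (q : ℝ × E3)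
    (hq : q ∈ (univ : Set ℝ) ×ˢ (extChartAt (𝓡∂ 3) x₀).target) :
    (univ : Set ℝ) ×ˢ (extChartAt (𝓡∂ 3) x₀).target ∈ 𝓝[slab] q := by
  rw [← Prod.mk.eta (p := q), nhdsWithin_prod_eq]
  exact prod_mem_prod univ_mem (extChartAt_target_mem_nhdsWithin_of_mem hq.2)

theorem cyl_target_subset (x₀ : M) :
    (univ : Set ℝ) ×ˢ (extChartAt (𝓡∂ 3) x₀).target ⊆ slab :=
  prod_mono subset_rfl (extChartAt_target_subset_range x₀)

variable [IsManifold (𝓡∂ 3) ∞ M]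

theorem contMDiffOn_chartMap (x₀ : M) : ContMDiffOn 𝓘(ℝ, ℝ × E3) (𝓡∂ 3) ∞ (F.chartMap x₀)
    (univ ×ˢ (extChartAt (𝓡∂ 3) x₀).target) := by
  have h1 : ContMDiffOn 𝓘(ℝ, ℝ × E3) (𝓡∂ 3) ∞ (fun q => (extChartAt (𝓡∂ 3) x₀).symm q.2)
      ((univ : Set ℝ) ×ˢ (extChartAt (𝓡∂ 3) x₀).target) :=
    (contMDiffOn_extChartAt_symm x₀).comp contDiff_snd.contMDiff.contMDiffOn fun q hq => hq.2
  exact F.act_smooth.comp_contMDiffOn (contDiff_fst.contMDiff.contMDiffOn.prodMk h1)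

theorem chartMap_mdifferentiableWithinAt {x₀ : M} {y : E3} (s : ℝ)
    (hy : y ∈ (extChartAt (𝓡∂ 3) x₀).target) :
    MDifferentiableWithinAt 𝓘(ℝ, ℝ × E3) (𝓡∂ 3) (F.chartMap x₀) slab (s, y) :=
  ((F.contMDiffOn_chartMap x₀ (s, y) ⟨mem_univ _, hy⟩).mdifferentiableWithinAt
    (by simp)).mono_of_mem_nhdsWithin (cyl_target_mem_nhdsWithin x₀ _ ⟨mem_univ _, hy⟩)

theorem derivOn_chartMap_inr {x₀ : M} {y : E3} (s : ℝ) (hy : y ∈ (extChartAt (𝓡∂ 3) x₀).target) :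
    (derivOn (𝓡∂ 3) (F.chartMap x₀) slab (s, y)).comp (.inr ℝ ℝ E3) =
      (F.dact s ((extChartAt (𝓡∂ 3) x₀).symm y)).comp (coordDeriv (𝓡∂ 3) x₀ y) := by
  have hyr : y ∈ range (𝓡∂ 3) := extChartAt_target_subset_range x₀ hy
  have hd : HasFDerivWithinAt (fun w : E3 => (s, w)) (.inr ℝ ℝ E3) (range (𝓡∂ 3)) y :=
    (hasFDerivAt_prodMk_right s y).hasFDerivWithinAt
  have h := derivOn_comp (F.chartMap_mdifferentiableWithinAt s hy) hd.differentiableWithinAt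
    ((𝓡∂ 3).uniqueDiffOn y hyr) (S := slab) fun w hw => ⟨mem_univ _, hw⟩
  rw [hd.fderivWithin ((𝓡∂ 3).uniqueDiffOn y hyr)] at h
  rw [← h]
  have : IsManifold (𝓡∂ 3) 1 M := .of_le (n := ∞) (by simp)
  have h2 := mfderivWithin_comp (g := F.act s) (f := (extChartAt (𝓡∂ 3) x₀).symm)
    (s := range (𝓡∂ 3)) (u := univ) y
    ((F.act_mdifferentiableAt s _).mdifferentiableWithinAt)
    (mdifferentiableWithinAt_extChartAt_symm hy) (mapsTo_univ _ _)
    ((𝓡∂ 3).uniqueDiffOn y hyr).uniqueMDiffWithinAt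
  rw [mfderivWithin_univ] at h2
  exact h2

theorem derivOn_chartMap_inl {x₀ : M} {y : E3} (s : ℝ) (hy : y ∈ (extChartAt (𝓡∂ 3) x₀).target) :
    derivOn (𝓡∂ 3) (F.chartMap x₀) slab (s, y) (1, 0) =
      F.nu (F.act s ((extChartAt (𝓡∂ 3) x₀).symm y)) := by
  have hyr : y ∈ range (𝓡∂ 3) := extChartAt_target_subset_range x₀ hy
  have hd : HasFDerivWithinAt (fun t : ℝ => (t, y)) (.inl ℝ ℝ E3) univ s :=
    (hasFDerivAt_prodMk_left s y).hasFDerivWithinAt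
  have h := derivOn_comp (g := fun t : ℝ => (t, y)) (F.chartMap_mdifferentiableWithinAt s hy)
    hd.differentiableWithinAt uniqueDiffWithinAt_univ (S := slab) fun w _ => ⟨mem_univ _, hyr⟩
  rw [hd.fderivWithin uniqueDiffWithinAt_univ] at h
  have h2 := congrArg (fun L : ℝ →L[ℝ] E3 => L 1) h
  rw [← velocity_act, velocity_eq_derivOn]
  exact h2.symm

/-- The pullback of a form to `ℝ × E3` along the flow. -/
def flowRep {n : ℕ} (ψ : M → E3 [⋀^Fin n]→L[ℝ] ℝ) (x₀ : M) (q : ℝ × E3) :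
    (ℝ × E3) [⋀^Fin n]→L[ℝ] ℝ := formPull (𝓡∂ 3) ψ (F.chartMap x₀) slab q

/-- Restriction of forms on `ℝ × E3` to slices. -/
def restr (n : ℕ) : (ℝ × E3) [⋀^Fin n]→L[ℝ] ℝ →L[ℝ] E3 [⋀^Fin n]→L[ℝ] ℝ :=
  ContinuousAlternatingMap.compContinuousLinearMapCLM (.inr ℝ ℝ E3)

/-- Contraction of forms on `ℝ × E3` with the first unit vector, followed by restriction to
slices. -/
def contract (n : ℕ) : (ℝ × E3) [⋀^Fin (n + 1)]→L[ℝ] ℝ →L[ℝ] E3 [⋀^Fin n]→L[ℝ] ℝ :=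
  restr n ∘L ContinuousLinearMap.apply ℝ _ ((1, 0) : ℝ × E3) ∘L
    (ContinuousAlternatingMap.curryLeftLI (𝕜 := ℝ) (E := ℝ × E3) (F := ℝ) (n := n)).toContinuousLinearMap

theorem restr_apply {n : ℕ} (η : (ℝ × E3) [⋀^Fin n]→L[ℝ] ℝ) :
    restr n η = η.compContinuousLinearMap (.inr ℝ ℝ E3) := rfl

theorem contract_apply {n : ℕ} (η : (ℝ × E3) [⋀^Fin (n + 1)]→L[ℝ] ℝ) :
    contract n η = (η.curryLeft (1, 0)).compContinuousLinearMap (.inr ℝ ℝ E3) := rfl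

theorem localRep_actPull (s : ℝ) {n : ℕ} (ψ : M → E3 [⋀^Fin n]→L[ℝ] ℝ) {x₀ : M} {y : E3}
    (hy : y ∈ (extChartAt (𝓡∂ 3) x₀).target) :
    localRep (𝓡∂ 3) (F.actPull s ψ) x₀ y = restr n (F.flowRep ψ x₀ (s, y)) := by
  ext v
  have h := F.derivOn_chartMap_inr s hy
  rw [restr_apply, flowRep, formPull]
  change _ = (ψ _) (fun i => ((derivOn (𝓡∂ 3) (F.chartMap x₀) slab (s, y)).comp (.inr ℝ ℝ E3)) (v i))
  rw [h]
  rfl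

theorem localRep_actPull_ctrNu (s : ℝ) {n : ℕ} (ψ : M → E3 [⋀^Fin (n + 1)]→L[ℝ] ℝ) {x₀ : M} {y : E3}
    (hy : y ∈ (extChartAt (𝓡∂ 3) x₀).target) :
    localRep (𝓡∂ 3) (F.actPull s (F.ctrNu ψ)) x₀ y = contract n (F.flowRep ψ x₀ (s, y)) := by
  rw [localRep_actPull F s _ hy, contract_apply, restr_apply, flowRep, formPull, flowRep, formPull,
    ContinuousAlternatingMap.curryLeft_compContinuousLinearMap, F.derivOn_chartMap_inl s hy]
  rfl

theorem contDiffOn_flowRep {n : ℕ} {ψ : M → E3 [⋀^Fin n]→L[ℝ] ℝ} (hψ : IsSmoothForm (𝓡∂ 3) ψ)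
    (x₀ : M) : ContDiffOn ℝ ∞ (F.flowRep ψ x₀) (univ ×ˢ (extChartAt (𝓡∂ 3) x₀).target) :=
  hψ.formPull_contDiffOn uniqueDiffOn_slab (cyl_target_subset x₀) (cyl_target_mem_nhdsWithin x₀)
    (F.contMDiffOn_chartMap x₀)

theorem flowRep_extD {n : ℕ} {ψ : M → E3 [⋀^Fin n]→L[ℝ] ℝ} (hψ : IsSmoothForm (𝓡∂ 3) ψ)
    {x₀ : M} {q : ℝ × E3} (hq : q ∈ (univ : Set ℝ) ×ˢ (extChartAt (𝓡∂ 3) x₀).target) :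
    F.flowRep (extD (𝓡∂ 3) ψ) x₀ q = extDerivWithin (F.flowRep ψ x₀) slab q :=
  (extDerivWithin_formPull hψ uniqueDiffOn_slab (cyl_target_subset x₀) (cyl_target_mem_nhdsWithin x₀)
    (F.contMDiffOn_chartMap x₀) hq (mem_closure_interior_slab (cyl_target_subset x₀ hq))).symm

end BulkFlow

end

variable {M : Type u} [TopologicalSpace M] [ChartedSpace (EuclideanHalfSpace 3) M]
  {N : Type v} [TopologicalSpace N] [ChartedSpace E2 N] [IsManifold (𝓡 2) ∞ N]
  {X : BulkBoundary M N} {ε : ℤˣ} (F : BulkFlow X ε)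

section

namespace BulkFlow

/-! ### The Cartan formula -/

theorem _root_.LinearMap.map_intervalIntegral {F G : Type*} [NormedAddCommGroup F] [NormedSpace ℝ F]
    [NormedAddCommGroup G] [NormedSpace ℝ G] [CompleteSpace F] [CompleteSpace G]
    (A : F →ₗ[ℝ] G) (hA : Continuous A) {f : ℝ → F} (hf : Continuous f) (a b : ℝ) :
    A (∫ s in a..b, f s) = ∫ s in a..b, A (f s) :=
  ((⟨A, hA⟩ : F →L[ℝ] G).intervalIntegral_comp_comm (hf.intervalIntegrable a b)).symm

theorem alternatizeUncurryFin_intervalIntegral {E : Type*} [NormedAddCommGroup E]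
    [NormedSpace ℝ E] {n : ℕ} {f : ℝ → E →L[ℝ] E [⋀^Fin n]→L[ℝ] ℝ} (hf : Continuous f) (a b : ℝ) :
    ContinuousAlternatingMap.alternatizeUncurryFin (∫ s in a..b, f s) =
      ∫ s in a..b, ContinuousAlternatingMap.alternatizeUncurryFin (f s) :=
  LinearMap.map_intervalIntegral (F := E →L[ℝ] E [⋀^Fin n]→L[ℝ] ℝ) (G := E [⋀^Fin (n + 1)]→L[ℝ] ℝ)
    (ContinuousAlternatingMap.alternatizeUncurryFinCLM ℝ E ℝ).toLinearMap
    (ContinuousAlternatingMap.alternatizeUncurryFinCLM ℝ E ℝ).continuous hf a b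

/-- The Cartan formula for the vector field `(1, 0)` on `ℝ × E3`, in terms of the first derivative
`L` of a form. -/
theorem contract_alternatizeUncurryFin {n : ℕ}
    (L : (ℝ × E3) →L[ℝ] (ℝ × E3) [⋀^Fin (n + 1)]→L[ℝ] ℝ) :
    ContinuousAlternatingMap.alternatizeUncurryFin (contract n ∘L L ∘L .inr ℝ ℝ E3) +
      contract (n + 1) (ContinuousAlternatingMap.alternatizeUncurryFin L) =
        restr (n + 1) (L (1, 0)) := by
  ext v
  have h1 : contract (n + 1) (ContinuousAlternatingMap.alternatizeUncurryFin L) v =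
      ContinuousAlternatingMap.alternatizeUncurryFin L
        (Matrix.vecCons (1, 0) fun i => ((0 : ℝ), v i)) := rfl
  have h2 : restr (n + 1) (L (1, 0)) v = L (1, 0) fun i => ((0 : ℝ), v i) := rfl
  rw [ContinuousAlternatingMap.add_apply, h1, h2,
    ContinuousAlternatingMap.alternatizeUncurryFin_apply,
    ContinuousAlternatingMap.alternatizeUncurryFin_apply, Fin.sum_univ_succ (n := n + 1)]
  have h3 : (0 : Fin (n + 2)).removeNth (Matrix.vecCons ((1 : ℝ), (0 : E3)) fun i => ((0 : ℝ), v i)) =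
      fun i => ((0 : ℝ), v i) := by
    ext i <;> rfl
  have h4 : ∀ i : Fin (n + 1), i.succ.removeNth (Matrix.vecCons ((1 : ℝ), (0 : E3))
      fun i => ((0 : ℝ), v i)) = Matrix.vecCons (1, 0) fun j => ((0 : ℝ), i.removeNth v j) := by
    intro i
    funext j
    refine Fin.cases ?_ (fun j => ?_) j
    · rfl
    · simp [Fin.removeNth, Fin.succ_succAbove_succ]
  have h5 : ∀ i : Fin (n + 1), (contract n ∘L L ∘L .inr ℝ ℝ E3) (v i) (i.removeNth v) =
      L (0, v i) (Matrix.vecCons (1, 0) fun j => ((0 : ℝ), i.removeNth v j)) := fun i => rfl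
  simp only [h3, h4, h5, Fin.val_zero, pow_zero, one_smul, Fin.val_succ, pow_succ]
  simp only [Matrix.cons_val_zero, Matrix.cons_val_succ, mul_neg, mul_one, neg_smul,
    Finset.sum_neg_distrib]
  ring

/-- The Cartan formula for functions. -/
theorem contract_alternatizeUncurryFin_zero (L : (ℝ × E3) →L[ℝ] (ℝ × E3) [⋀^Fin 0]→L[ℝ] ℝ) :
    contract 0 (ContinuousAlternatingMap.alternatizeUncurryFin L) = restr 0 (L (1, 0)) := by
  ext v
  have h1 : contract 0 (ContinuousAlternatingMap.alternatizeUncurryFin L) v =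
      ContinuousAlternatingMap.alternatizeUncurryFin L
        (Matrix.vecCons (1, 0) fun i => ((0 : ℝ), v i)) := rfl
  have h2 : restr 0 (L (1, 0)) v = L (1, 0) fun i => ((0 : ℝ), v i) := rfl
  rw [h1, h2, ContinuousAlternatingMap.alternatizeUncurryFin_apply, Fin.sum_univ_one]
  simp only [Fin.val_zero, pow_zero, one_smul, Matrix.cons_val_zero]
  exact congrArg _ (Subsingleton.elim _ _)

variable [IsManifold (𝓡∂ 3) ∞ M]

/-- The integral of the pullback of a form over a piece of the orbits. -/
def cyl (a b : ℝ) {n : ℕ} (ψ : M → E3 [⋀^Fin (n + 1)]→L[ℝ] ℝ) (x : M) : E3 [⋀^Fin n]→L[ℝ] ℝ :=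
  ∫ s in a..b, F.actPull s (F.ctrNu ψ) x

theorem continuous_actPull {n : ℕ} {ψ : M → E3 [⋀^Fin n]→L[ℝ] ℝ} (hψ : IsSmoothForm (𝓡∂ 3) ψ)
    (x : M) : Continuous fun s => F.actPull s ψ x := by
  have h : ∀ s, F.actPull s ψ x = restr n (F.flowRep ψ x (s, extChartAt (𝓡∂ 3) x x)) := fun s => by
    rw [← localRep_self (I := 𝓡∂ 3) (F.actPull s ψ) x, localRep_actPull F s _ (mem_extChartAt_target x)]
  simp only [h]
  exact (restr n).continuous.comp ((F.contDiffOn_flowRep hψ x).continuousOn.comp_continuous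
    (by fun_prop) fun s => ⟨mem_univ _, mem_extChartAt_target x⟩)

theorem continuous_actPull_ctrNu {n : ℕ} {ψ : M → E3 [⋀^Fin (n + 1)]→L[ℝ] ℝ}
    (hψ : IsSmoothForm (𝓡∂ 3) ψ) (x : M) : Continuous fun s => F.actPull s (F.ctrNu ψ) x := by
  have h := F.continuous_actPull hψ x
  have e : ∀ s, F.actPull s (F.ctrNu ψ) x = ContinuousLinearMap.apply ℝ _ (F.nu x)
      ((ContinuousAlternatingMap.curryLeftLI (𝕜 := ℝ) (E := E3) (F := ℝ)
        (n := n)).toContinuousLinearMap (F.actPull s ψ x)) := fun s => by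
    rw [← ctrNu_actPull]
    rfl
  simp only [e]
  fun_prop

theorem localRep_cyl (a b : ℝ) {n : ℕ} {ψ : M → E3 [⋀^Fin (n + 1)]→L[ℝ] ℝ}
    (hψ : IsSmoothForm (𝓡∂ 3) ψ) {x₀ : M} {y : E3} (hy : y ∈ (extChartAt (𝓡∂ 3) x₀).target) :
    localRep (𝓡∂ 3) (F.cyl a b ψ) x₀ y = ∫ s in a..b, contract n (F.flowRep ψ x₀ (s, y)) := by
  simp only [← F.localRep_actPull_ctrNu _ ψ hy]
  have hi : IntervalIntegrable (fun s => F.actPull s (F.ctrNu ψ) ((extChartAt (𝓡∂ 3) x₀).symm y))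
      volume a b := (F.continuous_actPull_ctrNu hψ _).intervalIntegrable a b
  exact ((ContinuousAlternatingMap.compContinuousLinearMapCLM
    (coordDeriv (𝓡∂ 3) x₀ y)).intervalIntegral_comp_comm hi).symm

theorem contDiffOn_contract_flowRep {n : ℕ} {ψ : M → E3 [⋀^Fin (n + 1)]→L[ℝ] ℝ}
    (hψ : IsSmoothForm (𝓡∂ 3) ψ) (x₀ : M) :
    ContDiffOn ℝ ∞ (fun q => contract n (F.flowRep ψ x₀ q))
      (univ ×ˢ (extChartAt (𝓡∂ 3) x₀).target) :=
  (contract n).contDiff.comp_contDiffOn (F.contDiffOn_flowRep hψ x₀)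

theorem isSmoothForm_cyl (a b : ℝ) {n : ℕ} {ψ : M → E3 [⋀^Fin (n + 1)]→L[ℝ] ℝ}
    (hψ : IsSmoothForm (𝓡∂ 3) ψ) : IsSmoothForm (𝓡∂ 3) (F.cyl a b ψ) := fun x₀ =>
  (contDiffOn_intervalIntegral (𝓡∂ 3).convex_range (extChartAt_target_subset_range x₀)
    (fun _ hy => extChartAt_target_mem_nhdsWithin_of_mem hy) (uniqueDiffOn_extChartAt_target x₀) a b
    (F.contDiffOn_contract_flowRep hψ x₀)).congr fun _ hy => F.localRep_cyl a b hψ hy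

theorem hasFDerivWithinAt_flowRep {n : ℕ} {ψ : M → E3 [⋀^Fin n]→L[ℝ] ℝ}
    (hψ : IsSmoothForm (𝓡∂ 3) ψ) {x₀ : M} {y : E3} (s : ℝ)
    (hy : y ∈ (extChartAt (𝓡∂ 3) x₀).target) :
    HasFDerivWithinAt (F.flowRep ψ x₀) (fderivWithin ℝ (F.flowRep ψ x₀) slab (s, y)) slab (s, y) :=
  (((F.contDiffOn_flowRep hψ x₀).differentiableOn (by simp) (s, y)
    ⟨mem_univ _, hy⟩).mono_of_mem_nhdsWithin
      (cyl_target_mem_nhdsWithin x₀ _ ⟨mem_univ _, hy⟩)).hasFDerivWithinAt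

theorem continuous_fderivWithin_flowRep {n : ℕ} {ψ : M → E3 [⋀^Fin n]→L[ℝ] ℝ}
    (hψ : IsSmoothForm (𝓡∂ 3) ψ) {x₀ : M} {y : E3} (hy : y ∈ (extChartAt (𝓡∂ 3) x₀).target) :
    Continuous fun s => fderivWithin ℝ (F.flowRep ψ x₀) slab (s, y) := by
  have h1 := (F.contDiffOn_flowRep hψ x₀).continuousOn_fderivWithin
    (uniqueDiffOn_univ.prod (uniqueDiffOn_extChartAt_target x₀)) (by simp)
  have h2 : ∀ s : ℝ, fderivWithin ℝ (F.flowRep ψ x₀) slab (s, y) =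
      fderivWithin ℝ (F.flowRep ψ x₀) (univ ×ˢ (extChartAt (𝓡∂ 3) x₀).target) (s, y) := fun s =>
    (((F.hasFDerivWithinAt_flowRep hψ s hy).mono (cyl_target_subset x₀)).fderivWithin
      ((uniqueDiffOn_univ.prod (uniqueDiffOn_extChartAt_target x₀)) _ ⟨mem_univ _, hy⟩)).symm
  simp only [h2]
  exact h1.comp_continuous (by fun_prop) fun s => ⟨mem_univ _, hy⟩

theorem integral_restr_fderivWithin (a b : ℝ) {n : ℕ} {ψ : M → E3 [⋀^Fin n]→L[ℝ] ℝ}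
    (hψ : IsSmoothForm (𝓡∂ 3) ψ) (x : M) :
    ∫ s in a..b, restr n (fderivWithin ℝ (F.flowRep ψ x) slab (s, extChartAt (𝓡∂ 3) x x) (1, 0)) =
      F.actPull b ψ x - F.actPull a ψ x := by
  have hy := mem_extChartAt_target (I := 𝓡∂ 3) x
  have h : ∀ s, F.actPull s ψ x = restr n (F.flowRep ψ x (s, extChartAt (𝓡∂ 3) x x)) := fun s => by
    rw [← localRep_self (I := 𝓡∂ 3) (F.actPull s ψ) x, localRep_actPull F s _ hy]
  rw [h, h]
  refine intervalIntegral.integral_eq_sub_of_hasDerivAt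
    (f := fun s => restr n (F.flowRep ψ x (s, extChartAt (𝓡∂ 3) x x))) (fun s _ => ?_) ?_
  · have h1 : HasFDerivWithinAt (fun t : ℝ => (t, extChartAt (𝓡∂ 3) x x)) (.inl ℝ ℝ E3) univ s :=
      (hasFDerivAt_prodMk_left s _).hasFDerivWithinAt
    have hm : MapsTo (fun t : ℝ => (t, extChartAt (𝓡∂ 3) x x)) univ slab :=
      fun t _ => ⟨mem_univ _, extChartAt_target_subset_range x hy⟩
    have h2 := (F.hasFDerivWithinAt_flowRep hψ s hy).comp s h1 hm
    have h3 := ((restr n).hasFDerivAt.comp_hasFDerivWithinAt s h2)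
    rw [hasFDerivWithinAt_univ] at h3
    exact h3.hasDerivAt
  · refine Continuous.intervalIntegrable ?_ a b
    have := F.continuous_fderivWithin_flowRep hψ hy
    fun_prop

/-- The Cartan formula, integrated over the orbits: `d (cyl ψ) + cyl (d ψ)` is the difference of the
pullbacks of `ψ` at the end points. -/
theorem extD_cyl_add (a b : ℝ) {n : ℕ} {ψ : M → E3 [⋀^Fin (n + 1)]→L[ℝ] ℝ}
    (hψ : IsSmoothForm (𝓡∂ 3) ψ) (x : M) :
    extD (𝓡∂ 3) (F.cyl a b ψ) x + F.cyl a b (extD (𝓡∂ 3) ψ) x =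
      F.actPull b ψ x - F.actPull a ψ x := by
  have hy := mem_extChartAt_target (I := 𝓡∂ 3) x
  have hyr : extChartAt (𝓡∂ 3) x x ∈ range (𝓡∂ 3) := ⟨_, rfl⟩
  set y := extChartAt (𝓡∂ 3) x x with hydef
  set L := fun s : ℝ => fderivWithin ℝ (F.flowRep ψ x) slab (s, y) with hL
  have hLc : Continuous L := F.continuous_fderivWithin_flowRep hψ hy
  let A : (E3 →L[ℝ] E3 [⋀^Fin n]→L[ℝ] ℝ) →L[ℝ] E3 [⋀^Fin (n + 1)]→L[ℝ] ℝ :=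
    ContinuousAlternatingMap.alternatizeUncurryFinCLM ℝ E3 ℝ
  let B : ((ℝ × E3) →L[ℝ] (ℝ × E3) [⋀^Fin (n + 1)]→L[ℝ] ℝ) →L[ℝ] (ℝ × E3) [⋀^Fin (n + 2)]→L[ℝ] ℝ :=
    ContinuousAlternatingMap.alternatizeUncurryFinCLM ℝ (ℝ × E3) ℝ
  have h1 : HasFDerivWithinAt (localRep (𝓡∂ 3) (F.cyl a b ψ) x)
      (∫ s in a..b, contract n ∘L L s ∘L .inr ℝ ℝ E3) (range (𝓡∂ 3)) y := by
    have := hasFDerivWithinAt_intervalIntegral_of_contDiffOn (𝓡∂ 3).convex_range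
      (extChartAt_target_subset_range x) (fun _ hy => extChartAt_target_mem_nhdsWithin_of_mem hy)
      (uniqueDiffOn_extChartAt_target x) a b ((F.contDiffOn_contract_flowRep hψ x).of_le (by simp)) hy
    have e : ∀ s : ℝ, fderivWithin ℝ (fun q => contract n (F.flowRep ψ x q))
        (univ ×ˢ (extChartAt (𝓡∂ 3) x).target) (s, y) = contract n ∘L L s := fun s =>
      (((contract n).hasFDerivAt.comp_hasFDerivWithinAt _
        (F.hasFDerivWithinAt_flowRep hψ s hy)).mono (cyl_target_subset x)).fderivWithin
        ((uniqueDiffOn_univ.prod (uniqueDiffOn_extChartAt_target x)) _ ⟨mem_univ _, hy⟩)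
    simp only [e] at this
    exact ((this.congr (fun z hz => F.localRep_cyl a b hψ hz)
      (F.localRep_cyl a b hψ hy)).mono_of_mem_nhdsWithin (extChartAt_target_mem_nhdsWithin_of_mem hy))
  have h2 : extD (𝓡∂ 3) (F.cyl a b ψ) x = ∫ s in a..b,
      ContinuousAlternatingMap.alternatizeUncurryFin (contract n ∘L L s ∘L .inr ℝ ℝ E3) := by
    rw [extD, extDerivWithin, ← hydef, h1.fderivWithin ((𝓡∂ 3).uniqueDiffOn y hyr)]
    exact alternatizeUncurryFin_intervalIntegral
      (f := fun s => contract n ∘L L s ∘L .inr ℝ ℝ E3) (by fun_prop) a b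
  have h3 : F.cyl a b (extD (𝓡∂ 3) ψ) x = ∫ s in a..b,
      contract (n + 1) (ContinuousAlternatingMap.alternatizeUncurryFin (L s)) := by
    rw [← localRep_self (I := 𝓡∂ 3) (F.cyl a b (extD (𝓡∂ 3) ψ)) x, F.localRep_cyl a b hψ.extD hy]
    refine intervalIntegral.integral_congr fun s _ => ?_
    rw [F.flowRep_extD hψ ⟨mem_univ _, hy⟩]
    rfl
  have hA1 : Continuous fun s => ContinuousAlternatingMap.alternatizeUncurryFin
      (contract n ∘L L s ∘L .inr ℝ ℝ E3) :=
    A.continuous.comp (by fun_prop)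
  have hA2 : Continuous fun s => contract (n + 1)
      (ContinuousAlternatingMap.alternatizeUncurryFin (L s)) :=
    (contract (n + 1)).continuous.comp
      (B.continuous.comp hLc)
  rw [h2, h3, ← intervalIntegral.integral_add (hA1.intervalIntegrable a b)
    (hA2.intervalIntegrable a b), ← F.integral_restr_fderivWithin a b hψ x]
  exact intervalIntegral.integral_congr fun s _ => contract_alternatizeUncurryFin (L s)

theorem cyl_extD_zero (a b : ℝ) {ψ : M → E3 [⋀^Fin 0]→L[ℝ] ℝ}
    (hψ : IsSmoothForm (𝓡∂ 3) ψ) (x : M) :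
    F.cyl a b (extD (𝓡∂ 3) ψ) x = F.actPull b ψ x - F.actPull a ψ x := by
  have hy := mem_extChartAt_target (I := 𝓡∂ 3) x
  rw [← localRep_self (I := 𝓡∂ 3) (F.cyl a b (extD (𝓡∂ 3) ψ)) x, F.localRep_cyl a b hψ.extD hy,
    ← F.integral_restr_fderivWithin a b hψ x]
  refine intervalIntegral.integral_congr fun s _ => ?_
  rw [F.flowRep_extD hψ ⟨mem_univ _, hy⟩, extDerivWithin, contract_alternatizeUncurryFin_zero]

end BulkFlow

end

section

namespace BulkFlow

/-! ### The boundary condition in terms of the flow -/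

/-- The generating vector field of the flow on the boundary. -/
def bnu (p : N) : E2 := velocity (𝓡 2) (fun s => F.flow s p) 0

theorem nu_ι (p : N) : F.nu (X.ι p) = X.dι p (F.bnu p) := by
  have h1 : ContMDiff 𝓘(ℝ, ℝ) (𝓡 2) ∞ fun s => F.flow s p :=
    F.flow_smooth.comp (contMDiff_id.prodMk contMDiff_const)
  have h := velocity_comp (f := X.ι) (γ := fun s => F.flow s p) (s := 0)
    (X.ι_smooth.mdifferentiableAt (by simp)) (h1.mdifferentiableAt (by simp))
  simp only [F.flow_zero] at h
  rw [nu]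
  simp only [F.act_ι]
  exact h

theorem eq_coord_smul (w : E2) : w = w 0 • stdVec 0 + w 1 • stdVec 1 := by
  ext i
  fin_cases i <;> simp

theorem two_form_apply (B : E2 [⋀^Fin 2]→L[ℝ] ℝ) (u w : E2) :
    B ![u, w] = (u 0 * w 1 - u 1 * w 0) * B ![stdVec 0, stdVec 1] := by
  have hl : ∀ (a b : ℝ) (x y z : E2), B ![a • x + b • y, z] = a * B ![x, z] + b * B ![y, z] := by
    intro a b x y z
    have h := (B.curryLeft (a • x + b • y)) ![z]
    have := congrArg (fun C => C ![z]) (show B.curryLeft (a • x + b • y) =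
      a • B.curryLeft x + b • B.curryLeft y by simp)
    exact this
  have hs : ∀ x y : E2, B ![x, y] = -B ![y, x] := by
    intro x y
    have h := B.toAlternatingMap.map_swap ![y, x] (i := 0) (j := 1) (by decide)
    have e : ![y, x] ∘ Equiv.swap (0 : Fin 2) 1 = ![x, y] := by
      ext i; fin_cases i <;> simp
    rw [e] at h
    exact h
  have h0 : ∀ x : E2, B ![x, x] = 0 := fun x => by linarith [hs x x]
  conv_lhs => rw [eq_coord_smul u, hl, hs, hs (stdVec 1), eq_coord_smul w, hl, hl, h0, h0,
    hs (stdVec 1)]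
  ring

theorem two_form_basis {t n : E2} (h : t 0 * n 1 - t 1 * n 0 ≠ 0) (w : E2) :
    ∃ a b : ℝ, w = a • t + b • n := by
  refine ⟨(w 0 * n 1 - w 1 * n 0) / (t 0 * n 1 - t 1 * n 0),
    (t 0 * w 1 - t 1 * w 0) / (t 0 * n 1 - t 1 * n 0), ?_⟩
  ext i
  fin_cases i
  · simp only [Fin.zero_eta, PiLp.add_apply, PiLp.smul_apply, smul_eq_mul]
    rw [div_mul_eq_mul_div, div_mul_eq_mul_div, ← add_div, eq_div_iff h]
    ring
  · simp only [Fin.mk_one, PiLp.add_apply, PiLp.smul_apply, smul_eq_mul]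
    rw [div_mul_eq_mul_div, div_mul_eq_mul_div, ← add_div, eq_div_iff h]
    ring

/-- The value of the volume form on the pair formed by the time orientation and the generator of a
chiral flow: since the latter is null, its modulus is that of their scalar product. -/
theorem vol_t_bnu (p : N) :
    X.vol p ![X.t p, F.bnu p] = -(((ε : ℤ) : ℝ) * X.g p (X.t p) (F.bnu p)) := by
  set t : E2 := X.t p with ht
  set n := F.bnu p with hn
  have hnull : X.g p n n = 0 := F.flow_null p
  have hfut : X.g p t n < 0 := F.flow_future p
  have hch : 0 < ((ε : ℤ) : ℝ) * X.vol p ![t, n] := F.flow_chiral p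
  set B := X.bdryOrient p with hB
  set D := |X.g p (stdVec 0) (stdVec 0) * X.g p (stdVec 1) (stdVec 1) -
    X.g p (stdVec 0) (stdVec 1) ^ 2| with hD
  have hv : X.vol p ![t, n] = √D / |B ![stdVec 0, stdVec 1]| *
      ((t 0 * n 1 - t 1 * n 0) * B ![stdVec 0, stdVec 1]) := by
    rw [← two_form_apply]
    rfl
  have hb : B ![stdVec 0, stdVec 1] ≠ 0 := by
    intro h
    rw [hv, h] at hch
    simp at hch
  have hg : ∀ u w : E2, X.g p u w = u 0 * w 0 * X.g p (stdVec 0) (stdVec 0) +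
      (u 0 * w 1 + u 1 * w 0) * X.g p (stdVec 0) (stdVec 1) +
      u 1 * w 1 * X.g p (stdVec 1) (stdVec 1) := by
    intro u w
    conv_lhs => rw [eq_coord_smul u, eq_coord_smul w]
    simp only [map_add, map_smul, _root_.add_apply, _root_.smul_apply,
      smul_eq_mul, X.g_symm p (stdVec 1) (stdVec 0)]
    ring
  -- the Gram determinant of `t` and `n`, which equals `-g(t, n)²` because `n` is null
  have hdet : (X.g p (stdVec 0) (stdVec 0) * X.g p (stdVec 1) (stdVec 1) -
      X.g p (stdVec 0) (stdVec 1) ^ 2) * (t 0 * n 1 - t 1 * n 0) ^ 2 = -(X.g p t n) ^ 2 := by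
    have h : X.g p t t * X.g p n n - X.g p t n ^ 2 = (X.g p (stdVec 0) (stdVec 0) *
      X.g p (stdVec 1) (stdVec 1) - X.g p (stdVec 0) (stdVec 1) ^ 2) *
      (t 0 * n 1 - t 1 * n 0) ^ 2 := by
      rw [hg t t, hg n n, hg t n]
      ring
    rw [← h, hnull]
    ring
  have hsq : X.vol p ![t, n] ^ 2 = X.g p t n ^ 2 := by
    rw [hv, mul_pow, div_pow, Real.sq_sqrt (abs_nonneg _), sq_abs, mul_pow]
    have h1 : D * (t 0 * n 1 - t 1 * n 0) ^ 2 = X.g p t n ^ 2 := by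
      rw [hD, ← abs_of_nonneg (sq_nonneg (t 0 * n 1 - t 1 * n 0)), ← abs_mul, hdet, abs_neg,
        abs_of_nonneg (sq_nonneg _)]
    rw [← h1, hD]
    field_simp
  rcases sq_eq_sq_iff_eq_or_eq_neg.mp hsq with h | h <;>
  rcases Int.units_eq_one_or ε with rfl | rfl <;>
  simp only [Units.val_one, Units.val_neg, Int.cast_neg, Int.cast_one, neg_mul, one_mul,
    neg_neg] at hch ⊢ <;> linarith

/-- A covector on the boundary is (anti-)self-dual if and only if it vanishes on the generator of a
chiral flow. -/
theorem isSelfDual_iff (p : N) (α : E2 [⋀^Fin 1]→L[ℝ] ℝ) :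
    X.IsSelfDual ε p α ↔ α ![F.bnu p] = 0 := by
  set t : E2 := X.t p with ht
  set n := F.bnu p with hn
  have hnull : X.g p n n = 0 := F.flow_null p
  have hfut : X.g p t n < 0 := F.flow_future p
  have hvol : X.vol p ![t, n] = -(((ε : ℤ) : ℝ) * X.g p t n) := F.vol_t_bnu p
  have hε : ((ε : ℤ) : ℝ) ≠ 0 := by
    rcases Int.units_eq_one_or ε with rfl | rfl <;> simp
  have hΔ : t 0 * n 1 - t 1 * n 0 ≠ 0 := by
    intro h
    rw [two_form_apply, h, zero_mul] at hvol
    have := mul_ne_zero hε hfut.ne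
    exact this (by linarith)
  have hadd : ∀ (a b : ℝ) (x y : E2), α ![a • x + b • y] = a * α ![x] + b * α ![y] := by
    intro a b x y
    have h := congrArg (fun C => C ![]) (show α.curryLeft (a • x + b • y) =
      a • α.curryLeft x + b • α.curryLeft y by simp)
    exact h
  have hv : ∀ u w : E2, (X.vol p).curryLeft u ![w] = X.vol p ![u, w] := fun _ _ => rfl
  have hs : ∀ x y : E2, X.vol p ![x, y] = (x 0 * y 1 - x 1 * y 0) / (t 0 * n 1 - t 1 * n 0) *
      X.vol p ![t, n] := by
    intro x y
    rw [two_form_apply, two_form_apply _ t]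
    field_simp
  constructor
  · rintro ⟨u, h1, h2⟩
    obtain ⟨a, b, rfl⟩ := two_form_basis hΔ u
    have h3 := congrArg (fun C => C ![n]) h2
    -- evaluate the self-duality relation on `n`; both sides are multiples of the `t`-coefficient of `u`
    simp only [hv, ContinuousAlternatingMap.smul_apply] at h3
    rw [hs, hvol, ← Int.cast_smul_eq_zsmul ℝ, smul_eq_mul] at h3
    have h4 := h1 n
    simp only [map_add, map_smul, _root_.add_apply, _root_.smul_apply,
      smul_eq_mul, hnull] at h4
    have h5 : ((a • t + b • n) 0 * n 1 - (a • t + b • n) 1 * n 0) / (t 0 * n 1 - t 1 * n 0) = a := by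
      simp only [PiLp.add_apply, PiLp.smul_apply, smul_eq_mul]
      rw [div_eq_iff hΔ]
      ring
    rw [h5] at h3
    have h6 : ((ε : ℤ) : ℝ) * (α ![n] + a * X.g p t n) = 0 := by linarith
    have h7 := (mul_eq_zero.mp h6).resolve_left hε
    linarith
  · intro h
    have key : ∀ w : E2, ∃ a b : ℝ, w = a • t + b • n := two_form_basis hΔ
    -- a covector which annihilates the null vector `n` is metrically dual to a multiple of `n`
    refine ⟨(α ![t] / X.g p t n) • n, fun w => ?_, ?_⟩
    · obtain ⟨a, b, rfl⟩ := key w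
      rw [hadd, h]
      simp only [map_add, map_smul, _root_.smul_apply, smul_eq_mul, hnull,
        X.g_symm p n t]
      field_simp [hfut.ne]
      ring
    · ext w
      obtain ⟨a, b, h'⟩ := key (w 0)
      have hw : w = ![a • t + b • n] := by
        rw [← h']
        ext i
        fin_cases i
        rfl
      rw [hw, hv, ContinuousAlternatingMap.smul_apply, hadd, h, hs, hvol,
        ← Int.cast_smul_eq_zsmul ℝ]
      have h5 : (((α ![t] / X.g p t n) • n) 0 * (a • t + b • n) 1 -
          ((α ![t] / X.g p t n) • n) 1 * (a • t + b • n) 0) / (t 0 * n 1 - t 1 * n 0) =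
          -(α ![t] / X.g p t n * a) := by
        simp only [PiLp.add_apply, PiLp.smul_apply, smul_eq_mul]
        rw [div_eq_iff hΔ]
        ring
      rw [h5, smul_eq_mul]
      field_simp [hfut.ne]
      ring

theorem boundaryCond_zero_iff {α : M → E3 [⋀^Fin 0]→L[ℝ] ℝ} :
    X.BoundaryCond ε α ↔ ∀ p, α (X.ι p) = 0 := by
  refine forall_congr' fun p => ⟨fun h => ?_, fun h => ?_⟩
  · ext v
    have := congrArg (fun C => C ![]) h
    rw [Subsingleton.elim v (X.dι p ∘ ![])]
    exact this
  · rw [BulkBoundary.pull, h]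
    rfl

/-- For `1`-forms, the (anti-)self-duality condition on the boundary says that the form vanishes on the
generator of the flow. -/
theorem boundaryCond_one_iff {α : M → E3 [⋀^Fin 1]→L[ℝ] ℝ} :
    X.BoundaryCond ε α ↔ ∀ p, α (X.ι p) ![F.nu (X.ι p)] = 0 := by
  refine forall_congr' fun p => ?_
  rw [F.isSelfDual_iff, nu_ι, BulkBoundary.pull,
    ContinuousAlternatingMap.compContinuousLinearMap_apply]
  have : X.dι p ∘ ![F.bnu p] = ![X.dι p (F.bnu p)] := by
    ext i
    fin_cases i
    rfl
  rw [this]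

/-! ### Green's homotopies -/

theorem alt_neg_one_smul {n : ℕ} (α : E3 [⋀^Fin n]→L[ℝ] ℝ) : (-1 : ℝ) • α = -α := by
  ext v
  simp

/-- By properness, the orbits of points of a compact set leave every compact set uniformly. -/
theorem exists_act_notMem {C K : Set M} (hC : IsCompact C) (hK : IsCompact K) :
    ∃ T : ℝ, 0 < T ∧ ∀ x ∈ C, ∀ s, T ≤ |s| → F.act s x ∉ K := by
  have h := (F.act_proper.isCompact_preimage (hC.prod hK)).image continuous_fst
  obtain ⟨T, hT⟩ := h.isBounded.exists_norm_le
  refine ⟨|T| + 1, by positivity, fun x hx s hs hsK => ?_⟩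
  have := hT s ⟨(s, x), ⟨hx, hsK⟩, rfl⟩
  rw [Real.norm_eq_abs] at this
  linarith [le_abs_self T]

theorem actPull_eq_zero {n : ℕ} {ψ : M → E3 [⋀^Fin n]→L[ℝ] ℝ} {s : ℝ} {x : M}
    (h : F.act s x ∉ tsupport ψ) : F.actPull s ψ x = 0 := by
  rw [actPull, image_eq_zero_of_notMem_tsupport h]
  rfl

theorem actPull_ctrNu_eq_zero {n : ℕ} {ψ : M → E3 [⋀^Fin (n + 1)]→L[ℝ] ℝ} {s : ℝ} {x : M}
    (h : F.act s x ∉ tsupport ψ) : F.actPull s (F.ctrNu ψ) x = 0 := by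
  rw [actPull, ctrNu, image_eq_zero_of_notMem_tsupport h]
  rfl

variable [IsManifold (𝓡∂ 3) ∞ M]

omit [IsManifold (𝓡∂ 3) ∞ M] in
theorem greenUp_eq_cyl {n : ℕ} {ψ : M → E3 [⋀^Fin (n + 1)]→L[ℝ] ℝ} {T : ℝ} (hT : 0 < T) {x : M}
    (h : ∀ s, T ≤ |s| → F.act s x ∉ tsupport ψ) :
    F.greenUp ψ x = (-1 : ℝ) • F.cyl (-T) 0 ψ x := by
  have h1 : F.greenUp ψ x = -F.fiberInt (Iic 0) ψ x := rfl
  rw [h1, fiberInt_eq, cyl, intervalIntegral.integral_of_le (by linarith), alt_neg_one_smul]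
  congr 1
  refine setIntegral_eq_of_subset_of_forall_sdiff_eq_zero measurableSet_Iic
    (fun s hs => hs.2) fun s hs => F.actPull_ctrNu_eq_zero (h s ?_)
  by_contra hlt
  rw [not_le, abs_lt] at hlt
  exact hs.2 ⟨hlt.1, hs.1⟩

omit [IsManifold (𝓡∂ 3) ∞ M] in
theorem greenDown_eq_cyl {n : ℕ} {ψ : M → E3 [⋀^Fin (n + 1)]→L[ℝ] ℝ} {T : ℝ} (hT : 0 < T) {x : M}
    (h : ∀ s, T ≤ |s| → F.act s x ∉ tsupport ψ) :
    F.greenDown ψ x = F.cyl 0 T ψ x := by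
  have h1 : F.greenDown ψ x = F.fiberInt (Ici 0) ψ x := rfl
  rw [h1, fiberInt_eq, cyl, intervalIntegral.integral_of_le hT.le, integral_Ici_eq_integral_Ioi]
  refine setIntegral_eq_of_subset_of_forall_sdiff_eq_zero measurableSet_Ioi
    (fun s hs => hs.1) fun s hs => F.actPull_ctrNu_eq_zero (h s ?_)
  by_contra hlt
  rw [not_le, abs_lt] at hlt
  exact hs.2 ⟨hs.1, hlt.2.le⟩

theorem green_eq_cyl {n : ℕ} {ψ : M → E3 [⋀^Fin (n + 1)]→L[ℝ] ℝ} (hψ : IsSmoothForm (𝓡∂ 3) ψ)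
    {T : ℝ} (hT : 0 < T) {x : M} (h : ∀ s, T ≤ |s| → F.act s x ∉ tsupport ψ) :
    F.green ψ x = (-1 : ℝ) • F.cyl (-T) T ψ x := by
  have h1 : F.green ψ x = F.greenUp ψ x - F.greenDown ψ x := rfl
  have hc := F.continuous_actPull_ctrNu hψ x
  rw [h1, F.greenUp_eq_cyl hT h, F.greenDown_eq_cyl hT h, cyl, cyl, cyl,
    ← intervalIntegral.integral_add_adjacent_intervals (hc.intervalIntegrable (-T) 0)
      (hc.intervalIntegrable 0 T), alt_neg_one_smul, alt_neg_one_smul, neg_add, sub_eq_add_neg]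

omit [IsManifold (𝓡∂ 3) ∞ M] in
/-- Near any given point, fiber integrals of compactly supported forms are integrals over a bounded
interval. -/
theorem exists_eventually_act_notMem (x : M) {K : Set M} (hK : IsCompact K) :
    ∃ T : ℝ, 0 < T ∧ ∀ᶠ z in 𝓝 x, ∀ s, T ≤ |s| → F.act s z ∉ K := by
  have : LocallyCompactSpace M := Manifold.locallyCompact_of_finiteDimensional (𝓡∂ 3)
  obtain ⟨C, hC, hxC⟩ := exists_compact_mem_nhds x
  obtain ⟨T, hT, h⟩ := F.exists_act_notMem hC hK
  exact ⟨T, hT, by filter_upwards [hxC] with z hz using h z hz⟩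

variable {F}

theorem isSmoothForm_greenUp {n : ℕ} {ψ : M → E3 [⋀^Fin (n + 1)]→L[ℝ] ℝ}
    (hψ : IsSmoothForm (𝓡∂ 3) ψ) (hc : HasCompactSupport ψ) :
    IsSmoothForm (𝓡∂ 3) (F.greenUp ψ) := by
  refine isSmoothForm_of_eventuallyEq fun x => ?_
  obtain ⟨T, hT, h⟩ := F.exists_eventually_act_notMem x hc
  exact ⟨_, (F.isSmoothForm_cyl (-T) 0 hψ).smul (-1), h.mono fun z hz => F.greenUp_eq_cyl hT hz⟩

theorem isSmoothForm_greenDown {n : ℕ} {ψ : M → E3 [⋀^Fin (n + 1)]→L[ℝ] ℝ}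
    (hψ : IsSmoothForm (𝓡∂ 3) ψ) (hc : HasCompactSupport ψ) :
    IsSmoothForm (𝓡∂ 3) (F.greenDown ψ) := by
  refine isSmoothForm_of_eventuallyEq fun x => ?_
  obtain ⟨T, hT, h⟩ := F.exists_eventually_act_notMem x hc
  exact ⟨_, F.isSmoothForm_cyl 0 T hψ, h.mono fun z hz => F.greenDown_eq_cyl hT hz⟩

/-- The upward Green's homotopy is a homotopy from the identity to zero, up to sign: near a given point
it is an integral over a bounded interval, one end of which contributes nothing. -/
theorem extD_greenUp {n : ℕ} {ψ : M → E3 [⋀^Fin (n + 1)]→L[ℝ] ℝ}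
    (hψ : IsSmoothForm (𝓡∂ 3) ψ) (hc : HasCompactSupport ψ) (x : M) :
    extD (𝓡∂ 3) (F.greenUp ψ) x + F.greenUp (extD (𝓡∂ 3) ψ) x = (-1 : ℝ) • ψ x := by
  obtain ⟨T, hT, h⟩ := F.exists_eventually_act_notMem x hc
  have h1 : F.greenUp ψ =ᶠ[𝓝 x] (-1 : ℝ) • F.cyl (-T) 0 ψ :=
    h.mono fun z hz => F.greenUp_eq_cyl hT hz
  have h2 := h.self_of_nhds
  rw [extD_congr h1, extD_smul,
    F.greenUp_eq_cyl hT fun s hs => fun hm => h2 s hs (tsupport_extD ψ hm)]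
  change (-1 : ℝ) • extD (𝓡∂ 3) (F.cyl (-T) 0 ψ) x + _ = _
  rw [← smul_add, F.extD_cyl_add _ _ hψ, F.actPull_zero,
    F.actPull_eq_zero (h2 (-T) (by rw [abs_neg, abs_of_pos hT])), sub_zero]

theorem extD_greenDown {n : ℕ} {ψ : M → E3 [⋀^Fin (n + 1)]→L[ℝ] ℝ}
    (hψ : IsSmoothForm (𝓡∂ 3) ψ) (hc : HasCompactSupport ψ) (x : M) :
    extD (𝓡∂ 3) (F.greenDown ψ) x + F.greenDown (extD (𝓡∂ 3) ψ) x = (-1 : ℝ) • ψ x := by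
  obtain ⟨T, hT, h⟩ := F.exists_eventually_act_notMem x hc
  have h1 : F.greenDown ψ =ᶠ[𝓝 x] F.cyl 0 T ψ :=
    h.mono fun z hz => F.greenDown_eq_cyl hT hz
  have h2 := h.self_of_nhds
  rw [extD_congr h1,
    F.greenDown_eq_cyl hT fun s hs => fun hm => h2 s hs (tsupport_extD ψ hm)]
  rw [F.extD_cyl_add _ _ hψ, F.actPull_zero,
    F.actPull_eq_zero (h2 T (by rw [abs_of_pos hT])), zero_sub, alt_neg_one_smul]

theorem greenUp_extD_zero {ψ : M → E3 [⋀^Fin 0]→L[ℝ] ℝ}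
    (hψ : IsSmoothForm (𝓡∂ 3) ψ) (hc : HasCompactSupport ψ) (x : M) :
    F.greenUp (extD (𝓡∂ 3) ψ) x = (-1 : ℝ) • ψ x := by
  obtain ⟨T, hT, h⟩ := F.exists_eventually_act_notMem x hc
  have h2 := h.self_of_nhds
  rw [F.greenUp_eq_cyl hT fun s hs => fun hm => h2 s hs (tsupport_extD ψ hm),
    F.cyl_extD_zero _ _ hψ, F.actPull_zero,
    F.actPull_eq_zero (h2 (-T) (by rw [abs_neg, abs_of_pos hT])), sub_zero]

theorem greenDown_extD_zero {ψ : M → E3 [⋀^Fin 0]→L[ℝ] ℝ}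
    (hψ : IsSmoothForm (𝓡∂ 3) ψ) (hc : HasCompactSupport ψ) (x : M) :
    F.greenDown (extD (𝓡∂ 3) ψ) x = (-1 : ℝ) • ψ x := by
  obtain ⟨T, hT, h⟩ := F.exists_eventually_act_notMem x hc
  have h2 := h.self_of_nhds
  rw [F.greenDown_eq_cyl hT fun s hs => fun hm => h2 s hs (tsupport_extD ψ hm),
    F.cyl_extD_zero _ _ hψ, F.actPull_zero,
    F.actPull_eq_zero (h2 T (by rw [abs_of_pos hT])), zero_sub, alt_neg_one_smul]

theorem green_extD_zero {ψ : M → E3 [⋀^Fin 0]→L[ℝ] ℝ}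
    (hψ : IsSmoothForm (𝓡∂ 3) ψ) (hc : HasCompactSupport ψ) :
    F.green (extD (𝓡∂ 3) ψ) = 0 := by
  funext x
  have h1 : F.green (extD (𝓡∂ 3) ψ) x =
    F.greenUp (extD (𝓡∂ 3) ψ) x - F.greenDown (extD (𝓡∂ 3) ψ) x := rfl
  rw [h1, greenUp_extD_zero hψ hc, greenDown_extD_zero hψ hc, sub_self]
  rfl

/-- The difference of the two Green's homotopies anticommutes with the differential. -/
theorem green_extD {n : ℕ} {ψ : M → E3 [⋀^Fin (n + 1)]→L[ℝ] ℝ}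
    (hψ : IsSmoothForm (𝓡∂ 3) ψ) (hc : HasCompactSupport ψ) :
    F.green (extD (𝓡∂ 3) ψ) = (-1 : ℝ) • extD (𝓡∂ 3) (F.green ψ) := by
  have h0 : F.green ψ = F.greenUp ψ - F.greenDown ψ := rfl
  rw [h0, extD_sub (isSmoothForm_greenUp hψ hc) (isSmoothForm_greenDown hψ hc)]
  funext x
  have h1 : F.green (extD (𝓡∂ 3) ψ) x =
    F.greenUp (extD (𝓡∂ 3) ψ) x - F.greenDown (extD (𝓡∂ 3) ψ) x := rfl
  have h2 := extD_greenUp (F := F) hψ hc x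
  have h3 := extD_greenDown (F := F) hψ hc x
  rw [← h3, ← sub_eq_zero] at h2
  change _ = (-1 : ℝ) • (extD (𝓡∂ 3) (F.greenUp ψ) x - extD (𝓡∂ 3) (F.greenDown ψ) x)
  rw [h1, ← sub_eq_zero, alt_neg_one_smul, ← h2]
  abel

/-- Integrals of a field over pieces of the orbits satisfy the boundary condition: for a `1`-form the
integrand is its value on the generator, and the contraction of a `2`-form with the generator
vanishes on the generator. -/
theorem boundaryCond_cyl (a b : ℝ) : ∀ {n : ℕ} {ψ : M → E3 [⋀^Fin (n + 1)]→L[ℝ] ℝ},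
    IsSmoothForm (𝓡∂ 3) ψ → X.BoundaryCond ε ψ → X.BoundaryCond ε (F.cyl a b ψ)
  | 0, ψ, hs, hb => boundaryCond_zero_iff.mpr fun p => by
      rw [F.boundaryCond_one_iff] at hb
      have h : ∀ s, F.actPull s (F.ctrNu ψ) (X.ι p) = 0 := fun s => by
        ext v
        change ψ (F.act s (X.ι p)) (Fin.cons (F.nu (F.act s (X.ι p))) _) = 0
        rw [F.act_ι]
        have := hb (F.flow s p)
        convert this using 2
        ext i
        fin_cases i
        rfl
      simp only [cyl, h, intervalIntegral.integral_zero]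
  | 1, ψ, hs, _ => F.boundaryCond_one_iff.mpr fun p => by
      have hi : IntervalIntegrable (fun s => F.actPull s (F.ctrNu ψ) (X.ι p)) volume a b :=
        (F.continuous_actPull_ctrNu hs _).intervalIntegrable a b
      have h := (ContinuousAlternatingMap.apply ℝ E3 ℝ
        ![F.nu (X.ι p)]).intervalIntegral_comp_comm hi
      refine h.symm.trans ?_
      have h0 : ∀ s, F.actPull s (F.ctrNu ψ) (X.ι p) ![F.nu (X.ι p)] = 0 := fun s => by
        change ψ (F.act s (X.ι p)) (Fin.cons (F.nu (F.act s (X.ι p)))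
          (F.dact s (X.ι p) ∘ ![F.nu (X.ι p)])) = 0
        refine (ψ (F.act s (X.ι p))).map_eq_zero_of_eq _ (i := 0) (j := 1) ?_ (by decide)
        exact (F.dact_nu s _).symm
      simp only [ContinuousAlternatingMap.apply_apply, h0, intervalIntegral.integral_zero]
  | _ + 2, _, _, _ => trivial

omit [IsManifold (𝓡∂ 3) ∞ M] in
/-- The boundary condition is pointwise. -/
theorem boundaryCond_congr : ∀ {n : ℕ} {α : M → E3 [⋀^Fin n]→L[ℝ] ℝ},
    (∀ p, ∃ β' : M → E3 [⋀^Fin n]→L[ℝ] ℝ, X.BoundaryCond ε β' ∧ α (X.ι p) = β' (X.ι p)) →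
      X.BoundaryCond ε α
  | 0, _, h => fun p => by
      obtain ⟨β', h1, h2⟩ := h p
      rw [BulkBoundary.pull, h2]
      exact h1 p
  | 1, _, h => fun p => by
      obtain ⟨β', h1, h2⟩ := h p
      rw [BulkBoundary.pull, h2]
      exact h1 p
  | _ + 2, _, _ => trivial

theorem greenUp_mem_fields {n : ℕ} {ψ : M → E3 [⋀^Fin (n + 1)]→L[ℝ] ℝ} {U : Set M}
    (hψ : ψ ∈ X.fieldsC ε U (n + 1)) : F.greenUp ψ ∈ X.fields ε n := by
  refine ⟨isSmoothForm_greenUp hψ.1.1 hψ.2.1, boundaryCond_congr fun p => ?_⟩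
  obtain ⟨T, hT, h⟩ := F.exists_eventually_act_notMem (X.ι p) hψ.2.1
  exact ⟨_, (boundaryCond_cyl (-T) 0 hψ.1.1 hψ.1.2).smul (-1), F.greenUp_eq_cyl hT h.self_of_nhds⟩

theorem greenDown_mem_fields {n : ℕ} {ψ : M → E3 [⋀^Fin (n + 1)]→L[ℝ] ℝ} {U : Set M}
    (hψ : ψ ∈ X.fieldsC ε U (n + 1)) : F.greenDown ψ ∈ X.fields ε n := by
  refine ⟨isSmoothForm_greenDown hψ.1.1 hψ.2.1, boundaryCond_congr fun p => ?_⟩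
  obtain ⟨T, hT, h⟩ := F.exists_eventually_act_notMem (X.ι p) hψ.2.1
  exact ⟨_, boundaryCond_cyl 0 T hψ.1.1 hψ.1.2, F.greenDown_eq_cyl hT h.self_of_nhds⟩

theorem green_mem_fields {n : ℕ} {ψ : M → E3 [⋀^Fin (n + 1)]→L[ℝ] ℝ} {U : Set M}
    (hψ : ψ ∈ X.fieldsC ε U (n + 1)) : F.green ψ ∈ X.fields ε n :=
  sub_mem (greenUp_mem_fields hψ) (greenDown_mem_fields hψ)

theorem cyl_add (a b : ℝ) {n : ℕ} {ψ ψ' : M → E3 [⋀^Fin (n + 1)]→L[ℝ] ℝ}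
    (hψ : IsSmoothForm (𝓡∂ 3) ψ) (hψ' : IsSmoothForm (𝓡∂ 3) ψ') (x : M) :
    F.cyl a b (ψ + ψ') x = F.cyl a b ψ x + F.cyl a b ψ' x :=
  intervalIntegral.integral_add ((F.continuous_actPull_ctrNu hψ x).intervalIntegrable a b)
    ((F.continuous_actPull_ctrNu hψ' x).intervalIntegrable a b)

theorem green_add {n : ℕ} {ψ ψ' : M → E3 [⋀^Fin (n + 1)]→L[ℝ] ℝ}
    (hψ : IsSmoothForm (𝓡∂ 3) ψ) (hc : HasCompactSupport ψ)
    (hψ' : IsSmoothForm (𝓡∂ 3) ψ') (hc' : HasCompactSupport ψ') :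
    F.green (ψ + ψ') = F.green ψ + F.green ψ' := by
  funext x
  obtain ⟨T, hT, h⟩ := F.exists_act_notMem (isCompact_singleton (x := x)) (hc.isCompact.union hc'.isCompact)
  replace h := h x rfl
  rw [Pi.add_apply, F.green_eq_cyl hψ hT fun s hs hm => h s hs (.inl hm),
    F.green_eq_cyl hψ' hT fun s hs hm => h s hs (.inr hm),
    F.green_eq_cyl (hψ.add hψ') hT fun s hs hm => h s hs (tsupport_add _ _ hm), cyl_add _ _ hψ hψ',
    smul_add]

omit [IsManifold (𝓡∂ 3) ∞ M] in
theorem green_smul (c : ℝ) {n : ℕ} (ψ : M → E3 [⋀^Fin (n + 1)]→L[ℝ] ℝ) :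
    F.green (c • ψ) = c • F.green ψ := by
  have h : ∀ S x, F.fiberInt S (c • ψ) x = c • F.fiberInt S ψ x := fun S x => by
    rw [fiberInt_eq, fiberInt_eq, ← integral_smul]
    rfl
  funext x
  change -F.fiberInt (Iic 0) (c • ψ) x - F.fiberInt (Ici 0) (c • ψ) x =
    c • (-F.fiberInt (Iic 0) ψ x - F.fiberInt (Ici 0) ψ x)
  rw [h, h, smul_sub, smul_neg]

end BulkFlow

end

section

namespace BulkBoundary

/-! ### The wedge product in dimension three -/

theorem wedge_eq_sum {p q : ℕ} (α : E3 [⋀^Fin p]→L[ℝ] ℝ) (β : E3 [⋀^Fin q]→L[ℝ] ℝ)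
    (v : Fin (p + q) → E3) :
    ((p.factorial * q.factorial : ℕ) : ℝ) * wedge α β v =
      ∑ σ : Equiv.Perm (Fin (p + q)), ((Equiv.Perm.sign σ : ℤ) : ℝ) *
        (α (fun i => v (σ (Fin.castAdd q i))) * β fun j => v (σ (Fin.natAdd p j))) := by
  have h := congrArg (fun L => LinearMap.mul' ℝ ℝ (L (v ∘ finSumFinEquiv)))
    (MultilinearMap.domCoprod_alternization_eq α.toAlternatingMap β.toAlternatingMap)
  simp only [Fintype.card_fin, AlternatingMap.smul_apply, map_nsmul] at h
  rw [← nsmul_eq_mul]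
  refine Eq.trans h.symm ?_
  rw [MultilinearMap.alternatization_apply, map_sum,
    ← (finSumFinEquiv (m := p) (n := q)).permCongr.sum_comp]
  refine Finset.sum_congr rfl fun σ _ => ?_
  rw [map_zsmul_unit, Equiv.Perm.sign_permCongr, Units.smul_def, zsmul_eq_mul]
  congr 1
  change α _ * β _ = α _ * β _
  congr 2
  · funext i
    simp
  · funext i
    simp

theorem sum_perm_three (f : Equiv.Perm (Fin 3) → ℝ) :
    ∑ σ, f σ = f 1 + f (Equiv.swap 0 1) + f (Equiv.swap 0 2) + f (Equiv.swap 1 2) +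
      f (Equiv.swap 0 1 * Equiv.swap 1 2) + f (Equiv.swap 1 2 * Equiv.swap 0 1) := by
  have h : (Finset.univ : Finset (Equiv.Perm (Fin 3))) = {1, Equiv.swap 0 1, Equiv.swap 0 2,
    Equiv.swap 1 2, Equiv.swap 0 1 * Equiv.swap 1 2, Equiv.swap 1 2 * Equiv.swap 0 1} := by decide
  rw [h, Finset.sum_insert (by decide), Finset.sum_insert (by decide),
    Finset.sum_insert (by decide), Finset.sum_insert (by decide), Finset.sum_insert (by decide),
    Finset.sum_singleton]
  ring

theorem wedge_sum_three {p q : ℕ} (h : p + q = 3) (α : E3 [⋀^Fin p]→L[ℝ] ℝ)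
    (β : E3 [⋀^Fin q]→L[ℝ] ℝ) (v : Fin 3 → E3) :
    ((p.factorial * q.factorial : ℕ) : ℝ) * (wedge α β).domDomCongr (finCongr h) v =
      ∑ σ : Equiv.Perm (Fin 3), ((Equiv.Perm.sign σ : ℤ) : ℝ) *
        (α (fun i => v (σ (Fin.cast h (Fin.castAdd q i)))) *
          β fun j => v (σ (Fin.cast h (Fin.natAdd p j)))) := by
  have key : ∀ (m : ℕ) (h' : p + q = m) (v : Fin m → E3),
      ((p.factorial * q.factorial : ℕ) : ℝ) * (wedge α β).domDomCongr (finCongr h') v =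
      ∑ σ : Equiv.Perm (Fin m), ((Equiv.Perm.sign σ : ℤ) : ℝ) *
        (α (fun i => v (σ (Fin.cast h' (Fin.castAdd q i)))) *
          β fun j => v (σ (Fin.cast h' (Fin.natAdd p j)))) := by
    rintro m rfl v
    exact wedge_eq_sum α β v
  exact key 3 h v

/-- The wedge product of forms on the bulk whose degrees add up to three, as a `3`-form. -/
def wedge3 {p q : ℕ} (h : p + q = 3) (α : E3 [⋀^Fin p]→L[ℝ] ℝ) (β : E3 [⋀^Fin q]→L[ℝ] ℝ) :
    E3 [⋀^Fin 3]→ₗ[ℝ] ℝ := (wedge α β).domDomCongr (finCongr h)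

theorem wedge3_eq_sum {p q : ℕ} (h : p + q = 3) (α : E3 [⋀^Fin p]→L[ℝ] ℝ)
    (β : E3 [⋀^Fin q]→L[ℝ] ℝ) (v : Fin 3 → E3) :
    wedge3 h α β v = ((p.factorial * q.factorial : ℕ) : ℝ)⁻¹ *
      ∑ σ : Equiv.Perm (Fin 3), ((Equiv.Perm.sign σ : ℤ) : ℝ) *
        (α (fun i => v (σ (Fin.cast h (Fin.castAdd q i)))) *
          β fun j => v (σ (Fin.cast h (Fin.natAdd p j)))) := by
  rw [← wedge_sum_three h, wedge3, inv_mul_cancel_left₀]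
  exact_mod_cast (Nat.mul_pos p.factorial_pos q.factorial_pos).ne'

theorem wedge3_comp {p q : ℕ} (h : p + q = 3) (α : E3 [⋀^Fin p]→L[ℝ] ℝ)
    (β : E3 [⋀^Fin q]→L[ℝ] ℝ) (L : E3 →L[ℝ] E3) (v : Fin 3 → E3) :
    wedge3 h (α.compContinuousLinearMap L) (β.compContinuousLinearMap L) v =
      wedge3 h α β (fun i => L (v i)) := by
  rw [wedge3_eq_sum, wedge3_eq_sum]
  rfl

theorem wedge3_add_left {p q : ℕ} (h : p + q = 3) (α α' : E3 [⋀^Fin p]→L[ℝ] ℝ)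
    (β : E3 [⋀^Fin q]→L[ℝ] ℝ) : wedge3 h (α + α') β = wedge3 h α β + wedge3 h α' β := by
  ext v
  rw [AlternatingMap.add_apply, wedge3_eq_sum, wedge3_eq_sum, wedge3_eq_sum, ← mul_add,
    ← Finset.sum_add_distrib]
  simp only [ContinuousAlternatingMap.add_apply, add_mul, mul_add]

theorem wedge3_add_right {p q : ℕ} (h : p + q = 3) (α : E3 [⋀^Fin p]→L[ℝ] ℝ)
    (β β' : E3 [⋀^Fin q]→L[ℝ] ℝ) : wedge3 h α (β + β') = wedge3 h α β + wedge3 h α β' := by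
  ext v
  rw [AlternatingMap.add_apply, wedge3_eq_sum, wedge3_eq_sum, wedge3_eq_sum, ← mul_add,
    ← Finset.sum_add_distrib]
  simp only [ContinuousAlternatingMap.add_apply, mul_add]

theorem wedge3_smul_left {p q : ℕ} (h : p + q = 3) (c : ℝ) (α : E3 [⋀^Fin p]→L[ℝ] ℝ)
    (β : E3 [⋀^Fin q]→L[ℝ] ℝ) : wedge3 h (c • α) β = c • wedge3 h α β := by
  ext v
  rw [AlternatingMap.smul_apply, wedge3_eq_sum, wedge3_eq_sum, smul_eq_mul, mul_left_comm]
  congr 1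
  rw [Finset.mul_sum]
  refine Finset.sum_congr rfl fun σ _ => ?_
  rw [ContinuousAlternatingMap.smul_apply, smul_eq_mul]
  ring

theorem wedge3_smul_right {p q : ℕ} (h : p + q = 3) (c : ℝ) (α : E3 [⋀^Fin p]→L[ℝ] ℝ)
    (β : E3 [⋀^Fin q]→L[ℝ] ℝ) : wedge3 h α (c • β) = c • wedge3 h α β := by
  ext v
  rw [AlternatingMap.smul_apply, wedge3_eq_sum, wedge3_eq_sum, smul_eq_mul, mul_left_comm]
  congr 1
  rw [Finset.mul_sum]
  refine Finset.sum_congr rfl fun σ _ => ?_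
  rw [ContinuousAlternatingMap.smul_apply, smul_eq_mul]
  ring

theorem wedge3_zero_left {p q : ℕ} (h : p + q = 3) (β : E3 [⋀^Fin q]→L[ℝ] ℝ) :
    wedge3 h (0 : E3 [⋀^Fin p]→L[ℝ] ℝ) β = 0 := by
  have := wedge3_smul_left h 0 (0 : E3 [⋀^Fin p]→L[ℝ] ℝ) β
  rwa [zero_smul, zero_smul] at this

theorem wedge3_zero_right {p q : ℕ} (h : p + q = 3) (α : E3 [⋀^Fin p]→L[ℝ] ℝ) :
    wedge3 h α (0 : E3 [⋀^Fin q]→L[ℝ] ℝ) = 0 := by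
  have := wedge3_smul_right h 0 α (0 : E3 [⋀^Fin q]→L[ℝ] ℝ)
  rwa [zero_smul, zero_smul] at this

/-- The wedge product with a fixed form, evaluated on fixed vectors, as a linear functional. -/
def wedgeRight {p q : ℕ} (h : p + q = 3) (α : E3 [⋀^Fin p]→L[ℝ] ℝ) (v : Fin 3 → E3) :
    E3 [⋀^Fin q]→L[ℝ] ℝ →ₗ[ℝ] ℝ where
  toFun β := wedge3 h α β v
  map_add' β β' := by rw [wedge3_add_right, AlternatingMap.add_apply]
  map_smul' c β := by rw [wedge3_smul_right, AlternatingMap.smul_apply, RingHom.id_apply]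

theorem continuousOn_wedge3 {Y : Type*} [TopologicalSpace Y] {S : Set Y} {p q : ℕ} (h : p + q = 3)
    {α : Y → E3 [⋀^Fin p]→L[ℝ] ℝ} {β : Y → E3 [⋀^Fin q]→L[ℝ] ℝ} (hα : ContinuousOn α S)
    (hβ : ContinuousOn β S) (v : Fin 3 → E3) :
    ContinuousOn (fun y => wedge3 h (α y) (β y) v) S := by
  have ev : ∀ (n : ℕ) (w : Fin n → E3) {γ : Y → E3 [⋀^Fin n]→L[ℝ] ℝ}, ContinuousOn γ S →
      ContinuousOn (fun y => γ y w) S := fun n w γ hγ =>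
    (ContinuousAlternatingMap.apply ℝ E3 ℝ w).continuous.comp_continuousOn hγ
  simp only [wedge3_eq_sum]
  refine continuousOn_const.mul (continuousOn_finsetSum _ fun σ _ => continuousOn_const.mul ?_)
  exact (ev _ _ hα).mul (ev _ _ hβ)

theorem map_swap_two (α : E3 [⋀^Fin 2]→L[ℝ] ℝ) (x y : E3) : α ![x, y] = -α ![y, x] := by
  have h := α.toAlternatingMap.map_swap ![y, x] (i := 0) (j := 1) (by decide)
  have e : ![y, x] ∘ Equiv.swap (0 : Fin 2) 1 = ![x, y] := by
    ext i; fin_cases i <;> simp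
  rw [e] at h
  exact h

theorem map_perm_three (α : E3 [⋀^Fin 3]→L[ℝ] ℝ) (v : Fin 3 → E3) (σ : Equiv.Perm (Fin 3)) :
    α (fun i => v (σ i)) = ((Equiv.Perm.sign σ : ℤ) : ℝ) * α v := by
  have h := α.toAlternatingMap.map_perm v σ
  rw [Units.smul_def, zsmul_eq_mul] at h
  exact h

theorem wedge3_zero_three (h : 0 + 3 = 3) (α : E3 [⋀^Fin 0]→L[ℝ] ℝ) (β : E3 [⋀^Fin 3]→L[ℝ] ℝ)
    (v : Fin 3 → E3) : wedge3 h α β v = α ![] * β v := by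
  rw [wedge3_eq_sum]
  have e : ∀ σ : Equiv.Perm (Fin 3), ((Equiv.Perm.sign σ : ℤ) : ℝ) *
      (α (fun i => v (σ (Fin.cast h (Fin.castAdd 3 i)))) *
        β fun j => v (σ (Fin.cast h (Fin.natAdd 0 j)))) = α ![] * β v := fun σ => by
    have e1 : (fun j => v (σ (Fin.cast h (Fin.natAdd 0 j)))) = fun j => v (σ j) := by
      funext j
      congr 2
      ext
      simp
    have e2 : ((Equiv.Perm.sign σ : ℤ) : ℝ) * ((Equiv.Perm.sign σ : ℤ) : ℝ) = 1 := by
      rw [← Int.cast_mul, ← Units.val_mul, Int.units_mul_self]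
      simp
    rw [e1, map_perm_three, Subsingleton.elim (fun i => v (σ (Fin.cast h (Fin.castAdd 3 i)))) ![]]
    linear_combination (α ![] * β v) * e2
  simp only [e, Finset.sum_const, Finset.card_univ, Fintype.card_perm, Fintype.card_fin]
  norm_num [Nat.factorial]
  ring

theorem wedge3_three_zero (h : 3 + 0 = 3) (α : E3 [⋀^Fin 3]→L[ℝ] ℝ) (β : E3 [⋀^Fin 0]→L[ℝ] ℝ)
    (v : Fin 3 → E3) : wedge3 h α β v = α v * β ![] := by
  rw [wedge3_eq_sum]
  have e : ∀ σ : Equiv.Perm (Fin 3), ((Equiv.Perm.sign σ : ℤ) : ℝ) *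
      (α (fun i => v (σ (Fin.cast h (Fin.castAdd 0 i)))) *
        β fun j => v (σ (Fin.cast h (Fin.natAdd 3 j)))) = α v * β ![] := fun σ => by
    have e1 : (fun i => v (σ (Fin.cast h (Fin.castAdd 0 i)))) = fun j => v (σ j) := rfl
    have e2 : ((Equiv.Perm.sign σ : ℤ) : ℝ) * ((Equiv.Perm.sign σ : ℤ) : ℝ) = 1 := by
      rw [← Int.cast_mul, ← Units.val_mul, Int.units_mul_self]
      simp
    rw [e1, map_perm_three, Subsingleton.elim (fun j => v (σ (Fin.cast h (Fin.natAdd 3 j)))) ![]]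
    linear_combination (α v * β ![]) * e2
  simp only [e, Finset.sum_const, Finset.card_univ, Fintype.card_perm, Fintype.card_fin]
  norm_num [Nat.factorial]
  ring

theorem wedge3_one_two (h : 1 + 2 = 3) (α : E3 [⋀^Fin 1]→L[ℝ] ℝ) (β : E3 [⋀^Fin 2]→L[ℝ] ℝ)
    (v : Fin 3 → E3) : wedge3 h α β v =
      α ![v 0] * β ![v 1, v 2] - α ![v 1] * β ![v 0, v 2] + α ![v 2] * β ![v 0, v 1] := by
  have e : ∀ σ : Equiv.Perm (Fin 3), (α (fun i => v (σ (Fin.cast h (Fin.castAdd 2 i)))) *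
      β fun j => v (σ (Fin.cast h (Fin.natAdd 1 j)))) =
      α ![v (σ 0)] * β ![v (σ 1), v (σ 2)] := fun σ => by
    congr 2
    · funext i
      fin_cases i
      rfl
    · funext i
      fin_cases i <;> rfl
  rw [wedge3_eq_sum, sum_perm_three]
  simp only [e]
  have hs : ∀ i j : Fin 3, i ≠ j → Equiv.Perm.sign (Equiv.swap i j) = -1 := fun i j =>
    Equiv.Perm.sign_swap
  simp [hs, Equiv.swap_apply_def, Nat.factorial, map_swap_two β (v 1) (v 0),
    map_swap_two β (v 2) (v 0), map_swap_two β (v 2) (v 1)]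
  ring

theorem wedge3_two_one (h : 2 + 1 = 3) (α : E3 [⋀^Fin 2]→L[ℝ] ℝ) (β : E3 [⋀^Fin 1]→L[ℝ] ℝ)
    (v : Fin 3 → E3) : wedge3 h α β v =
      α ![v 0, v 1] * β ![v 2] - α ![v 0, v 2] * β ![v 1] + α ![v 1, v 2] * β ![v 0] := by
  have e : ∀ σ : Equiv.Perm (Fin 3), (α (fun i => v (σ (Fin.cast h (Fin.castAdd 1 i)))) *
      β fun j => v (σ (Fin.cast h (Fin.natAdd 2 j)))) =
      α ![v (σ 0), v (σ 1)] * β ![v (σ 2)] := fun σ => by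
    congr 2
    · funext i
      fin_cases i <;> rfl
    · funext i
      fin_cases i
      rfl
  rw [wedge3_eq_sum, sum_perm_three]
  simp only [e]
  have hs : ∀ i j : Fin 3, i ≠ j → Equiv.Perm.sign (Equiv.swap i j) = -1 := fun i j =>
    Equiv.Perm.sign_swap
  simp [hs, Equiv.swap_apply_def, Nat.factorial, map_swap_two α (v 1) (v 0),
    map_swap_two α (v 2) (v 0), map_swap_two α (v 2) (v 1)]
  ring

/-! ### Forms of top degree -/

theorem top_form_eq (f : E3 [⋀^Fin 3]→ₗ[ℝ] ℝ) :
    f = f stdVec • ((EuclideanSpace.basisFun (Fin 3) ℝ).toBasis.det : E3 [⋀^Fin 3]→ₗ[ℝ] ℝ) := by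
  have h := f.eq_smul_basis_det (EuclideanSpace.basisFun (Fin 3) ℝ).toBasis
  have e : ⇑(EuclideanSpace.basisFun (Fin 3) ℝ).toBasis = stdVec := by
    ext i
    simp
  rwa [e] at h

theorem top_form_ext {f g : E3 [⋀^Fin 3]→ₗ[ℝ] ℝ} (h : f stdVec = g stdVec) : f = g := by
  rw [top_form_eq f, top_form_eq g, h]

theorem top_form_comp (f : E3 [⋀^Fin 3]→ₗ[ℝ] ℝ) (L : E3 →L[ℝ] E3) (v : Fin 3 → E3) :
    f (fun i => L (v i)) = L.det * f v := by
  rw [top_form_eq f, AlternatingMap.smul_apply, AlternatingMap.smul_apply]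
  have := (EuclideanSpace.basisFun (Fin 3) ℝ).toBasis.det_comp (L : E3 →ₗ[ℝ] E3) v
  rw [smul_eq_mul, smul_eq_mul, mul_left_comm]
  congr 1

theorem eq_coord_smul_three (w : E3) :
    w = w 0 • stdVec 0 + w 1 • stdVec 1 + w 2 • stdVec 2 := by
  ext i
  fin_cases i <;> simp

theorem curryLeft_eq_sum {n : ℕ} (α : E3 [⋀^Fin (n + 1)]→L[ℝ] ℝ) (w : E3) (v : Fin n → E3) :
    α.curryLeft w v = w 0 * α (Matrix.vecCons (stdVec 0) v) +
      w 1 * α (Matrix.vecCons (stdVec 1) v) + w 2 * α (Matrix.vecCons (stdVec 2) v) := by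
  conv_lhs => rw [eq_coord_smul_three w]
  simp only [map_add, map_smul]
  rfl

theorem map_rotate_three (α : E3 [⋀^Fin 3]→L[ℝ] ℝ) (x y z : E3) :
    α ![z, x, y] = α ![x, y, z] := by
  have h := map_perm_three α ![x, y, z] (Equiv.swap 1 2 * Equiv.swap 0 1)
  have e : (fun i => ![x, y, z] ((Equiv.swap (1 : Fin 3) 2 * Equiv.swap 0 1 : Equiv.Perm (Fin 3)) i)) = ![z, x, y] := by
    ext i
    fin_cases i <;> rfl
  rw [e, Equiv.Perm.sign_mul, Equiv.Perm.sign_swap (by decide), Equiv.Perm.sign_swap (by decide)] at h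
  simpa using h

theorem map_swap_three (α : E3 [⋀^Fin 3]→L[ℝ] ℝ) (x y z : E3) :
    α ![y, x, z] = -α ![x, y, z] := by
  have h := map_perm_three α ![x, y, z] (Equiv.swap 0 1)
  have e : (fun i => ![x, y, z] (Equiv.swap (0 : Fin 3) 1 i)) = ![y, x, z] := by
    ext i
    fin_cases i <;> rfl
  rw [e, Equiv.Perm.sign_swap (by decide)] at h
  simpa using h

theorem map_two_self (α : E3 [⋀^Fin 2]→L[ℝ] ℝ) (x : E3) : α ![x, x] = 0 := by
  linarith [map_swap_two α x x]

theorem map_three_self (α : E3 [⋀^Fin 3]→L[ℝ] ℝ) (x z : E3) : α ![x, x, z] = 0 := by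
  linarith [map_swap_three α x x z]

theorem map_three_self' (α : E3 [⋀^Fin 3]→L[ℝ] ℝ) (x z : E3) : α ![x, z, x] = 0 := by
  rw [map_rotate_three, map_rotate_three, map_three_self]

theorem form_eq_zero_of_four_le {n : ℕ} (hn : 4 ≤ n) (α : E3 [⋀^Fin n]→L[ℝ] ℝ) : α = 0 := by
  ext v
  refine α.toAlternatingMap.map_linearDependent v fun h => ?_
  have := h.fintype_card_le_finrank
  simp at this
  omega

/-- Contracting the (vanishing) wedge product of a `1`-form and a `3`-form on a `3`-dimensional space
with a vector. -/
theorem wedge3_contract_one_three (α : E3 [⋀^Fin 1]→L[ℝ] ℝ) (β : E3 [⋀^Fin 3]→L[ℝ] ℝ) (w : E3)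
    (h : 1 + 2 = 3) (h' : 3 + 0 = 3) :
    wedge3 h α (β.curryLeft w) = wedge3 h' β (α.curryLeft w) := by
  refine top_form_ext ?_
  have e : (stdVec : Fin 3 → E3) = ![stdVec 0, stdVec 1, stdVec 2] := by
    ext i; fin_cases i <;> rfl
  rw [wedge3_one_two, wedge3_three_zero, curryLeft_eq_sum, curryLeft_eq_sum, curryLeft_eq_sum,
    curryLeft_eq_sum, e]
  have h1 := map_three_self β (stdVec 0) (stdVec 1)
  have h2 := map_three_self β (stdVec 0) (stdVec 2)
  have h3 := map_three_self β (stdVec 1) (stdVec 2)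
  have h4 := map_three_self' β (stdVec 2) (stdVec 1)
  have h5 := map_three_self' β (stdVec 2) (stdVec 0)
  have h6 := map_three_self' β (stdVec 1) (stdVec 0)
  have h7 := map_rotate_three β (stdVec 0) (stdVec 1) (stdVec 2)
  have h8 := map_swap_three β (stdVec 0) (stdVec 1) (stdVec 2)
  change α ![stdVec 0] * (w 0 * β ![stdVec 0, stdVec 1, stdVec 2] +
      w 1 * β ![stdVec 1, stdVec 1, stdVec 2] + w 2 * β ![stdVec 2, stdVec 1, stdVec 2]) -
    α ![stdVec 1] * (w 0 * β ![stdVec 0, stdVec 0, stdVec 2] +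
      w 1 * β ![stdVec 1, stdVec 0, stdVec 2] + w 2 * β ![stdVec 2, stdVec 0, stdVec 2]) +
    α ![stdVec 2] * (w 0 * β ![stdVec 0, stdVec 0, stdVec 1] +
      w 1 * β ![stdVec 1, stdVec 0, stdVec 1] + w 2 * β ![stdVec 2, stdVec 0, stdVec 1]) =
    β ![stdVec 0, stdVec 1, stdVec 2] *
      (w 0 * α ![stdVec 0] + w 1 * α ![stdVec 1] + w 2 * α ![stdVec 2])
  rw [h1, h2, h3, h4, h5, h6, h7, h8]
  ring

/-- Contracting the (vanishing) wedge product of two `2`-forms on a `3`-dimensional space with a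
vector. -/
theorem wedge3_contract_two_two (α β : E3 [⋀^Fin 2]→L[ℝ] ℝ) (w : E3) (h : 2 + 1 = 3) :
    wedge3 h α (β.curryLeft w) = (-1 : ℝ) • wedge3 h β (α.curryLeft w) := by
  refine top_form_ext ?_
  rw [AlternatingMap.smul_apply, wedge3_two_one, wedge3_two_one]
  simp only [curryLeft_eq_sum]
  have h := fun γ : E3 [⋀^Fin 2]→L[ℝ] ℝ => And.intro (map_two_self γ (stdVec 0))
    (And.intro (map_two_self γ (stdVec 1)) (map_two_self γ (stdVec 2)))
  obtain ⟨a0, a1, a2⟩ := h α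
  obtain ⟨b0, b1, b2⟩ := h β
  simp only [a0, a1, a2, b0, b1, b2, map_swap_two _ (stdVec 1) (stdVec 0),
    map_swap_two _ (stdVec 2) (stdVec 0), map_swap_two _ (stdVec 2) (stdVec 1), smul_eq_mul]
  ring

end BulkBoundary

end

section

open BulkBoundary

/-! ### Densities of top forms in charts -/

/-- The density of a `3`-form in the chart at `i`. -/
def dens (χ : M → E3 [⋀^Fin 3]→ₗ[ℝ] ℝ) (i : M) (y : E3) : ℝ :=
  χ ((extChartAt (𝓡∂ 3) i).symm y) fun j => coordDeriv (𝓡∂ 3) i y (stdVec j)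

theorem measurableSet_target (i : M) : MeasurableSet (extChartAt (𝓡∂ 3) i).target := by
  rw [extChartAt_target]
  exact ((chartAt _ i).open_target.preimage (𝓡∂ 3).continuous_symm).measurableSet.inter
    (𝓡∂ 3).isClosed_range.measurableSet

theorem ContinuousOn.measurableSet_inter_preimage {Y : Type*} [TopologicalSpace Y] {f : E3 → Y}
    {S : Set E3} (hf : ContinuousOn f S) (hS : MeasurableSet S) {V : Set Y} (hV : IsOpen V) :
    MeasurableSet (S ∩ f ⁻¹' V) := by
  obtain ⟨u, hu, h⟩ := continuousOn_iff'.mp hf V hV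
  rw [inter_comm, h]
  exact hu.measurableSet.inter hS

theorem ContinuousLinearMap.det_ne_zero_of_comp {C R : E3 →L[ℝ] E3}
    (h : C.comp R = ContinuousLinearMap.id ℝ E3) : C.det ≠ 0 := by
  have h1 : (C : E3 →ₗ[ℝ] E3) ∘ₗ (R : E3 →ₗ[ℝ] E3) = LinearMap.id := by
    ext v
    exact congrArg (fun L : E3 →L[ℝ] E3 => L v _) h
  have h2 := congrArg LinearMap.det h1
  rw [LinearMap.det_comp, LinearMap.det_id] at h2
  exact left_ne_zero_of_mul_eq_one h2

section

variable [IsManifold (𝓡∂ 3) ∞ M]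

theorem det_coordDeriv_ne_zero {i : M} {y : E3} (hy : y ∈ (extChartAt (𝓡∂ 3) i).target) :
    (coordDeriv (𝓡∂ 3) i y).det ≠ 0 := by
  set x := (extChartAt (𝓡∂ 3) i).symm y with hx
  have h := coordDeriv_change (I := 𝓡∂ 3) (x₀ := x) (x₁ := i) (mem_extChartAt_target x)
    (by rw [extChartAt_to_inv]; exact (extChartAt (𝓡∂ 3) i).map_target hy)
  rw [coordDeriv_self, extChartAt_to_inv, hx, (extChartAt (𝓡∂ 3) i).right_inv hy] at h
  exact ContinuousLinearMap.det_ne_zero_of_comp h.symm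

variable (X) in
/-- The sign of the orientation in the chart at `i`. -/
def osgn (i : M) (y : E3) : ℝ := (SignType.sign (localRep (𝓡∂ 3) X.orient i y stdVec) : ℝ)

variable (X) in
omit [IsManifold (𝓡∂ 3) ∞ M] in
theorem orient_ne_zero' (x : M) : X.orient x stdVec ≠ 0 := by
  intro h
  apply X.orient_ne_zero x
  have h1 : (X.orient x).toAlternatingMap = 0 := by
    rw [top_form_eq (X.orient x).toAlternatingMap]
    have : (X.orient x).toAlternatingMap stdVec = 0 := h
    rw [this, zero_smul]
  ext v
  exact congrArg (fun L : E3 [⋀^Fin 3]→ₗ[ℝ] ℝ => L v) h1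

variable (X) in
theorem localRep_orient_ne_zero {i : M} {y : E3} (hy : y ∈ (extChartAt (𝓡∂ 3) i).target) :
    localRep (𝓡∂ 3) X.orient i y stdVec ≠ 0 := by
  have h := top_form_comp (X.orient ((extChartAt (𝓡∂ 3) i).symm y)).toAlternatingMap
    (coordDeriv (𝓡∂ 3) i y) stdVec
  refine ne_of_eq_of_ne h (mul_ne_zero (det_coordDeriv_ne_zero hy) (orient_ne_zero' X _))

variable (X) in
theorem continuousOn_osgn (i : M) : ContinuousOn (osgn X i) (extChartAt (𝓡∂ 3) i).target := by
  have h1 : ContinuousOn (fun y => localRep (𝓡∂ 3) X.orient i y stdVec)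
      (extChartAt (𝓡∂ 3) i).target :=
    (ContinuousAlternatingMap.apply ℝ E3 ℝ stdVec).continuous.comp_continuousOn
      (X.orient_smooth i).continuousOn
  intro y hy
  have h2 : ContinuousAt (fun r : ℝ => (SignType.sign r : ℝ))
      (localRep (𝓡∂ 3) X.orient i y stdVec) :=
    (continuous_of_discreteTopology (f := ((↑) : SignType → ℝ))).continuousAt.comp
      (continuousAt_sign_of_ne_zero (localRep_orient_ne_zero X hy))
  exact ContinuousAt.comp_continuousWithinAt (g := fun r : ℝ => (SignType.sign r : ℝ))
    (f := fun y => localRep (𝓡∂ 3) X.orient i y stdVec) h2 (h1 y hy)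

end

namespace BulkFlow

/-- The pullback of a `3`-form along the flow. -/
def actPull3 (s : ℝ) (χ : M → E3 [⋀^Fin 3]→ₗ[ℝ] ℝ) (x : M) : E3 [⋀^Fin 3]→ₗ[ℝ] ℝ :=
  (χ (F.act s x)).compLinearMap (F.dact s x)

theorem det_dact_ne_zero (s : ℝ) (x : M) : (F.dact s x).det ≠ 0 := by
  have h := F.dact_add s (-s) (F.act s x)
  rw [add_neg_cancel, dact_zero, act_neg_act] at h
  exact ContinuousLinearMap.det_ne_zero_of_comp h.symm

variable [IsManifold (𝓡∂ 3) ∞ M]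

/-- The flow preserves the orientation, since it is connected to the identity. -/
theorem det_dact_mul_pos (s : ℝ) (x : M) :
    0 < (F.dact s x).det * X.orient (F.act s x) stdVec * X.orient x stdVec := by
  have hc : Continuous fun t => F.actPull t X.orient x stdVec * X.orient x stdVec :=
    ((ContinuousAlternatingMap.apply ℝ E3 ℝ stdVec).continuous.comp
      (F.continuous_actPull X.orient_smooth x)).mul continuous_const
  have he : ∀ t, F.actPull t X.orient x stdVec = (F.dact t x).det * X.orient (F.act t x) stdVec :=
    fun t => top_form_comp (X.orient (F.act t x)).toAlternatingMap (F.dact t x) stdVec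
  have hne : ∀ t, F.actPull t X.orient x stdVec * X.orient x stdVec ≠ 0 := fun t => by
    rw [he]
    exact mul_ne_zero (mul_ne_zero (F.det_dact_ne_zero t x) (orient_ne_zero' X _))
      (orient_ne_zero' X _)
  have h0 : 0 < F.actPull 0 X.orient x stdVec * X.orient x stdVec := by
    rw [actPull_zero]
    exact mul_self_pos.mpr (orient_ne_zero' X x)
  rw [← he]
  by_contra hlt
  obtain ⟨t, ht⟩ := intermediate_value_univ s 0 hc (show (0 : ℝ) ∈ Icc _ _ from
    ⟨not_lt.mp hlt, h0.le⟩)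
  exact hne t ht

/-- The expression of the flow in charts. -/
def actChart (s : ℝ) (i j : M) (y : E3) : E3 :=
  extChartAt (𝓡∂ 3) j (F.act s ((extChartAt (𝓡∂ 3) i).symm y))

/-- The set on which the expression of the flow in charts is meaningful. -/
def actChartSource (s : ℝ) (i j : M) : Set E3 :=
  (extChartAt (𝓡∂ 3) i).target ∩
    (fun y => F.act s ((extChartAt (𝓡∂ 3) i).symm y)) ⁻¹' (extChartAt (𝓡∂ 3) j).source

omit [IsManifold (𝓡∂ 3) ∞ M] in
theorem measurableSet_actChartSource (s : ℝ) (i j : M) :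
    MeasurableSet (F.actChartSource s i j) :=
  ContinuousOn.measurableSet_inter_preimage
    ((F.act_contMDiff s).continuous.comp_continuousOn (continuousOn_extChartAt_symm i))
    (measurableSet_target i) (isOpen_extChartAt_source j)

theorem hasFDerivWithinAt_actChart {s : ℝ} {i j : M} {y : E3} (hy : y ∈ F.actChartSource s i j) :
    HasFDerivWithinAt (F.actChart s i j) (fderivWithin ℝ (F.actChart s i j) (range (𝓡∂ 3)) y)
      (F.actChartSource s i j) y := by
  have hf : ContMDiffOn 𝓘(ℝ, E3) (𝓡∂ 3) ∞ (F.act s ∘ (extChartAt (𝓡∂ 3) i).symm)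
      (extChartAt (𝓡∂ 3) i).target :=
    (F.act_contMDiff s).comp_contMDiffOn (contMDiffOn_extChartAt_symm i)
  have h := hf.contDiffWithinAt_extChartAt_comp (extChartAt_target_mem_nhdsWithin_of_mem hy.1)
    hy.1 hy.2
  exact ((h.differentiableWithinAt (by simp)).hasFDerivWithinAt).mono
    (inter_subset_left.trans (extChartAt_target_subset_range i))

theorem dact_comp_coordDeriv {s : ℝ} {i j : M} {y : E3} (hy : y ∈ F.actChartSource s i j) :
    (F.dact s ((extChartAt (𝓡∂ 3) i).symm y)).comp (coordDeriv (𝓡∂ 3) i y) =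
      (coordDeriv (𝓡∂ 3) j (F.actChart s i j y)).comp
        (fderivWithin ℝ (F.actChart s i j) (range (𝓡∂ 3)) y) := by
  have hyr : y ∈ range (𝓡∂ 3) := extChartAt_target_subset_range i hy.1
  have : IsManifold (𝓡∂ 3) 1 M := .of_le (n := ∞) (by simp)
  have h2 := mfderivWithin_comp (g := F.act s) (f := (extChartAt (𝓡∂ 3) i).symm)
    (s := range (𝓡∂ 3)) (u := univ) y
    ((F.act_mdifferentiableAt s _).mdifferentiableWithinAt)
    (mdifferentiableWithinAt_extChartAt_symm hy.1) (mapsTo_univ _ _)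
    ((𝓡∂ 3).uniqueDiffOn y hyr).uniqueMDiffWithinAt
  rw [mfderivWithin_univ] at h2
  have h3 := derivOn_eq (f := F.act s ∘ (extChartAt (𝓡∂ 3) i).symm) (S := range (𝓡∂ 3))
    ((𝓡∂ 3).uniqueDiffOn y hyr) hyr
    ((F.act_mdifferentiableAt s _).comp_mdifferentiableWithinAt y
      (mdifferentiableWithinAt_extChartAt_symm hy.1)) (x₁ := j) hy.2
  exact Eq.trans h2.symm h3

theorem dens_actPull3 (χ : M → E3 [⋀^Fin 3]→ₗ[ℝ] ℝ) {s : ℝ} {i j : M} {y : E3}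
    (hy : y ∈ F.actChartSource s i j) :
    dens (F.actPull3 s χ) i y = (fderivWithin ℝ (F.actChart s i j) (range (𝓡∂ 3)) y).det *
      dens χ j (F.actChart s i j y) := by
  have hs : (extChartAt (𝓡∂ 3) j).symm (F.actChart s i j y) =
      F.act s ((extChartAt (𝓡∂ 3) i).symm y) := (extChartAt (𝓡∂ 3) j).left_inv hy.2
  rw [dens, dens, hs, actPull3]
  have h1 := top_form_comp ((χ (F.act s ((extChartAt (𝓡∂ 3) i).symm y))).compLinearMap
    (coordDeriv (𝓡∂ 3) j (F.actChart s i j y)))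
    (fderivWithin ℝ (F.actChart s i j) (range (𝓡∂ 3)) y) stdVec
  refine Eq.trans ?_ h1
  change (χ _) (fun k => _) = (χ _) (fun k => _)
  congr 1
  funext k
  exact congrArg (fun L : E3 →L[ℝ] E3 => L (stdVec k)) (F.dact_comp_coordDeriv hy)

/-- The flow preserves the orientation, so the sign of its Jacobian in charts is the product of the signs
of the orientation in the charts. -/
theorem osgn_mul_det {s : ℝ} {i j : M} {y : E3} (hy : y ∈ F.actChartSource s i j) :
    osgn X i y * (fderivWithin ℝ (F.actChart s i j) (range (𝓡∂ 3)) y).det =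
      |(fderivWithin ℝ (F.actChart s i j) (range (𝓡∂ 3)) y).det| *
        osgn X j (F.actChart s i j y) := by
  set D := (fderivWithin ℝ (F.actChart s i j) (range (𝓡∂ 3)) y).det with hD
  set x := (extChartAt (𝓡∂ 3) i).symm y with hx
  have hs : (extChartAt (𝓡∂ 3) j).symm (F.actChart s i j y) = F.act s x :=
    (extChartAt (𝓡∂ 3) j).left_inv hy.2
  have h1 : localRep (𝓡∂ 3) X.orient i y stdVec =
      (coordDeriv (𝓡∂ 3) i y).det * X.orient x stdVec :=
    top_form_comp (X.orient x).toAlternatingMap (coordDeriv (𝓡∂ 3) i y) stdVec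
  have h2 : localRep (𝓡∂ 3) X.orient j (F.actChart s i j y) stdVec =
      (coordDeriv (𝓡∂ 3) j (F.actChart s i j y)).det * X.orient (F.act s x) stdVec := by
    have := top_form_comp (X.orient (F.act s x)).toAlternatingMap
      (coordDeriv (𝓡∂ 3) j (F.actChart s i j y)) stdVec
    refine Eq.trans ?_ this
    rw [localRep, hs]
    rfl
  have hdet : ∀ A B : E3 →L[ℝ] E3, (A.comp B).det = A.det * B.det := fun A B =>
    LinearMap.det_comp (A : E3 →ₗ[ℝ] E3) B
  have h3 := congrArg ContinuousLinearMap.det (F.dact_comp_coordDeriv hy)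
  rw [hdet, hdet, ← hD, ← hx] at h3
  have h4 := F.det_dact_mul_pos s x
  rw [osgn, osgn, h1, h2]
  set a := (coordDeriv (𝓡∂ 3) i y).det
  set b := (coordDeriv (𝓡∂ 3) j (F.actChart s i j y)).det
  set c := (F.dact s x).det
  set o := X.orient x stdVec
  set o' := X.orient (F.act s x) stdVec
  have ha : a ≠ 0 := det_coordDeriv_ne_zero hy.1
  have hc : c ≠ 0 := F.det_dact_ne_zero s x
  have hb : b ≠ 0 := fun h => by
    rw [h, zero_mul] at h3
    exact mul_ne_zero hc ha h3
  have key : (SignType.sign (a * o) : SignType) * SignType.sign D = SignType.sign (b * o') := by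
    rw [← sign_mul]
    have h5 : 0 < (a * o * D) * (b * o') := by
      have : (a * o * D) * (b * o') = a ^ 2 * (c * o' * o) := by linear_combination (-a * o * o') * h3
      rw [this]
      positivity
    rcases pos_and_pos_or_neg_and_neg_of_mul_pos h5 with ⟨h6, h7⟩ | ⟨h6, h7⟩
    · rw [sign_pos h6, sign_pos h7]
    · rw [sign_neg h6, sign_neg h7]
  rw [← key, SignType.coe_mul]
  have h6 : (SignType.sign D : ℝ) * |D| = D := sign_mul_abs D
  linear_combination (-(SignType.sign (a * o) : ℝ)) * h6

/-- The transformation formula for the flow in charts. -/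
theorem integral_target_actPull3 (s : ℝ) (i j : M) {h : M → ℝ}
    (hh : ∀ x, h x ≠ 0 → x ∈ (extChartAt (𝓡∂ 3) i).source) {χ : M → E3 [⋀^Fin 3]→ₗ[ℝ] ℝ}
    (hχ : ∀ x, χ x ≠ 0 → x ∈ (extChartAt (𝓡∂ 3) j).source) :
    ∫ y in (extChartAt (𝓡∂ 3) i).target, osgn X i y *
        (h ((extChartAt (𝓡∂ 3) i).symm y) * dens (F.actPull3 s χ) i y) =
      ∫ z in (extChartAt (𝓡∂ 3) j).target, osgn X j z *
        (h (F.act (-s) ((extChartAt (𝓡∂ 3) j).symm z)) * dens χ j z) := by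
  set A := F.actChartSource s i j with hA
  set Φ := F.actChart s i j with hΦ
  have hsymm : ∀ y ∈ A, (extChartAt (𝓡∂ 3) j).symm (Φ y) =
      F.act s ((extChartAt (𝓡∂ 3) i).symm y) := fun y hy => (extChartAt (𝓡∂ 3) j).left_inv hy.2
  have hinj : InjOn Φ A := fun y hy y' hy' h => by
    have h1 := congrArg (fun z => F.act (-s) ((extChartAt (𝓡∂ 3) j).symm z)) h
    simp only [hsymm y hy, hsymm y' hy', act_neg_act] at h1
    exact (extChartAt (𝓡∂ 3) i).symm.injOn hy.1 hy'.1 h1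
  have hsub : Φ '' A ⊆ (extChartAt (𝓡∂ 3) j).target := by
    rintro _ ⟨y, hy, rfl⟩
    exact (extChartAt (𝓡∂ 3) j).map_source hy.2
  have e1 : ∫ y in (extChartAt (𝓡∂ 3) i).target, osgn X i y *
        (h ((extChartAt (𝓡∂ 3) i).symm y) * dens (F.actPull3 s χ) i y) =
      ∫ y in A, osgn X i y *
        (h ((extChartAt (𝓡∂ 3) i).symm y) * dens (F.actPull3 s χ) i y) := by
    refine setIntegral_eq_of_subset_of_forall_sdiff_eq_zero (measurableSet_target i)
      inter_subset_left fun y hy => ?_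
    have : χ (F.act s ((extChartAt (𝓡∂ 3) i).symm y)) = 0 := by
      by_contra hne
      exact hy.2 ⟨hy.1, hχ _ hne⟩
    rw [dens, actPull3, this]
    simp
  have e2 : ∫ z in (extChartAt (𝓡∂ 3) j).target, osgn X j z *
        (h (F.act (-s) ((extChartAt (𝓡∂ 3) j).symm z)) * dens χ j z) =
      ∫ z in Φ '' A, osgn X j z *
        (h (F.act (-s) ((extChartAt (𝓡∂ 3) j).symm z)) * dens χ j z) := by
    refine setIntegral_eq_of_subset_of_forall_sdiff_eq_zero (measurableSet_target j) hsub
      fun z hz => ?_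
    have : h (F.act (-s) ((extChartAt (𝓡∂ 3) j).symm z)) = 0 := by
      by_contra hne
      have h1 := hh _ hne
      refine hz.2 ⟨extChartAt (𝓡∂ 3) i (F.act (-s) ((extChartAt (𝓡∂ 3) j).symm z)),
        ⟨(extChartAt (𝓡∂ 3) i).map_source h1, ?_⟩, ?_⟩
      · change F.act s ((extChartAt (𝓡∂ 3) i).symm _) ∈ (extChartAt (𝓡∂ 3) j).source
        rw [(extChartAt (𝓡∂ 3) i).left_inv h1, act_act_neg]
        exact (extChartAt (𝓡∂ 3) j).map_target hz.1
      · rw [hΦ, actChart, (extChartAt (𝓡∂ 3) i).left_inv h1, act_act_neg]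
        exact (extChartAt (𝓡∂ 3) j).right_inv hz.1
    rw [this]
    simp
  rw [e1, e2, integral_image_eq_integral_abs_det_fderiv_smul volume
    (F.measurableSet_actChartSource s i j) (fun y hy => F.hasFDerivWithinAt_actChart hy) hinj]
  refine setIntegral_congr_fun (F.measurableSet_actChartSource s i j) fun y hy => ?_
  have h1 := F.osgn_mul_det hy
  have h2 : F.act (-s) ((extChartAt (𝓡∂ 3) j).symm (F.actChart s i j y)) =
      (extChartAt (𝓡∂ 3) i).symm y := by
    rw [← hΦ, hsymm y hy, act_neg_act]
  simp only [smul_eq_mul]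
  rw [F.dens_actPull3 χ hy, h2]
  linear_combination (h ((extChartAt (𝓡∂ 3) i).symm y) * dens χ j (F.actChart s i j y)) * h1

end BulkFlow

end

section

open BulkBoundary

/-! ### Integration of top forms -/

theorem integrableOn_of_continuousOn_of_eq_zero {α : Type*} [TopologicalSpace α] [MeasurableSpace α]
    [OpensMeasurableSpace α] [T2Space α] {μ : Measure α} [IsFiniteMeasureOnCompacts μ]
    {g : α → ℝ} {S C : Set α} (hS : MeasurableSet S) (hC : IsCompact C) (hCS : C ⊆ S)
    (hg : ContinuousOn g S) (h0 : ∀ x ∈ S \ C, g x = 0) : IntegrableOn g S μ :=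
  ((hg.mono hCS).integrableOn_compact hC).of_forall_sdiff_eq_zero hS h0

/-- A `3`-form with continuous densities in all charts. -/
def ContDens (χ : M → E3 [⋀^Fin 3]→ₗ[ℝ] ℝ) : Prop :=
  ∀ i, ContinuousOn (dens χ i) (extChartAt (𝓡∂ 3) i).target

variable (X) in
/-- The integral of the product of a function and a `3`-form over the domain of the chart at `i`. -/
def chartIntegral (i : M) (h : M → ℝ) (χ : M → E3 [⋀^Fin 3]→ₗ[ℝ] ℝ) : ℝ :=
  ∫ y in (extChartAt (𝓡∂ 3) i).target,
    osgn X i y * (h ((extChartAt (𝓡∂ 3) i).symm y) * dens χ i y)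

theorem dens_add (χ χ' : M → E3 [⋀^Fin 3]→ₗ[ℝ] ℝ) (i : M) (y : E3) :
    dens (χ + χ') i y = dens χ i y + dens χ' i y := rfl

theorem dens_eq_zero {χ : M → E3 [⋀^Fin 3]→ₗ[ℝ] ℝ} {i : M} {y : E3}
    (h : χ ((extChartAt (𝓡∂ 3) i).symm y) = 0) : dens χ i y = 0 := by
  rw [dens, h]
  rfl

theorem ContDens.add {χ χ' : M → E3 [⋀^Fin 3]→ₗ[ℝ] ℝ} (h : ContDens χ) (h' : ContDens χ') :
    ContDens (χ + χ') := fun i => (h i).add (h' i)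

theorem ContDens.smul (c : ℝ) {χ : M → E3 [⋀^Fin 3]→ₗ[ℝ] ℝ} (h : ContDens χ) :
    ContDens (c • χ) := fun i => continuousOn_const.mul (h i)

theorem ContDens.fun_smul {f : M → ℝ} (hf : Continuous f) {χ : M → E3 [⋀^Fin 3]→ₗ[ℝ] ℝ}
    (h : ContDens χ) : ContDens (fun x => f x • χ x) := fun i =>
  (hf.comp_continuousOn (continuousOn_extChartAt_symm i)).mul (h i)

theorem contDens_zero : ContDens (0 : M → E3 [⋀^Fin 3]→ₗ[ℝ] ℝ) :=
  fun _ => continuousOn_const (c := (0 : ℝ))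

variable [IsManifold (𝓡∂ 3) ∞ M]

/-- Integrands supported in a compact subset of a chart domain are continuous on the chart image and
vanish off a compact set. -/
theorem integrableOn_chart {i : M} {h : M → ℝ} (hh : Continuous h)
    {χ : M → E3 [⋀^Fin 3]→ₗ[ℝ] ℝ} (hχ : ContDens χ) {K : Set M} (hK : IsCompact K)
    (hKi : K ⊆ (extChartAt (𝓡∂ 3) i).source) (h0 : ∀ x, x ∉ K → h x = 0 ∨ χ x = 0) :
    IntegrableOn (fun y => osgn X i y * (h ((extChartAt (𝓡∂ 3) i).symm y) * dens χ i y))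
      (extChartAt (𝓡∂ 3) i).target := by
  refine integrableOn_of_continuousOn_of_eq_zero (measurableSet_target i)
    (hK.image_of_continuousOn ((continuousOn_extChartAt i).mono hKi))
    ((image_mono hKi).trans (extChartAt (𝓡∂ 3) i).image_source_eq_target.le) ?_ ?_
  · exact (continuousOn_osgn X i).mul
      ((hh.comp_continuousOn (continuousOn_extChartAt_symm i)).mul (hχ i))
  · intro y hy
    have hn : (extChartAt (𝓡∂ 3) i).symm y ∉ K := fun hm =>
      hy.2 ⟨_, hm, (extChartAt (𝓡∂ 3) i).right_inv hy.1⟩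
    rcases h0 _ hn with h | h
    · rw [h, zero_mul, mul_zero]
    · rw [dens_eq_zero h, mul_zero, mul_zero]

variable [T2Space M] [SigmaCompactSpace M]

theorem tsupport_chartPartition (i : M) :
    tsupport (chartPartition M i) ⊆ (extChartAt (𝓡∂ 3) i).source := by
  rw [extChartAt_source]
  exact (SmoothPartitionOfUnity.exists_isSubordinate_chartAt_source (𝓡∂ 3) M).choose_spec i

theorem mem_source_of_chartPartition_ne_zero {i x : M} (h : chartPartition M i x ≠ 0) :
    x ∈ (extChartAt (𝓡∂ 3) i).source :=
  tsupport_chartPartition i (subset_tsupport _ h)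

theorem continuous_chartPartition (i : M) : Continuous (chartPartition M i) :=
  (chartPartition M i).contMDiff.continuous

/-- The (finitely many) indices of the partition of unity which matter on a compact set. -/
def activeCharts {K : Set M} (hK : IsCompact K) : Finset M :=
  ((chartPartition M).locallyFinite.finite_nonempty_inter_compact hK).toFinset

theorem chartPartition_eq_zero {K : Set M} (hK : IsCompact K) {i x : M} (hx : x ∈ K)
    (hi : i ∉ activeCharts hK) : chartPartition M i x = 0 := by
  by_contra hne
  exact hi (by simpa [activeCharts] using ⟨x, hne, hx⟩)

theorem sum_chartPartition {K : Set M} (hK : IsCompact K) {x : M} (hx : x ∈ K) :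
    ∑ i ∈ activeCharts hK, chartPartition M i x = 1 := by
  rw [← (chartPartition M).sum_eq_one (mem_univ x)]
  refine (finsum_eq_sum_of_support_subset _ fun i hi => ?_).symm
  by_contra hn
  exact hi (chartPartition_eq_zero hK hx hn)

theorem integral_eq_sum {K : Set M} (hK : IsCompact K) {χ : M → E3 [⋀^Fin 3]→ₗ[ℝ] ℝ}
    (h0 : ∀ x, x ∉ K → χ x = 0) :
    X.integral χ = ∑ i ∈ activeCharts hK, chartIntegral X i (chartPartition M i) χ := by
  refine finsum_eq_sum_of_support_subset _ fun i hi => ?_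
  by_contra hn
  refine hi (Eq.trans (integral_congr_ae (g := fun _ => (0 : ℝ)) (Eventually.of_forall fun y => ?_))
    (by simp))
  change osgn X i y * (chartPartition M i ((extChartAt (𝓡∂ 3) i).symm y) * dens χ i y) = 0
  by_cases hy : (extChartAt (𝓡∂ 3) i).symm y ∈ K
  · rw [chartPartition_eq_zero hK hy hn, zero_mul, mul_zero]
  · rw [dens_eq_zero (h0 _ hy), mul_zero, mul_zero]

theorem integral_zero : X.integral 0 = 0 := by
  rw [integral_eq_sum isCompact_empty (χ := 0) (fun _ _ => rfl)]
  simp [activeCharts]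

theorem integrableOn_chartPartition {i : M} {χ : M → E3 [⋀^Fin 3]→ₗ[ℝ] ℝ} (hχ : ContDens χ)
    {K : Set M} (hK : IsCompact K) (h0 : ∀ x, x ∉ K → χ x = 0) :
    IntegrableOn (fun y => osgn X i y *
      (chartPartition M i ((extChartAt (𝓡∂ 3) i).symm y) * dens χ i y))
      (extChartAt (𝓡∂ 3) i).target := by
  refine integrableOn_chart (continuous_chartPartition i) hχ
    (K := tsupport (chartPartition M i) ∩ K) (hK.inter_left (isClosed_tsupport _))
    (inter_subset_left.trans (tsupport_chartPartition i)) fun x hx => ?_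
  by_cases h : x ∈ K
  · exact .inl (image_eq_zero_of_notMem_tsupport fun hm => hx ⟨hm, h⟩)
  · exact .inr (h0 x h)

theorem integral_add {K : Set M} (hK : IsCompact K) {χ χ' : M → E3 [⋀^Fin 3]→ₗ[ℝ] ℝ}
    (hχ : ContDens χ) (hχ' : ContDens χ') (h0 : ∀ x, x ∉ K → χ x = 0) (h0' : ∀ x, x ∉ K → χ' x = 0) :
    X.integral (χ + χ') = X.integral χ + X.integral χ' := by
  rw [integral_eq_sum hK h0, integral_eq_sum hK h0', integral_eq_sum hK (χ := χ + χ')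
    (fun x hx => by rw [Pi.add_apply, h0 x hx, h0' x hx, add_zero]), ← Finset.sum_add_distrib]
  refine Finset.sum_congr rfl fun i _ => ?_
  rw [chartIntegral, chartIntegral, chartIntegral, ← MeasureTheory.integral_add
    (integrableOn_chartPartition hχ hK h0) (integrableOn_chartPartition hχ' hK h0')]
  refine integral_congr_ae (Eventually.of_forall fun y => ?_)
  simp only [dens_add]
  ring

theorem integral_smul' (c : ℝ) (χ : M → E3 [⋀^Fin 3]→ₗ[ℝ] ℝ) :
    X.integral (c • χ) = c * X.integral χ := by
  rw [BulkBoundary.integral, BulkBoundary.integral, ← smul_eq_mul, smul_finsum]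
  refine finsum_congr fun i => ?_
  rw [← integral_smul]
  refine integral_congr_ae (Eventually.of_forall fun y => ?_)
  simp only [Pi.smul_apply, AlternatingMap.smul_apply, smul_eq_mul]
  ring

theorem integral_sum {ι : Type*} {K : Set M} (hK : IsCompact K) (J : Finset ι)
    {χ : ι → M → E3 [⋀^Fin 3]→ₗ[ℝ] ℝ} (hχ : ∀ j, ContDens (χ j))
    (h0 : ∀ j x, x ∉ K → χ j x = 0) :
    X.integral (∑ j ∈ J, χ j) = ∑ j ∈ J, X.integral (χ j) := by
  classical
  have key : ContDens (∑ j ∈ J, χ j) ∧ (∀ x, x ∉ K → (∑ j ∈ J, χ j) x = 0) ∧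
      X.integral (∑ j ∈ J, χ j) = ∑ j ∈ J, X.integral (χ j) := by
    induction J using Finset.induction_on with
    | empty => exact ⟨contDens_zero, fun _ _ => rfl, integral_zero⟩
    | insert j J hj ih =>
      rw [Finset.sum_insert hj, Finset.sum_insert hj]
      exact ⟨(hχ j).add ih.1, fun x hx => by rw [Pi.add_apply, h0 j x hx, ih.2.1 x hx, add_zero],
        by rw [integral_add hK (hχ j) ih.1 (h0 j) ih.2.1, ih.2.2]⟩
  exact key.2.2

namespace BulkFlow

/-- The integral of the pullback along the flow of a form supported in a chart domain. -/
theorem integral_actPull3_of_subset_source (s : ℝ) {j : M} {K : Set M} (hK : IsCompact K)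
    (hKj : K ⊆ (extChartAt (𝓡∂ 3) j).source) {χ : M → E3 [⋀^Fin 3]→ₗ[ℝ] ℝ} (hχ : ContDens χ)
    (h0 : ∀ x, x ∉ K → χ x = 0) :
    X.integral (F.actPull3 s χ) =
      ∫ z in (extChartAt (𝓡∂ 3) j).target, osgn X j z * dens χ j z := by
  have hK' : IsCompact (F.act (-s) '' K) := hK.image (F.act_contMDiff (-s)).continuous
  have h0' : ∀ x, x ∉ F.act (-s) '' K → F.actPull3 s χ x = 0 := fun x hx => by
    rw [actPull3, h0 _ fun hm => hx ⟨_, hm, F.act_neg_act s x⟩]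
    rfl
  rw [integral_eq_sum hK' h0']
  have e : ∀ i, chartIntegral X i (chartPartition M i) (F.actPull3 s χ) =
      ∫ z in (extChartAt (𝓡∂ 3) j).target, osgn X j z *
        (chartPartition M i (F.act (-s) ((extChartAt (𝓡∂ 3) j).symm z)) * dens χ j z) := fun i =>
    F.integral_target_actPull3 s i j (fun x hx => mem_source_of_chartPartition_ne_zero hx)
      fun x hx => hKj (by_contra fun hn => hx (h0 x hn))
  simp only [e]
  rw [← integral_finsetSum]
  · refine integral_congr_ae (Eventually.of_forall fun z => ?_)
    simp only
    rw [← Finset.mul_sum, ← Finset.sum_mul]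
    by_cases hz : (extChartAt (𝓡∂ 3) j).symm z ∈ K
    · rw [sum_chartPartition hK' ⟨_, hz, rfl⟩, one_mul]
    · rw [dens_eq_zero (h0 _ hz), mul_zero]
  · intro i _
    exact integrableOn_chart (h := fun x => chartPartition M i (F.act (-s) x))
      ((continuous_chartPartition i).comp (F.act_contMDiff (-s)).continuous) hχ hK hKj
      fun x hx => .inr (h0 x hx)

/-- Integrals are invariant under the flow. -/
theorem integral_actPull3 (s : ℝ) {K : Set M} (hK : IsCompact K) {χ : M → E3 [⋀^Fin 3]→ₗ[ℝ] ℝ}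
    (hχ : ContDens χ) (hχ' : ContDens (F.actPull3 s χ)) (h0 : ∀ x, x ∉ K → χ x = 0) :
    X.integral (F.actPull3 s χ) = X.integral χ := by
  -- decompose `χ`, rather than its pullback, by the partition of unity
  have hK' : IsCompact (F.act (-s) '' K) := hK.image (F.act_contMDiff (-s)).continuous
  have e : F.actPull3 s χ = ∑ j ∈ activeCharts hK,
      F.actPull3 s (fun x => chartPartition M j x • χ x) := by
    funext x
    rw [Finset.sum_apply]
    change _ = ∑ j ∈ activeCharts hK, chartPartition M j (F.act s x) • F.actPull3 s χ x
    by_cases hx : F.act s x ∈ K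
    · rw [← Finset.sum_smul, sum_chartPartition hK hx, one_smul]
    · have : F.actPull3 s χ x = 0 := by
        rw [actPull3, h0 _ hx]
        rfl
      simp [this]
  rw [e, integral_sum hK', integral_eq_sum hK h0]
  · refine Finset.sum_congr rfl fun j _ => ?_
    refine F.integral_actPull3_of_subset_source s (j := j)
      (hK.inter_left (isClosed_tsupport (chartPartition M j)))
      (inter_subset_left.trans (tsupport_chartPartition j))
      (hχ.fun_smul (continuous_chartPartition j)) fun x hx => ?_
    by_cases h : x ∈ K
    · rw [image_eq_zero_of_notMem_tsupport fun hm => hx ⟨hm, h⟩, zero_smul]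
    · rw [h0 x h, smul_zero]
  · intro j
    exact hχ'.fun_smul ((continuous_chartPartition j).comp (F.act_contMDiff s).continuous)
  · intro j x hx
    change chartPartition M j (F.act s x) • F.actPull3 s χ x = 0
    rw [actPull3, h0 _ fun hm => hx ⟨_, hm, F.act_neg_act s x⟩]
    exact smul_zero _

include F in
/-- The integral of a form supported in a chart domain. -/
theorem integral_eq_of_subset_source {j : M} {K : Set M} (hK : IsCompact K)
    (hKj : K ⊆ (extChartAt (𝓡∂ 3) j).source) {χ : M → E3 [⋀^Fin 3]→ₗ[ℝ] ℝ} (hχ : ContDens χ)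
    (h0 : ∀ x, x ∉ K → χ x = 0) :
    X.integral χ = ∫ z in (extChartAt (𝓡∂ 3) j).target, osgn X j z * dens χ j z := by
  rw [← F.integral_actPull3_of_subset_source 0 hK hKj hχ h0]
  congr 1
  funext x
  rw [actPull3, F.act_zero, F.dact_zero]
  rfl

end BulkFlow

/-- Fubini's theorem for integrals of `3`-forms depending on a parameter. -/
theorem integral_intervalIntegral {K : Set M} (hK : IsCompact K)
    {χ : ℝ → M → E3 [⋀^Fin 3]→ₗ[ℝ] ℝ} {χ' : M → E3 [⋀^Fin 3]→ₗ[ℝ] ℝ} {a b : ℝ}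
    (hχ' : ∀ x v, χ' x v = ∫ s in a..b, χ s x v)
    (hχ : ∀ i, ContinuousOn (fun q : ℝ × E3 => dens (χ q.1) i q.2)
      (univ ×ˢ (extChartAt (𝓡∂ 3) i).target))
    (h0 : ∀ s x, x ∉ K → χ s x = 0) :
    X.integral χ' = ∫ s in a..b, X.integral (χ s) := by
  have h0' : ∀ x, x ∉ K → χ' x = 0 := fun x hx => by
    ext v
    rw [hχ']
    simp [h0 _ x hx]
  rw [integral_eq_sum hK h0']
  simp only [integral_eq_sum hK (h0 _)]
  have hint : ∀ i, Integrable (fun q : ℝ × E3 => osgn X i q.2 *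
      (chartPartition M i ((extChartAt (𝓡∂ 3) i).symm q.2) * dens (χ q.1) i q.2))
      ((volume.restrict (uIoc a b)).prod
        (volume.restrict (extChartAt (𝓡∂ 3) i).target)) := by
    intro i
    set K' := extChartAt (𝓡∂ 3) i '' (tsupport (chartPartition M i) ∩ K) with hK'
    have hsub : tsupport (chartPartition M i) ∩ K ⊆ (extChartAt (𝓡∂ 3) i).source :=
      inter_subset_left.trans (tsupport_chartPartition i)
    have hKc : IsCompact K' := (hK.inter_left (isClosed_tsupport _)).image_of_continuousOn
      ((continuousOn_extChartAt i).mono hsub)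
    have hKt : K' ⊆ (extChartAt (𝓡∂ 3) i).target :=
      (image_mono hsub).trans (extChartAt (𝓡∂ 3) i).image_source_eq_target.le
    rw [Measure.prod_restrict]
    refine IntegrableOn.mono_set (t := uIcc a b ×ˢ (extChartAt (𝓡∂ 3) i).target) ?_
      (prod_mono uIoc_subset_uIcc subset_rfl)
    refine integrableOn_of_continuousOn_of_eq_zero
      (measurableSet_uIcc.prod (measurableSet_target i)) (isCompact_uIcc.prod hKc)
      (prod_mono subset_rfl hKt) ?_ ?_
    · have h1 : ContinuousOn (fun q : ℝ × E3 => osgn X i q.2)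
          (uIcc a b ×ˢ (extChartAt (𝓡∂ 3) i).target) :=
        (continuousOn_osgn X i).comp continuousOn_snd fun q hq => hq.2
      have h2 : ContinuousOn (fun q : ℝ × E3 =>
          chartPartition M i ((extChartAt (𝓡∂ 3) i).symm q.2))
          (uIcc a b ×ˢ (extChartAt (𝓡∂ 3) i).target) :=
        ((continuous_chartPartition i).comp_continuousOn (continuousOn_extChartAt_symm i)).comp
          continuousOn_snd fun q hq => hq.2
      exact h1.mul (h2.mul ((hχ i).mono (prod_mono (subset_univ _) subset_rfl)))
    · rintro ⟨s, y⟩ ⟨hq, hn⟩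
      have hyK : (extChartAt (𝓡∂ 3) i).symm y ∉ tsupport (chartPartition M i) ∩ K := fun hm =>
        hn ⟨hq.1, _, hm, (extChartAt (𝓡∂ 3) i).right_inv hq.2⟩
      by_cases h : (extChartAt (𝓡∂ 3) i).symm y ∈ K
      · simp only
        rw [image_eq_zero_of_notMem_tsupport fun hm => hyK ⟨hm, h⟩, zero_mul, mul_zero]
      · simp only
        rw [dens_eq_zero (h0 s _ h), mul_zero, mul_zero]
  have hint' : ∀ i, IntervalIntegrable (fun s => chartIntegral X i (chartPartition M i) (χ s))
      volume a b := fun i => by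
    rw [intervalIntegrable_iff]
    exact (hint i).integral_prod_left
  rw [intervalIntegral.integral_finsetSum fun i _ => hint' i]
  refine Finset.sum_congr rfl fun i _ => ?_
  simp only [chartIntegral]
  rw [intervalIntegral_integral_swap (hint i)]
  refine integral_congr_ae (Eventually.of_forall fun y => ?_)
  simp only
  rw [intervalIntegral.integral_const_mul, intervalIntegral.integral_const_mul, dens, hχ']
  rfl

end

section

open BulkBoundary

/-! ### The divergence theorem on the half space -/

/-- The divergence theorem for a compactly supported vector field on the half space `0 ≤ x₀` which
is tangent to the boundary. -/
theorem integral_halfSpace_divergence (W : Fin 3 → E3 → ℝ) (W' : Fin 3 → E3 → E3 →L[ℝ] ℝ)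
    {K : Set E3} (hK : IsCompact K) (hc : ∀ i, ContinuousOn (W i) {x : E3 | 0 ≤ x 0})
    (hd : ∀ i, ∀ x : E3, 0 < x 0 → HasFDerivAt (W i) (W' i x) x)
    (hW : ∀ i, ∀ x ∉ K, W i x = 0) (hW' : ∀ i, ∀ x ∉ K, W' i x = 0)
    (h0 : ∀ x : E3, x 0 = 0 → W 0 x = 0)
    (hint : IntegrableOn (fun x => ∑ i, W' i x (stdVec i)) {x : E3 | 0 ≤ x 0}) :
    ∫ x in {x : E3 | 0 ≤ x 0}, ∑ i, W' i x (stdVec i) = 0 := by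
  obtain ⟨R₀, hR₀⟩ := hK.isBounded.exists_norm_le
  set R : ℝ := |R₀| + 1 with hR
  have hRpos : 0 < R := by positivity
  have hKR : ∀ x ∈ K, ∀ i, |x i| < R := fun x hx i => by
    have h1 := PiLp.norm_apply_le x i
    have h2 := hR₀ x hx
    rw [Real.norm_eq_abs] at h1
    linarith [le_abs_self R₀]
  -- a box with one face on the boundary which otherwise contains `K` in its interior
  set a : Fin 3 → ℝ := ![0, -R, -R] with ha
  set b : Fin 3 → ℝ := fun _ => R with hb
  have hab : a ≤ b := fun i => by
    fin_cases i <;> simp [ha, hb] <;> linarith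
  let L : (Fin 3 → ℝ) ≃L[ℝ] E3 := (EuclideanSpace.equiv (Fin 3) ℝ).symm
  have hL : ∀ x i, (L x) i = x i := fun _ _ => rfl
  have hLe : ∀ i, L (Pi.single i 1) = stdVec i := fun i => rfl
  have hemb : MeasurableEmbedding (L : (Fin 3 → ℝ) → E3) := L.toHomeomorph.measurableEmbedding
  have hmp : MeasurePreserving (L : (Fin 3 → ℝ) → E3) := PiLp.volume_preserving_toLp (Fin 3)
  set B : Set E3 := {x : E3 | (L.symm x) ∈ Icc a b} with hB
  have hBpre : (L : (Fin 3 → ℝ) → E3) ⁻¹' B = Icc a b := by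
    ext x
    simp [hB]
  have hBH : B ⊆ {x : E3 | 0 ≤ x 0} := fun x hx => hx.1 0
  have hBm : MeasurableSet B := measurableSet_Icc.preimage L.symm.continuous.measurable
  have hoff : ∀ x ∈ {x : E3 | 0 ≤ x 0} \ B, x ∉ K := by
    intro x hx hxK
    refine hx.2 ⟨fun i => ?_, fun i => ?_⟩
    · have := (abs_lt.mp (hKR x hxK i)).1.le
      fin_cases i
      · exact hx.1
      · exact this
      · exact this
    · exact (abs_lt.mp (hKR x hxK i)).2.le
  have hHm : MeasurableSet {x : E3 | 0 ≤ x 0} :=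
    (isClosed_le continuous_const (by fun_prop)).measurableSet
  rw [setIntegral_eq_of_subset_of_forall_sdiff_eq_zero hHm hBH fun x hx => by
    simp [hW' _ x (hoff x hx)]]
  rw [← hmp.setIntegral_preimage_emb hemb, hBpre]
  have key := integral_divergence_of_hasFDerivAt_off_countable' a b hab
    (fun i x => W i (L x)) (fun i x => (W' i (L x)).comp (L : (Fin 3 → ℝ) →L[ℝ] E3)) ∅
    countable_empty
    (fun i => (hc i).comp L.continuous.continuousOn fun x hx => hx.1 0)
    (fun x hx i => ?_) ?_
  · have e : ∀ x, ∑ i, ((W' i (L x)).comp (L : (Fin 3 → ℝ) →L[ℝ] E3)) (Pi.single i 1) =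
        ∑ i, W' i (L x) (stdVec i) := fun x => rfl
    simp only [e] at key
    rw [key]
    refine Finset.sum_eq_zero fun i _ => ?_
    have z1 : ∀ x, W i (L (i.insertNth (b i) x)) = 0 := fun x => hW i _ fun hm => by
      have := hKR _ hm i
      rw [hL, Fin.insertNth_apply_same] at this
      exact (lt_irrefl _ ((le_abs_self _).trans_lt this))
    have z2 : ∀ x, W i (L (i.insertNth (a i) x)) = 0 := fun x => by
      rcases eq_or_ne i 0 with rfl | hi
      · refine h0 _ ?_
        rw [hL, Fin.insertNth_apply_same]
        rfl
      · refine hW i _ fun hm => ?_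
        have := hKR _ hm i
        rw [hL, Fin.insertNth_apply_same] at this
        have ha' : a i = -R := by
          fin_cases i
          · exact absurd rfl hi
          · rfl
          · rfl
        rw [ha', abs_neg] at this
        exact (lt_irrefl _ ((le_abs_self _).trans_lt this))
    simp only [z1, z2, MeasureTheory.integral_zero, sub_self]
  · have hpos : 0 < (L x) 0 := (hx.1 0 (mem_univ _)).1
    exact (hd i (L x) hpos).comp x L.hasFDerivAt
  · have h1 : IntegrableOn (fun x => ∑ i, W' i x (stdVec i)) B := hint.mono_set hBH
    have h2 := (hmp.integrableOn_comp_preimage hemb).mpr h1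
    rw [hBpre] at h2
    exact h2

variable [IsManifold (𝓡∂ 3) ∞ M]

variable (X) in
theorem osgn_eventuallyEq {i : M} {y : E3} (hy : y ∈ (extChartAt (𝓡∂ 3) i).target) :
    ∀ᶠ z in 𝓝[range (𝓡∂ 3)] y, osgn X i z = osgn X i y := by
  have h1 : ContinuousWithinAt (fun y => localRep (𝓡∂ 3) X.orient i y stdVec)
      (extChartAt (𝓡∂ 3) i).target y :=
    (ContinuousAlternatingMap.apply ℝ E3 ℝ stdVec).continuous.comp_continuousOn
      (X.orient_smooth i).continuousOn y hy
  have h2 : ContinuousWithinAt (fun y => SignType.sign (localRep (𝓡∂ 3) X.orient i y stdVec))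
      (extChartAt (𝓡∂ 3) i).target y :=
    ContinuousAt.comp_continuousWithinAt (g := fun r : ℝ => SignType.sign r)
      (f := fun y => localRep (𝓡∂ 3) X.orient i y stdVec)
      (continuousAt_sign_of_ne_zero (localRep_orient_ne_zero X hy)) h1
  have h3 := h2 ((isOpen_discrete {SignType.sign (localRep (𝓡∂ 3) X.orient i y stdVec)}).mem_nhds rfl)
  have h4 : 𝓝[range (𝓡∂ 3)] y ≤ 𝓝[(extChartAt (𝓡∂ 3) i).target] y :=
    nhdsWithin_le_of_mem (extChartAt_target_mem_nhdsWithin_of_mem hy)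
  filter_upwards [h4 h3] with z hz
  rw [osgn, osgn, show SignType.sign (localRep (𝓡∂ 3) X.orient i z stdVec) = _ from hz]

variable (X) in
/-- The divergence theorem in a chart. -/
theorem integral_chart_divergence (k : M) (V : Fin 3 → E3 → ℝ)
    (hV : ∀ i, ContDiffOn ℝ ∞ (V i) (extChartAt (𝓡∂ 3) k).target) {K : Set E3} (hK : IsCompact K)
    (hKT : K ⊆ (extChartAt (𝓡∂ 3) k).target)
    (h0 : ∀ i, ∀ y ∈ (extChartAt (𝓡∂ 3) k).target, y ∉ K → V i y = 0)
    (hb : ∀ y ∈ (extChartAt (𝓡∂ 3) k).target, y 0 = 0 → V 0 y = 0) :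
    ∫ y in (extChartAt (𝓡∂ 3) k).target, osgn X k y *
      ∑ i, fderivWithin ℝ (V i) (range (𝓡∂ 3)) y (stdVec i) = 0 := by
  set T := (extChartAt (𝓡∂ 3) k).target with hT
  have hH : range (𝓡∂ 3) = {x : E3 | 0 ≤ x 0} := range_modelWithCornersEuclideanHalfSpace 3
  have hTH : T ⊆ range (𝓡∂ 3) := extChartAt_target_subset_range k
  have hTn : ∀ y ∈ T, T ∈ 𝓝[range (𝓡∂ 3)] y := fun y hy =>
    extChartAt_target_mem_nhdsWithin_of_mem hy
  -- Extend by zero to the half space. The sign of the orientation is locally constant and can be treated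
  -- as a constant under differentiation.
  set W : Fin 3 → E3 → ℝ := fun i => T.indicator fun y => osgn X k y * V i y with hW
  set W' : Fin 3 → E3 → E3 →L[ℝ] ℝ := fun i =>
    T.indicator fun y => osgn X k y • fderivWithin ℝ (V i) (range (𝓡∂ 3)) y with hW'
  have hWK : ∀ i, ∀ y ∉ K, W i y = 0 := fun i y hy => by
    by_cases hyT : y ∈ T
    · simp only [hW, indicator_of_mem hyT, h0 i y hyT hy, mul_zero]
    · simp only [hW, indicator_of_notMem hyT]
  have hdV : ∀ i, ∀ y ∈ T, HasFDerivWithinAt (V i) (fderivWithin ℝ (V i) (range (𝓡∂ 3)) y)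
      (range (𝓡∂ 3)) y := fun i y hy =>
    (((hV i).differentiableOn (by simp) y hy).mono_of_mem_nhdsWithin (hTn y hy)).hasFDerivWithinAt
  -- at points of the half space outside the chart, `W` vanishes nearby since `K` is compact
  have hdW : ∀ i, ∀ y, HasFDerivWithinAt (W i) (W' i y) (range (𝓡∂ 3)) y := by
    intro i y
    by_cases hyT : y ∈ T
    · have h1 : W i =ᶠ[𝓝[range (𝓡∂ 3)] y] fun z => osgn X k y * V i z := by
        filter_upwards [osgn_eventuallyEq X hyT, hTn y hyT] with z hz hzT
        simp only [hW, indicator_of_mem hzT, hz]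
      have h2 : W' i y = osgn X k y • fderivWithin ℝ (V i) (range (𝓡∂ 3)) y := by
        simp only [hW', indicator_of_mem hyT]
      rw [h2]
      exact ((hdV i y hyT).const_mul _).congr_of_eventuallyEq h1
        (h1.self_of_nhdsWithin (hTH hyT))
    · have h1 : W i =ᶠ[𝓝 y] fun _ => 0 := by
        filter_upwards [hK.isClosed.isOpen_compl.mem_nhds fun hm => hyT (hKT hm)] with z hz
        exact hWK i z hz
      have h2 : W' i y = 0 := by
        simp only [hW', indicator_of_notMem hyT]
      rw [h2]
      exact ((hasFDerivAt_const (0 : ℝ) y).congr_of_eventuallyEq h1).hasFDerivWithinAt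
  have hW'K : ∀ i, ∀ y ∉ K, W' i y = 0 := fun i y hy => by
    by_cases hyT : y ∈ T
    · have h1 : V i =ᶠ[𝓝[range (𝓡∂ 3)] y] fun _ => 0 := by
        filter_upwards [hTn y hyT, nhdsWithin_le_nhds (hK.isClosed.isOpen_compl.mem_nhds hy)]
          with z hz hz'
        exact h0 i z hz hz'
      simp only [hW', indicator_of_mem hyT]
      rw [h1.fderivWithin_eq_of_mem (hTH hyT), fderivWithin_const_apply, smul_zero]
    · simp only [hW', indicator_of_notMem hyT]
  have hTm : MeasurableSet T := measurableSet_target k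
  have hHm : MeasurableSet {x : E3 | 0 ≤ x 0} :=
    (isClosed_le continuous_const (by fun_prop)).measurableSet
  have hsum : ∀ y ∈ T, ∑ i, W' i y (stdVec i) =
      osgn X k y * ∑ i, fderivWithin ℝ (V i) (range (𝓡∂ 3)) y (stdVec i) := fun y hy => by
    simp only [hW', indicator_of_mem hy, _root_.smul_apply, smul_eq_mul, Finset.mul_sum]
  have hint : IntegrableOn (fun x => ∑ i, W' i x (stdVec i)) {x : E3 | 0 ≤ x 0} := by
    refine IntegrableOn.of_forall_sdiff_eq_zero (s := T) ?_ hHm fun y hy => ?_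
    · refine integrableOn_of_continuousOn_of_eq_zero hTm hK hKT ?_ fun y hy => ?_
      · refine ContinuousOn.congr ?_ hsum
        refine (continuousOn_osgn X k).mul (continuousOn_finsetSum _ fun i _ => ?_)
        have h1 := (hV i).continuousOn_fderivWithin (uniqueDiffOn_extChartAt_target k) (by simp)
        refine (ContinuousOn.clm_apply h1 (continuousOn_const (c := stdVec i))).congr
          (g := fun y => fderivWithin ℝ (V i) (range (𝓡∂ 3)) y (stdVec i)) fun y hy => ?_
        dsimp only
        rw [((hdV i y hy).mono hTH).fderivWithin (uniqueDiffOn_extChartAt_target k y hy)]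
      · exact Finset.sum_eq_zero fun i _ => by rw [hW'K i y hy.2]; rfl
    · exact Finset.sum_eq_zero fun i _ => by rw [hW'K i y fun hm => hy.2 (hKT hm)]; rfl
  have key := integral_halfSpace_divergence W W' hK
    (fun i y hy => by
      have := (hdW i y).continuousWithinAt
      rwa [hH] at this)
    (fun i y hy => (hdW i y).hasFDerivAt (by
      rw [hH]
      exact mem_of_superset ((isOpen_lt continuous_const
        (by fun_prop : Continuous fun z : E3 => z 0)).mem_nhds
          (show y ∈ {z : E3 | (0 : ℝ) < z 0} from hy)) fun z (hz : (0 : ℝ) < z 0) => hz.le))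
    hWK hW'K
    (fun y hy => by
      by_cases hyT : y ∈ T
      · simp only [hW, indicator_of_mem hyT, hb y hyT hy, mul_zero]
      · simp only [hW, indicator_of_notMem hyT])
    hint
  rw [setIntegral_eq_of_subset_of_forall_sdiff_eq_zero hHm (hTH.trans hH.le) fun y hy =>
    Finset.sum_eq_zero fun i _ => by rw [hW'K i y fun hm => hy.2 (hKT hm)]; rfl] at key
  rw [← key]
  exact setIntegral_congr_fun hTm fun y hy => (hsum y hy).symm

end

section

open BulkBoundary

/-! ### The Leibniz rule as a divergence formula -/

section Leibniz

variable {S : Set E3} {y : E3}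

theorem extDerivWithin_zero_form {η : E3 → E3 [⋀^Fin 0]→L[ℝ] ℝ}
    (h : DifferentiableWithinAt ℝ η S y) (hS : UniqueDiffWithinAt ℝ S y) (u : E3) :
    extDerivWithin η S y ![u] = fderivWithin ℝ (fun z => η z ![]) S y u := by
  rw [extDerivWithin_apply h hS, Fin.sum_univ_one, Fin.val_zero, pow_zero, one_smul]
  have e : (fun z => η z ((0 : Fin 1).removeNth ![u])) = fun z => η z ![] := by
    funext z
    congr 1
  rw [e]
  rfl

theorem extDerivWithin_one_form {η : E3 → E3 [⋀^Fin 1]→L[ℝ] ℝ}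
    (h : DifferentiableWithinAt ℝ η S y) (hS : UniqueDiffWithinAt ℝ S y) (u v : E3) :
    extDerivWithin η S y ![u, v] =
      fderivWithin ℝ (fun z => η z ![v]) S y u - fderivWithin ℝ (fun z => η z ![u]) S y v := by
  have e0 : (0 : Fin 2).removeNth ![u, v] = ![v] := by
    ext i; fin_cases i; rfl
  have e1 : (1 : Fin 2).removeNth ![u, v] = ![u] := by
    ext i; fin_cases i; rfl
  rw [extDerivWithin_apply h hS, Fin.sum_univ_two, e0, e1]
  simp [sub_eq_add_neg]

theorem extDerivWithin_two_form {η : E3 → E3 [⋀^Fin 2]→L[ℝ] ℝ}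
    (h : DifferentiableWithinAt ℝ η S y) (hS : UniqueDiffWithinAt ℝ S y) (v : Fin 3 → E3) :
    extDerivWithin η S y v =
      fderivWithin ℝ (fun z => η z ![v 1, v 2]) S y (v 0) -
        fderivWithin ℝ (fun z => η z ![v 0, v 2]) S y (v 1) +
        fderivWithin ℝ (fun z => η z ![v 0, v 1]) S y (v 2) := by
  have e0 : (0 : Fin 3).removeNth v = ![v 1, v 2] := by
    ext i; fin_cases i <;> rfl
  have e1 : (1 : Fin 3).removeNth v = ![v 0, v 2] := by
    ext i; fin_cases i <;> rfl
  have e2 : (2 : Fin 3).removeNth v = ![v 0, v 1] := by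
    ext i; fin_cases i <;> rfl
  rw [extDerivWithin_apply h hS, Fin.sum_univ_three, e0, e1, e2]
  simp [sub_eq_add_neg]

theorem fderivWithin_mul_apply {f g : E3 → ℝ} (hS : UniqueDiffWithinAt ℝ S y)
    (hf : DifferentiableWithinAt ℝ f S y) (hg : DifferentiableWithinAt ℝ g S y) (v : E3) :
    fderivWithin ℝ (fun z => f z * g z) S y v =
      f y * fderivWithin ℝ g S y v + g y * fderivWithin ℝ f S y v := by
  rw [fderivWithin_fun_mul hS hf hg]
  rfl

theorem fderivWithin_mul_sub_apply {f g f' g' : E3 → ℝ} (hS : UniqueDiffWithinAt ℝ S y)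
    (hf : DifferentiableWithinAt ℝ f S y) (hg : DifferentiableWithinAt ℝ g S y)
    (hf' : DifferentiableWithinAt ℝ f' S y) (hg' : DifferentiableWithinAt ℝ g' S y) (v : E3) :
    fderivWithin ℝ (fun z => f z * g z - f' z * g' z) S y v =
      f y * fderivWithin ℝ g S y v + g y * fderivWithin ℝ f S y v -
        (f' y * fderivWithin ℝ g' S y v + g' y * fderivWithin ℝ f' S y v) := by
  rw [← fderivWithin_mul_apply hS hf hg, ← fderivWithin_mul_apply hS hf' hg',
    show (fun z => f z * g z - f' z * g' z) = (f * g) - (f' * g') from rfl,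
    fderivWithin_sub hS (hf.mul hg) (hf'.mul hg')]
  rfl

theorem fderivWithin_neg_mul_apply {f g : E3 → ℝ} (hS : UniqueDiffWithinAt ℝ S y)
    (hf : DifferentiableWithinAt ℝ f S y) (hg : DifferentiableWithinAt ℝ g S y) (v : E3) :
    fderivWithin ℝ (fun z => -(f z * g z)) S y v =
      -(f y * fderivWithin ℝ g S y v + g y * fderivWithin ℝ f S y v) := by
  rw [← fderivWithin_mul_apply hS hf hg, fderivWithin_fun_neg hS]
  rfl

theorem one_form_apply (α : E3 [⋀^Fin 1]→L[ℝ] ℝ) (w : E3) :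
    α (fun _ => w) = w 0 * α ![stdVec 0] + w 1 * α ![stdVec 1] + w 2 * α ![stdVec 2] := by
  rw [show (fun _ => w) = ![w] from funext fun i => by fin_cases i; rfl]
  exact curryLeft_eq_sum α w ![]

/-- The exterior derivative of the wedge product of a `p`-form and a `q`-form with `p + q = 2` is
the divergence of a vector field. This vector field is tangent to the boundary of the half space if
the forms satisfy boundary conditions: `0`-forms vanish, and `1`-forms vanish on a common
nonzero tangent vector of the boundary. -/
theorem exists_wedge_divergence {p q : ℕ} (h₁ : p + 1 + q = 3) (h₂ : p + (q + 1) = 3)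
    {A : E3 → E3 [⋀^Fin p]→L[ℝ] ℝ} {B : E3 → E3 [⋀^Fin q]→L[ℝ] ℝ} {T : Set E3}
    (hA : ContDiffOn ℝ ∞ A T) (hB : ContDiffOn ℝ ∞ B T) (hT : ∀ y ∈ T, T ∈ 𝓝[S] y)
    (hS : ∀ y ∈ T, UniqueDiffWithinAt ℝ S y) :
    ∃ V : Fin 3 → E3 → ℝ, (∀ i, ContDiffOn ℝ ∞ (V i) T) ∧ (∀ i y, A y = 0 → V i y = 0) ∧
      (∀ y ∈ T, wedge3 h₁ (extDerivWithin A S y) (B y) stdVec +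
        sgn p * wedge3 h₂ (A y) (extDerivWithin B S y) stdVec =
          ∑ i, fderivWithin ℝ (V i) S y (stdVec i)) ∧
      ∀ y (w : E3), w ≠ 0 → w 0 = 0 → (p = 0 → A y = 0) → (q = 0 → B y = 0) →
        (p = 1 → A y (fun _ => w) = 0) → (q = 1 → B y (fun _ => w) = 0) → V 0 y = 0 := by
  have ev : ∀ {n : ℕ} {C : E3 → E3 [⋀^Fin n]→L[ℝ] ℝ}, ContDiffOn ℝ ∞ C T → ∀ v : Fin n → E3,
      ContDiffOn ℝ ∞ (fun y => C y v) T := fun hC v =>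
    (ContinuousAlternatingMap.apply ℝ E3 ℝ v).contDiff.comp_contDiffOn hC
  have df : ∀ {G : Type} [NormedAddCommGroup G] [NormedSpace ℝ G] {f : E3 → G},
      ContDiffOn ℝ ∞ f T → ∀ y ∈ T, DifferentiableWithinAt ℝ f S y := fun hf y hy =>
    ((hf.differentiableOn (by simp)) y hy).mono_of_mem_nhdsWithin (hT y hy)
  obtain rfl | rfl | rfl : p = 0 ∨ p = 1 ∨ p = 2 := by omega
  · obtain rfl : q = 2 := by omega
    refine ⟨![fun y => A y ![] * B y ![stdVec 1, stdVec 2],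
      fun y => -(A y ![] * B y ![stdVec 0, stdVec 2]),
      fun y => A y ![] * B y ![stdVec 0, stdVec 1]], ?_, ?_, ?_, ?_⟩
    · intro i
      fin_cases i
      · exact (ev hA _).mul (ev hB _)
      · exact ((ev hA _).mul (ev hB _)).neg
      · exact (ev hA _).mul (ev hB _)
    · intro i y h
      fin_cases i <;> simp [h]
    · intro y hy
      have a := df (ev hA ![]) y hy
      have b := fun v => df (ev hB v) y hy
      rw [wedge3_one_two, wedge3_zero_three, extDerivWithin_two_form (df hB y hy) (hS y hy)]
      simp only [extDerivWithin_zero_form (df hA y hy) (hS y hy), Fin.sum_univ_three,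
        Matrix.cons_val]
      rw [fderivWithin_mul_apply (hS y hy) a (b _), fderivWithin_mul_apply (hS y hy) a (b _),
        fderivWithin_neg_mul_apply (hS y hy) a (b _)]
      have : (sgn ((0 : ℕ) : ℤ) : ℝ) = 1 := by simp [sgn]
      rw [this]
      ring
    · intro y w _ _ h _ _ _
      simp [h rfl]
  · obtain rfl : q = 1 := by omega
    refine ⟨![fun y => A y ![stdVec 1] * B y ![stdVec 2] - A y ![stdVec 2] * B y ![stdVec 1],
      fun y => A y ![stdVec 2] * B y ![stdVec 0] - A y ![stdVec 0] * B y ![stdVec 2],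
      fun y => A y ![stdVec 0] * B y ![stdVec 1] - A y ![stdVec 1] * B y ![stdVec 0]],
      ?_, ?_, ?_, ?_⟩
    · intro i
      fin_cases i <;> exact ((ev hA _).mul (ev hB _)).sub ((ev hA _).mul (ev hB _))
    · intro i y h
      fin_cases i <;> simp [h]
    · intro y hy
      have a := fun v => df (ev hA v) y hy
      have b := fun v => df (ev hB v) y hy
      rw [wedge3_two_one, wedge3_one_two]
      simp only [extDerivWithin_one_form (df hA y hy) (hS y hy),
        extDerivWithin_one_form (df hB y hy) (hS y hy), Fin.sum_univ_three, Matrix.cons_val]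
      rw [fderivWithin_mul_sub_apply (hS y hy) (a _) (b _) (a _) (b _),
        fderivWithin_mul_sub_apply (hS y hy) (a _) (b _) (a _) (b _),
        fderivWithin_mul_sub_apply (hS y hy) (a _) (b _) (a _) (b _)]
      have : (sgn ((1 : ℕ) : ℤ) : ℝ) = -1 := by simp [sgn]
      rw [this]
      ring
    -- two covectors which vanish on a common nonzero vector tangent to the boundary are proportional
    -- there
    · intro y w hw hw0 _ _ h1 h2
      have h1 := h1 rfl
      have h2 := h2 rfl
      rw [one_form_apply, hw0] at h1 h2
      simp only [Matrix.cons_val]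
      have hne : w 1 ≠ 0 ∨ w 2 ≠ 0 := by
        by_contra! hn
        refine hw ?_
        ext i
        fin_cases i
        · exact hw0
        · exact hn.1
        · exact hn.2
      rcases hne with hn | hn
      · refine (mul_eq_zero.mp (?_ : w 1 * _ = 0)).resolve_left hn
        linear_combination B y ![stdVec 2] * h1 - A y ![stdVec 2] * h2
      · refine (mul_eq_zero.mp (?_ : w 2 * _ = 0)).resolve_left hn
        linear_combination A y ![stdVec 1] * h2 - B y ![stdVec 1] * h1
  · obtain rfl : q = 0 := by omega
    refine ⟨![fun y => A y ![stdVec 1, stdVec 2] * B y ![],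
      fun y => -(A y ![stdVec 0, stdVec 2] * B y ![]),
      fun y => A y ![stdVec 0, stdVec 1] * B y ![]], ?_, ?_, ?_, ?_⟩
    · intro i
      fin_cases i
      · exact (ev hA _).mul (ev hB _)
      · exact ((ev hA _).mul (ev hB _)).neg
      · exact (ev hA _).mul (ev hB _)
    · intro i y h
      fin_cases i <;> simp [h]
    · intro y hy
      have a := fun v => df (ev hA v) y hy
      have b := df (ev hB ![]) y hy
      rw [wedge3_three_zero, wedge3_two_one, extDerivWithin_two_form (df hA y hy) (hS y hy)]
      simp only [extDerivWithin_zero_form (df hB y hy) (hS y hy), Fin.sum_univ_three,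
        Matrix.cons_val]
      rw [fderivWithin_mul_apply (hS y hy) (a _) b, fderivWithin_mul_apply (hS y hy) (a _) b,
        fderivWithin_neg_mul_apply (hS y hy) (a _) b]
      have : (sgn ((2 : ℕ) : ℤ) : ℝ) = 1 := by simp [sgn]
      rw [this]
      ring
    · intro y w _ _ _ h _ _
      simp [h rfl]

end Leibniz

end

section

open BulkBoundary

/-! ### Stokes' theorem -/

section BoundaryPoints

variable [IsManifold (𝓡∂ 3) ∞ M]

/-- The boundary points are those at which the first coordinate of any chart vanishes. -/
theorem mem_boundary_iff {k x : M} (hx : x ∈ (extChartAt (𝓡∂ 3) k).source) :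
    x ∈ (𝓡∂ 3).boundary M ↔ extChartAt (𝓡∂ 3) k x 0 = 0 := by
  have hx' : x ∈ (chartAt (EuclideanHalfSpace 3) k).source := by rwa [extChartAt_source] at hx
  have h1 := (𝓡∂ 3).isInteriorPoint_iff_of_mem_atlas (n := ∞) (by simp)
    (chart_mem_atlas (EuclideanHalfSpace 3) k) hx'
  have h2 : x ∈ (𝓡∂ 3).boundary M ↔ ¬ (𝓡∂ 3).IsInteriorPoint x := by
    rw [(𝓡∂ 3).isInteriorPoint_iff_not_isBoundaryPoint, not_not]
    rfl
  change (𝓡∂ 3).IsInteriorPoint x ↔ extChartAt (𝓡∂ 3) k x ∈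
    interior (extChartAt (𝓡∂ 3) k).target at h1
  have hi := interior_range_modelWithCornersEuclideanHalfSpace 3
  have hr := range_modelWithCornersEuclideanHalfSpace 3
  have ht : extChartAt (𝓡∂ 3) k x ∈ (extChartAt (𝓡∂ 3) k).target :=
    (extChartAt (𝓡∂ 3) k).map_source hx
  have hge : 0 ≤ extChartAt (𝓡∂ 3) k x 0 := by
    have := extChartAt_target_subset_range k ht
    rwa [hr] at this
  rw [h2, h1]
  constructor
  · intro hn
    by_contra h0
    refine hn ?_
    have hm : extChartAt (𝓡∂ 3) k x ∈ interior (range (𝓡∂ 3)) := by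
      rw [hi]
      exact lt_of_le_of_ne hge (Ne.symm h0)
    have h3 := extChartAt_target_mem_nhdsWithin_of_mem ht
    rw [nhdsWithin_eq_nhds.mpr (mem_interior_iff_mem_nhds.mp hm)] at h3
    exact mem_interior_iff_mem_nhds.mpr h3
  · intro h0 hn
    have := interior_mono (extChartAt_target_subset_range k) hn
    rw [hi] at this
    exact this.ne' h0

namespace BulkFlow

omit [IsManifold (𝓡∂ 3) ∞ M] in
theorem nu_ι_ne_zero (p : N) : F.nu (X.ι p) ≠ 0 := by
  intro h
  rw [F.nu_ι, ← map_zero (X.dι p)] at h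
  have h1 : F.bnu p = 0 := X.ι_immersion p h
  have h2 := F.flow_future p
  change X.g p (X.t p) (F.bnu p) < 0 at h2
  rw [h1, map_zero] at h2
  exact lt_irrefl _ h2

/-- In a chart, the generator of the flow is tangent to the boundary of the half space. -/
theorem exists_coordDeriv_eq_nu {k : M} {y : E3} (hy : y ∈ (extChartAt (𝓡∂ 3) k).target) (p : N)
    (hp : (extChartAt (𝓡∂ 3) k).symm y = X.ι p) :
    ∃ w : E3, w ≠ 0 ∧ w 0 = 0 ∧ coordDeriv (𝓡∂ 3) k y w = F.nu (X.ι p) := by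
  have hxs : X.ι p ∈ (extChartAt (𝓡∂ 3) k).source := hp ▸ (extChartAt (𝓡∂ 3) k).map_target hy
  set c : ℝ → E3 := fun s => extChartAt (𝓡∂ 3) k (F.act s (X.ι p)) with hc
  have hc0 : c 0 = y := by
    simp only [hc, F.act_zero, ← hp]
    exact (extChartAt (𝓡∂ 3) k).right_inv hy
  have hγ : ContinuousAt (fun s => F.act s (X.ι p)) 0 :=
    (F.orbit_contMDiff (X.ι p)).continuous.continuousAt
  have hev : ∀ᶠ s in 𝓝 (0 : ℝ), F.act s (X.ι p) ∈ (extChartAt (𝓡∂ 3) k).source :=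
    hγ ((isOpen_extChartAt_source k).mem_nhds (by simpa only [F.act_zero] using hxs))
  have hcd : DifferentiableAt ℝ c 0 := by
    rw [← mdifferentiableAt_iff_differentiableAt]
    refine MDifferentiableAt.comp (g := extChartAt (𝓡∂ 3) k) (I' := 𝓡∂ 3) 0 ?_
      (F.orbit_mdifferentiableAt (X.ι p) 0)
    refine (contMDiffAt_extChartAt' (n := ∞) ?_).mdifferentiableAt (by simp)
    rw [F.act_zero]
    rwa [extChartAt_source] at hxs
  have hd : coordDeriv (𝓡∂ 3) k y (fderiv ℝ c 0 1) = F.nu (X.ι p) := by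
    have hs : HasMFDerivWithinAt 𝓘(ℝ, E3) (𝓡∂ 3) (extChartAt (𝓡∂ 3) k).symm (range (𝓡∂ 3)) (c 0)
        (coordDeriv (𝓡∂ 3) k y) := by
      rw [hc0]
      have : IsManifold (𝓡∂ 3) 1 M := .of_le (n := ∞) (by simp)
      exact (mdifferentiableWithinAt_extChartAt_symm hy).hasMFDerivWithinAt
    have h1 := hasMFDerivWithinAt_univ.mp (HasMFDerivWithinAt.comp (f := c) 0 hs
      hcd.hasFDerivAt.hasMFDerivAt.hasMFDerivWithinAt
      (s := univ) fun s _ => mem_range_self (f := 𝓡∂ 3) _)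
    have h2 : (extChartAt (𝓡∂ 3) k).symm ∘ c =ᶠ[𝓝 0] fun s => F.act s (X.ι p) := by
      filter_upwards [hev] with s hs
      exact (extChartAt (𝓡∂ 3) k).left_inv hs
    have h3 := (h1.congr_of_eventuallyEq h2.symm).mfderiv
    rw [nu, velocity, h3]
    rfl
  refine ⟨fderiv ℝ c 0 1, fun h => F.nu_ι_ne_zero p ?_, ?_, hd⟩
  · rw [← hd, h, map_zero]
  · have h1 : HasFDerivAt (fun s => c s 0) ((EuclideanSpace.proj (𝕜 := ℝ) (0 : Fin 3)).comp
        (fderiv ℝ c 0)) 0 :=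
      (EuclideanSpace.proj (𝕜 := ℝ) (0 : Fin 3)).hasFDerivAt.comp 0 hcd.hasFDerivAt
    have h2 : (fun s => c s 0) =ᶠ[𝓝 0] fun _ => 0 := by
      filter_upwards [hev] with s hs
      refine (mem_boundary_iff hs).mp ?_
      rw [F.act_ι, ← X.range_ι]
      exact mem_range_self _
    have h3 := (h1.congr_of_eventuallyEq h2.symm).unique (hasFDerivAt_const (0 : ℝ) (0 : ℝ))
    exact congrArg (fun L : ℝ →L[ℝ] ℝ => L 1) h3

end BulkFlow

end BoundaryPoints

section Smul

variable {n : ℕ} {f : M → ℝ} {α : M → E3 [⋀^Fin n]→L[ℝ] ℝ}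

theorem IsSmoothForm.fun_smul [IsManifold (𝓡∂ 3) ∞ M] (hf : ContMDiff (𝓡∂ 3) 𝓘(ℝ, ℝ) ∞ f)
    (hα : IsSmoothForm (𝓡∂ 3) α) : IsSmoothForm (𝓡∂ 3) fun x => f x • α x := fun x₀ =>
  (hf.comp_contMDiffOn (contMDiffOn_extChartAt_symm x₀)).contDiffOn.smul (hα x₀)

theorem BoundaryCond.fun_smul (f : M → ℝ) : ∀ {n : ℕ} {α : M → E3 [⋀^Fin n]→L[ℝ] ℝ},
    X.BoundaryCond ε α → X.BoundaryCond ε fun x => f x • α x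
  | 0, _, h => fun p => (congrArg (fun β => f (X.ι p) • β) (h p)).trans (smul_zero _)
  | 1, _, h => fun p => (h p).smul (f (X.ι p))
  | _ + 2, _, _ => trivial

theorem fun_smul_mem_fields [IsManifold (𝓡∂ 3) ∞ M] (hf : ContMDiff (𝓡∂ 3) 𝓘(ℝ, ℝ) ∞ f)
    (hα : α ∈ X.fields ε n) : (fun x => f x • α x) ∈ X.fields ε n :=
  ⟨hα.1.fun_smul hf, BoundaryCond.fun_smul f hα.2⟩

end Smul

/-- The wedge product with a fixed form on the right, as a linear map. -/
def wedgeLeft {p q : ℕ} (h : p + q = 3) (β : E3 [⋀^Fin q]→L[ℝ] ℝ) :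
    E3 [⋀^Fin p]→L[ℝ] ℝ →ₗ[ℝ] E3 [⋀^Fin 3]→ₗ[ℝ] ℝ where
  toFun α := wedge3 h α β
  map_add' α α' := wedge3_add_left h α α' β
  map_smul' c α := wedge3_smul_left h c α β

/-- The wedge product of two fields as a field of `3`-forms. -/
def wedgeForm {p q : ℕ} (h : p + q = 3) (φ : M → E3 [⋀^Fin p]→L[ℝ] ℝ)
    (η : M → E3 [⋀^Fin q]→L[ℝ] ℝ) (x : M) : E3 [⋀^Fin 3]→ₗ[ℝ] ℝ := wedge3 h (φ x) (η x)

theorem dens_wedgeForm {p q : ℕ} (h : p + q = 3) (φ : M → E3 [⋀^Fin p]→L[ℝ] ℝ)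
    (η : M → E3 [⋀^Fin q]→L[ℝ] ℝ) (i : M) (y : E3) :
    dens (wedgeForm h φ η) i y = wedge3 h (localRep (𝓡∂ 3) φ i y) (localRep (𝓡∂ 3) η i y) stdVec :=
  (wedge3_comp h _ _ _ _).symm

theorem contDens_wedgeForm {p q : ℕ} (h : p + q = 3) {φ : M → E3 [⋀^Fin p]→L[ℝ] ℝ}
    {η : M → E3 [⋀^Fin q]→L[ℝ] ℝ} (hφ : IsSmoothForm (𝓡∂ 3) φ) (hη : IsSmoothForm (𝓡∂ 3) η) :
    ContDens (wedgeForm h φ η) := fun i => by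
  refine ContinuousOn.congr ?_ fun y _ => dens_wedgeForm h φ η i y
  exact continuousOn_wedge3 h (hφ i).continuousOn (hη i).continuousOn stdVec

omit [ChartedSpace (EuclideanHalfSpace 3) M] in
theorem wedgeForm_eq_zero_left {p q : ℕ} (h : p + q = 3) {φ : M → E3 [⋀^Fin p]→L[ℝ] ℝ}
    (η : M → E3 [⋀^Fin q]→L[ℝ] ℝ) {x : M} (hx : x ∉ tsupport φ) : wedgeForm h φ η x = 0 := by
  rw [wedgeForm, image_eq_zero_of_notMem_tsupport hx, wedge3_zero_left]

variable [IsManifold (𝓡∂ 3) ∞ M]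

/-- The integrand `dφ ∧ η + (-1)^p φ ∧ dη` in Stokes' theorem. -/
def leibniz {p q : ℕ} (h₁ : p + 1 + q = 3) (h₂ : p + (q + 1) = 3) (φ : M → E3 [⋀^Fin p]→L[ℝ] ℝ)
    (η : M → E3 [⋀^Fin q]→L[ℝ] ℝ) : M → E3 [⋀^Fin 3]→ₗ[ℝ] ℝ :=
  wedgeForm h₁ (extD (𝓡∂ 3) φ) η + ((sgn p : ℤ) : ℝ) • wedgeForm h₂ φ (extD (𝓡∂ 3) η)

theorem contDens_leibniz {p q : ℕ} (h₁ : p + 1 + q = 3) (h₂ : p + (q + 1) = 3)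
    {φ : M → E3 [⋀^Fin p]→L[ℝ] ℝ} {η : M → E3 [⋀^Fin q]→L[ℝ] ℝ} (hφ : IsSmoothForm (𝓡∂ 3) φ)
    (hη : IsSmoothForm (𝓡∂ 3) η) : ContDens (leibniz h₁ h₂ φ η) :=
  (contDens_wedgeForm h₁ hφ.extD hη).add ((contDens_wedgeForm h₂ hφ hη.extD).smul _)

omit [IsManifold (𝓡∂ 3) ∞ M] in
theorem leibniz_eq_zero {p q : ℕ} (h₁ : p + 1 + q = 3) (h₂ : p + (q + 1) = 3)
    {φ : M → E3 [⋀^Fin p]→L[ℝ] ℝ} (η : M → E3 [⋀^Fin q]→L[ℝ] ℝ) {x : M} (hx : x ∉ tsupport φ) :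
    leibniz h₁ h₂ φ η x = 0 := by
  rw [leibniz, Pi.add_apply, Pi.smul_apply, wedgeForm_eq_zero_left h₂ _ hx,
    wedgeForm_eq_zero_left h₁ _ fun h => hx (tsupport_extD φ h), smul_zero, add_zero]

variable [T2Space M] [SigmaCompactSpace M]

include F in
/-- Stokes' theorem for fields supported in a chart domain. -/
theorem integral_leibniz_of_subset_source {p q : ℕ} (h₁ : p + 1 + q = 3) (h₂ : p + (q + 1) = 3)
    {φ : M → E3 [⋀^Fin p]→L[ℝ] ℝ} {η : M → E3 [⋀^Fin q]→L[ℝ] ℝ} (hφ : φ ∈ X.fields ε p)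
    (hη : η ∈ X.fields ε q) (hc : HasCompactSupport φ) {k : M}
    (hk : tsupport φ ⊆ (extChartAt (𝓡∂ 3) k).source) : X.integral (leibniz h₁ h₂ φ η) = 0 := by
  rw [F.integral_eq_of_subset_source hc hk (contDens_leibniz h₁ h₂ hφ.1 hη.1)
    fun x hx => leibniz_eq_zero h₁ h₂ η hx]
  set T := (extChartAt (𝓡∂ 3) k).target with hT
  obtain ⟨V, hV, hV0, hVd, hVb⟩ := exists_wedge_divergence h₁ h₂ (S := range (𝓡∂ 3)) (hφ.1 k) (hη.1 k)
    (fun y hy => extChartAt_target_mem_nhdsWithin_of_mem hy)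
    fun y hy => (𝓡∂ 3).uniqueDiffOn y (extChartAt_target_subset_range k hy)
  have hK := hc.isCompact.image_of_continuousOn ((continuousOn_extChartAt k).mono hk)
  have hKT : extChartAt (𝓡∂ 3) k '' tsupport φ ⊆ T :=
    (image_mono hk).trans (extChartAt (𝓡∂ 3) k).image_source_eq_target.le
  refine Eq.trans ?_ (integral_chart_divergence X k V hV hK hKT (fun i y hy hyK => hV0 i y ?_) ?_)
  · refine setIntegral_congr_fun (measurableSet_target k) fun y hy => ?_
    have e : dens (leibniz h₁ h₂ φ η) k y = dens (wedgeForm h₁ (extD (𝓡∂ 3) φ) η) k y +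
      sgn p * dens (wedgeForm h₂ φ (extD (𝓡∂ 3) η)) k y := rfl
    simp only [e, dens_wedgeForm, localRep_extD hφ.1 hy, localRep_extD hη.1 hy, ← hVd y hy]
  · have hn : (extChartAt (𝓡∂ 3) k).symm y ∉ tsupport φ := fun hm =>
      hyK ⟨_, hm, (extChartAt (𝓡∂ 3) k).right_inv hy⟩
    rw [localRep, image_eq_zero_of_notMem_tsupport hn]
    rfl
  -- at boundary points, both forms vanish (in degree `0`) or vanish on the generator (in degree `1`)
  · intro y hy hy0
    have hb : (extChartAt (𝓡∂ 3) k).symm y ∈ (𝓡∂ 3).boundary M := by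
      rw [mem_boundary_iff ((extChartAt (𝓡∂ 3) k).map_target hy),
        (extChartAt (𝓡∂ 3) k).right_inv hy]
      exact hy0
    rw [← X.range_ι] at hb
    obtain ⟨b, hb⟩ := hb
    obtain ⟨w, hw, hw0, hwn⟩ := F.exists_coordDeriv_eq_nu hy b hb.symm
    have c0 : ∀ {n : ℕ} {α : M → E3 [⋀^Fin n]→L[ℝ] ℝ}, α ∈ X.fields ε n → n = 0 →
        localRep (𝓡∂ 3) α k y = 0 := fun {n α} hα hn => by
      subst hn
      rw [localRep, ← hb, BulkFlow.boundaryCond_zero_iff.mp hα.2 b]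
      rfl
    have c1 : ∀ {n : ℕ} {α : M → E3 [⋀^Fin n]→L[ℝ] ℝ}, α ∈ X.fields ε n → n = 1 →
        localRep (𝓡∂ 3) α k y (fun _ => w) = 0 := fun {n α} hα hn => by
      subst hn
      rw [localRep, ContinuousAlternatingMap.compContinuousLinearMap_apply, ← hb]
      refine Eq.trans (congrArg _ ?_) (F.boundaryCond_one_iff.mp hα.2 b)
      funext i
      fin_cases i
      exact hwn
    exact hVb y w hw hw0 (c0 hφ) (c0 hη) (c1 hφ) (c1 hη)

theorem contMDiff_chartPartition (i : M) : ContMDiff (𝓡∂ 3) 𝓘(ℝ, ℝ) ∞ (chartPartition M i) :=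
  (chartPartition M i).contMDiff

omit [IsManifold (𝓡∂ 3) ∞ M] [T2Space M] [SigmaCompactSpace M] in
theorem extD_sum {ι : Type*} (J : Finset ι) {n : ℕ} {α : ι → M → E3 [⋀^Fin n]→L[ℝ] ℝ}
    (hα : ∀ j, IsSmoothForm (𝓡∂ 3) (α j)) :
    extD (𝓡∂ 3) (∑ j ∈ J, α j) = ∑ j ∈ J, extD (𝓡∂ 3) (α j) := by
  classical
  have key : IsSmoothForm (𝓡∂ 3) (∑ j ∈ J, α j) ∧
      extD (𝓡∂ 3) (∑ j ∈ J, α j) = ∑ j ∈ J, extD (𝓡∂ 3) (α j) := by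
    induction J using Finset.induction_on with
    | empty =>
      refine ⟨isSmoothForm_zero, ?_⟩
      have := extD_smul (I := 𝓡∂ 3) (M := M) (n := n) 0 0
      rwa [zero_smul, zero_smul] at this
    | insert j J hj ih =>
      rw [Finset.sum_insert hj, Finset.sum_insert hj]
      exact ⟨(hα j).add ih.1, by rw [extD_add (hα j) ih.1, ih.2]⟩
  exact key.2

include F in
/-- Stokes' theorem: the boundary terms vanish because of the chiral boundary conditions. -/
theorem integral_leibniz {p q : ℕ} (h₁ : p + 1 + q = 3) (h₂ : p + (q + 1) = 3)
    {φ : M → E3 [⋀^Fin p]→L[ℝ] ℝ} {η : M → E3 [⋀^Fin q]→L[ℝ] ℝ} (hφ : φ ∈ X.fields ε p)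
    (hη : η ∈ X.fields ε q) (hc : HasCompactSupport φ) : X.integral (leibniz h₁ h₂ φ η) = 0 := by
  have hsm : ∀ j, (fun x => chartPartition M j x • φ x) ∈ X.fields ε p := fun j =>
    fun_smul_mem_fields (contMDiff_chartPartition j) hφ
  have hsub : ∀ j, tsupport (fun x => chartPartition M j x • φ x) ⊆ tsupport φ := fun j =>
    tsupport_smul_subset_right (chartPartition M j) φ
  have hφe : φ = ∑ j ∈ activeCharts hc, fun x => chartPartition M j x • φ x := by
    funext x
    rw [Finset.sum_apply]
    by_cases hx : x ∈ tsupport φ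
    · rw [← Finset.sum_smul, sum_chartPartition hc hx, one_smul]
    · simp [image_eq_zero_of_notMem_tsupport hx]
  have e : leibniz h₁ h₂ φ η = ∑ j ∈ activeCharts hc,
      leibniz h₁ h₂ (fun x => chartPartition M j x • φ x) η := by
    have hd := extD_sum (activeCharts hc) fun j => (hsm j).1
    rw [← hφe] at hd
    funext x
    have hx1 := congrFun hφe x
    have hx2 := congrFun hd x
    rw [Finset.sum_apply] at hx1 hx2 ⊢
    change wedgeLeft h₁ (η x) (extD (𝓡∂ 3) φ x) +
      ((sgn p : ℤ) : ℝ) • wedgeLeft h₂ (extD (𝓡∂ 3) η x) (φ x) = _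
    rw [hx2, map_sum, hx1, map_sum, Finset.smul_sum, ← Finset.sum_add_distrib]
    rfl
  rw [e, integral_sum hc _ (fun j => contDens_leibniz h₁ h₂ (hsm j).1 hη.1)
    fun j x hx => leibniz_eq_zero h₁ h₂ η fun h => hx (hsub j h)]
  refine Finset.sum_eq_zero fun j _ => integral_leibniz_of_subset_source F h₁ h₂ (hsm j) hη
    (k := j) (hc.of_isClosed_subset (isClosed_tsupport _) (hsub j)) ?_
  exact (tsupport_smul_subset_left (chartPartition M j) φ).trans (tsupport_chartPartition j)

end

section

open BulkBoundary

namespace BulkFlow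

/-! ### Graded antisymmetry of the pairing -/

variable [IsManifold (𝓡∂ 3) ∞ M]

theorem continuousOn_dens_wedgeForm_actPull {p q : ℕ} (h : p + q = 3)
    {φ : M → E3 [⋀^Fin p]→L[ℝ] ℝ} (hφ : IsSmoothForm (𝓡∂ 3) φ)
    {ψ : M → E3 [⋀^Fin (q + 1)]→L[ℝ] ℝ} (hψ : IsSmoothForm (𝓡∂ 3) ψ) (i : M) :
    ContinuousOn (fun r : ℝ × E3 => dens (wedgeForm h φ (F.actPull r.1 (F.ctrNu ψ))) i r.2)
      (univ ×ˢ (extChartAt (𝓡∂ 3) i).target) := by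
  refine ContinuousOn.congr (continuousOn_wedge3 h
    ((hφ i).continuousOn.comp continuousOn_snd fun r hr => hr.2)
    (F.contDiffOn_contract_flowRep hψ i).continuousOn stdVec) fun r hr => ?_
  rw [dens_wedgeForm, F.localRep_actPull_ctrNu r.1 ψ hr.2]
  rfl

theorem contDens_wedgeForm_actPull {p q : ℕ} (h : p + q = 3)
    {φ : M → E3 [⋀^Fin p]→L[ℝ] ℝ} (hφ : IsSmoothForm (𝓡∂ 3) φ)
    {ψ : M → E3 [⋀^Fin (q + 1)]→L[ℝ] ℝ} (hψ : IsSmoothForm (𝓡∂ 3) ψ) (s : ℝ) :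
    ContDens (wedgeForm h φ (F.actPull s (F.ctrNu ψ))) := fun i =>
  (F.continuousOn_dens_wedgeForm_actPull h hφ hψ i).comp (f := fun y : E3 => (s, y))
    (by fun_prop) fun _ hy => ⟨mem_univ _, hy⟩

variable [T2Space M] [SigmaCompactSpace M]

/-- The integral `∫ φ ∧ Gψ` as an integral over the parameter of the flow. -/
theorem integral_wedgeForm_green {p q : ℕ} (h : p + q = 3) {φ : M → E3 [⋀^Fin p]→L[ℝ] ℝ}
    (hφ : IsSmoothForm (𝓡∂ 3) φ) (hcφ : HasCompactSupport φ) {ψ : M → E3 [⋀^Fin (q + 1)]→L[ℝ] ℝ}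
    (hψ : IsSmoothForm (𝓡∂ 3) ψ) {T : ℝ} (hT : 0 < T)
    (hTs : ∀ x ∈ tsupport φ, ∀ s, T ≤ |s| → F.act s x ∉ tsupport ψ) :
    X.integral (wedgeForm h φ (F.green ψ)) =
      -∫ s in (-T)..T, X.integral (wedgeForm h φ (F.actPull s (F.ctrNu ψ))) := by
  have e : wedgeForm h φ (F.green ψ) = (-1 : ℝ) • wedgeForm h φ (F.cyl (-T) T ψ) := by
    funext x
    by_cases hx : x ∈ tsupport φ
    · rw [wedgeForm, F.green_eq_cyl hψ hT (hTs x hx), wedge3_smul_right]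
      rfl
    · rw [Pi.smul_apply, wedgeForm_eq_zero_left h _ hx, wedgeForm_eq_zero_left h _ hx, smul_zero]
  rw [e, integral_smul', neg_one_mul, integral_intervalIntegral hcφ (a := -T) (b := T)
    (χ := fun s => wedgeForm h φ (F.actPull s (F.ctrNu ψ))) ?_
    (fun i => F.continuousOn_dens_wedgeForm_actPull h hφ hψ i)
    fun s x hx => wedgeForm_eq_zero_left h _ hx]
  intro x v
  refine LinearMap.map_intervalIntegral (wedgeRight h (φ x) v) ?_
    (F.continuous_actPull_ctrNu hψ x) (-T) T
  exact continuousOn_univ.mp (continuousOn_wedge3 h continuousOn_const continuousOn_id v)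

/-- Graded antisymmetry of the pairing, which follows from the invariance of the integral under the
flow and from an identity for contractions with a vector. -/
theorem integral_wedgeForm_green_comm {a b : ℕ} (h : a + 1 + b = 3) (h' : b + 1 + a = 3) (c : ℝ)
    (hcontr : ∀ (α : E3 [⋀^Fin (a + 1)]→L[ℝ] ℝ) (β : E3 [⋀^Fin (b + 1)]→L[ℝ] ℝ) (w : E3),
      wedge3 h α (β.curryLeft w) = c • wedge3 h' β (α.curryLeft w))
    {φ : M → E3 [⋀^Fin (a + 1)]→L[ℝ] ℝ} (hφ : IsSmoothForm (𝓡∂ 3) φ) (hcφ : HasCompactSupport φ)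
    {ψ : M → E3 [⋀^Fin (b + 1)]→L[ℝ] ℝ} (hψ : IsSmoothForm (𝓡∂ 3) ψ)
    (hcψ : HasCompactSupport ψ) :
    X.integral (wedgeForm h φ (F.green ψ)) = c * X.integral (wedgeForm h' ψ (F.green φ)) := by
  obtain ⟨T, hT, hTs⟩ := F.exists_act_notMem hcφ.isCompact hcψ.isCompact
  have hTs' : ∀ x ∈ tsupport ψ, ∀ s, T ≤ |s| → F.act s x ∉ tsupport φ := fun x hx s hs hm =>
    hTs _ hm (-s) (by rwa [abs_neg]) (by rwa [F.act_neg_act])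
  have key : ∀ s, X.integral (wedgeForm h φ (F.actPull s (F.ctrNu ψ))) =
      c * X.integral (wedgeForm h' ψ (F.actPull (-s) (F.ctrNu φ))) := fun s => by
    -- `Θ₋ₛ* (φ ∧ Θₛ* ι_ν ψ) = Θ₋ₛ* φ ∧ ι_ν ψ`, which is `c • ψ ∧ Θ₋ₛ* ι_ν φ` by the contraction identity
    have e : F.actPull3 (-s) (wedgeForm h φ (F.actPull s (F.ctrNu ψ))) =
        c • wedgeForm h' ψ (F.actPull (-s) (F.ctrNu φ)) := by
      funext x
      have e1 : F.actPull3 (-s) (wedgeForm h φ (F.actPull s (F.ctrNu ψ))) x =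
          wedge3 h (F.actPull (-s) φ x) (F.actPull (-s) (F.actPull s (F.ctrNu ψ)) x) := by
        ext v
        exact (wedge3_comp h _ _ _ _).symm
      rw [e1, actPull_actPull, add_neg_cancel, actPull_zero, Pi.smul_apply, wedgeForm,
        ← ctrNu_actPull]
      exact hcontr _ _ _
    rw [← integral_smul', ← e, F.integral_actPull3 (-s) hcφ
      (F.contDens_wedgeForm_actPull h hφ hψ s) ?_ fun x hx => wedgeForm_eq_zero_left h _ hx]
    rw [e]
    exact (F.contDens_wedgeForm_actPull h' hψ hφ (-s)).smul c
  rw [F.integral_wedgeForm_green h hφ hcφ hψ hT hTs, F.integral_wedgeForm_green h' hψ hcψ hφ hT hTs']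
  simp only [key]
  rw [intervalIntegral.integral_const_mul, intervalIntegral.integral_comp_neg
    fun s => X.integral (wedgeForm h' ψ (F.actPull s (F.ctrNu φ))), neg_neg]
  ring

/-! ### The pairing of homogeneous observables -/

section Ev

variable {p q : ℕ}

theorem ev_eq (h : p + q = 3) (φ : M → E3 [⋀^Fin p]→L[ℝ] ℝ) (α : M → E3 [⋀^Fin q]→L[ℝ] ℝ) :
    X.ev φ α = sgn ((p : ℤ) - 2 + 1) * X.integral (wedgeForm h φ α) := dif_pos h

theorem ev_eq_zero (h : p + q ≠ 3) (φ : M → E3 [⋀^Fin p]→L[ℝ] ℝ) (α : M → E3 [⋀^Fin q]→L[ℝ] ℝ) :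
    X.ev φ α = 0 := dif_neg h

theorem ev_smul_left (c : ℝ) (φ : M → E3 [⋀^Fin p]→L[ℝ] ℝ) (α : M → E3 [⋀^Fin q]→L[ℝ] ℝ) :
    X.ev (c • φ) α = c * X.ev φ α := by
  by_cases h : p + q = 3
  · have e : wedgeForm h (c • φ) α = c • wedgeForm h φ α :=
      funext fun x => wedge3_smul_left h c _ _
    rw [ev_eq h, ev_eq h, e, integral_smul']
    ring
  · rw [ev_eq_zero h, ev_eq_zero h, mul_zero]

theorem ev_smul_right (c : ℝ) (φ : M → E3 [⋀^Fin p]→L[ℝ] ℝ) (α : M → E3 [⋀^Fin q]→L[ℝ] ℝ) :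
    X.ev φ (c • α) = c * X.ev φ α := by
  by_cases h : p + q = 3
  · have e : wedgeForm h φ (c • α) = c • wedgeForm h φ α :=
      funext fun x => wedge3_smul_right h c _ _
    rw [ev_eq h, ev_eq h, e, integral_smul']
    ring
  · rw [ev_eq_zero h, ev_eq_zero h, mul_zero]

theorem ev_zero_left (α : M → E3 [⋀^Fin q]→L[ℝ] ℝ) :
    X.ev (0 : M → E3 [⋀^Fin p]→L[ℝ] ℝ) α = 0 := by
  have := ev_smul_left (X := X) 0 (0 : M → E3 [⋀^Fin p]→L[ℝ] ℝ) α
  rwa [zero_smul, zero_mul] at this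

theorem ev_zero_right (φ : M → E3 [⋀^Fin p]→L[ℝ] ℝ) :
    X.ev φ (0 : M → E3 [⋀^Fin q]→L[ℝ] ℝ) = 0 := by
  have := ev_smul_right (X := X) 0 φ (0 : M → E3 [⋀^Fin q]→L[ℝ] ℝ)
  rwa [zero_smul, zero_mul] at this

theorem ev_add_left {φ φ' : M → E3 [⋀^Fin p]→L[ℝ] ℝ} {α : M → E3 [⋀^Fin q]→L[ℝ] ℝ}
    (hφ : IsSmoothForm (𝓡∂ 3) φ) (hc : HasCompactSupport φ) (hφ' : IsSmoothForm (𝓡∂ 3) φ')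
    (hc' : HasCompactSupport φ') (hα : IsSmoothForm (𝓡∂ 3) α) :
    X.ev (φ + φ') α = X.ev φ α + X.ev φ' α := by
  by_cases h : p + q = 3
  · have e : wedgeForm h (φ + φ') α = wedgeForm h φ α + wedgeForm h φ' α :=
      funext fun x => wedge3_add_left h _ _ _
    rw [ev_eq h, ev_eq h, ev_eq h, e, integral_add (hc.isCompact.union hc'.isCompact)
      (contDens_wedgeForm h hφ hα) (contDens_wedgeForm h hφ' hα)
      (fun x hx => wedgeForm_eq_zero_left h _ fun hm => hx (.inl hm))
      (fun x hx => wedgeForm_eq_zero_left h _ fun hm => hx (.inr hm)), mul_add]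
  · rw [ev_eq_zero h, ev_eq_zero h, ev_eq_zero h, add_zero]

theorem ev_add_right {φ : M → E3 [⋀^Fin p]→L[ℝ] ℝ} {α α' : M → E3 [⋀^Fin q]→L[ℝ] ℝ}
    (hφ : IsSmoothForm (𝓡∂ 3) φ) (hc : HasCompactSupport φ) (hα : IsSmoothForm (𝓡∂ 3) α)
    (hα' : IsSmoothForm (𝓡∂ 3) α') : X.ev φ (α + α') = X.ev φ α + X.ev φ α' := by
  by_cases h : p + q = 3
  · have e : wedgeForm h φ (α + α') = wedgeForm h φ α + wedgeForm h φ α' :=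
      funext fun x => wedge3_add_right h _ _ _
    rw [ev_eq h, ev_eq h, ev_eq h, e, integral_add hc.isCompact
      (contDens_wedgeForm h hφ hα) (contDens_wedgeForm h hφ hα')
      (fun x hx => wedgeForm_eq_zero_left h _ hx)
      (fun x hx => wedgeForm_eq_zero_left h _ hx), mul_add]
  · rw [ev_eq_zero h, ev_eq_zero h, ev_eq_zero h, add_zero]

include F in
/-- Integration by parts for the evaluation pairing. -/
theorem ev_extD {φ : M → E3 [⋀^Fin p]→L[ℝ] ℝ} {η : M → E3 [⋀^Fin q]→L[ℝ] ℝ}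
    (hφ : φ ∈ X.fields ε p) (hη : η ∈ X.fields ε q) (hc : HasCompactSupport φ) :
    X.ev (extD (𝓡∂ 3) φ) η = sgn ((p : ℤ) - 2) * X.ev φ (extD (𝓡∂ 3) η) := by
  by_cases h : p + 1 + q = 3
  · have h2 : p + (q + 1) = 3 := by omega
    have hS := integral_leibniz F h h2 hφ hη hc
    have hcd : HasCompactSupport (extD (𝓡∂ 3) φ) :=
      hc.of_isClosed_subset (isClosed_tsupport _) (tsupport_extD φ)
    rw [leibniz, integral_add hc.isCompact (contDens_wedgeForm h hφ.1.extD hη.1)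
      ((contDens_wedgeForm h2 hφ.1 hη.1.extD).smul _)
      (fun x hx => wedgeForm_eq_zero_left h _ fun hm => hx (tsupport_extD φ hm))
      (fun x hx => by rw [Pi.smul_apply, wedgeForm_eq_zero_left h2 _ hx, smul_zero]),
      integral_smul'] at hS
    rw [ev_eq h, ev_eq h2, eq_neg_of_add_eq_zero_left hS]
    have s1 : sgn ((p : ℤ) - 2) = sgn p := by
      rw [sub_eq_add_neg, sgn_add, show sgn (-2) = 1 from rfl, mul_one]
    have s2 : sgn (((p + 1 : ℕ) : ℤ) - 2 + 1) = sgn p := by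
      rw [show ((p + 1 : ℕ) : ℤ) - 2 + 1 = p by push_cast; ring]
    have s3 : sgn ((p : ℤ) - 2 + 1) = -sgn p := by
      rw [sgn_add, s1, sgn_one, mul_neg_one]
    rw [s1, s2, s3]
    push_cast
    ring
  · rw [ev_eq_zero h, ev_eq_zero (by omega), mul_zero]

end Ev
end BulkFlow

end

section

open BulkBoundary

namespace BulkFlow

/-! ### The Poisson structure on linear observables -/

variable {U : Set M}

/-- A homogeneous observable is zero or given by a form of the corresponding degree. -/
theorem eq_zero_or_eq_lof {i : ℤ} {φ : ObsSpace X ε U} (h : φ ∈ obsGr X ε U i) :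
    φ = 0 ∨ ∃ (n : ℕ) (α : FieldC X ε U n), i = (n : ℤ) - 2 ∧
      φ = DirectSum.lof ℝ ℕ (FieldC X ε U) n α := by
  by_cases hi : ∃ n : ℕ, (n : ℤ) - 2 = i
  · obtain ⟨n, rfl⟩ := hi
    exact .inr ⟨n, φ n, rfl, eq_lof_of_mem_obsGr h⟩
  · exact .inl (DFinsupp.ext fun n => h n fun h => hi ⟨n, h⟩)

variable [IsManifold (𝓡∂ 3) ∞ M] [T2Space M] [SigmaCompactSpace M]

omit [T2Space M] [SigmaCompactSpace M] in
theorem green_zero {n : ℕ} : F.green (0 : M → E3 [⋀^Fin (n + 1)]→L[ℝ] ℝ) = 0 := by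
  have := F.green_smul 0 (0 : M → E3 [⋀^Fin (n + 1)]→L[ℝ] ℝ)
  rwa [zero_smul, zero_smul] at this

theorem obsτ_add_left (φ φ' ψ : ObsSpace X ε U) :
    F.obsτ (φ + φ') ψ = F.obsτ φ ψ + F.obsτ φ' ψ := by
  simp only [obsτ, ← Finset.sum_add_distrib]
  refine Finset.sum_congr rfl fun p _ => Finset.sum_congr rfl fun q _ => ?_
  exact ev_add_left (φ p).form_mem.1.1 (φ p).form_mem.2.1 (φ' p).form_mem.1.1
    (φ' p).form_mem.2.1 (green_mem_fields (F := F) (ψ (q + 1)).form_mem).1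

theorem obsτ_smul_left (c : ℝ) (φ ψ : ObsSpace X ε U) :
    F.obsτ (c • φ) ψ = c * F.obsτ φ ψ := by
  simp only [obsτ, Finset.mul_sum]
  exact Finset.sum_congr rfl fun p _ => Finset.sum_congr rfl fun q _ => ev_smul_left c _ _

theorem obsτ_add_right (φ ψ ψ' : ObsSpace X ε U) :
    F.obsτ φ (ψ + ψ') = F.obsτ φ ψ + F.obsτ φ ψ' := by
  simp only [obsτ, ← Finset.sum_add_distrib]
  refine Finset.sum_congr rfl fun p _ => Finset.sum_congr rfl fun q _ => ?_
  rw [← ev_add_right (φ p).form_mem.1.1 (φ p).form_mem.2.1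
    (green_mem_fields (F := F) (ψ (q + 1)).form_mem).1
    (green_mem_fields (F := F) (ψ' (q + 1)).form_mem).1, ← F.green_add
      (ψ (q + 1)).form_mem.1.1 (ψ (q + 1)).form_mem.2.1 (ψ' (q + 1)).form_mem.1.1
      (ψ' (q + 1)).form_mem.2.1]
  rfl

theorem obsτ_smul_right (c : ℝ) (φ ψ : ObsSpace X ε U) :
    F.obsτ φ (c • ψ) = c * F.obsτ φ ψ := by
  simp only [obsτ, Finset.mul_sum]
  refine Finset.sum_congr rfl fun p _ => Finset.sum_congr rfl fun q _ => ?_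
  rw [← ev_smul_right, ← green_smul]
  rfl

theorem obsτ_zero_left (ψ : ObsSpace X ε U) : F.obsτ 0 ψ = 0 := by
  have := F.obsτ_smul_left 0 0 ψ
  rwa [zero_smul, zero_mul] at this

theorem obsτ_zero_right (φ : ObsSpace X ε U) : F.obsτ φ 0 = 0 := by
  have := F.obsτ_smul_right 0 φ 0
  rwa [zero_smul, zero_mul] at this

omit [IsManifold (𝓡∂ 3) ∞ M] [T2Space M] [SigmaCompactSpace M] in
theorem lof_form_of_ne {n m : ℕ} (h : m ≠ n) (α : FieldC X ε U n) :
    (DirectSum.lof ℝ ℕ (FieldC X ε U) n α m).form = 0 := by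
  have : DirectSum.lof ℝ ℕ (FieldC X ε U) n α m = 0 := DirectSum.of_eq_of_ne _ _ _ h
  rw [this]
  rfl

omit [IsManifold (𝓡∂ 3) ∞ M] [T2Space M] [SigmaCompactSpace M] in
theorem lof_form_same {n : ℕ} (α : FieldC X ε U n) :
    (DirectSum.lof ℝ ℕ (FieldC X ε U) n α n).form = α.form :=
  congrArg FieldC.form (DirectSum.of_eq_same (β := FieldC X ε U) n α)

theorem obsτ_lof_succ {p q : ℕ} (φ : FieldC X ε U p) (ψ : FieldC X ε U (q + 1)) :
    F.obsτ (DirectSum.lof ℝ ℕ (FieldC X ε U) p φ) (DirectSum.lof ℝ ℕ (FieldC X ε U) (q + 1) ψ) =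
      X.ev φ.form (F.green ψ.form) := by
  by_cases h : p + q = 3
  · rw [obsτ, Finset.sum_eq_single p, Finset.sum_eq_single q, lof_form_same, lof_form_same]
    · intro m _ hm
      rw [lof_form_of_ne (n := q + 1) (m := m + 1) (by omega), green_zero, ev_zero_right]
    · intro hm
      exact absurd (Finset.mem_range.mpr (by omega)) hm
    · intro m _ hm
      refine Finset.sum_eq_zero fun r _ => ?_
      rw [lof_form_of_ne hm, ev_zero_left]
    · intro hm
      exact absurd (Finset.mem_range.mpr (by omega)) hm
  · rw [ev_eq_zero h]
    refine Finset.sum_eq_zero fun m _ => Finset.sum_eq_zero fun r _ => ?_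
    by_cases hm : m = p
    · by_cases hr : r = q
      · subst hm hr
        exact ev_eq_zero h _ _
      · rw [lof_form_of_ne (n := q + 1) (m := r + 1) (by omega), green_zero, ev_zero_right]
    · rw [lof_form_of_ne hm, ev_zero_left]

theorem obsτ_lof_zero (φ : ObsSpace X ε U) (ψ : FieldC X ε U 0) :
    F.obsτ φ (DirectSum.lof ℝ ℕ (FieldC X ε U) 0 ψ) = 0 :=
  Finset.sum_eq_zero fun m _ => Finset.sum_eq_zero fun r _ => by
    rw [lof_form_of_ne (n := 0) (m := r + 1) (by omega), green_zero, ev_zero_right]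

omit [IsManifold (𝓡∂ 3) ∞ M] [T2Space M] [SigmaCompactSpace M] in
/-- In degree `4` and above there are no nonzero forms. -/
theorem lof_eq_zero_of_four_le {n : ℕ} (hn : 4 ≤ n) (α : FieldC X ε U n) : α = 0 :=
  FieldC.form_ext (funext fun x => form_eq_zero_of_four_le hn (α.form x))

theorem obsτ_degree_zero {p r : ℕ} (h : p + r ≠ 4) (φ : FieldC X ε U p) (ψ : FieldC X ε U r) :
    F.obsτ (DirectSum.lof ℝ ℕ (FieldC X ε U) p φ) (DirectSum.lof ℝ ℕ (FieldC X ε U) r ψ) = 0 := by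
  cases r with
  | zero => exact F.obsτ_lof_zero _ ψ
  | succ q => rw [obsτ_lof_succ, ev_eq_zero (by omega)]

/-- Antisymmetry on forms of complementary degrees. -/
theorem obsτ_antisymm {p r : ℕ} (h : p + r = 4) (φ : FieldC X ε U p) (ψ : FieldC X ε U r) :
    F.obsτ (DirectSum.lof ℝ ℕ (FieldC X ε U) p φ) (DirectSum.lof ℝ ℕ (FieldC X ε U) r ψ) =
      -(sgn (((p : ℤ) - 2) * ((r : ℤ) - 2)) * F.obsτ (DirectSum.lof ℝ ℕ (FieldC X ε U) r ψ)
        (DirectSum.lof ℝ ℕ (FieldC X ε U) p φ)) := by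
  have h13 : ∀ (φ : FieldC X ε U 1) (ψ : FieldC X ε U 3),
      X.ev φ.form (F.green ψ.form) = X.ev ψ.form (F.green φ.form) := fun φ ψ => by
    rw [ev_eq (p := 1) (q := 2) rfl, ev_eq (p := 3) (q := 0) rfl,
      F.integral_wedgeForm_green_comm (a := 0) (b := 2) rfl rfl 1 (fun α β w => by
        rw [one_smul]; exact wedge3_contract_one_three α β w rfl rfl)
        φ.form_mem.1.1 φ.form_mem.2.1 ψ.form_mem.1.1 ψ.form_mem.2.1, one_mul]
    rfl
  have hp : p ≤ 4 := by omega
  obtain rfl : r = 4 - p := by omega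
  interval_cases p
  · rw [lof_eq_zero_of_four_le (n := 4 - 0) le_rfl ψ, map_zero, obsτ_zero_right, obsτ_zero_left]
    simp
  · change F.obsτ (DirectSum.lof ℝ ℕ (FieldC X ε U) 1 φ) (DirectSum.lof ℝ ℕ (FieldC X ε U) (2 + 1) ψ)
      = -(((-1 : ℤ) : ℝ) * F.obsτ (DirectSum.lof ℝ ℕ (FieldC X ε U) 3 ψ)
        (DirectSum.lof ℝ ℕ (FieldC X ε U) (0 + 1) φ))
    rw [obsτ_lof_succ, obsτ_lof_succ]
    push_cast
    rw [neg_one_mul, neg_neg]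
    exact h13 φ ψ
  · change F.obsτ (DirectSum.lof ℝ ℕ (FieldC X ε U) 2 φ) (DirectSum.lof ℝ ℕ (FieldC X ε U) (1 + 1) ψ)
      = -(((1 : ℤ) : ℝ) * F.obsτ (DirectSum.lof ℝ ℕ (FieldC X ε U) 2 ψ)
        (DirectSum.lof ℝ ℕ (FieldC X ε U) (1 + 1) φ))
    rw [obsτ_lof_succ, obsτ_lof_succ, ev_eq (p := 2) (q := 1) rfl, ev_eq (p := 2) (q := 1) rfl,
      F.integral_wedgeForm_green_comm (a := 1) (b := 1) rfl rfl (-1) (fun α β w =>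
        wedge3_contract_two_two α β w rfl)
        φ.form_mem.1.1 φ.form_mem.2.1 ψ.form_mem.1.1 ψ.form_mem.2.1]
    push_cast
    ring
  · change F.obsτ (DirectSum.lof ℝ ℕ (FieldC X ε U) 3 φ) (DirectSum.lof ℝ ℕ (FieldC X ε U) (0 + 1) ψ)
      = -(((-1 : ℤ) : ℝ) * F.obsτ (DirectSum.lof ℝ ℕ (FieldC X ε U) 1 ψ)
        (DirectSum.lof ℝ ℕ (FieldC X ε U) (2 + 1) φ))
    rw [obsτ_lof_succ, obsτ_lof_succ]
    push_cast
    rw [neg_one_mul, neg_neg]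
    exact (h13 ψ φ).symm
  · rw [lof_eq_zero_of_four_le le_rfl φ, map_zero, obsτ_zero_right, obsτ_zero_left]
    simp

/-- Compatibility of the pairing with the differential: Stokes' theorem for `φ` and `Gψ`, together with
`G d = -d G`. -/
theorem obsτ_cocycle {p r : ℕ} (φ : FieldC X ε U p) (ψ : FieldC X ε U r) :
    F.obsτ (DirectSum.lof ℝ ℕ (FieldC X ε U) (p + 1) (dForm X ε U p φ))
        (DirectSum.lof ℝ ℕ (FieldC X ε U) r ψ) +
      sgn ((p : ℤ) - 2) * F.obsτ (DirectSum.lof ℝ ℕ (FieldC X ε U) p φ)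
        (DirectSum.lof ℝ ℕ (FieldC X ε U) (r + 1) (dForm X ε U r ψ)) = 0 := by
  cases r with
  | zero =>
    have h : F.green (dForm X ε U 0 ψ).form = 0 :=
      green_extD_zero ψ.form_mem.1.1 ψ.form_mem.2.1
    rw [obsτ_lof_zero, obsτ_lof_succ, h, ev_zero_right, mul_zero, add_zero]
  | succ q =>
    have h1 : (dForm X ε U p φ).form = extD (𝓡∂ 3) φ.form := rfl
    have h2 : (dForm X ε U (q + 1) ψ).form = extD (𝓡∂ 3) ψ.form := rfl
    rw [obsτ_lof_succ, obsτ_lof_succ, h1, h2, green_extD ψ.form_mem.1.1 ψ.form_mem.2.1,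
      ev_extD F φ.form_mem.1 (green_mem_fields ψ.form_mem) φ.form_mem.2.1, ev_smul_right]
    ring

theorem obsτ_eq_zero_of_mem {i j : ℤ} {v w : ObsSpace X ε U} (hv : v ∈ obsGr X ε U i)
    (hw : w ∈ obsGr X ε U j) (hij : i + j ≠ 0) : F.obsτ v w = 0 := by
  obtain rfl | ⟨p, φ, rfl, rfl⟩ := eq_zero_or_eq_lof hv
  · exact F.obsτ_zero_left w
  obtain rfl | ⟨r, ψ, rfl, rfl⟩ := eq_zero_or_eq_lof hw
  · exact F.obsτ_zero_right _
  exact F.obsτ_degree_zero (by omega) φ ψ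

theorem obsτ_antisymm_of_mem {i j : ℤ} {v w : ObsSpace X ε U} (hv : v ∈ obsGr X ε U i)
    (hw : w ∈ obsGr X ε U j) : F.obsτ v w = -(sgn (i * j) * F.obsτ w v) := by
  obtain rfl | ⟨p, φ, rfl, rfl⟩ := eq_zero_or_eq_lof hv
  · rw [F.obsτ_zero_left, F.obsτ_zero_right, mul_zero, neg_zero]
  obtain rfl | ⟨r, ψ, rfl, rfl⟩ := eq_zero_or_eq_lof hw
  · rw [F.obsτ_zero_left, F.obsτ_zero_right, mul_zero, neg_zero]
  by_cases h : p + r = 4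
  · exact F.obsτ_antisymm h φ ψ
  · rw [F.obsτ_degree_zero h, F.obsτ_degree_zero (by omega), mul_zero, neg_zero]

theorem obsτ_cocycle_of_mem {i : ℤ} {v : ObsSpace X ε U} (hv : v ∈ obsGr X ε U i)
    (w : ObsSpace X ε U) :
    F.obsτ (obsD X ε U v) w + sgn i * F.obsτ v (obsD X ε U w) = 0 := by
  obtain rfl | ⟨p, φ, rfl, rfl⟩ := eq_zero_or_eq_lof hv
  · rw [map_zero, F.obsτ_zero_left, F.obsτ_zero_left, mul_zero, add_zero]
  induction w using DirectSum.induction_on with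
  | zero => rw [map_zero, F.obsτ_zero_right, F.obsτ_zero_right, mul_zero, add_zero]
  | of r ψ =>
    rw [← DirectSum.lof_eq_of ℝ, obsD_lof, obsD_lof]
    exact F.obsτ_cocycle φ ψ
  | add w w' h h' =>
    rw [map_add, F.obsτ_add_right, F.obsτ_add_right]
    linear_combination h + h'

/-- The pairing `τ` is an unshifted linear Poisson structure. -/
theorem isPoisson_obs (U : Set M) : (F.obs U).IsPoisson where
  add_left := F.obsτ_add_left
  smul_left := F.obsτ_smul_left
  add_right := F.obsτ_add_right
  smul_right := F.obsτ_smul_right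
  degree_zero _ _ _ hv _ hw hij := F.obsτ_eq_zero_of_mem hv hw hij
  antisymm _ _ _ hv _ hw := F.obsτ_antisymm_of_mem hv hw
  cocycle _ _ hv w := F.obsτ_cocycle_of_mem hv w

/-! ### Einstein causality -/

/-- Observables in disjoint regions have vanishing pairing. -/
theorem obsτ_ext_of_disjoint {U₁ U₂ U : Set M} (h₁ : U₁ ⊆ U) (h₂ : U₂ ⊆ U)
    (hd : (F.JUp U₁ ∪ F.JDown U₁) ∩ U₂ = ∅) (φ : ObsSpace X ε U₁) (ψ : ObsSpace X ε U₂) :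
    F.obsτ (ext h₁ φ) (ext h₂ ψ) = 0 := by
  refine Finset.sum_eq_zero fun p _ => Finset.sum_eq_zero fun q _ => ?_
  rw [ext_apply, ext_apply]
  change X.ev (φ p).form (F.green (ψ (q + 1)).form) = 0
  by_cases h : p + q = 3
  · have e : wedgeForm h (φ p).form (F.green (ψ (q + 1)).form) = 0 := by
      funext x
      by_cases hx : x ∈ tsupport (φ p).form
      -- no orbit through the support of the first observable meets the support of the second
      · have hs : ∀ s, F.act s x ∉ tsupport (ψ (q + 1)).form := fun s hm => by
          have h2 := (ψ (q + 1)).form_mem.2.2 hm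
          have h1 := (φ p).form_mem.2.2 hx
          have : F.act s x ∈ (F.JUp U₁ ∪ F.JDown U₁) ∩ U₂ := by
            refine ⟨?_, h2⟩
            rcases le_total 0 s with h | h
            · exact .inl ⟨x, h1, s, h, rfl⟩
            · exact .inr ⟨x, h1, s, h, rfl⟩
          rw [hd] at this
          exact this
        rw [wedgeForm, F.green_eq_cyl (ψ (q + 1)).form_mem.1.1 one_pos fun s _ => hs s, cyl]
        simp only [F.actPull_ctrNu_eq_zero (hs _), intervalIntegral.integral_zero, smul_zero]
        exact wedge3_zero_right h _
      · exact wedgeForm_eq_zero_left h _ hx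
    rw [ev_eq h, e, CSWZW.integral_zero, mul_zero]
  · exact ev_eq_zero h _ _

theorem einsteinCausality : F.EinsteinCausality F.aqft := fun _ _ U f₁ f₂ hd i j a ha b hb =>
  PairedComplex.mapCCR_commute (F.isPoisson_obs U.carrier) (F.extHom (leOfHom f₁))
    (F.extHom (leOfHom f₂)) (F.obsτ_ext_of_disjoint _ _ hd) i j a ha b hb

end BulkFlow

end

section

open BulkBoundary

namespace BulkFlow

/-! ### Futures and pasts of compact sets -/

theorem subset_JUp (S : Set M) : S ⊆ F.JUp S := fun x hx => ⟨x, hx, 0, le_rfl, (F.act_zero x).symm⟩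

theorem JUp_mono {S S' : Set M} (h : S ⊆ S') : F.JUp S ⊆ F.JUp S' :=
  fun _ ⟨x, hx, s, hs, e⟩ => ⟨x, h hx, s, hs, e⟩

theorem JDown_mono {S S' : Set M} (h : S ⊆ S') : F.JDown S ⊆ F.JDown S' :=
  fun _ ⟨x, hx, s, hs, e⟩ => ⟨x, h hx, s, hs, e⟩

theorem mem_JUp_of_act_mem {S : Set M} {x : M} {s : ℝ} (hs : s ≤ 0) (h : F.act s x ∈ S) :
    x ∈ F.JUp S := ⟨_, h, -s, by linarith, (F.act_neg_act s x).symm⟩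

theorem mem_JDown_of_act_mem {S : Set M} {x : M} {s : ℝ} (hs : 0 ≤ s) (h : F.act s x ∈ S) :
    x ∈ F.JDown S := ⟨_, h, -s, by linarith, (F.act_neg_act s x).symm⟩

section GreenSupport

variable {n : ℕ} {ψ : M → E3 [⋀^Fin (n + 1)]→L[ℝ] ℝ}

theorem greenUp_eq_zero {x : M} (hx : x ∉ F.JUp (tsupport ψ)) : F.greenUp ψ x = 0 := by
  have h1 : F.greenUp ψ x = -F.fiberInt (Iic 0) ψ x := rfl
  rw [h1, fiberInt_eq, setIntegral_congr_fun measurableSet_Iic (g := fun _ => 0) fun s hs =>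
    F.actPull_ctrNu_eq_zero fun hm => hx (F.mem_JUp_of_act_mem hs hm)]
  simp

theorem greenDown_eq_zero {x : M} (hx : x ∉ F.JDown (tsupport ψ)) : F.greenDown ψ x = 0 := by
  have h1 : F.greenDown ψ x = F.fiberInt (Ici 0) ψ x := rfl
  rw [h1, fiberInt_eq, setIntegral_congr_fun measurableSet_Ici (g := fun _ => 0) fun s hs =>
    F.actPull_ctrNu_eq_zero fun hm => hx (F.mem_JDown_of_act_mem hs hm)]
  simp

end GreenSupport

/-- The integral of a function over the past half of an orbit. -/
def avgDown (w : M → ℝ) (x : M) : ℝ := ∫ s in Iic 0, w (F.act s x)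

/-- The integral of a function over the future half of an orbit. -/
def avgUp (w : M → ℝ) (x : M) : ℝ := ∫ s in Ioi 0, w (F.act s x)

theorem avgDown_eq_zero {w : M → ℝ} {x : M} (hx : x ∉ F.JUp (tsupport w)) : F.avgDown w x = 0 := by
  rw [avgDown, setIntegral_congr_fun measurableSet_Iic (g := fun _ => 0) fun s hs =>
    image_eq_zero_of_notMem_tsupport fun hm => hx (F.mem_JUp_of_act_mem hs hm)]
  simp

theorem avgUp_eq_zero {w : M → ℝ} {x : M} (hx : x ∉ F.JDown (tsupport w)) : F.avgUp w x = 0 := by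
  rw [avgUp, setIntegral_congr_fun measurableSet_Ioi (g := fun _ => 0) fun s hs =>
    image_eq_zero_of_notMem_tsupport fun hm => hx (F.mem_JDown_of_act_mem (le_of_lt hs) hm)]
  simp

variable [IsManifold (𝓡∂ 3) ∞ M]

section Closed

variable [T2Space M]

/-- A set which near each point agrees with the image of `A` under the flow for a compact set of times
is closed. -/
theorem isClosed_of_eventually_eq_image {A : Set M} (hA : IsCompact A) {J : Set M} {S : ℝ → Set ℝ}
    (hS : ∀ T, IsCompact (S T))
    (hJ : ∀ T, (fun q : ℝ × M => F.act q.1 q.2) '' (S T ×ˢ A) ⊆ J)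
    (hJ' : ∀ (T : ℝ) (x : M), (∀ s, T ≤ |s| → F.act s x ∉ A) → x ∈ J →
      x ∈ (fun q : ℝ × M => F.act q.1 q.2) '' (S T ×ˢ A)) : IsClosed J := by
  refine isOpen_compl_iff.mp (isOpen_iff_mem_nhds.mpr fun x hx => ?_)
  obtain ⟨T, _, h⟩ := F.exists_eventually_act_notMem x hA
  have hc : IsClosed ((fun q : ℝ × M => F.act q.1 q.2) '' (S T ×ˢ A)) :=
    (((hS T).prod hA).image F.continuous_act).isClosed
  filter_upwards [h, hc.isOpen_compl.mem_nhds fun hm => hx (hJ T hm)] with z hz hz' hzJ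
  exact hz' (hJ' T z hz hzJ)

theorem isClosed_JUp {A : Set M} (hA : IsCompact A) : IsClosed (F.JUp A) := by
  refine F.isClosed_of_eventually_eq_image hA (S := fun T => Icc 0 T) (fun T => isCompact_Icc) ?_ ?_
  · rintro T _ ⟨⟨s, x⟩, ⟨hs, hx⟩, rfl⟩
    exact ⟨x, hx, s, hs.1, rfl⟩
  · rintro T _ h ⟨x, hx, s, hs, rfl⟩
    refine ⟨(s, x), ⟨⟨hs, ?_⟩, hx⟩, rfl⟩
    by_contra hn
    refine h (-s) ?_ (by rwa [F.act_neg_act])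
    rw [abs_neg, abs_of_nonneg hs]
    exact (not_le.mp hn).le

theorem isClosed_JDown {A : Set M} (hA : IsCompact A) : IsClosed (F.JDown A) := by
  refine F.isClosed_of_eventually_eq_image hA (S := fun T => Icc (-T) 0) (fun T => isCompact_Icc)
    ?_ ?_
  · rintro T _ ⟨⟨s, x⟩, ⟨hs, hx⟩, rfl⟩
    exact ⟨x, hx, s, hs.2, rfl⟩
  · rintro T _ h ⟨x, hx, s, hs, rfl⟩
    refine ⟨(s, x), ⟨⟨?_, hs⟩, hx⟩, rfl⟩
    by_contra hn
    refine h (-s) ?_ (by rwa [F.act_neg_act])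
    rw [abs_neg, abs_of_nonpos hs]
    linarith

/-- By properness, the set of points between two compact sets is compact. -/
theorem isCompact_JUp_inter_JDown {A B : Set M} (hA : IsCompact A) (hB : IsCompact B) :
    IsCompact (F.JUp A ∩ F.JDown B) := by
  obtain ⟨T, hT, h⟩ := F.exists_act_notMem hA hB
  refine (((isCompact_Icc (a := 0) (b := T)).prod hA).image F.continuous_act).of_isClosed_subset
    ((F.isClosed_JUp hA).inter (F.isClosed_JDown hB)) ?_
  rintro _ ⟨⟨x, hx, s, hs, rfl⟩, y, hy, t, ht, e⟩
  refine ⟨(s, x), ⟨⟨hs, ?_⟩, hx⟩, rfl⟩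
  by_contra hn
  refine h x hx (-t + s) ?_ ?_
  · rw [abs_of_nonneg (by linarith)]
    linarith
  · rw [F.act_add, e, F.act_neg_act]
    exact hy

end Closed

/-! ### Averages of functions along the flow -/

section Average

/-- The integral of a function along pieces of the orbits depends smoothly on the orbit. -/
theorem contMDiff_intervalIntegral {w : M → ℝ} (hw : ContMDiff (𝓡∂ 3) 𝓘(ℝ, ℝ) ∞ w) (a b : ℝ) :
    ContMDiff (𝓡∂ 3) 𝓘(ℝ, ℝ) ∞ fun x => ∫ s in a..b, w (F.act s x) := by
  intro x
  have h1 : ContDiffOn ℝ ∞ (fun y => ∫ s in a..b, w (F.chartMap x (s, y)))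
      (extChartAt (𝓡∂ 3) x).target :=
    contDiffOn_intervalIntegral (𝓡∂ 3).convex_range (extChartAt_target_subset_range x)
      (fun _ hy => extChartAt_target_mem_nhdsWithin_of_mem hy) (uniqueDiffOn_extChartAt_target x) a b
      (f := fun q => w (F.chartMap x q))
      (hw.comp_contMDiffOn (F.contMDiffOn_chartMap x)).contDiffOn
  have h2 := h1.contMDiffOn.comp (contMDiffOn_extChartAt (I := 𝓡∂ 3) (n := ∞) (x := x))
    fun z hz => (extChartAt (𝓡∂ 3) x).map_source (by rwa [extChartAt_source])
  refine (h2.contMDiffAt ((chartAt _ x).open_source.mem_nhds (mem_chart_source _ x))).congr_of_eventuallyEq ?_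
  filter_upwards [extChartAt_source_mem_nhds (I := 𝓡∂ 3) x] with z hz
  simp only [Function.comp_apply, chartMap, (extChartAt (𝓡∂ 3) x).left_inv hz]

theorem contMDiff_avgDown {w : M → ℝ} (hw : ContMDiff (𝓡∂ 3) 𝓘(ℝ, ℝ) ∞ w)
    (hc : HasCompactSupport w) : ContMDiff (𝓡∂ 3) 𝓘(ℝ, ℝ) ∞ (F.avgDown w) := by
  intro x
  obtain ⟨T, hT, h⟩ := F.exists_eventually_act_notMem x hc
  refine (F.contMDiff_intervalIntegral hw (-T) 0 x).congr_of_eventuallyEq (h.mono fun z hz => ?_)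
  simp only [avgDown]
  rw [intervalIntegral.integral_of_le (by linarith)]
  refine setIntegral_eq_of_subset_of_forall_sdiff_eq_zero measurableSet_Iic
    (fun s hs => hs.2) fun s hs => image_eq_zero_of_notMem_tsupport (hz s ?_)
  by_contra hlt
  rw [not_le, abs_lt] at hlt
  exact hs.2 ⟨hlt.1, hs.1⟩

theorem contMDiff_avgUp {w : M → ℝ} (hw : ContMDiff (𝓡∂ 3) 𝓘(ℝ, ℝ) ∞ w)
    (hc : HasCompactSupport w) : ContMDiff (𝓡∂ 3) 𝓘(ℝ, ℝ) ∞ (F.avgUp w) := by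
  intro x
  obtain ⟨T, hT, h⟩ := F.exists_eventually_act_notMem x hc
  refine (F.contMDiff_intervalIntegral hw 0 T x).congr_of_eventuallyEq (h.mono fun z hz => ?_)
  simp only [avgUp]
  rw [intervalIntegral.integral_of_le hT.le]
  refine setIntegral_eq_of_subset_of_forall_sdiff_eq_zero measurableSet_Ioi
    (fun s hs => hs.1) fun s hs => image_eq_zero_of_notMem_tsupport (hz s ?_)
  by_contra hlt
  rw [not_le, abs_lt] at hlt
  exact hs.2 ⟨hs.1, hlt.2.le⟩

/-- The total weight of an orbit on which `w` does not vanish identically is positive. -/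
theorem avg_pos {w : M → ℝ} (hw : Continuous w) (hc : HasCompactSupport w) (h0 : ∀ x, 0 ≤ w x)
    {x : M} {s : ℝ} (hs : w (F.act s x) ≠ 0) : 0 < F.avgDown w x + F.avgUp w x := by
  obtain ⟨T, hT, h⟩ := F.exists_eventually_act_notMem x hc
  have hcont : Continuous fun s => w (F.act s x) :=
    hw.comp (F.continuous_act.comp (continuous_id.prodMk continuous_const))
  have hcs : HasCompactSupport fun s => w (F.act s x) := by
    refine HasCompactSupport.intro (isCompact_Icc (a := -T) (b := T)) fun s hs =>
      image_eq_zero_of_notMem_tsupport (h.self_of_nhds s ?_)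
    by_contra hlt
    rw [not_le, abs_lt] at hlt
    exact hs ⟨hlt.1.le, hlt.2.le⟩
  have hint := hcont.integrable_of_hasCompactSupport (μ := volume) hcs
  rw [avgDown, avgUp, intervalIntegral.integral_Iic_add_Ioi hint.integrableOn hint.integrableOn]
  exact hcont.integral_pos_of_hasCompactSupport_nonneg_nonzero hcs (fun s => h0 _) hs

end Average

variable [T2Space M] [SigmaCompactSpace M]

/-- If all orbits through the compact set `K` meet the open set `U`, there is a nonnegative smooth
function with compact support in `U` which is not identically zero on any orbit through `K`. -/
theorem exists_weight {U K : Set M} (hU : IsOpen U) (hK : IsCompact K)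
    (h : ∀ x ∈ K, ∃ s, F.act s x ∈ U) : ∃ w : M → ℝ, ContMDiff (𝓡∂ 3) 𝓘(ℝ, ℝ) ∞ w ∧
      HasCompactSupport w ∧ tsupport w ⊆ U ∧ (∀ x, 0 ≤ w x) ∧ ∀ x ∈ K, ∃ s, w (F.act s x) ≠ 0 := by
  have : LocallyCompactSpace M := Manifold.locallyCompact_of_finiteDimensional (𝓡∂ 3)
  choose! s hs using h
  have hcpt : ∀ x ∈ K, ∃ C, IsCompact C ∧ F.act (s x) x ∈ interior C ∧ C ⊆ U := fun x hx =>
    exists_compact_subset hU (hs x hx)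
  choose! C hC hC' hCU using hcpt
  obtain ⟨J, hJK, hJ⟩ := hK.elim_nhds_subcover (fun x => F.act (s x) ⁻¹' interior (C x))
    fun x hx => (isOpen_interior.preimage (F.act_contMDiff (s x)).continuous).mem_nhds (hC' x hx)
  have hL : IsCompact (⋃ x ∈ J, C x) := J.isCompact_biUnion fun x hx => hC x (hJK x hx)
  have hLU : (⋃ x ∈ J, C x) ⊆ U := iUnion₂_subset fun x hx => hCU x (hJK x hx)
  obtain ⟨L', hL', hLL', hL'U⟩ := exists_compact_between hL hU hLU
  have : NormalSpace M := inferInstance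
  obtain ⟨w, hw1, hw0, hw⟩ := exists_contMDiffMap_one_nhds_of_subset_interior (n := ⊤) (𝓡∂ 3)
    hL.isClosed hLL'
  have hsupp : tsupport w ⊆ L' := closure_minimal (fun x hx => by_contra fun hn => hx (hw0 x hn))
    hL'.isClosed
  refine ⟨w, w.contMDiff, hL'.of_isClosed_subset (isClosed_tsupport _) hsupp, hsupp.trans hL'U,
    fun x => (hw x).1, fun x hx => ?_⟩
  obtain ⟨z, hz, hxz⟩ := mem_iUnion₂.mp (hJ hx)
  refine ⟨s z, ?_⟩
  rw [hw1.self_of_nhdsSet _ (mem_iUnion₂.mpr ⟨z, hz, interior_subset hxz⟩)]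
  exact one_ne_zero

end BulkFlow

end

section

open BulkBoundary

namespace BulkFlow

/-! ### The time-slice axiom -/

/-- The element of `FieldC X ε U n` with a given underlying form. -/
def FieldC.mk {U : Set M} {n : ℕ} (α : M → E3 [⋀^Fin n]→L[ℝ] ℝ) (h : α ∈ X.fieldsC ε U n) :
    FieldC X ε U n := ⟨α, h⟩

theorem ext_injective {U U' : Set M} (hUU' : U ⊆ U') :
    Function.Injective (ext hUU' : ObsSpace X ε U →ₗ[ℝ] ObsSpace X ε U') := fun φ φ' h =>
  DFinsupp.ext fun n => by
    have := congrArg (fun φ : ObsSpace X ε U' => (φ n).form) h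
    simp only [ext_apply] at this
    exact FieldC.form_ext this

theorem lof_injective {U : Set M} {n : ℕ} {α β : FieldC X ε U n}
    (h : DirectSum.lof ℝ ℕ (FieldC X ε U) n α = DirectSum.lof ℝ ℕ (FieldC X ε U) n β) : α = β := by
  have := congrArg (fun φ : ObsSpace X ε U => φ n) h
  simpa only [DirectSum.lof_apply] using this

variable [IsManifold (𝓡∂ 3) ∞ M]

theorem obsD_apply_succ {U : Set M} (φ : ObsSpace X ε U) (n : ℕ) :
    obsD X ε U φ (n + 1) = dForm X ε U n (φ n) := by
  induction φ using DirectSum.induction_on with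
  | zero => simp
  | of m α =>
    rw [← DirectSum.lof_eq_of ℝ, obsD_lof]
    by_cases h : m = n
    · subst h
      rw [DirectSum.lof_apply, DirectSum.lof_apply]
    · rw [DirectSum.lof_eq_of, DirectSum.lof_eq_of,
        DirectSum.of_eq_of_ne (β := FieldC X ε U) _ _ _ (Ne.symm h),
        DirectSum.of_eq_of_ne (β := FieldC X ε U) _ _ _ fun e => h (by omega), map_zero]
  | add v w hv hw => rw [map_add, DirectSum.add_apply, DirectSum.add_apply, map_add, hv, hw]

theorem obsD_apply_zero {U : Set M} (φ : ObsSpace X ε U) : obsD X ε U φ 0 = 0 := by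
  induction φ using DirectSum.induction_on with
  | zero => simp
  | of m α =>
    rw [← DirectSum.lof_eq_of ℝ, obsD_lof]
    exact DirectSum.of_eq_of_ne (β := FieldC X ε U) _ _ _ (Nat.succ_ne_zero m).symm
  | add v w hv hw => rw [map_add, DirectSum.add_apply, hv, hw, add_zero]

/-- The product of a smooth form with a function which is smooth near its support. -/
theorem isSmoothForm_fun_smul_of_tsupport {n : ℕ} {f : M → ℝ} {α : M → E3 [⋀^Fin n]→L[ℝ] ℝ}
    (hf : ∀ x ∈ tsupport α, ContMDiffAt (𝓡∂ 3) 𝓘(ℝ, ℝ) ∞ f x) (hα : IsSmoothForm (𝓡∂ 3) α) :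
    IsSmoothForm (𝓡∂ 3) fun x => f x • α x := by
  intro x₀ y hy
  by_cases hx : (extChartAt (𝓡∂ 3) x₀).symm y ∈ tsupport α
  · have h1 : ContMDiffWithinAt 𝓘(ℝ, E3) 𝓘(ℝ, ℝ) ∞ (f ∘ (extChartAt (𝓡∂ 3) x₀).symm)
        (extChartAt (𝓡∂ 3) x₀).target y :=
      (hf _ hx).comp_contMDiffWithinAt (f := (extChartAt (𝓡∂ 3) x₀).symm) y
        (contMDiffOn_extChartAt_symm x₀ y hy)
    exact h1.contDiffWithinAt.smul (hα x₀ y hy)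
  · have h0 : (fun x => f x • α x) =ᶠ[𝓝 ((extChartAt (𝓡∂ 3) x₀).symm y)] 0 := by
      filter_upwards [notMem_tsupport_iff_eventuallyEq.mp hx] with z hz
      rw [hz]
      exact smul_zero _
    have h1 := localRep_congr h0 ((extChartAt (𝓡∂ 3) x₀).map_target hy)
    rw [(extChartAt (𝓡∂ 3) x₀).right_inv hy] at h1
    exact (isSmoothForm_zero x₀ y hy).congr_of_eventuallyEq_of_mem
      (h1.filter_mono (nhdsWithin_mono y (extChartAt_target_subset_range x₀))) hy

variable [T2Space M] [SigmaCompactSpace M]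

/-- Let `U ⊆ U'` be convex such that every orbit through `U'` meets `U`. Then every field `ψ` with
compact support in `U'` whose differential is supported in `U` is cohomologous in `U'` to a field
supported in `U`. -/
theorem exists_sub_extD_mem {U U' : Set M} (hU : IsOpen U) (hUU' : U ⊆ U')
    (hconv : F.JUp U ∩ F.JDown U ⊆ U) (hconv' : F.JUp U' ∩ F.JDown U' ⊆ U')
    (hC : ∀ x ∈ U', ∃ s, F.act s x ∈ U) {n : ℕ} {ψ : M → E3 [⋀^Fin (n + 1)]→L[ℝ] ℝ}
    (hψ : ψ ∈ X.fieldsC ε U' (n + 1)) (hdψ : tsupport (extD (𝓡∂ 3) ψ) ⊆ U) :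
    ∃ η ∈ X.fieldsC ε U' n, ψ - extD (𝓡∂ 3) η ∈ X.fieldsC ε U (n + 1) := by
  obtain ⟨w, hw, hwc, hwU, hw0, hwK⟩ := F.exists_weight hU hψ.2.1.isCompact
    fun x hx => hC x (hψ.2.2 hx)
  set K := tsupport ψ with hKdef
  set A := tsupport (extD (𝓡∂ 3) ψ) with hAdef
  have hK : IsCompact K := hψ.2.1
  have hA : IsCompact A := hK.of_isClosed_subset (isClosed_tsupport _) (tsupport_extD ψ)
  have hAK : A ⊆ K := tsupport_extD ψ
  set S := tsupport w with hSdef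
  have hS : IsCompact S := hwc
  have hKUp := F.isClosed_JUp hK
  have hKDown := F.isClosed_JDown hK
  have hSUp := F.isClosed_JUp hS
  have hSDown := F.isClosed_JDown hS
  set b := F.avgDown w with hb
  set c := F.avgUp w with hc
  have hbs : ContMDiff (𝓡∂ 3) 𝓘(ℝ, ℝ) ∞ b := F.contMDiff_avgDown hw hwc
  have hcs : ContMDiff (𝓡∂ 3) 𝓘(ℝ, ℝ) ∞ c := F.contMDiff_avgUp hw hwc
  have hmeet : ∀ x ∈ F.JUp K ∪ F.JDown K, ∃ s, w (F.act s x) ≠ 0 := by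
    rintro _ (⟨x, hx, t, _, rfl⟩ | ⟨x, hx, t, _, rfl⟩) <;>
    · obtain ⟨s, hs⟩ := hwK x hx
      refine ⟨s - t, ?_⟩
      rwa [← F.act_add, sub_add_cancel]
  have hpos : ∀ x ∈ F.JUp K ∪ F.JDown K, b x + c x ≠ 0 := fun x hx => by
    obtain ⟨s, hs⟩ := hmeet x hx
    exact (F.avg_pos hw.continuous hwc hw0 hs).ne'
  -- `f` and `g` are the fractions of the total weight of an orbit which lie in the past and in the
  -- future of a point; they are smooth near the orbits through `K`
  set f : M → ℝ := fun x => b x / (b x + c x) with hf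
  set g : M → ℝ := fun x => c x / (b x + c x) with hg
  have hfg : ∀ x, b x + c x ≠ 0 → f x + g x = 1 := fun x hx => by
    simp only [hf, hg]
    rw [← add_div, div_self hx]
  have hfs : ∀ x ∈ F.JUp K ∪ F.JDown K, ContMDiffAt (𝓡∂ 3) 𝓘(ℝ, ℝ) ∞ f x := fun x hx =>
    (hbs x).div₀ ((hbs x).add (hcs x)) (hpos x hx)
  have hgs : ∀ x ∈ F.JUp K ∪ F.JDown K, ContMDiffAt (𝓡∂ 3) 𝓘(ℝ, ℝ) ∞ g x := fun x hx =>
    (hcs x).div₀ ((hbs x).add (hcs x)) (hpos x hx)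
  have hαs : tsupport (F.greenDown ψ) ⊆ F.JDown K := closure_minimal
    (fun x hx => by_contra fun hn => hx (F.greenDown_eq_zero hn)) hKDown
  have hβs : tsupport (F.greenUp ψ) ⊆ F.JUp K := closure_minimal
    (fun x hx => by_contra fun hn => hx (F.greenUp_eq_zero hn)) hKUp
  have hα := greenDown_mem_fields (F := F) hψ
  have hβ := greenUp_mem_fields (F := F) hψ
  have hα' : (fun x => f x • F.greenDown ψ x) ∈ X.fields ε n :=
    ⟨isSmoothForm_fun_smul_of_tsupport (fun x hx => hfs x (.inr (hαs hx))) hα.1,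
      BoundaryCond.fun_smul f hα.2⟩
  have hβ' : (fun x => g x • F.greenUp ψ x) ∈ X.fields ε n :=
    ⟨isSmoothForm_fun_smul_of_tsupport (fun x hx => hgs x (.inl (hβs hx))) hβ.1,
      BoundaryCond.fun_smul g hβ.2⟩
  have hαc : tsupport (fun x => f x • F.greenDown ψ x) ⊆ F.JUp S ∩ F.JDown K := by
    refine closure_minimal (fun x hx => ?_) (hSUp.inter hKDown)
    refine ⟨by_contra fun hn => hx ?_, by_contra fun hn => hx ?_⟩
    · simp only [hf, hb, F.avgDown_eq_zero hn, zero_div, zero_smul]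
    · simp only [F.greenDown_eq_zero hn, smul_zero]
  have hβc : tsupport (fun x => g x • F.greenUp ψ x) ⊆ F.JUp K ∩ F.JDown S := by
    refine closure_minimal (fun x hx => ?_) (hKUp.inter hSDown)
    refine ⟨by_contra fun hn => hx ?_, by_contra fun hn => hx ?_⟩
    · simp only [F.greenUp_eq_zero hn, smul_zero]
    · simp only [hg, hc, F.avgUp_eq_zero hn, zero_div, zero_smul]
  have hSU' : S ⊆ U' := hwU.trans hUU'
  have hαm : (fun x => f x • F.greenDown ψ x) ∈ X.fieldsC ε U' n :=
    ⟨hα', (F.isCompact_JUp_inter_JDown hS hK).of_isClosed_subset (isClosed_tsupport _) hαc,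
      (hαc.trans (inter_subset_inter (F.JUp_mono hSU') (F.JDown_mono hψ.2.2))).trans hconv'⟩
  have hβm : (fun x => g x • F.greenUp ψ x) ∈ X.fieldsC ε U' n :=
    ⟨hβ', (F.isCompact_JUp_inter_JDown hK hS).of_isClosed_subset (isClosed_tsupport _) hβc,
      (hβc.trans (inter_subset_inter (F.JUp_mono hψ.2.2) (F.JDown_mono hSU'))).trans hconv'⟩
  -- the cutoffs confine the Green's homotopies to the region between `K` and the support of `w`
  set η : M → E3 [⋀^Fin n]→L[ℝ] ℝ :=
    (-1 : ℝ) • ((fun x => f x • F.greenDown ψ x) + fun x => g x • F.greenUp ψ x) with hη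
  have hηm : η ∈ X.fieldsC ε U' n := Submodule.smul_mem _ _ (add_mem hαm hβm)
  refine ⟨η, hηm, ?_⟩
  have hm : ψ - extD (𝓡∂ 3) η ∈ X.fieldsC ε U' (n + 1) := sub_mem hψ (extD_mem_fieldsC hηm)
  refine ⟨hm.1, hm.2.1, fun x hx => ?_⟩
  by_contra hxU
  refine notMem_tsupport_iff_eventuallyEq.mpr ?_ hx
  -- Away from `U`, the form `η` is locally `-G ψ` for one of the two Green's homotopies `G`, for which
  -- `d G ψ + G d ψ = -ψ`, and `G d ψ` vanishes locally.
  have hloc : ∀ {β : M → E3 [⋀^Fin n]→L[ℝ] ℝ} {γ : M → E3 [⋀^Fin (n + 1)]→L[ℝ] ℝ},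
      η =ᶠ[𝓝 x] (-1 : ℝ) • β → (∀ᶠ z in 𝓝 x, extD (𝓡∂ 3) β z + γ z = (-1 : ℝ) • ψ z) → γ =ᶠ[𝓝 x] 0 →
      ψ - extD (𝓡∂ 3) η =ᶠ[𝓝 x] 0 := fun {β γ} h1 h2 h3 => by
    have h4 := h1.extD (I := 𝓡∂ 3)
    filter_upwards [h4, h2, h3] with z hz1 h5 hz2
    rw [Pi.sub_apply, hz1, extD_smul]
    rw [hz2] at h5
    change ψ z - (-1 : ℝ) • extD (𝓡∂ 3) β z = 0
    change extD (𝓡∂ 3) β z + 0 = (-1 : ℝ) • ψ z at h5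
    rw [add_zero] at h5
    rw [h5]
    ext v
    change ψ z v - (-1 : ℝ) * ((-1 : ℝ) * ψ z v) = 0
    ring
  by_cases hxK : x ∈ F.JUp K ∪ F.JDown K
  · have hnz : ∀ᶠ z in 𝓝 x, b z + c z ≠ 0 :=
      (hbs.continuous.add hcs.continuous).continuousAt.eventually_ne (hpos x hxK)
    by_cases hxS : x ∈ F.JUp S
    -- the weight of the orbit lies in the past of `x`, so `f = 1` and `g = 0` near `x`
    · have hxS' : x ∉ F.JDown S := fun h =>
        hxU (hconv ⟨F.JUp_mono hwU hxS, F.JDown_mono hwU h⟩)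
      refine hloc (β := F.greenDown ψ) (γ := F.greenDown (extD (𝓡∂ 3) ψ)) ?_
        (.of_forall (extD_greenDown hψ.1.1 hψ.2.1)) ?_
      · filter_upwards [hnz, hSDown.isOpen_compl.mem_nhds hxS'] with z hz hz'
        have hg0 : g z = 0 := by simp only [hg, hc, F.avgUp_eq_zero hz', zero_div]
        have hf1 : f z = 1 := by rw [← hfg z hz, hg0, add_zero]
        change (-1 : ℝ) • (f z • F.greenDown ψ z + g z • F.greenUp ψ z) = (-1 : ℝ) • F.greenDown ψ z
        rw [hg0, hf1, one_smul, zero_smul, add_zero]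
      · have hxA : x ∉ F.JDown A := fun h =>
          hxU (hconv ⟨F.JUp_mono hwU hxS, F.JDown_mono hdψ h⟩)
        filter_upwards [(F.isClosed_JDown hA).isOpen_compl.mem_nhds hxA] with z hz
        exact F.greenDown_eq_zero hz
    -- the weight of the orbit lies in the future of `x`, so `f = 0` and `g = 1` near `x`
    · refine hloc (β := F.greenUp ψ) (γ := F.greenUp (extD (𝓡∂ 3) ψ)) ?_
        (.of_forall (extD_greenUp hψ.1.1 hψ.2.1)) ?_
      · filter_upwards [hnz, hSUp.isOpen_compl.mem_nhds hxS] with z hz hz'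
        have hf0 : f z = 0 := by simp only [hf, hb, F.avgDown_eq_zero hz', zero_div]
        have hg1 : g z = 1 := by rw [← hfg z hz, hf0, zero_add]
        change (-1 : ℝ) • (f z • F.greenDown ψ z + g z • F.greenUp ψ z) = (-1 : ℝ) • F.greenUp ψ z
        rw [hf0, hg1, one_smul, zero_smul, zero_add]
      · have hxA : x ∉ F.JUp A := fun h => by
          obtain ⟨s, hs⟩ := hmeet x hxK
          have hsS : F.act s x ∈ S := subset_tsupport w hs
          rcases le_total s 0 with h0 | h0
          · exact hxS (F.mem_JUp_of_act_mem h0 hsS)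
          · exact hxU (hconv ⟨F.JUp_mono hdψ h,
              F.JDown_mono hwU (F.mem_JDown_of_act_mem h0 hsS)⟩)
        filter_upwards [(F.isClosed_JUp hA).isOpen_compl.mem_nhds hxA] with z hz
        exact F.greenUp_eq_zero hz
  · have hev := (hKUp.union hKDown).isOpen_compl.mem_nhds hxK
    refine hloc (β := 0) (γ := 0) ?_ ?_ ?_
    · filter_upwards [hev] with z hz
      change (-1 : ℝ) • (f z • F.greenDown ψ z + g z • F.greenUp ψ z) = (-1 : ℝ) • 0
      rw [F.greenDown_eq_zero fun h => hz (.inr h), F.greenUp_eq_zero fun h => hz (.inl h),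
        smul_zero, smul_zero, add_zero]
    · filter_upwards [hev] with z hz
      have h0 := extD_smul (I := 𝓡∂ 3) 0 (0 : M → E3 [⋀^Fin n]→L[ℝ] ℝ)
      rw [zero_smul, zero_smul] at h0
      rw [h0, image_eq_zero_of_notMem_tsupport fun h => hz (.inl (F.subset_JUp K h)), smul_zero]
      exact add_zero _
    · rfl

omit [SigmaCompactSpace M] in
/-- A function with compact support in `U'` whose differential is supported in the convex set `U` is
itself supported in `U`. -/
theorem mem_fieldsC_of_extD {U U' : Set M} (hconv : F.JUp U ∩ F.JDown U ⊆ U)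
    {ψ : M → E3 [⋀^Fin 0]→L[ℝ] ℝ} (hψ : ψ ∈ X.fieldsC ε U' 0)
    (hdψ : tsupport (extD (𝓡∂ 3) ψ) ⊆ U) : ψ ∈ X.fieldsC ε U 0 := by
  set A := tsupport (extD (𝓡∂ 3) ψ) with hAdef
  have hA : IsCompact A := hψ.2.1.isCompact.of_isClosed_subset (isClosed_tsupport _)
    (tsupport_extD ψ)
  have key : ∀ x, (-1 : ℝ) • ψ x = 0 → ψ x = 0 := fun x h => by
    rwa [alt_neg_one_smul, neg_eq_zero] at h
  refine ⟨hψ.1, hψ.2.1, ?_⟩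
  refine Subset.trans (closure_minimal (t := F.JUp A ∩ F.JDown A) (fun x hx => ?_)
    ((F.isClosed_JUp hA).inter (F.isClosed_JDown hA)))
    ((inter_subset_inter (F.JUp_mono hdψ) (F.JDown_mono hdψ)).trans hconv)
  refine ⟨by_contra fun hn => hx (key x ?_), by_contra fun hn => hx (key x ?_)⟩
  · rw [← greenUp_extD_zero (F := F) hψ.1.1 hψ.2.1, F.greenUp_eq_zero hn]
  · rw [← greenDown_extD_zero (F := F) hψ.1.1 hψ.2.1, F.greenDown_eq_zero hn]

/-- Every closed observable in `U'` is cohomologous to one in `U`. -/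
theorem exists_eq_ext_add_obsD {U U' : Set M} (hU : IsOpen U) (hUU' : U ⊆ U')
    (hconv : F.JUp U ∩ F.JDown U ⊆ U) (hconv' : F.JUp U' ∩ F.JDown U' ⊆ U')
    (hC : ∀ x ∈ U', ∃ s, F.act s x ∈ U) {i : ℤ}
    {φ : ObsSpace X ε U'} (hφ : φ ∈ obsGr X ε U' i)
    (hd : obsD X ε U' φ = 0) :
    ∃ (a : ObsSpace X ε U) (φ' : ObsSpace X ε U'), φ = ext hUU' a + obsD X ε U' φ' := by
  obtain rfl | ⟨n, ψ, rfl, rfl⟩ := eq_zero_or_eq_lof hφ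
  · exact ⟨0, 0, by simp⟩
  have hd0 : extD (𝓡∂ 3) ψ.form = 0 := by
    rw [obsD_lof, ← map_zero (DirectSum.lof ℝ ℕ (FieldC X ε U') (n + 1))] at hd
    exact congrArg FieldC.form (lof_injective hd)
  have hds : tsupport (extD (𝓡∂ 3) ψ.form) ⊆ U := by simp [hd0]
  cases n with
  | zero =>
    have h := F.mem_fieldsC_of_extD hconv ψ.form_mem hds
    refine ⟨DirectSum.lof ℝ ℕ (FieldC X ε U) 0 (.mk ψ.form h), 0, ?_⟩
    rw [ext_lof, map_zero, add_zero]
    rfl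
  | succ n =>
    obtain ⟨η, hη, h⟩ := F.exists_sub_extD_mem hU hUU' hconv hconv' hC ψ.form_mem hds
    refine ⟨DirectSum.lof ℝ ℕ (FieldC X ε U) (n + 1) (.mk _ h),
      DirectSum.lof ℝ ℕ (FieldC X ε U') n (.mk η hη), ?_⟩
    rw [ext_lof, obsD_lof, ← map_add]
    exact congrArg _ (FieldC.form_ext (sub_add_cancel ψ.form (extD (𝓡∂ 3) η)).symm)

/-- An observable in `U` which is exact in `U'` is exact in `U`. -/
theorem exists_eq_obsD_of_ext {U U' : Set M} (hU : IsOpen U) (hUU' : U ⊆ U')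
    (hconv : F.JUp U ∩ F.JDown U ⊆ U) (hconv' : F.JUp U' ∩ F.JDown U' ⊆ U')
    (hC : ∀ x ∈ U', ∃ s, F.act s x ∈ U) {i : ℤ}
    {a : ObsSpace X ε U} (ha : a ∈ obsGr X ε U i)
    {φ : ObsSpace X ε U'} (h : ext hUU' a = obsD X ε U' φ) : ∃ a', a = obsD X ε U a' := by
  obtain rfl | ⟨n, α, rfl, rfl⟩ := eq_zero_or_eq_lof ha
  · exact ⟨0, by simp⟩
  rw [ext_lof] at h
  have hn := congrArg (fun φ : ObsSpace X ε U' => φ n) h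
  simp only [DirectSum.lof_apply] at hn
  cases n with
  | zero =>
    rw [obsD_apply_zero] at hn
    have h0 : α = 0 := FieldC.form_ext
      (show α.form = (0 : FieldC X ε U' 0).form from congrArg FieldC.form hn)
    exact ⟨0, by rw [h0, map_zero, map_zero]⟩
  | succ n =>
    rw [obsD_apply_succ] at hn
    have hα : α.form = extD (𝓡∂ 3) (φ n).form := congrArg FieldC.form hn
    have hds : tsupport (extD (𝓡∂ 3) (φ n).form) ⊆ U := hα ▸ α.form_mem.2.2
    cases n with
    | zero =>
      have h1 := F.mem_fieldsC_of_extD hconv (φ 0).form_mem hds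
      refine ⟨DirectSum.lof ℝ ℕ (FieldC X ε U) 0 (.mk (φ 0).form h1), ?_⟩
      rw [obsD_lof]
      exact congrArg _ (FieldC.form_ext hα)
    | succ n =>
      obtain ⟨η, hη, h1⟩ := F.exists_sub_extD_mem hU hUU' hconv hconv' hC (φ (n + 1)).form_mem hds
      refine ⟨DirectSum.lof ℝ ℕ (FieldC X ε U) (n + 1) (.mk _ h1), ?_⟩
      rw [obsD_lof]
      refine congrArg _ (FieldC.form_ext (hα.trans ?_))
      change _ = extD (𝓡∂ 3) ((φ (n + 1)).form - extD (𝓡∂ 3) η)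
      rw [extD_sub (φ (n + 1)).form_mem.1.1 hη.1.1.extD, extD_extD hη.1.1, sub_zero]

theorem timeSlice : F.TimeSlice F.aqft := fun U U' f hf => by
  have hUU' : U.carrier ⊆ U'.carrier := leOfHom f
  have hC : ∀ x ∈ U'.carrier, ∃ s, F.act s x ∈ U.carrier := fun x hx => by
    have h1 : Quotient.mk F.orbitRel x ∈ Quotient.mk F.orbitRel '' U.carrier := by
      rw [show Quotient.mk F.orbitRel '' U.carrier = _ from hf]
      exact mem_image_of_mem _ hx
    obtain ⟨z, hz, e⟩ := h1
    obtain ⟨s, hs⟩ := F.orbitRel.symm (Quotient.exact e)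
    exact ⟨s, hs ▸ hz⟩
  obtain ⟨ρ⟩ := PairedComplex.exists_retraction (F.extHom hUU') (ext_injective hUU')
    (fun i q hq hd => F.exists_eq_ext_add_obsD U.1.isOpen hUU' U.2.2 U'.2.2 hC hq hd)
    fun i a ha q h => F.exists_eq_obsD_of_ext U.1.isOpen hUU' U.2.2 U'.2.2 hC ha h
  exact PairedComplex.quasiIso_mapCCR (F.isPoisson_obs U.carrier) (F.isPoisson_obs U'.carrier) ρ

end BulkFlow

end

end
end CSWZW

theorem mainTheorem3
    {M : Type*} [TopologicalSpace M] [ChartedSpace (EuclideanHalfSpace 3) M]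
    [IsManifold (𝓡∂ 3) ∞ M] [T2Space M] [SigmaCompactSpace M]
    {N : Type*} [TopologicalSpace N] [ChartedSpace (EuclideanSpace ℝ (Fin 2)) N]
    [IsManifold (𝓡 2) ∞ N]
    (X : CSWZW.BulkBoundary M N) (ε : ℤˣ) (F : CSWZW.BulkFlow X ε) :
    (∀ (n : ℕ), ∀ ψ ∈ X.fieldsC ε univ (n + 1), F.green ψ ∈ X.fields ε n) ∧
    (∀ U : F.Region, (F.obsFunctor.obj U).IsPoisson) ∧
    F.EinsteinCausality F.aqft ∧
    F.TimeSlice F.aqft := by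
  exact ⟨fun n ψ hψ => CSWZW.BulkFlow.green_mem_fields hψ, fun U => F.isPoisson_obs U.carrier,
    F.einsteinCausality, F.timeSlice⟩
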